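/- Let $M$ be a smooth four-dimensional manifold (Hausdorff, second countable), $\Lambda\in\mathbb R$, and let $g_{ab}(\lambda)$, $\lambda\ge 0$, be a one-parameter family of smooth Lorentzian metrics on $M$ of signature $(-,+,+,+)$, with smooth tensor fields $T_{ab}(\lambda)$, $\lambda>0$. Put $g^{(0)}_{ab}=g_{ab}(0)$ and $\gamma_{ab}(\lambda)=g_{ab}(\lambda)-g^{(0)}_{ab}$. Fix a smooth Riemannian metric on $M$, with respect to which norms $|\cdot|$ of tensors are taken, and a smooth connection $\nabla_a$ on the tangent bundle. We say that tensor fields $A_{a_1\dots a_n}(\lambda)$ converge weakly to $A^{(0)}_{a_1\dots a_n}$, written $\operatorname{w-lim}_{\lambda\to0}A_{a_1\dots a_n}(\lambda)=A^{(0)}_{a_1\dots a_n}$, if $\lim_{\lambda\to0^+}\int f^{a_1\dots a_n}A_{a_1\dots a_n}(\lambda)=\int f^{a_1\dots a_n}A^{(0)}_{a_1\dots a_n}$ for all smooth tensor fields $f^{a_1\dots a_n}$ of compact support, the integrals being taken with respect to the volume element of $g^{(0)}_{ab}$. Assume: (i) for all $\lambda>0$, $G_{ab}(g(\lambda))+\Lambda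 g_{ab}(\lambda)=8\pi T_{ab}(\lambda)$, where $G_{ab}$ is the Einstein tensor, and $T_{ab}(\lambda)$ satisfies the weak energy condition, i.e. $T_{ab}(\lambda)t^at^b\ge0$ for all vectors $t^a$ that are timelike with respect to $g_{ab}(\lambda)$; (ii) there is a smooth positive function $C_1$ on $M$ such that $|\gamma_{ab}(\lambda,x)|\le\lambda C_1(x)$ for all $\lambda>0$, $x\in M$; (iii) there is a smooth positive function $C_2$ on $M$ such that $|\nabla_c\gamma_{ab}(\lambda,x)|\le C_2(x)$ for all $\lambda>0$, $x\in M$; (iv) there is a smooth tensor field $\mu_{abcdef}$ on $M$ such that $\operatorname{w-lim}_{\lambda\to0}\left[\nabla_a\gamma_{cd}(\lambda)\nabla_b\gamma_{ef}(\lambda)\right]=\mu_{abcdef}$. Then $T_{ab}(\lambda)$ has a smooth weak limit $T^{(0)}_{ab}$ as $\lambda\to0$, so that the averaged Einstein equation $$G_{ab}(g^{(0)})+\Lambda g^{(0)}_{ab}=8\pi\left(T^{(0)}_{ab}+t^{(0)}_{ab}\right)$$ determines a unique smooth tensor field $t^{(0)}_{ab}$, the effective stress-energy tensor; and $t^{(0)}_{ab}$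 satisfies the weak energy condition: $t^{(0)}_{ab}t^at^b\ge0$ for every vector $t^a$ that is timelike with respect to $g^{(0)}_{ab}$. -/

import Mathlib

open scoped Manifold ContDiff Topology Matrix
open Bundle MeasureTheory Set Filter

noncomputable section

namespace Backreaction

/-! ### Tensor fields on a four-dimensional manifold -/

/-- The model space of a four-dimensional manifold. -/
abbrev R4 : Type := EuclideanSpace ℝ (Fin 4)

section Tensors

variable (M : Type*) [TopologicalSpace M] [ChartedSpace R4 M]

/-- The tangent space of `M` at `x`. -/
abbrev Tan {M : Type*} [TopologicalSpace M] [ChartedSpace R4 M] (x : M) : Type :=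
  TangentSpace 𝓘(ℝ, R4) x

/-- The value at `x` of a covariant tensor field with `k` indices. -/
abbrev CovTensor {M : Type*} [TopologicalSpace M] [ChartedSpace R4 M] (k : ℕ) (x : M) : Type :=
  MultilinearMap ℝ (fun _ : Fin k => Tan x) ℝ

/-- The value at `x` of a contravariant tensor field with `k` indices. -/
abbrev ContraTensor {M : Type*} [TopologicalSpace M] [ChartedSpace R4 M] (k : ℕ) (x : M) : Type :=
  MultilinearMap ℝ (fun _ : Fin k => Tan x →L[ℝ] ℝ) ℝ

/-- Smooth covariant tensor fields with two indices: the smooth sections of the bundle of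
bilinear forms on the tangent spaces. -/
abbrev BilinField [IsManifold 𝓘(ℝ, R4) ∞ M] : Type _ :=
  ContMDiffSection 𝓘(ℝ, R4) (R4 →L[ℝ] R4 →L[ℝ] ℝ) ∞
    (fun x : M => Tan x →L[ℝ] Tan x →L[ℝ] ℝ)

/-- The smooth charts of `M`. -/
abbrev smoothCharts : Set (OpenPartialHomeomorph M R4) :=
  IsManifold.maximalAtlas 𝓘(ℝ, R4) ∞ M

variable {M}

/-- The coordinate vector `∂/∂xⁱ` of the chart `e`, at the point with coordinates `y`. -/
def coordVec (e : OpenPartialHomeomorph M R4) (y : R4) (i : Fin 4) : Tan (e.symm y) :=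
  mfderiv 𝓘(ℝ, R4) 𝓘(ℝ, R4) e.symm y (EuclideanSpace.single i (1 : ℝ))

/-- The coordinate covector `dxⁱ` of the chart `e`, at the point with coordinates `y`. -/
def coordCovec (e : OpenPartialHomeomorph M R4) (y : R4) (i : Fin 4) :
    Tan (e.symm y) →L[ℝ] ℝ :=
  (EuclideanSpace.proj i : R4 →L[ℝ] ℝ) ∘L
    (mfderiv 𝓘(ℝ, R4) 𝓘(ℝ, R4) e (e.symm y) : Tan (e.symm y) →L[ℝ] R4)

/-- A covariant tensor field is smooth: its components in every smooth chart are smooth. -/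
def SmoothCov {k : ℕ} (A : (x : M) → CovTensor k x) : Prop :=
  ∀ e ∈ smoothCharts M, ∀ i : Fin k → Fin 4,
    ContDiffOn ℝ ∞ (fun y => A (e.symm y) (fun j => coordVec e y (i j))) e.target

/-- A contravariant tensor field is smooth: its components in every smooth chart are smooth. -/
def SmoothContra {k : ℕ} (f : (x : M) → ContraTensor k x) : Prop :=
  ∀ e ∈ smoothCharts M, ∀ i : Fin k → Fin 4,
    ContDiffOn ℝ ∞ (fun y => f (e.symm y) (fun j => coordCovec e y (i j))) e.target

/-- The full contraction `f^{a₁…a_k} A_{a₁…a_k}` at the point `x`. It does not depend on the basis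
of the tangent space at `x`; the basis used here is the standard one of the model space. -/
def contract {k : ℕ} {x : M} (f : ContraTensor k x) (A : CovTensor k x) : ℝ :=
  ∑ i : Fin k → Fin 4,
    f (fun j => (EuclideanSpace.proj (i j) : R4 →L[ℝ] ℝ)) *
      A (fun j => (EuclideanSpace.single (i j) (1 : ℝ) : R4))

/-- A bilinear form as a tensor with two indices. -/
def toCov {x : M} (b : Tan x →L[ℝ] Tan x →L[ℝ] ℝ) : CovTensor 2 x :=
  .mk' (fun v => b (v 0) (v 1))
    (fun v i p q => by
      match i with
      | 0 => simp
      | 1 => simp)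
    (fun v i p q => by
      match i with
      | 0 => simp
      | 1 => simp)

set_option synthInstance.maxHeartbeats 400000 in
/-- For a trilinear form `B`, the tensor `A_{cab}` with `A(u, v, w) = B(v, w)(u)`. -/
def triTensor (B : R4 →L[ℝ] R4 →L[ℝ] (R4 →L[ℝ] ℝ)) :
    MultilinearMap ℝ (fun _ : Fin 3 => R4) ℝ :=
  .mk' (fun v => B (v 1) (v 2) (v 0))
    (fun v i p q => by
      match i with
      | 0 => simp
      | 1 => simp
      | 2 => simp)
    (fun v i p q => by
      match i with
      | 0 => simp
      | 1 => simp
      | 2 => simp)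

set_option synthInstance.maxHeartbeats 400000 in
set_option maxHeartbeats 1000000 in
/-- With `A = triTensor B`, the tensor `A_{acd} A_{bef}`, with index order `a, b, c, d, e, f`. -/
def sqTensor (B : R4 →L[ℝ] R4 →L[ℝ] (R4 →L[ℝ] ℝ)) :
    MultilinearMap ℝ (fun _ : Fin 6 => R4) ℝ :=
  .mk' (fun v => B (v 2) (v 3) (v 0) * B (v 4) (v 5) (v 1))
    (fun v i p q => by
      match i with
      | 0 => simp; ring
      | 1 => simp; ring
      | 2 => simp; ring
      | 3 => simp; ring
      | 4 => simp; ring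
      | 5 => simp; ring)
    (fun v i p q => by
      match i with
      | 0 => simp; ring
      | 1 => simp; ring
      | 2 => simp; ring
      | 3 => simp; ring
      | 4 => simp; ring
      | 5 => simp; ring)

end Tensors

section Geometry

variable {M : Type*} [TopologicalSpace M] [ChartedSpace R4 M] [IsManifold 𝓘(ℝ, R4) ∞ M]

/-! ### Lorentzian metrics, curvature and Einstein's equation -/

/-- `g` is a Lorentzian metric of signature `(-,+,+,+)`. -/
def IsLorentzian (g : BilinField M) : Prop :=
  ∀ x : M, (∀ v w : Tan x, g x v w = g x w v) ∧
    ∃ b : Module.Basis (Fin 4) ℝ (Tan x), ∀ i j,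
      g x (b i) (b j) = (Matrix.diagonal ![-1, 1, 1, 1] : Matrix (Fin 4) (Fin 4) ℝ) i j

/-- The weak energy condition for `T` with respect to the metric `g`: `T_{ab} t^a t^b ≥ 0` for
every vector `t` that is timelike with respect to `g`. -/
def WeakEnergy (g T : BilinField M) : Prop :=
  ∀ (x : M) (t : Tan x), g x t t < 0 → 0 ≤ T x t t

/-- The matrix of components of a bilinear field in the chart `e`, as a function of the
coordinates. -/
def comp (e : OpenPartialHomeomorph M R4) (g : BilinField M) (y : R4) :
    Matrix (Fin 4) (Fin 4) ℝ :=
  Matrix.of fun i j => g (e.symm y) (coordVec e y i) (coordVec e y j)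

/-- The partial derivative with respect to the `k`-th coordinate. -/
def pd (k : Fin 4) (F : R4 → ℝ) (y : R4) : ℝ :=
  fderiv ℝ F y (EuclideanSpace.single k (1 : ℝ))

/-- The Christoffel symbols `Γ^i_{jk}` of the metric with components `G`. -/
def christoffel (G : R4 → Matrix (Fin 4) (Fin 4) ℝ) (i j k : Fin 4) (y : R4) : ℝ :=
  (1 / 2) * ∑ l, (G y)⁻¹ i l *
    (pd j (fun z => G z l k) y + pd k (fun z => G z l j) y - pd l (fun z => G z j k) y)

/-- The components `R_{jk}` of the Ricci tensor (positive for round spheres). -/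
def ricci (G : R4 → Matrix (Fin 4) (Fin 4) ℝ) (j k : Fin 4) (y : R4) : ℝ :=
  ∑ i, (pd i (christoffel G i j k) y - pd j (christoffel G i i k) y
    + ∑ l, (christoffel G l j k y * christoffel G i l i y
      - christoffel G l i k y * christoffel G i l j y))

/-- The scalar curvature. -/
def scalarCurv (G : R4 → Matrix (Fin 4) (Fin 4) ℝ) (y : R4) : ℝ :=
  ∑ j, ∑ k, (G y)⁻¹ j k * ricci G j k y

/-- The components of the Einstein tensor `G_{ab} = R_{ab} - (1/2) R g_{ab}`. -/
def einstein (G : R4 → Matrix (Fin 4) (Fin 4) ℝ) (j k : Fin 4) (y : R4) : ℝ :=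
  ricci G j k y - (1 / 2) * scalarCurv G y * G y j k

/-- Einstein's equation `G_{ab}(g) + Λ g_{ab} = 8 π T_{ab}` on `M`, that is, in the coordinates of
every smooth chart. -/
def EinsteinEq (Λ : ℝ) (g T : BilinField M) : Prop :=
  ∀ e ∈ smoothCharts M, ∀ y ∈ e.target, ∀ j k : Fin 4,
    einstein (comp e g) j k y + Λ * comp e g y j k = 8 * Real.pi * comp e T y j k

/-! ### Integration and weak limits -/

section Integration

variable [MeasurableSpace M]

/-- The volume measure `√|det g| d⁴x` of `g` on the domain of the chart `e`. -/
def chartVolume (g : BilinField M) (e : OpenPartialHomeomorph M R4) : Measure M :=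
  (((volume : Measure R4).restrict e.target).withDensity
    (fun y => ENNReal.ofReal √|(comp e g y).det|)).map e.symm

/-- The volume measure of `g`: the measures of the chart domains agree on overlaps, and their
supremum is the measure on `M` that restricts to each of them. -/
def volumeMeasure (g : BilinField M) : Measure M :=
  ⨆ e ∈ smoothCharts M, chartVolume g e

/-- The tensor fields `A lam` converge weakly to `A₀` as `lam → 0`, `lam > 0`: for every smooth
contravariant tensor field `f` of compact support, the integrals of `f^{a₁…a_k} A_{a₁…a_k}(lam)`
with respect to the volume of the metric `g₀` converge to that of `f^{a₁…a_k} A₀_{a₁…a_k}`. -/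
def WeakLimit {k : ℕ} (g₀ : BilinField M) (A : ℝ → (x : M) → CovTensor k x)
    (A₀ : (x : M) → CovTensor k x) : Prop :=
  ∀ f : (x : M) → ContraTensor k x, SmoothContra f → IsCompact (closure {x | f x ≠ 0}) →
    Tendsto (fun lam => ∫ x, contract (f x) (A lam x) ∂(volumeMeasure g₀)) (𝓝[>] 0)
      (𝓝 (∫ x, contract (f x) (A₀ x) ∂(volumeMeasure g₀)))

end Integration

/-! ### Covariant derivatives of two-index tensor fields, and norms -/

/-- A connection ("derivative operator") on the tangent bundle. -/
abbrev Connection (M : Type*) [TopologicalSpace M] [ChartedSpace R4 M]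
    [IsManifold 𝓘(ℝ, R4) ∞ M] : Type _ :=
  CovariantDerivative 𝓘(ℝ, R4) R4 (TangentSpace 𝓘(ℝ, R4) : M → Type _)

/-- The bilinear form with the two arguments interchanged. -/
def flipForm (b : R4 →L[ℝ] R4 →L[ℝ] ℝ) : R4 →L[ℝ] R4 →L[ℝ] ℝ := b.flip

/-- The value at `x` of the one-form `X ↦ X(γ(Y,Z)) - γ(∇_X Y, Z) - γ(Y, ∇_X Z)`. -/
def nablaAux (D : Connection M) (γ : BilinField M)
    (Y Z : (x : M) → TangentSpace 𝓘(ℝ, R4) x) (x : M) : TangentSpace 𝓘(ℝ, R4) x →L[ℝ] ℝ :=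
  mvfderiv 𝓘(ℝ, R4) (fun x' => γ x' (Y x') (Z x')) x
    - (flipForm (γ x) (Z x) : TangentSpace 𝓘(ℝ, R4) x →L[ℝ] ℝ) ∘L D Y x
    - γ x (Y x) ∘L D Z x

theorem nablaAux_apply (D : Connection M) (γ : BilinField M)
    (Y Z : (x : M) → TangentSpace 𝓘(ℝ, R4) x) (x : M) (X : TangentSpace 𝓘(ℝ, R4) x) :
    nablaAux D γ Y Z x X = mvfderiv 𝓘(ℝ, R4) (fun x' => γ x' (Y x') (Z x')) x X
      - γ x (D Y x X) (Z x) - γ x (Y x) (D Z x X) := rfl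

theorem mdiff_bilin (γ : BilinField M) {Y Z : (x : M) → TangentSpace 𝓘(ℝ, R4) x} {x : M}
    (hY : MDifferentiableAt 𝓘(ℝ, R4) (𝓘(ℝ, R4).prod 𝓘(ℝ, R4)) (T% Y) x)
    (hZ : MDifferentiableAt 𝓘(ℝ, R4) (𝓘(ℝ, R4).prod 𝓘(ℝ, R4)) (T% Z) x) :
    MDifferentiableAt 𝓘(ℝ, R4) 𝓘(ℝ, ℝ) (fun x' => γ x' (Y x') (Z x')) x := by
  have hg := (γ.contMDiff x).mdifferentiableAt (by simp)
  have : MDifferentiableAt 𝓘(ℝ, R4) (𝓘(ℝ, R4).prod 𝓘(ℝ))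
      (fun m : M => TotalSpace.mk' ℝ (E := Bundle.Trivial M ℝ) m (γ m (Y m) (Z m))) x := by
    apply MDifferentiableAt.clm_bundle_apply₂ (F₁ := R4) (F₂ := R4)
    · exact hg
    · exact hY
    · exact hZ
  simp only [mdifferentiableAt_totalSpace] at this
  exact this.2

theorem tensorial_left (D : Connection M) (γ : BilinField M) (x : M)
    (Z : (x : M) → TangentSpace 𝓘(ℝ, R4) x) 
    (hZ : MDifferentiableAt 𝓘(ℝ, R4) (𝓘(ℝ, R4).prod 𝓘(ℝ, R4)) (T% Z) x) :
    TensorialAt 𝓘(ℝ, R4) R4 (fun Y => nablaAux D γ Y Z x) x where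
  smul {f Y} hf hY := by
    ext X
    have h := mvfderiv_fun_mul hf (mdiff_bilin γ hY hZ)
    have h1 := D.isCovariantDerivativeOnUniv.leibniz hY hf
    simp [nablaAux_apply, h1, h]
    ring
  add {Y Y'} hY hY' := by
    ext X
    have h := mvfderiv_fun_add (mdiff_bilin γ hY hZ) (mdiff_bilin γ hY' hZ)
    have h1 := D.isCovariantDerivativeOnUniv.add hY hY'
    simp [nablaAux_apply, h1, h]
    ring

theorem tensorial_right (D : Connection M) (γ : BilinField M) (x : M)
    (Y : (x : M) → TangentSpace 𝓘(ℝ, R4) x) 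
    (hY : MDifferentiableAt 𝓘(ℝ, R4) (𝓘(ℝ, R4).prod 𝓘(ℝ, R4)) (T% Y) x) :
    TensorialAt 𝓘(ℝ, R4) R4 (fun Z => nablaAux D γ Y Z x) x where
  smul {f Z} hf hZ := by
    ext X
    have h := mvfderiv_fun_mul hf (mdiff_bilin γ hY hZ)
    have h1 := D.isCovariantDerivativeOnUniv.leibniz hZ hf
    simp [nablaAux_apply, h1, h]
    ring
  add {Z Z'} hZ hZ' := by
    ext X
    have h := mvfderiv_fun_add (mdiff_bilin γ hY hZ) (mdiff_bilin γ hY hZ')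
    have h1 := D.isCovariantDerivativeOnUniv.add hZ hZ'
    simp [nablaAux_apply, h1, h]
    ring

/-- The covariant derivative of `γ` at `x`, as the trilinear form `Y, Z, X ↦ (∇_X γ)(Y, Z)`. -/
def nablaForm (D : Connection M) (γ : BilinField M) (x : M) :
    Tan x →L[ℝ] Tan x →L[ℝ] (Tan x →L[ℝ] ℝ) :=
  TensorialAt.mkHom₂ (I := 𝓘(ℝ, R4)) (F := R4) (F' := R4)
    (V := (TangentSpace 𝓘(ℝ, R4) : M → Type _)) (V' := (TangentSpace 𝓘(ℝ, R4) : M → Type _))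
    (fun Y Z => nablaAux D γ Y Z x) x
    (fun Z hZ => tensorial_left D γ x Z hZ) (fun Y hY => tensorial_right D γ x Y hY)

/-- The tensor `∇_c γ_{ab}`, with index order `c, a, b`. -/
def nabla (D : Connection M) (γ : BilinField M) (x : M) : CovTensor 3 x :=
  triTensor (nablaForm D γ x)

/-- The tensor `∇_a γ_{cd} ∇_b γ_{ef}`, with index order `a, b, c, d, e, f`. -/
def nablaSq (D : Connection M) (γ : BilinField M) (x : M) : CovTensor 6 x :=
  sqTensor (nablaForm D γ x)

/-- A smooth Riemannian metric on `M`. -/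
abbrev RiemMetric (M : Type*) [TopologicalSpace M] [ChartedSpace R4 M]
    [IsManifold 𝓘(ℝ, R4) ∞ M] : Type _ :=
  ContMDiffRiemannianMetric 𝓘(ℝ, R4) ∞ R4 (TangentSpace 𝓘(ℝ, R4) : M → Type _)

/-- `|A| ≤ c` for the norm of the tensor `A` at `x` as a multilinear form on the tangent space
with the inner product `h`. (Any other norm on tensors that is built from `h` is equivalent to this
one, with constants that depend only on the number of indices.) -/
def NormLE (h : RiemMetric M) {k : ℕ} {x : M} (A : CovTensor k x) (c : ℝ) : Prop :=
  ∀ v : Fin k → Tan x, |A v| ≤ c * ∏ j, √(h.inner x (v j) (v j))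

/-! ### One-parameter families and the effective stress-energy tensor -/

variable [MeasurableSpace M]

set_option synthInstance.maxHeartbeats 400000 in
/-- The assumptions on a one-parameter family `g lam`, `lam ≥ 0`, of smooth Lorentzian metrics
with stress-energy tensors `T lam`. The background metric is `g 0`, the deviation from it is
`γ lam = g lam - g 0`; norms are those of the Riemannian metric `h`, and `D` is the derivative
operator. -/
structure Admissible (Λ : ℝ) (h : RiemMetric M) (D : Connection M)
    (g T : ℝ → BilinField M) : Prop where
  lorentzian : ∀ lam, 0 ≤ lam → IsLorentzian (g lam)
  einstein_eq : ∀ lam, 0 < lam → EinsteinEq Λ (g lam) (T lam)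
  weak_energy : ∀ lam, 0 < lam → WeakEnergy (g lam) (T lam)
  small : ∃ C₁ : M → ℝ, ContMDiff 𝓘(ℝ, R4) 𝓘(ℝ, ℝ) ∞ C₁ ∧ (∀ x, 0 < C₁ x) ∧
    ∀ lam, 0 < lam → ∀ x, NormLE h (toCov ((g lam - g 0) x)) (lam * C₁ x)
  deriv_bounded : ∃ C₂ : M → ℝ, ContMDiff 𝓘(ℝ, R4) 𝓘(ℝ, ℝ) ∞ C₂ ∧ (∀ x, 0 < C₂ x) ∧
    ∀ lam, 0 < lam → ∀ x, NormLE h (nabla D (g lam - g 0) x) (C₂ x)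
  weak_limit : ∃ μ : (x : M) → CovTensor 6 x, SmoothCov μ ∧
    WeakLimit (g 0) (fun lam x => nablaSq D (g lam - g 0) x) μ

set_option synthInstance.maxHeartbeats 400000 in
/-- `t` is the effective stress-energy tensor of the family: the stress-energy tensors `T lam` have
a smooth weak limit `T₀` as `lam → 0`, the averaged stress-energy tensor, and the background metric
satisfies the averaged Einstein equation `G_{ab}(g⁰) + Λ g⁰_{ab} = 8 π (T⁰_{ab} + t_{ab})`. Since
weak limits are unique, this determines `t`. -/
def IsEffectiveStressEnergy (Λ : ℝ) (g T : ℝ → BilinField M) (t : BilinField M) : Prop :=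
  ∃ T₀ : BilinField M,
    WeakLimit (g 0) (fun lam x => toCov (T lam x)) (fun x => toCov (T₀ x)) ∧
      EinsteinEq Λ (g 0) (T₀ + t)

end Geometry

end Backreaction

end

noncomputable section

namespace Backreaction

set_option linter.unusedSectionVars false
set_option linter.unusedSimpArgs false

/-! ### Coordinate frames and coframes of smooth charts -/

section Frames

variable {M : Type*} [TopologicalSpace M] [ChartedSpace R4 M] [IsManifold 𝓘(ℝ, R4) ∞ M]
  {e : OpenPartialHomeomorph M R4}

/-! Everything is local. In a chart, `∇γ` and `∂γ` differ by connection coefficients times `γ =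
O(λ)`, so the products `∂γ ∂γ` are bounded and converge weakly to the components of `μ`
(`Admissible.wconv_pd_mul_pd`). The Ricci tensor has the form `∂Γ + ΓΓ`. The weak limit of `∂Γ` is
found by integrating by parts and is that of the background; `ΓΓ` contributes the background term
and an expression linear in `μ` (`wconv_ricci`).

The Einstein tensor also contains `g⁻¹ g Ric`, a product with unbounded second derivatives. Here the
energy condition enters: `G + Λg` is nonnegative on an open set of vectors `w`, and its integrals
against test functions are bounded by integration by parts. A nonnegative family with bounded
integrals is locally bounded in `L¹`. Polarisation and trace reversal carry the bound over to the
symmetrised Ricci tensor (`lb_einsteinLam`, `lb_ricci`), and `O(λ)` times locally `L¹`-bounded tends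
weakly to zero. Hence `T(λ)` has a smooth weak limit, and `8π t = -Q(μ)`, with `Q` the explicit
linear expression `einsteinQ` (`wconv_einsteinLam`, `comp_effective`).

The sign of `Q` is a matter of compensated compactness. Given a timelike vector at a point, choose a
chart in which the background is Minkowskian at that point and the vector is proportional to the
zeroth coordinate vector. For a plane wave with wave vector `ξ` and amplitude `h`, an explicit
identity shows that the energy density `-Q₀₀` is a nonnegative square plus products of `h` with the
linearised Ricci tensor `L(ξ)h` (`waveEnergy_axis`, `waveEnergy_ge`). It is applied to the Fourier
transform of `φγ`, with `φ` a cutoff supported where the background is `ε`-close to Minkowski.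

It remains to see that the linearised Ricci tensor of `φγ` is negligible. It is the divergence of a
bounded field. It is also an `L¹`-bounded function plus the divergence of a field of size `O(ε)` in
`L²`, which comes from freezing the coefficients. Pairing the two representations, as in Murat's
lemma, bounds it in a negative Sobolev norm over frequencies above `1/θ` by `O(θ)` plus `O(ε²)`
(`integral_weight_mul_le`). Lower frequencies cost `θ⁻² ‖φγ‖² = O(θ⁻² λ²)`. With `θ = √λ`, letting
`λ → 0` and then `ε → 0` gives `-Q₀₀ ≥ 0` (`exists_energy_bound`, `einsteinQ_nonpos`). -/

omit [IsManifold 𝓘(ℝ, R4) ∞ M] in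
theorem mdifferentiable_of_mem_smoothCharts (he : e ∈ smoothCharts M) :
    e.MDifferentiable 𝓘(ℝ, R4) 𝓘(ℝ, R4) :=
  ⟨(contMDiffOn_of_mem_maximalAtlas he).mdifferentiableOn (by simp),
    (contMDiffOn_symm_of_mem_maximalAtlas he).mdifferentiableOn (by simp)⟩

/-- The tangent map of the inverse chart is smooth, and the coordinate vector field is its value on
a constant section. -/
theorem contMDiffOn_coordVec (he : e ∈ smoothCharts M) (i : Fin 4) :
    ContMDiffOn 𝓘(ℝ, R4) (𝓘(ℝ, R4).prod 𝓘(ℝ, R4)) ∞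
      (fun y => TotalSpace.mk' R4 (E := (TangentSpace 𝓘(ℝ, R4) : M → Type _)) (e.symm y)
        (coordVec e y i)) e.target := by
  have h1 := (contMDiffOn_symm_of_mem_maximalAtlas he).contMDiffOn_tangentMapWithin (m := ∞)
    (by simp) e.open_target.uniqueMDiffOn
  have h2 : ContMDiff 𝓘(ℝ, R4) (𝓘(ℝ, R4).prod 𝓘(ℝ, R4)) ∞
      (fun y : R4 => TotalSpace.mk' R4 (E := (TangentSpace 𝓘(ℝ, R4) : R4 → Type _)) y
        (EuclideanSpace.single i (1 : ℝ))) := by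
    exact contMDiff_vectorSpace_iff_contDiff.2 contDiff_const
  have h3 := h1.comp (h2.contMDiffOn (s := e.target)) (fun y hy => hy)
  refine h3.congr fun y hy => ?_
  simp only [Function.comp, tangentMapWithin, coordVec]
  rw [mfderivWithin_of_isOpen e.open_target hy]

theorem contDiffOn_bilin_coordVec (he : e ∈ smoothCharts M) (g : BilinField M) (i j : Fin 4) :
    ContDiffOn ℝ ∞ (fun y => g (e.symm y) (coordVec e y i) (coordVec e y j)) e.target := by
  have hg : ContMDiffOn 𝓘(ℝ, R4) (𝓘(ℝ, R4).prod 𝓘(ℝ, R4 →L[ℝ] R4 →L[ℝ] ℝ)) ∞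
      (fun y => TotalSpace.mk' (R4 →L[ℝ] R4 →L[ℝ] ℝ)
        (E := fun x : M => Tan x →L[ℝ] Tan x →L[ℝ] ℝ) (e.symm y) (g (e.symm y))) e.target :=
    g.contMDiff.comp_contMDiffOn (contMDiffOn_symm_of_mem_maximalAtlas he)
  have h : ContMDiffOn 𝓘(ℝ, R4) (𝓘(ℝ, R4).prod 𝓘(ℝ)) ∞
      (fun y => TotalSpace.mk' ℝ (E := Bundle.Trivial M ℝ) (e.symm y)
        (g (e.symm y) (coordVec e y i) (coordVec e y j))) e.target := by
    apply ContMDiffOn.clm_bundle_apply₂ (F₁ := R4) (F₂ := R4)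
    · exact hg
    · exact contMDiffOn_coordVec he i
    · exact contMDiffOn_coordVec he j
  intro y hy
  have := (contMDiffWithinAt_totalSpace.1 (h y hy)).2
  exact contMDiffWithinAt_iff_contDiffWithinAt.1 this

/-- The derivative of the inverse of the chart `e`, as an endomorphism of the model space. -/
def chartD (e : OpenPartialHomeomorph M R4) (y : R4) : R4 →L[ℝ] R4 :=
  mfderiv 𝓘(ℝ, R4) 𝓘(ℝ, R4) e.symm y

/-- The derivative of the chart `e`, as an endomorphism of the model space. -/
def chartDinv (e : OpenPartialHomeomorph M R4) (y : R4) : R4 →L[ℝ] R4 :=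
  mfderiv 𝓘(ℝ, R4) 𝓘(ℝ, R4) e (e.symm y)

omit [IsManifold 𝓘(ℝ, R4) ∞ M] in
theorem chartDinv_chartD (he : e ∈ smoothCharts M) {y : R4} (hy : y ∈ e.target) (v : R4) :
    chartDinv e y (chartD e y v) = v :=
  congrArg (fun L : R4 →L[ℝ] R4 => L v)
    ((mdifferentiable_of_mem_smoothCharts he).comp_symm_deriv hy)

omit [IsManifold 𝓘(ℝ, R4) ∞ M] in
theorem chartD_chartDinv (he : e ∈ smoothCharts M) {y : R4} (hy : y ∈ e.target) (v : R4) :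
    chartD e y (chartDinv e y v) = v := by
  have h := (mdifferentiable_of_mem_smoothCharts he).symm_comp_deriv (e.map_target hy)
  rw [e.right_inv hy] at h
  exact congrArg (fun L : R4 →L[ℝ] R4 => L v) h

theorem sum_smul_single (w : R4) : ∑ i, w i • (EuclideanSpace.single i (1 : ℝ) : R4) = w := by
  ext k; simp [Finset.sum_apply, Pi.single_apply]

omit [IsManifold 𝓘(ℝ, R4) ∞ M] in
theorem coordCovec_coordVec (he : e ∈ smoothCharts M) {y : R4} (hy : y ∈ e.target) (i j : Fin 4) :
    coordCovec e y i (coordVec e y j) = if i = j then 1 else 0 := by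
  change (chartDinv e y (chartD e y (EuclideanSpace.single j (1 : ℝ)))) i = _
  rw [chartDinv_chartD he hy]
  simp [Pi.single_apply]

omit [IsManifold 𝓘(ℝ, R4) ∞ M] in
theorem sum_coordCovec_smul_coordVec (he : e ∈ smoothCharts M) {y : R4} (hy : y ∈ e.target)
    (v : Tan (e.symm y)) : ∑ i, coordCovec e y i v • coordVec e y i = v := by
  change ∑ i, (chartDinv e y v) i • chartD e y (EuclideanSpace.single i (1 : ℝ)) = v
  simp_rw [← map_smul]
  rw [← map_sum, sum_smul_single]
  exact chartD_chartDinv he hy v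

end Frames

/-! ### Sections of the bundle of bilinear forms from smooth components -/

section Construction

variable {M : Type*} [TopologicalSpace M] [ChartedSpace R4 M] [IsManifold 𝓘(ℝ, R4) ∞ M]
  {e e' : OpenPartialHomeomorph M R4}

theorem contDiffOn_of_coordVec {B : (x : M) → R4 →L[ℝ] R4 →L[ℝ] ℝ} {s : Set R4}
    (h : ∀ i j, ContDiffOn ℝ ∞ (fun y => B (e.symm y) (coordVec e y i) (coordVec e y j)) s)
    (v w : R4) : ContDiffOn ℝ ∞ (fun y => B (e.symm y) (chartD e y v) (chartD e y w)) s := by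
  have : (fun y => B (e.symm y) (chartD e y v) (chartD e y w)) = fun y => ∑ i, ∑ j,
      v i * w j * B (e.symm y) (coordVec e y i) (coordVec e y j) := by
    ext y
    conv_lhs => rw [← sum_smul_single v, ← sum_smul_single w]
    simp only [map_sum, map_smul, sum_apply, smul_apply,
      smul_eq_mul, Finset.mul_sum]
    rw [Finset.sum_comm]
    refine Finset.sum_congr rfl fun i _ => Finset.sum_congr rfl fun j _ => ?_
    rw [mul_assoc, mul_left_comm]
    rfl
  rw [this]
  exact ContDiffOn.sum fun i _ => ContDiffOn.sum fun j _ => contDiffOn_const.mul (h i j)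

/-- A field of bilinear forms with smooth components is a smooth section. -/
theorem contMDiff_of_coordVec (B : (x : M) → Tan x →L[ℝ] Tan x →L[ℝ] ℝ)
    (h : ∀ e ∈ smoothCharts M, ∀ i j, ContDiffOn ℝ ∞
      (fun y => B (e.symm y) (coordVec e y i) (coordVec e y j)) e.target) :
    ContMDiff 𝓘(ℝ, R4) (𝓘(ℝ, R4).prod 𝓘(ℝ, R4 →L[ℝ] R4 →L[ℝ] ℝ)) ∞
      (fun x => TotalSpace.mk' (R4 →L[ℝ] R4 →L[ℝ] ℝ)
        (E := fun x : M => Tan x →L[ℝ] Tan x →L[ℝ] ℝ) x (B x)) := by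
  intro x₀
  rw [contMDiffAt_hom_bundle]
  refine ⟨contMDiffAt_id, ?_⟩
  have he : chartAt R4 x₀ ∈ smoothCharts M := IsManifold.chart_mem_maximalAtlas x₀
  set e := chartAt R4 x₀ with hedef
  have hx₀ : x₀ ∈ e.source := mem_chart_source R4 x₀
  have key : ContDiffOn ℝ ∞ (fun y => ContinuousLinearMap.inCoordinates R4
      (fun x : M => Tan x) (R4 →L[ℝ] ℝ) (fun x : M => Tan x →L[ℝ] ℝ) x₀ (e.symm y) x₀ (e.symm y)
      (B (e.symm y))) e.target := by
    rw [contDiffOn_clm_apply]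
    intro v
    rw [contDiffOn_clm_apply]
    intro w
    refine (contDiffOn_of_coordVec (e := e) (B := B) (h e he) v w).congr fun y hy => ?_
    have hs : e.symm y ∈ (chartAt R4 x₀).source := e.map_target hy
    rw [inCoordinates_apply_eq₂ (by simpa using hs) (by simpa using hs) (by simp)]
    have hsymm : ∀ u : R4, (trivializationAt R4 (TangentSpace 𝓘(ℝ, R4) : M → Type _) x₀).symm
        (e.symm y) u = chartD e y u := by
      intro u
      have h1 := TangentBundle.symmL_trivializationAt (I := 𝓘(ℝ, R4)) hs
      have hz : ∀ z : R4, z = y → (mfderivWithin 𝓘(ℝ, R4) 𝓘(ℝ, R4)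
          (extChartAt 𝓘(ℝ, R4) x₀).symm (range 𝓘(ℝ, R4)) z : R4 →L[ℝ] R4) u = chartD e y u := by
        rintro z rfl
        rw [modelWithCornersSelf_coe, range_id, mfderivWithin_univ]
        rfl
      have h2 := (congrArg (fun L : R4 →L[ℝ] R4 => L u) h1).trans (hz _ (e.right_inv hy))
      rw [← h2]
      exact (Trivialization.symmL_apply (R := ℝ) _ (by simpa using hs) u).symm
    rw [hsymm, hsymm]
    simp
    rfl
  have h3 : ContMDiffOn 𝓘(ℝ, R4) 𝓘(ℝ, R4 →L[ℝ] R4 →L[ℝ] ℝ) ∞ (fun x =>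
      ContinuousLinearMap.inCoordinates R4
      (fun x : M => Tan x) (R4 →L[ℝ] ℝ) (fun x : M => Tan x →L[ℝ] ℝ) x₀ (e.symm (e x)) x₀
      (e.symm (e x)) (B (e.symm (e x)))) e.source :=
    key.contMDiffOn.comp (contMDiffOn_of_mem_maximalAtlas he) (fun x hx => e.map_source hx)
  have h4 : ContMDiffOn 𝓘(ℝ, R4) 𝓘(ℝ, R4 →L[ℝ] R4 →L[ℝ] ℝ) ∞ (fun x =>
      ContinuousLinearMap.inCoordinates R4
      (fun x : M => Tan x) (R4 →L[ℝ] ℝ) (fun x : M => Tan x →L[ℝ] ℝ) x₀ x x₀ x (B x)) e.source :=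
    h3.congr fun x hx => by rw [e.left_inv hx]
  exact (h4 x₀ hx₀).contMDiffAt (e.open_source.mem_nhds hx₀)

/-- The smooth section given by a field of bilinear forms with smooth components. -/
def bilinFieldOf (B : (x : M) → Tan x →L[ℝ] Tan x →L[ℝ] ℝ)
    (h : ∀ e ∈ smoothCharts M, ∀ i j, ContDiffOn ℝ ∞
      (fun y => B (e.symm y) (coordVec e y i) (coordVec e y j)) e.target) : BilinField M :=
  ⟨B, contMDiff_of_coordVec B h⟩

end Construction

/-! ### The contraction in an arbitrary frame -/

section Contraction

/-- Expanding the standard vectors in `b`, and the `β` in the standard covectors, produces the same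
coefficients `∏ β (e_J)`. Both sides are therefore the same double sum in different orders. -/
theorem contract_eq_sum_of_dual {k : ℕ} (f : MultilinearMap ℝ (fun _ : Fin k => R4 →L[ℝ] ℝ) ℝ)
    (A : MultilinearMap ℝ (fun _ : Fin k => R4) ℝ) (b : Fin 4 → R4) (β : Fin 4 → R4 →L[ℝ] ℝ)
    (hb : ∀ v, ∑ i, β i v • b i = v) :
    ∑ i : Fin k → Fin 4, f (fun j => (EuclideanSpace.proj (i j) : R4 →L[ℝ] ℝ)) *
      A (fun j => (EuclideanSpace.single (i j) (1 : ℝ) : R4)) =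
    ∑ i : Fin k → Fin 4, f (fun j => β (i j)) * A (fun j => b (i j)) := by
  have hA : ∀ J : Fin k → Fin 4, A (fun s => (EuclideanSpace.single (J s) (1 : ℝ) : R4)) =
      ∑ I : Fin k → Fin 4, (∏ s, β (I s) (EuclideanSpace.single (J s) 1)) * A (fun s => b (I s)) := by
    intro J
    have h1 : (fun s => (EuclideanSpace.single (J s) (1 : ℝ) : R4)) =
        fun s => ∑ i, β i (EuclideanSpace.single (J s) 1) • b i := by
      ext1 s; rw [hb]
    rw [h1, MultilinearMap.map_sum]
    simp_rw [MultilinearMap.map_smul_univ, smul_eq_mul]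
  have hβ : ∀ i, β i = ∑ j, β i (EuclideanSpace.single j 1) • (EuclideanSpace.proj j : R4 →L[ℝ] ℝ) := by
    intro i
    ext v
    conv_lhs => rw [← sum_smul_single v]
    simp [mul_comm]
  have hf : ∀ I : Fin k → Fin 4, f (fun s => β (I s)) =
      ∑ J : Fin k → Fin 4, (∏ s, β (I s) (EuclideanSpace.single (J s) 1)) *
        f (fun s => (EuclideanSpace.proj (J s) : R4 →L[ℝ] ℝ)) := by
    intro I
    have h1 : (fun s => β (I s)) = fun s => ∑ j, β (I s) (EuclideanSpace.single j 1) •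
        (EuclideanSpace.proj j : R4 →L[ℝ] ℝ) := by
      ext1 s; exact hβ _
    rw [h1, MultilinearMap.map_sum]
    simp_rw [MultilinearMap.map_smul_univ, smul_eq_mul]
  simp_rw [hA, hf, Finset.mul_sum, Finset.sum_mul]
  rw [Finset.sum_comm]
  refine Finset.sum_congr rfl fun i _ => Finset.sum_congr rfl fun j _ => ?_
  ring

variable {M : Type*} [TopologicalSpace M] [ChartedSpace R4 M]
  {e e' : OpenPartialHomeomorph M R4}

theorem contract_eq_sum_coord (he : e ∈ smoothCharts M) {y : R4} (hy : y ∈ e.target) {k : ℕ}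
    (f : ContraTensor k (e.symm y)) (A : CovTensor k (e.symm y)) :
    contract f A = ∑ i : Fin k → Fin 4, f (fun j => coordCovec e y (i j)) *
      A (fun j => coordVec e y (i j)) :=
  contract_eq_sum_of_dual f A (coordVec e y) (coordCovec e y)
    (sum_coordCovec_smul_coordVec he hy)

end Contraction

/-! ### Changes of charts, and test tensors supported in one chart -/

section Transition

variable {M : Type*} [TopologicalSpace M] [ChartedSpace R4 M] [IsManifold 𝓘(ℝ, R4) ∞ M]
  {e e' : OpenPartialHomeomorph M R4}

theorem contDiffOn_transition (he : e ∈ smoothCharts M) (he' : e' ∈ smoothCharts M) :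
    ContDiffOn ℝ ∞ (fun y => e' (e.symm y)) (e.target ∩ e.symm ⁻¹' e'.source) := by
  have h := (contMDiffOn_of_mem_maximalAtlas he').comp
    ((contMDiffOn_symm_of_mem_maximalAtlas he).mono
      (inter_subset_left (t := e.symm ⁻¹' e'.source))) (fun y hy => hy.2)
  exact contMDiffOn_iff_contDiffOn.1 h

theorem isOpen_transition : IsOpen (e.target ∩ e.symm ⁻¹' e'.source) :=
  e.symm.isOpen_inter_preimage e'.open_source

theorem chartD_transition (he : e ∈ smoothCharts M) (he' : e' ∈ smoothCharts M) {y : R4}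
    (hy : y ∈ e.target) (hy' : e.symm y ∈ e'.source) (v : R4) :
    chartD e y v = chartD e' (e' (e.symm y)) (fderiv ℝ (fun z => e' (e.symm z)) y v) := by
  have h1 : e.symm =ᶠ[𝓝 y] e'.symm ∘ fun z => e' (e.symm z) := by
    filter_upwards [isOpen_transition.mem_nhds ⟨hy, hy'⟩] with z hz
    simp only [Function.comp]
    rw [e'.left_inv hz.2]
  have hd : MDifferentiableAt 𝓘(ℝ, R4) 𝓘(ℝ, R4) (fun z => e' (e.symm z)) y :=
    (((contDiffOn_transition he he').contDiffAt
      (isOpen_transition.mem_nhds ⟨hy, hy'⟩)).differentiableAt (by simp)).mdifferentiableAt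
  have h2 := mfderiv_comp (I' := 𝓘(ℝ, R4)) y
    ((mdifferentiable_of_mem_smoothCharts he').mdifferentiableAt_symm (e'.map_source hy')) hd
  rw [← h1.mfderiv_eq, mfderiv_eq_fderiv] at h2
  exact congrArg (fun L : R4 →L[ℝ] R4 => L v) h2

theorem coordCovec_chartD_transition (he : e ∈ smoothCharts M) (he' : e' ∈ smoothCharts M) {y' : R4}
    (hy : y' ∈ e'.target) (hy' : e'.symm y' ∈ e.source) (v : R4) (j : Fin 4) :
    coordCovec e' y' j (chartD e (e (e'.symm y')) v) =
      (fderiv ℝ (fun z => e' (e.symm z)) (e (e'.symm y')) v) j := by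
  have h := chartD_transition he he' (y := e (e'.symm y')) (e.map_source hy')
    (by rw [e.left_inv hy']; exact e'.map_target hy) v
  rw [e.left_inv hy', e'.right_inv hy] at h
  rw [h]
  change (chartDinv e' y' (chartD e' y' _)) j = _
  rw [chartDinv_chartD he' hy]

/-- The decomposable contravariant tensor with factors `v`. -/
def pureContra {k : ℕ} (v : Fin k → R4) : MultilinearMap ℝ (fun _ : Fin k => R4 →L[ℝ] ℝ) ℝ :=
  (MultilinearMap.mkPiAlgebra ℝ (Fin k) ℝ).compLinearMap
    fun s => (ContinuousLinearMap.apply ℝ ℝ (v s)).toLinearMap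

theorem pureContra_apply {k : ℕ} (v : Fin k → R4) (α : Fin k → R4 →L[ℝ] ℝ) :
    pureContra v α = ∏ s, α s (v s) := by
  simp [pureContra]

/-- The contravariant tensor field with the single component `φ` in the chart `e`. -/
def coordTensor (e : OpenPartialHomeomorph M R4) {k : ℕ} (φ : R4 → ℝ) (I : Fin k → Fin 4) (x : M) :
    ContraTensor k x :=
  (e.source.indicator (fun x => φ (e x)) x •
    pureContra fun s => chartD e (e x) (EuclideanSpace.single (I s) (1 : ℝ)) :
      MultilinearMap ℝ (fun _ : Fin k => R4 →L[ℝ] ℝ) ℝ)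

theorem coordTensor_apply {k : ℕ} (φ : R4 → ℝ) (I : Fin k → Fin 4) {x : M} (hx : x ∈ e.source)
    (α : Fin k → Tan x →L[ℝ] ℝ) : coordTensor e φ I x α =
      φ (e x) * ∏ s, α s (chartD e (e x) (EuclideanSpace.single (I s) (1 : ℝ))) := by
  change e.source.indicator (fun x => φ (e x)) x * pureContra _ _ = _
  rw [indicator_of_mem hx]
  exact congrArg _ (pureContra_apply _ (α : Fin k → R4 →L[ℝ] ℝ))

/-- These test tensors pick out one component, which is how weak convergence on the manifold is
turned into weak convergence of components. -/
theorem contract_coordTensor (he : e ∈ smoothCharts M) {k : ℕ} (φ : R4 → ℝ) (I : Fin k → Fin 4)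
    {y : R4} (hy : y ∈ e.target) (A : CovTensor k (e.symm y)) :
    contract (coordTensor e φ I (e.symm y)) A = φ y * A (fun s => coordVec e y (I s)) := by
  rw [contract_eq_sum_coord he hy, Finset.sum_eq_single I]
  · have : coordTensor e φ I (e.symm y) (fun s => coordCovec e y (I s)) = φ y := by
      rw [coordTensor_apply φ I (e.map_target hy), e.right_inv hy]
      have : ∀ s, coordCovec e y (I s) (chartD e y (EuclideanSpace.single (I s) (1 : ℝ))) = 1 := by
        intro s
        have := coordCovec_coordVec he hy (I s) (I s)
        rw [if_pos rfl] at this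
        exact this
      rw [Finset.prod_eq_one fun s _ => this s, mul_one]
    rw [this]
  · intro J _ hJ
    obtain ⟨s, hs⟩ : ∃ s, J s ≠ I s := by
      by_contra! h; exact hJ (funext h)
    have : coordTensor e φ I (e.symm y) (fun s => coordCovec e y (J s)) = 0 := by
      rw [coordTensor_apply φ I (e.map_target hy), e.right_inv hy]
      have h0 : coordCovec e y (J s) (chartD e y (EuclideanSpace.single (I s) (1 : ℝ))) = 0 := by
        have := coordCovec_coordVec he hy (J s) (I s)
        rw [if_neg hs] at this
        exact this
      rw [Finset.prod_eq_zero (Finset.mem_univ s) h0, mul_zero]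
    rw [this, zero_mul]
  · simp

theorem coordTensor_of_notMem {k : ℕ} {φ : R4 → ℝ} (I : Fin k → Fin 4) {x : M}
    (hx : x ∉ e.symm '' tsupport φ) : coordTensor e φ I x = 0 := by
  have h0 : e.source.indicator (fun x => φ (e x)) x = 0 := by
    by_contra h0
    have h1 := mem_of_indicator_ne_zero h0
    rw [indicator_of_mem h1] at h0
    exact hx ⟨e x, subset_tsupport φ h0, e.left_inv h1⟩
  rw [coordTensor, h0]
  exact zero_smul ℝ (pureContra _)

theorem isCompact_image_tsupport {φ : R4 → ℝ} (hφ : HasCompactSupport φ)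
    (hs : tsupport φ ⊆ e.target) : IsCompact (e.symm '' tsupport φ) :=
  IsCompact.image_of_continuousOn hφ (e.continuousOn_symm.mono hs)

theorem isCompact_closure_coordTensor [T2Space M] {k : ℕ} {φ : R4 → ℝ} (hφ : HasCompactSupport φ)
    (hs : tsupport φ ⊆ e.target) (I : Fin k → Fin 4) :
    IsCompact (closure {x | coordTensor e φ I x ≠ 0}) := by
  have hK := isCompact_image_tsupport hφ hs
  refine hK.of_isClosed_subset isClosed_closure (closure_minimal ?_ hK.isClosed)
  intro x hx
  by_contra h
  exact hx (coordTensor_of_notMem I h)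

/-- Over the domain of `e` the components in another chart are `φ` times entries of the Jacobian of
the transition. At points outside that domain the field vanishes in a neighbourhood, because the
compact image of the support is closed in a Hausdorff space. -/
theorem smoothContra_coordTensor [T2Space M] (he : e ∈ smoothCharts M) {k : ℕ} {φ : R4 → ℝ}
    (hφ : HasCompactSupport φ) (hφs : ContDiff ℝ ∞ φ)
    (hs : tsupport φ ⊆ e.target) (I : Fin k → Fin 4) : SmoothContra (coordTensor e φ I) := by
  intro e' he' J y' hy'
  by_cases hx : e'.symm y' ∈ e.source
  · apply ContDiffAt.contDiffWithinAt
    have ho := (isOpen_transition (e := e') (e' := e)).mem_nhds ⟨hy', hx⟩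
    have h1 := (contDiffOn_transition he' he).contDiffAt ho
    have hmem : e (e'.symm y') ∈ e.target ∩ e.symm ⁻¹' e'.source :=
      ⟨e.map_source hx, by rw [mem_preimage, e.left_inv hx]; exact e'.map_target hy'⟩
    have h2 := ((contDiffOn_transition he he').contDiffAt (isOpen_transition.mem_nhds hmem))
    have h3 := h2.fderiv_right (m := ∞) (by simp)
    have h4 : ContDiffAt ℝ ∞ (fun z => φ (e (e'.symm z)) * ∏ s,
        (fderiv ℝ (fun z => e' (e.symm z)) (e (e'.symm z)) (EuclideanSpace.single (I s) (1 : ℝ)))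
          (J s)) y' := by
      refine (hφs.contDiffAt.comp y' h1).mul (contDiffAt_prod fun s _ => ?_)
      have h5 := ContDiffAt.comp y' h3 h1
      have h6 := h5.clm_apply (contDiffAt_const (c := (EuclideanSpace.single (I s) (1 : ℝ) : R4)))
      exact (EuclideanSpace.proj (J s) : R4 →L[ℝ] ℝ).contDiff.contDiffAt.comp y' h6
    refine h4.congr_of_eventuallyEq ?_
    filter_upwards [ho] with z hz
    rw [coordTensor_apply φ I hz.2]
    congr 1
    exact Finset.prod_congr rfl fun s _ => coordCovec_chartD_transition he he' hz.1 hz.2 _ _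
  · apply ContDiffAt.contDiffWithinAt
    have hK := (isCompact_image_tsupport hφ hs).isClosed
    have hn : e'.symm y' ∉ e.symm '' tsupport φ := by
      rintro ⟨z, hz, hzx⟩
      exact hx (hzx ▸ e.map_target (hs hz))
    have ho : e'.target ∩ e'.symm ⁻¹' (e.symm '' tsupport φ)ᶜ ∈ 𝓝 y' :=
      (e'.symm.isOpen_inter_preimage hK.isOpen_compl).mem_nhds ⟨hy', hn⟩
    refine (contDiffAt_const (c := (0 : ℝ))).congr_of_eventuallyEq ?_
    filter_upwards [ho] with z hz
    rw [coordTensor_of_notMem I hz.2]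
    rfl

end Transition

/-! ### The volume measure in coordinates -/

section Volume

variable {M : Type*} [TopologicalSpace M] [ChartedSpace R4 M] [IsManifold 𝓘(ℝ, R4) ∞ M]
  {e e' : OpenPartialHomeomorph M R4}

theorem contDiffOn_comp (he : e ∈ smoothCharts M) (g : BilinField M) (i j : Fin 4) :
    ContDiffOn ℝ ∞ (fun y => comp e g y i j) e.target :=
  contDiffOn_bilin_coordVec he g i j

/-- The Jacobian matrix of the change of charts from `e` to `e'`. -/
def jacobian (e e' : OpenPartialHomeomorph M R4) (y : R4) : Matrix (Fin 4) (Fin 4) ℝ :=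
  Matrix.of fun k i => (fderiv ℝ (fun z => e' (e.symm z)) y (EuclideanSpace.single i 1)) k

theorem det_jacobian (e e' : OpenPartialHomeomorph M R4) (y : R4) :
    (jacobian e e' y).det = (fderiv ℝ (fun z => e' (e.symm z)) y).det := by
  have h := LinearMap.det_toMatrix (EuclideanSpace.basisFun (Fin 4) ℝ).toBasis
    (fderiv ℝ (fun z => e' (e.symm z)) y).toLinearMap
  rw [ContinuousLinearMap.det, ← h]
  congr 1

theorem coordVec_transition (he : e ∈ smoothCharts M) (he' : e' ∈ smoothCharts M) {y : R4}
    (hy : y ∈ e.target) (hy' : e.symm y ∈ e'.source) (i : Fin 4) :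
    coordVec e y i = ∑ k, jacobian e e' y k i •
      (coordVec e' (e' (e.symm y)) k : R4) := by
  change chartD e y (EuclideanSpace.single i 1) = ∑ k, jacobian e e' y k i •
    chartD e' (e' (e.symm y)) (EuclideanSpace.single k 1)
  rw [chartD_transition he he' hy hy']
  conv_lhs => rw [← sum_smul_single (fderiv ℝ (fun z => e' (e.symm z)) y _)]
  rw [map_sum]
  simp_rw [map_smul]
  rfl

theorem bilin_sum_smul {ι : Type*} [Fintype ι] (b : R4 →L[ℝ] R4 →L[ℝ] ℝ) (a c : ι → ℝ)
    (u w : ι → R4) : b (∑ k, a k • u k) (∑ l, c l • w l) = ∑ k, ∑ l, a k * c l * b (u k) (w l) := by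
  simp only [map_sum, map_smul, sum_apply, smul_apply, smul_eq_mul, Finset.mul_sum]
  rw [Finset.sum_comm]
  refine Finset.sum_congr rfl fun i _ => Finset.sum_congr rfl fun j _ => ?_
  ring

theorem bilin_transition (he : e ∈ smoothCharts M) (he' : e' ∈ smoothCharts M) {y : R4}
    (hy : y ∈ e.target) (hy' : e.symm y ∈ e'.source) (b : R4 →L[ℝ] R4 →L[ℝ] ℝ) (i j : Fin 4) :
    b (coordVec e y i) (coordVec e y j) = ∑ k, ∑ l, jacobian e e' y k i * jacobian e e' y l j *
      b (coordVec e' (e' (e.symm y)) k) (coordVec e' (e' (e.symm y)) l) := by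
  rw [coordVec_transition he he' hy hy' i, coordVec_transition he he' hy hy' j]
  exact bilin_sum_smul b _ _ _ _

theorem comp_transition (he : e ∈ smoothCharts M) (he' : e' ∈ smoothCharts M) (g : BilinField M)
    {y : R4} (hy : y ∈ e.target) (hy' : e.symm y ∈ e'.source) :
    comp e g y = (jacobian e e' y)ᵀ * comp e' g (e' (e.symm y)) * jacobian e e' y := by
  ext i j
  have h := bilin_transition he he' hy hy' (g (e.symm y)) i j
  have hc : ∀ k l, comp e' g (e' (e.symm y)) k l =
      (g (e.symm y) : R4 →L[ℝ] R4 →L[ℝ] ℝ) (coordVec e' (e' (e.symm y)) k)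
        (coordVec e' (e' (e.symm y)) l) := by
    intro k l
    have : e'.symm (e' (e.symm y)) = e.symm y := e'.left_inv hy'
    change (g (e'.symm (e' (e.symm y))) : R4 →L[ℝ] R4 →L[ℝ] ℝ) _ _ = _
    rw [this]
  simp only [Matrix.mul_apply, Matrix.transpose_apply, Finset.sum_mul, hc]
  rw [Finset.sum_comm]
  refine h.trans (Finset.sum_congr rfl fun k _ => Finset.sum_congr rfl fun l _ => ?_)
  exact mul_right_comm _ _ _

variable [MeasurableSpace M] [BorelSpace M]

theorem measurableSet_target_inter_preimage {A : Set M} (hA : MeasurableSet A) :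
    MeasurableSet (e.target ∩ e.symm ⁻¹' A) := by
  have h : Measurable (e.target.domRestrict e.symm) :=
    (continuousOn_iff_continuous_domRestrict.1 e.continuousOn_symm).measurable
  have h2 := MeasurableSet.subtype_image e.open_target.measurableSet (h hA)
  convert! h2 using 1
  ext y; simp [and_comm]

theorem aemeasurable_chart_symm (g : BilinField M) : AEMeasurable e.symm
    (((volume : Measure R4).restrict e.target).withDensity
    (fun y => ENNReal.ofReal √|(comp e g y).det|)) :=
  (e.continuousOn_symm.aemeasurable e.open_target.measurableSet).mono_ac
    (withDensity_absolutelyContinuous _ _)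

theorem chartVolume_apply (g : BilinField M) {A : Set M} (hA : MeasurableSet A) :
    chartVolume g e A = ∫⁻ y in e.target ∩ e.symm ⁻¹' A, ENNReal.ofReal √|(comp e g y).det| := by
  rw [chartVolume, Measure.map_apply_of_aemeasurable (aemeasurable_chart_symm g) hA,
    withDensity_apply', Measure.restrict_restrict' e.open_target.measurableSet, inter_comm]

/-- Change of variables: the component matrices are related by `JᵀGJ`, so `√|det|` acquires the
factor `|det J|` that the transformation formula for integrals requires. -/
theorem chartVolume_eq_of_subset (he : e ∈ smoothCharts M) (he' : e' ∈ smoothCharts M)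
    (g : BilinField M) {A : Set M} (hA : MeasurableSet A) (h : A ⊆ e.source) (h' : A ⊆ e'.source) :
    chartVolume g e' A = chartVolume g e A := by
  rw [chartVolume_apply g hA, chartVolume_apply g hA]
  have hs := measurableSet_target_inter_preimage (e := e) hA
  have himg : e'.target ∩ e'.symm ⁻¹' A =
      (fun z => e' (e.symm z)) '' (e.target ∩ e.symm ⁻¹' A) := by
    ext z
    constructor
    · rintro ⟨hz, hzA⟩
      refine ⟨e (e'.symm z), ⟨e.map_source (h hzA), ?_⟩, ?_⟩
      · rw [mem_preimage, e.left_inv (h hzA)]; exact hzA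
      · simp only [e.left_inv (h hzA), e'.right_inv hz]
    · rintro ⟨w, ⟨hw, hwA⟩, rfl⟩
      refine ⟨e'.map_source (h' hwA), ?_⟩
      rw [mem_preimage, e'.left_inv (h' hwA)]; exact hwA
  rw [himg, lintegral_image_eq_lintegral_abs_det_fderiv_mul volume hs
    (f' := fun y => fderiv ℝ (fun z => e' (e.symm z)) y)]
  · refine setLIntegral_congr_fun hs fun y hy => ?_
    rw [comp_transition he he' g hy.1 (h' hy.2), ← det_jacobian, ← ENNReal.ofReal_mul (abs_nonneg _)]
    congr 1
    rw [Matrix.det_mul, Matrix.det_mul, Matrix.det_transpose, mul_right_comm, abs_mul,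
      Real.sqrt_mul (abs_nonneg _), abs_mul_self, Real.sqrt_mul_self_eq_abs]
  · intro y hy
    exact ((((contDiffOn_transition he he').contDiffAt (isOpen_transition.mem_nhds
      ⟨hy.1, h' hy.2⟩)).differentiableAt (by simp)).hasFDerivAt).hasFDerivWithinAt
  · intro y hy z hz hyz
    have h1 := e'.injOn (h' hy.2) (h' hz.2) hyz
    exact e.symm.injOn hy.1 hz.1 h1

theorem chartVolume_restrict_compl (g : BilinField M) :
    (chartVolume g e).restrict e.sourceᶜ = 0 := by
  rw [Measure.restrict_eq_zero, chartVolume_apply g e.open_source.measurableSet.compl]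
  have : e.target ∩ e.symm ⁻¹' e.sourceᶜ = ∅ := by
    ext y; simp only [mem_inter_iff, mem_preimage, mem_compl_iff, mem_empty_iff_false, iff_false]
    exact fun h => h.2 (e.map_target h.1)
  rw [this]; simp

theorem chartVolume_restrict_source (g : BilinField M) :
    (chartVolume g e).restrict e.source = chartVolume g e := by
  conv_rhs => rw [← Measure.restrict_add_restrict_compl (μ := chartVolume g e)
    e.open_source.measurableSet]
  rw [chartVolume_restrict_compl, add_zero]

theorem volumeMeasure_restrict_source (he : e ∈ smoothCharts M) (g : BilinField M) :
    (volumeMeasure g).restrict e.source = chartVolume g e := by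
  have hm := e.open_source.measurableSet
  apply le_antisymm
  -- The supremum only has to be controlled on `e.source`, so the trivial upper bound `⊤` is enough
  -- on the complement.
  · have h1 : volumeMeasure g ≤ chartVolume g e + (⊤ : Measure M).restrict e.sourceᶜ := by
      refine iSup₂_le fun e' he' => ?_
      rw [← Measure.restrict_add_restrict_compl (μ := chartVolume g e') hm]
      gcongr
      · rw [Measure.le_iff]
        intro A hA
        rw [Measure.restrict_apply hA, ← Measure.restrict_add_restrict_compl
          (μ := chartVolume g e') e'.open_source.measurableSet, chartVolume_restrict_compl, add_zero,
          Measure.restrict_apply (hA.inter hm), chartVolume_eq_of_subset he he' g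
          ((hA.inter hm).inter e'.open_source.measurableSet)
          (fun x hx => hx.1.2) (fun x hx => hx.2)]
        exact measure_mono fun x hx => hx.1.1
      · exact le_top
    calc (volumeMeasure g).restrict e.source
        ≤ (chartVolume g e + (⊤ : Measure M).restrict e.sourceᶜ).restrict e.source :=
          Measure.restrict_mono_measure h1 _
      _ = chartVolume g e := by
          rw [Measure.restrict_add, chartVolume_restrict_source, Measure.restrict_restrict hm]
          simp
  · rw [← chartVolume_restrict_source]
    exact Measure.restrict_mono_measure (le_iSup₂ (f := fun e (_ : e ∈ smoothCharts M) =>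
      chartVolume g e) e he) _

theorem contDiffOn_det {s : Set R4} {G : R4 → Matrix (Fin 4) (Fin 4) ℝ} {n : WithTop ℕ∞}
    (hG : ∀ i j, ContDiffOn ℝ n (fun y => G y i j) s) : ContDiffOn ℝ n (fun y => (G y).det) s := by
  simp_rw [Matrix.det_apply]
  exact ContDiffOn.sum fun σ _ => (contDiffOn_prod fun i _ => hG _ _).const_smul _

/-- Integrals against the volume measure of functions supported in a chart domain, in
coordinates. -/
theorem integral_volumeMeasure [SecondCountableTopology M] (he : e ∈ smoothCharts M)
    (g : BilinField M) {F : M → ℝ}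
    (hF : ContinuousOn (fun y => F (e.symm y)) e.target) (hF0 : ∀ x ∉ e.source, F x = 0) :
    ∫ x, F x ∂(volumeMeasure g) = ∫ y in e.target, √|(comp e g y).det| * F (e.symm y) := by
  rw [← setIntegral_eq_integral_of_forall_compl_eq_zero hF0, volumeMeasure_restrict_source he]
  have hFc : ContinuousOn F e.source := by
    refine (hF.comp e.continuousOn (fun x hx => e.map_source hx)).congr fun x hx => ?_
    simp [e.left_inv hx]
  have hFm : AEStronglyMeasurable F (chartVolume g e) := by
    rw [← chartVolume_restrict_source]
    exact hFc.aestronglyMeasurable e.open_source.measurableSet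
  have hd : ContinuousOn (fun y => (comp e g y).det) e.target :=
    (contDiffOn_det (n := ∞) fun i j => contDiffOn_comp he g i j).continuousOn
  rw [chartVolume, integral_map (aemeasurable_chart_symm g) hFm,
    integral_withDensity_eq_integral_toReal_smul₀]
  · simp_rw [ENNReal.toReal_ofReal (Real.sqrt_nonneg _), smul_eq_mul]
  · exact (hd.abs.sqrt.aemeasurable e.open_target.measurableSet).ennreal_ofReal
  · exact ae_of_all _ fun _ => ENNReal.ofReal_lt_top

end Volume

/-! ### Connection coefficients and components of covariant derivatives -/

section ConnectionCoefficients

variable {M : Type*} [TopologicalSpace M] [ChartedSpace R4 M] [IsManifold 𝓘(ℝ, R4) ∞ M]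
  {e : OpenPartialHomeomorph M R4}

/-- The coordinate vector field `∂/∂xⁱ` on the domain of the chart `e`. -/
def coordField (e : OpenPartialHomeomorph M R4) (i : Fin 4) (x : M) : TangentSpace 𝓘(ℝ, R4) x :=
  chartD e (e x) (EuclideanSpace.single i (1 : ℝ))

theorem coordField_symm {y : R4} (hy : y ∈ e.target) (i : Fin 4) :
    coordField e i (e.symm y) = coordVec e y i := by
  change chartD e (e (e.symm y)) _ = chartD e y _
  rw [e.right_inv hy]

theorem contMDiffOn_coordField (he : e ∈ smoothCharts M) (i : Fin 4) :
    ContMDiffOn 𝓘(ℝ, R4) (𝓘(ℝ, R4).prod 𝓘(ℝ, R4)) ∞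
      (fun x => TotalSpace.mk' R4 (E := (TangentSpace 𝓘(ℝ, R4) : M → Type _)) x
        (coordField e i x)) e.source := by
  refine ((contMDiffOn_coordVec he i).comp (contMDiffOn_of_mem_maximalAtlas he)
    (fun x hx => e.map_source hx)).congr fun x hx => ?_
  simp only [Function.comp]
  have : ∀ x', x' = x → TotalSpace.mk' R4 (E := (TangentSpace 𝓘(ℝ, R4) : M → Type _)) x
        (coordField e i x) = TotalSpace.mk' R4 x' (chartD e (e x) (EuclideanSpace.single i (1 : ℝ))) := by
    rintro x' rfl; rfl
  exact this _ (e.left_inv hx)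

theorem mdifferentiableAt_coordField (he : e ∈ smoothCharts M) (i : Fin 4) {x : M}
    (hx : x ∈ e.source) :
    MDifferentiableAt 𝓘(ℝ, R4) (𝓘(ℝ, R4).prod 𝓘(ℝ, R4)) (T% (coordField e i)) x :=
  ((contMDiffOn_coordField he i).contMDiffAt (e.open_source.mem_nhds hx)).mdifferentiableAt (by simp)

/-- The components of a vector field that is smooth along the inverse of a chart are smooth. -/
theorem contDiffAt_coordCovec (he : e ∈ smoothCharts M) {y₀ : R4} (hy₀ : y₀ ∈ e.target)
    (W : (y : R4) → TangentSpace 𝓘(ℝ, R4) (e.symm y))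
    (hW : ContMDiffAt 𝓘(ℝ, R4) (𝓘(ℝ, R4).prod 𝓘(ℝ, R4)) ∞
      (fun y => TotalSpace.mk' R4 (E := (TangentSpace 𝓘(ℝ, R4) : M → Type _)) (e.symm y) (W y)) y₀)
    (k : Fin 4) : ContDiffAt ℝ ∞ (fun y => coordCovec e y k (W y)) y₀ := by
  have h1 := (contMDiffOn_of_mem_maximalAtlas he).contMDiffOn_tangentMapWithin (m := ∞)
    (by simp) e.open_source.uniqueMDiffOn
  have hO : IsOpen (π R4 (TangentSpace 𝓘(ℝ, R4) : M → Type _) ⁻¹' e.source) :=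
    e.open_source.preimage (FiberBundle.continuous_proj R4 (TangentSpace 𝓘(ℝ, R4) : M → Type _))
  have h2 := (h1.contMDiffAt (hO.mem_nhds
    (show TotalSpace.mk' R4 (e.symm y₀) (W y₀) ∈ _ from e.map_target hy₀))).comp y₀ hW
  have h3 := (contMDiff_snd_tangentBundle_modelSpace R4 𝓘(ℝ, R4) (n := ∞)).contMDiffAt.comp y₀ h2
  have h4 := ((EuclideanSpace.proj k : R4 →L[ℝ] ℝ).contDiff.contDiffAt).comp y₀ h3.contDiffAt
  refine h4.congr_of_eventuallyEq ?_
  filter_upwards [e.open_target.mem_nhds hy₀] with y hy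
  simp only [Function.comp, tangentMapWithin, TotalSpace.mk']
  rw [mfderivWithin_of_isOpen e.open_source (e.map_target hy)]
  rfl

/-- The coefficients `Γ^k_{ca}` of a connection in a chart. -/
def connCoef (D : Connection M) (e : OpenPartialHomeomorph M R4) (k c a : Fin 4) (y : R4) : ℝ :=
  coordCovec e y k (D (coordField e a) (e.symm y) (coordVec e y c))

/-- Smoothness of `D` is used for vector fields smooth on all of `M`. The coordinate field is
therefore multiplied by a bump function equal to one near the point, and locality of `D` removes the
bump again. -/
theorem continuousOn_connCoef [T2Space M] (he : e ∈ smoothCharts M) (D : Connection M)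
    (hD : D.ContMDiffCovariantDerivative ∞) (k c a : Fin 4) :
    ContinuousOn (connCoef D e k c a) e.target := by
  intro y₀ hy₀
  apply ContinuousAt.continuousWithinAt
  have hx₀ := e.map_target hy₀
  obtain ⟨χ, -, hχ⟩ := ((SmoothBumpFunction.nhds_basis_tsupport (I := 𝓘(ℝ, R4)) (e.symm y₀)).mem_iff).1
    (e.open_source.mem_nhds hx₀)
  have hY : ContMDiff 𝓘(ℝ, R4) (𝓘(ℝ, R4).prod 𝓘(ℝ, R4)) ∞ (T% ((χ : M → ℝ) • coordField e a)) :=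
    ContMDiffOn.smul_section_of_tsupport χ.contMDiff.contMDiffOn e.open_source hχ
      (contMDiffOn_coordField he a)
  have hDY := hD.contMDiff.contMDiff (σ := (χ : M → ℝ) • coordField e a) hY.contMDiffOn
  have h1 := (contMDiffOn_univ.1 hDY).contMDiffAt (x := e.symm y₀)
  have hsymm := contMDiffAt_symm_of_mem_maximalAtlas he hy₀
  have h2 : ContMDiffAt 𝓘(ℝ, R4) (𝓘(ℝ, R4).prod 𝓘(ℝ, R4)) ∞
      (fun y => TotalSpace.mk' R4 (E := (TangentSpace 𝓘(ℝ, R4) : M → Type _)) (e.symm y)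
        (D ((χ : M → ℝ) • coordField e a) (e.symm y) (coordVec e y c))) y₀ :=
    ContMDiffAt.clm_bundle_apply (E₁ := (TangentSpace 𝓘(ℝ, R4) : M → Type _))
      (E₂ := (TangentSpace 𝓘(ℝ, R4) : M → Type _)) (h1.comp y₀ hsymm)
      ((contMDiffOn_coordVec he c).contMDiffAt (e.open_target.mem_nhds hy₀))
  have h3 := (contDiffAt_coordCovec he hy₀ _ h2 k).continuousAt
  refine h3.congr ?_
  have hev : ∀ᶠ x in 𝓝 (e.symm y₀), ∀ᶠ x' in 𝓝 x, χ x' = 1 :=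
    eventually_eventually_nhds.2 χ.eventuallyEq_one
  filter_upwards [(e.continuousAt_symm hy₀).eventually hev, e.open_target.mem_nhds hy₀] with y hy hyt
  have := D.isCovariantDerivativeOnUniv.congr_of_eventuallyEq (σ := (χ : M → ℝ) • coordField e a)
    (σ' := coordField e a) (x := e.symm y) (hY.contMDiffAt.mdifferentiableAt (by simp))
    (mdifferentiableAt_coordField he a (e.map_target hyt)) univ_mem
    (hy.mono fun x' hx' => by simp [hx'])
  simp only [connCoef]
  rw [← this]

/-- The partial derivative of the components of a tensor field as a derivative along a coordinate
vector field. -/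
theorem mvfderiv_coordVec (he : e ∈ smoothCharts M) {y : R4} (hy : y ∈ e.target) {F : M → ℝ}
    (hF : MDifferentiableAt 𝓘(ℝ, R4) 𝓘(ℝ, ℝ) F (e.symm y)) (c : Fin 4) :
    mvfderiv 𝓘(ℝ, R4) F (e.symm y) (coordVec e y c) = pd c (fun z => F (e.symm z)) y := by
  have h := mfderiv_comp y hF ((mdifferentiable_of_mem_smoothCharts he).mdifferentiableAt_symm hy)
  have h2 := congrArg (fun L : R4 →L[ℝ] ℝ => L (EuclideanSpace.single c 1)) h
  rw [pd, ← mfderiv_eq_fderiv]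
  exact h2.symm

/-- The components `∇_c γ_{ab}` in a chart. -/
def nablaComp (D : Connection M) (γ : BilinField M) (e : OpenPartialHomeomorph M R4)
    (c a b : Fin 4) (y : R4) : ℝ :=
  pd c (fun z => comp e γ z a b) y - ∑ k, connCoef D e k c a y * comp e γ y k b
    - ∑ k, connCoef D e k c b y * comp e γ y a k

theorem nablaForm_coordVec (he : e ∈ smoothCharts M) (D : Connection M) (γ : BilinField M) {y : R4}
    (hy : y ∈ e.target) (c a b : Fin 4) :
    nablaForm D γ (e.symm y) (coordVec e y a) (coordVec e y b) (coordVec e y c) =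
      nablaComp D γ e c a b y := by
  have hx := e.map_target hy
  have ha := mdifferentiableAt_coordField he a hx
  have hb := mdifferentiableAt_coordField he b hx
  have h1 : nablaForm D γ (e.symm y) (coordField e a (e.symm y)) (coordField e b (e.symm y)) =
      nablaAux D γ (coordField e a) (coordField e b) (e.symm y) :=
    TensorialAt.mkHom₂_apply _ _ ha hb
  rw [coordField_symm hy, coordField_symm hy] at h1
  rw [h1, nablaAux_apply, mvfderiv_coordVec he hy (mdiff_bilin γ ha hb)]
  have h2 : pd c (fun z => γ (e.symm z) (coordField e a (e.symm z)) (coordField e b (e.symm z))) y =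
      pd c (fun z => comp e γ z a b) y := by
    simp only [pd]
    congr 1
    apply Filter.EventuallyEq.fderiv_eq
    filter_upwards [e.open_target.mem_nhds hy] with z hz
    rw [coordField_symm hz, coordField_symm hz]
    rfl
  have h3 : ∀ a', D (coordField e a') (e.symm y) (coordVec e y c) =
      ∑ k, connCoef D e k c a' y • coordVec e y k := fun a' =>
    (sum_coordCovec_smul_coordVec he hy _).symm
  rw [h2, h3, h3, coordField_symm hy, coordField_symm hy]
  simp only [map_sum, map_smul, sum_apply, smul_apply, smul_eq_mul]
  rfl

theorem nabla_coordVec (he : e ∈ smoothCharts M) (D : Connection M) (γ : BilinField M) {y : R4}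
    (hy : y ∈ e.target) (i : Fin 3 → Fin 4) :
    nabla D γ (e.symm y) (fun s => coordVec e y (i s)) = nablaComp D γ e (i 0) (i 1) (i 2) y :=
  nablaForm_coordVec he D γ hy _ _ _

theorem nablaSq_coordVec (he : e ∈ smoothCharts M) (D : Connection M) (γ : BilinField M) {y : R4}
    (hy : y ∈ e.target) (i : Fin 6 → Fin 4) :
    nablaSq D γ (e.symm y) (fun s => coordVec e y (i s)) =
      nablaComp D γ e (i 0) (i 2) (i 3) y * nablaComp D γ e (i 1) (i 4) (i 5) y :=
  congrArg₂ (· * ·) (nablaForm_coordVec he D γ hy _ _ _) (nablaForm_coordVec he D γ hy _ _ _)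

end ConnectionCoefficients

/-! ### Test functions, uniform bounds and weak convergence of families -/

section WeakConvergence

/-- Smooth functions with compact support in `V`. -/
structure IsTest (V : Set R4) (φ : R4 → ℝ) : Prop where
  contDiff : ContDiff ℝ ∞ φ
  compact : HasCompactSupport φ
  subset : tsupport φ ⊆ V

variable {V : Set R4} {φ : R4 → ℝ}

theorem IsTest.mono {W : Set R4} (h : IsTest V φ) (hVW : V ⊆ W) : IsTest W φ :=
  ⟨h.contDiff, h.compact, h.subset.trans hVW⟩

/-- Regularity of `u` on `V` is enough: off the support of `φ` the product vanishes locally,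
whatever `u` does there. -/
theorem IsTest.contDiff_mul (h : IsTest V φ) (hV : IsOpen V) {n : ℕ∞} {u : R4 → ℝ}
    (hu : ContDiffOn ℝ n u V) : ContDiff ℝ n (fun y => φ y * u y) := by
  rw [contDiff_iff_contDiffAt]
  intro y
  by_cases hy : y ∈ tsupport φ
  · exact (h.contDiff.contDiffAt.of_le (by exact_mod_cast le_top)).mul
      (hu.contDiffAt (hV.mem_nhds (h.subset hy)))
  · refine (contDiffAt_const (c := (0 : ℝ))).congr_of_eventuallyEq ?_
    filter_upwards [(isClosed_tsupport φ).isOpen_compl.mem_nhds hy] with z hz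
    rw [image_eq_zero_of_notMem_tsupport hz, zero_mul]

theorem IsTest.continuous_mul (h : IsTest V φ) (hV : IsOpen V) {u : R4 → ℝ}
    (hu : ContinuousOn u V) : Continuous (fun y => φ y * u y) :=
  (h.contDiff_mul hV (n := 0) (contDiffOn_zero.2 hu)).continuous

theorem IsTest.mul (h : IsTest V φ) (hV : IsOpen V) {u : R4 → ℝ}
    (hu : ContDiffOn ℝ ∞ u V) : IsTest V (fun y => φ y * u y) :=
  ⟨h.contDiff_mul hV hu, h.compact.mul_right, (tsupport_mul_subset_left).trans h.subset⟩

theorem IsTest.integrable_mul (h : IsTest V φ) (hV : IsOpen V) {u : R4 → ℝ}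
    (hu : ContinuousOn u V) : Integrable (fun y => φ y * u y) :=
  (h.continuous_mul hV hu).integrable_of_hasCompactSupport h.compact.mul_right

theorem IsTest.integrable (h : IsTest V φ) : Integrable φ :=
  h.contDiff.continuous.integrable_of_hasCompactSupport h.compact

theorem IsTest.eq_zero (h : IsTest V φ) {y : R4} (hy : y ∉ V) : φ y = 0 :=
  image_eq_zero_of_notMem_tsupport fun hy' => hy (h.subset hy')

theorem IsTest.pd (h : IsTest V φ) (i : Fin 4) : IsTest V (pd i φ) := by
  refine ⟨?_, h.compact.fderiv_apply ℝ _, (tsupport_fderiv_apply_subset ℝ _).trans h.subset⟩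
  exact (h.contDiff.fderiv_right (m := ∞) (by simp)).clm_apply contDiff_const

theorem contDiffOn_pd (hV : IsOpen V) {n m : WithTop ℕ∞} {u : R4 → ℝ} (hu : ContDiffOn ℝ n u V)
    (hmn : m + 1 ≤ n) (i : Fin 4) : ContDiffOn ℝ m (pd i u) V :=
  (hu.fderiv_of_isOpen hV hmn).clm_apply contDiffOn_const

theorem pd_mul {u w : R4 → ℝ} {y : R4} (hu : DifferentiableAt ℝ u y) (hw : DifferentiableAt ℝ w y)
    (i : Fin 4) : pd i (fun z => u z * w z) y = pd i u y * w y + u y * pd i w y := by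
  simp only [pd]
  rw [fderiv_fun_mul hu hw]
  simp only [add_apply, smul_apply, smul_eq_mul]
  ring

theorem pd_sub {u w : R4 → ℝ} {y : R4} (hu : DifferentiableAt ℝ u y) (hw : DifferentiableAt ℝ w y)
    (i : Fin 4) : pd i (fun z => u z - w z) y = pd i u y - pd i w y := by
  simp only [pd]
  rw [fderiv_fun_sub hu hw]
  simp

theorem pd_add {u w : R4 → ℝ} {y : R4} (hu : DifferentiableAt ℝ u y) (hw : DifferentiableAt ℝ w y)
    (i : Fin 4) : pd i (fun z => u z + w z) y = pd i u y + pd i w y := by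
  simp only [pd]
  rw [fderiv_fun_add hu hw]
  simp

theorem pd_sum {ι : Type*} {s : Finset ι} {u : ι → R4 → ℝ} {y : R4}
    (hu : ∀ j ∈ s, DifferentiableAt ℝ (u j) y)
    (i : Fin 4) : pd i (fun z => ∑ j ∈ s, u j z) y = ∑ j ∈ s, pd i (u j) y := by
  simp only [pd]
  rw [fderiv_fun_sum hu]
  simp

theorem pd_congr (hV : IsOpen V) {u w : R4 → ℝ} {y : R4} (hy : y ∈ V)
    (h : ∀ z ∈ V, u z = w z) (i : Fin 4) : pd i u y = pd i w y := by
  simp only [pd]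
  rw [Filter.EventuallyEq.fderiv_eq (f := w)]
  filter_upwards [hV.mem_nhds hy] with z hz using h z hz

theorem integral_pd_eq_zero {F : R4 → ℝ} (hF : ContDiff ℝ 1 F) (hc : HasCompactSupport F)
    (i : Fin 4) : ∫ y, pd i F y = 0 := by
  have h := integral_mul_fderiv_eq_neg_fderiv_mul_of_integrable (μ := (volume : Measure R4))
    (f := fun _ => (1 : ℝ)) (g := F) (v := EuclideanSpace.single i (1 : ℝ)) (by simp)
    (by simpa using ((hF.continuous_fderiv one_ne_zero).clm_apply
      continuous_const).integrable_of_hasCompactSupport (hc.fderiv_apply ℝ _))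
    (by simpa using hF.continuous.integrable_of_hasCompactSupport hc) (by fun_prop)
    (fun x _ => hF.differentiable one_ne_zero x)
  simpa [pd] using h

/-- Integration by parts against a test function. -/
theorem IsTest.integral_mul_pd (h : IsTest V φ) (hV : IsOpen V) {u : R4 → ℝ}
    (hu : ContDiffOn ℝ 1 u V) (i : Fin 4) :
    ∫ y, φ y * Backreaction.pd i u y = -∫ y, Backreaction.pd i φ y * u y := by
  have h0 := integral_pd_eq_zero (h.contDiff_mul hV (n := 1) hu) h.compact.mul_right i
  have h1 : ∀ y, Backreaction.pd i (fun z => φ z * u z) y =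
      φ y * Backreaction.pd i u y + Backreaction.pd i φ y * u y := by
    intro y
    by_cases hy : y ∈ V
    · rw [pd_mul (h.contDiff.differentiable (by simp) y)
        ((hu.contDiffAt (hV.mem_nhds hy)).differentiableAt one_ne_zero)]
      ring
    · rw [h.eq_zero hy, (h.pd i).eq_zero hy]
      have : y ∉ tsupport (fun z => φ z * u z) := fun hy' =>
        hy (h.subset (tsupport_mul_subset_left hy'))
      simp only [Backreaction.pd, fderiv_of_notMem_tsupport ℝ this]
      simp
  simp_rw [h1] at h0
  rw [integral_add (h.integrable_mul hV (contDiffOn_pd hV hu (m := 0) (by simp) i).continuousOn)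
    ((h.pd i).integrable_mul hV hu.continuousOn)] at h0
  linarith

/-- Weak convergence, as `lam → 0`, `lam > 0`, of continuous functions on an open set. -/
structure WConv (V : Set R4) (A : ℝ → R4 → ℝ) (A₀ : R4 → ℝ) : Prop where
  cont : ∀ lam, 0 < lam → ContinuousOn (A lam) V
  cont₀ : ContinuousOn A₀ V
  lim : ∀ φ, IsTest V φ →
    Tendsto (fun lam => ∫ y, φ y * A lam y) (𝓝[>] 0) (𝓝 (∫ y, φ y * A₀ y))

/-- Uniformly bounded families of functions. -/
def UB (V : Set R4) (A : ℝ → R4 → ℝ) : Prop :=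
  ∃ C, ∀ᶠ lam in 𝓝[>] (0 : ℝ), ∀ y ∈ V, |A lam y| ≤ C

/-- Families of functions that are uniformly `O(lam)`. -/
def SB (V : Set R4) (A : ℝ → R4 → ℝ) : Prop :=
  ∃ C, ∀ᶠ lam in 𝓝[>] (0 : ℝ), ∀ y ∈ V, |A lam y| ≤ C * lam

/-- Families of functions that are locally bounded in `L¹`. -/
def LB (V : Set R4) (A : ℝ → R4 → ℝ) : Prop :=
  ∀ φ, IsTest V φ → ∃ C, ∀ᶠ lam in 𝓝[>] (0 : ℝ), ∫ y, |φ y * A lam y| ≤ C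

section Bounds

variable {A B : ℝ → R4 → ℝ} {A₀ B₀ : R4 → ℝ}

theorem eventually_pos : ∀ᶠ lam in 𝓝[>] (0 : ℝ), 0 < lam := eventually_mem_nhdsWithin

theorem UB.nonneg (h : UB V A) : ∃ C, 0 ≤ C ∧ ∀ᶠ lam in 𝓝[>] (0 : ℝ), ∀ y ∈ V, |A lam y| ≤ C := by
  obtain ⟨C, hC⟩ := h
  exact ⟨max C 0, le_max_right _ _, hC.mono fun lam h y hy => (h y hy).trans (le_max_left _ _)⟩

theorem SB.nonneg (h : SB V A) :
    ∃ C, 0 ≤ C ∧ ∀ᶠ lam in 𝓝[>] (0 : ℝ), ∀ y ∈ V, |A lam y| ≤ C * lam := by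
  obtain ⟨C, hC⟩ := h
  refine ⟨max C 0, le_max_right _ _, ?_⟩
  filter_upwards [hC, eventually_pos] with lam h hl y hy
  exact (h y hy).trans (mul_le_mul_of_nonneg_right (le_max_left _ _) hl.le)

theorem SB.ub (h : SB V A) : UB V A := by
  obtain ⟨C, hC0, hC⟩ := h.nonneg
  refine ⟨C, ?_⟩
  filter_upwards [hC, Ioo_mem_nhdsGT (zero_lt_one' ℝ)] with lam h hl y hy
  exact (h y hy).trans (mul_le_of_le_one_right hC0 hl.2.le)

theorem UB.add (hA : UB V A) (hB : UB V B) : UB V (fun lam y => A lam y + B lam y) := by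
  obtain ⟨C, hC⟩ := hA
  obtain ⟨C', hC'⟩ := hB
  refine ⟨C + C', ?_⟩
  filter_upwards [hC, hC'] with lam h h' y hy
  exact (abs_add_le _ _).trans (add_le_add (h y hy) (h' y hy))

theorem UB.neg (hA : UB V A) : UB V (fun lam y => -A lam y) := by
  obtain ⟨C, hC⟩ := hA
  exact ⟨C, by simpa using hC⟩

theorem UB.sub (hA : UB V A) (hB : UB V B) : UB V (fun lam y => A lam y - B lam y) := by
  simpa only [sub_eq_add_neg] using hA.add hB.neg

theorem UB.mul (hA : UB V A) (hB : UB V B) : UB V (fun lam y => A lam y * B lam y) := by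
  obtain ⟨C, hC0, hC⟩ := hA.nonneg
  obtain ⟨C', hC'⟩ := hB
  refine ⟨C * C', ?_⟩
  filter_upwards [hC, hC'] with lam h h' y hy
  rw [abs_mul]
  exact mul_le_mul (h y hy) (h' y hy) (abs_nonneg _) hC0

theorem UB.const (c : ℝ) : UB V (fun _ _ => c) := ⟨|c|, by simp⟩

theorem UB.sum {ι : Type*} {s : Finset ι} {A : ι → ℝ → R4 → ℝ} (h : ∀ i ∈ s, UB V (A i)) :
    UB V (fun lam y => ∑ i ∈ s, A i lam y) := by
  classical
  induction s using Finset.induction_on with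
  | empty => simpa using UB.const 0
  | insert i s hi ih =>
    simp only [Finset.sum_insert hi]
    exact (h i (Finset.mem_insert_self i s)).add (ih fun j hj => h j (Finset.mem_insert_of_mem hj))

theorem SB.add (hA : SB V A) (hB : SB V B) : SB V (fun lam y => A lam y + B lam y) := by
  obtain ⟨C, hC⟩ := hA
  obtain ⟨C', hC'⟩ := hB
  refine ⟨C + C', ?_⟩
  filter_upwards [hC, hC'] with lam h h' y hy
  rw [add_mul]
  exact (abs_add_le _ _).trans (add_le_add (h y hy) (h' y hy))

theorem SB.neg (hA : SB V A) : SB V (fun lam y => -A lam y) := by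
  obtain ⟨C, hC⟩ := hA
  exact ⟨C, by simpa using hC⟩

theorem SB.mul_ub (hA : SB V A) (hB : UB V B) : SB V (fun lam y => A lam y * B lam y) := by
  obtain ⟨C, hC⟩ := hA
  obtain ⟨C', hC'0, hC'⟩ := hB.nonneg
  refine ⟨C * C', ?_⟩
  filter_upwards [hC, hC'] with lam h h' y hy
  rw [abs_mul, mul_right_comm]
  exact mul_le_mul (h y hy) (h' y hy) (abs_nonneg _) ((abs_nonneg _).trans (h y hy))

theorem SB.ub_mul (hB : SB V B) (hA : UB V A) : SB V (fun lam y => A lam y * B lam y) := by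
  simpa only [mul_comm] using hB.mul_ub hA

theorem SB.zero : SB V (fun _ _ => (0 : ℝ)) := ⟨0, by simp⟩

theorem SB.sum {ι : Type*} {s : Finset ι} {A : ι → ℝ → R4 → ℝ} (h : ∀ i ∈ s, SB V (A i)) :
    SB V (fun lam y => ∑ i ∈ s, A i lam y) := by
  classical
  induction s using Finset.induction_on with
  | empty => simpa using SB.zero
  | insert i s hi ih =>
    simp only [Finset.sum_insert hi]
    exact (h i (Finset.mem_insert_self i s)).add (ih fun j hj => h j (Finset.mem_insert_of_mem hj))

theorem UB.congr (h : UB V A) (hAB : ∀ lam, 0 < lam → ∀ y ∈ V, A lam y = B lam y) : UB V B := by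
  obtain ⟨C, hC⟩ := h
  refine ⟨C, ?_⟩
  filter_upwards [hC, eventually_pos] with lam h hl y hy
  rw [← hAB lam hl y hy]; exact h y hy

theorem SB.congr (h : SB V A) (hAB : ∀ lam, 0 < lam → ∀ y ∈ V, A lam y = B lam y) : SB V B := by
  obtain ⟨C, hC⟩ := h
  refine ⟨C, ?_⟩
  filter_upwards [hC, eventually_pos] with lam h hl y hy
  rw [← hAB lam hl y hy]; exact h y hy

theorem IsTest.abs_mul_le (hφ : IsTest V φ) {u : R4 → ℝ} {C : ℝ} (h : ∀ y ∈ V, |u y| ≤ C) (y : R4) :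
    |φ y * u y| ≤ C * |φ y| := by
  by_cases hy : y ∈ V
  · rw [abs_mul, mul_comm]
    exact mul_le_mul_of_nonneg_right (h y hy) (abs_nonneg _)
  · rw [hφ.eq_zero hy]; simp

theorem UB.lb (hV : IsOpen V) (h : UB V A) (hc : ∀ lam, 0 < lam → ContinuousOn (A lam) V) :
    LB V A := by
  obtain ⟨C, hC⟩ := h
  refine fun φ hφ => ⟨C * ∫ y, |φ y|, ?_⟩
  filter_upwards [hC, eventually_pos] with lam h hl
  rw [← integral_const_mul]
  exact integral_mono (hφ.integrable_mul hV (hc lam hl)).abs (hφ.integrable.abs.const_mul C)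
    fun y => hφ.abs_mul_le h y

theorem LB.add (hV : IsOpen V) (hA : LB V A) (hB : LB V B)
    (hAc : ∀ lam, 0 < lam → ContinuousOn (A lam) V)
    (hBc : ∀ lam, 0 < lam → ContinuousOn (B lam) V) : LB V (fun lam y => A lam y + B lam y) := by
  intro φ hφ
  obtain ⟨C, hC⟩ := hA φ hφ
  obtain ⟨C', hC'⟩ := hB φ hφ
  refine ⟨C + C', ?_⟩
  filter_upwards [hC, hC', eventually_pos] with lam h h' hl
  have hi := (hφ.integrable_mul hV (hAc lam hl)).abs
  have hi' := (hφ.integrable_mul hV (hBc lam hl)).abs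
  calc ∫ y, |φ y * (A lam y + B lam y)| ≤ ∫ y, (|φ y * A lam y| + |φ y * B lam y|) :=
        integral_mono (hφ.integrable_mul hV ((hAc lam hl).add (hBc lam hl))).abs (hi.add hi')
          fun y => by simp only [mul_add]; exact abs_add_le _ _
    _ ≤ C + C' := by rw [integral_add hi hi']; exact add_le_add h h'

theorem LB.ub_mul (hV : IsOpen V) (hA : UB V A) (hB : LB V B)
    (hAc : ∀ lam, 0 < lam → ContinuousOn (A lam) V)
    (hBc : ∀ lam, 0 < lam → ContinuousOn (B lam) V) : LB V (fun lam y => A lam y * B lam y) := by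
  intro φ hφ
  obtain ⟨C, hC0, hC⟩ := hA.nonneg
  obtain ⟨C', hC'⟩ := hB φ hφ
  refine ⟨C * C', ?_⟩
  filter_upwards [hC, hC', eventually_pos] with lam h h' hl
  calc ∫ y, |φ y * (A lam y * B lam y)| ≤ ∫ y, C * |φ y * B lam y| := by
        refine integral_mono (hφ.integrable_mul hV ((hAc lam hl).mul (hBc lam hl))).abs
          ((hφ.integrable_mul hV (hBc lam hl)).abs.const_mul C) fun y => ?_
        by_cases hy : y ∈ V
        · simp only
          rw [mul_left_comm, abs_mul]
          exact mul_le_mul_of_nonneg_right (h y hy) (abs_nonneg _)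
        · simp [hφ.eq_zero hy]
    _ ≤ C * C' := by rw [integral_const_mul]; exact mul_le_mul_of_nonneg_left h' hC0

theorem LB.congr (h : LB V A) (hAB : ∀ lam, 0 < lam → ∀ y ∈ V, A lam y = B lam y) : LB V B := by
  intro φ hφ
  obtain ⟨C, hC⟩ := h φ hφ
  refine ⟨C, ?_⟩
  filter_upwards [hC, eventually_pos] with lam h hl
  refine le_of_eq_of_le (integral_congr_ae (ae_of_all _ fun y => ?_)) h
  by_cases hy : y ∈ V
  · simp only [hAB lam hl y hy]
  · simp [hφ.eq_zero hy]

theorem LB.sum (hV : IsOpen V) {ι : Type*} {s : Finset ι} {A : ι → ℝ → R4 → ℝ}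
    (h : ∀ i ∈ s, LB V (A i)) (hc : ∀ i ∈ s, ∀ lam, 0 < lam → ContinuousOn (A i lam) V) :
    LB V (fun lam y => ∑ i ∈ s, A i lam y) := by
  classical
  induction s using Finset.induction_on with
  | empty => exact fun φ _ => ⟨0, by simp⟩
  | insert i s hi ih =>
    simp only [Finset.sum_insert hi]
    exact (h i (Finset.mem_insert_self i s)).add hV
      (ih (fun j hj => h j (Finset.mem_insert_of_mem hj))
        fun j hj => hc j (Finset.mem_insert_of_mem hj)) (hc i (Finset.mem_insert_self i s))
      fun lam hl => continuousOn_finsetSum _ fun j hj => hc j (Finset.mem_insert_of_mem hj) lam hl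

theorem WConv.congr (h : WConv V A A₀) (hA : ∀ lam, 0 < lam → ∀ y ∈ V, A lam y = B lam y)
    (hA₀ : ∀ y ∈ V, A₀ y = B₀ y) : WConv V B B₀ := by
  refine ⟨fun lam hl => (h.cont lam hl).congr fun y hy => (hA lam hl y hy).symm,
    h.cont₀.congr fun y hy => (hA₀ y hy).symm, fun φ hφ => ?_⟩
  have h0 : ∫ y, φ y * B₀ y = ∫ y, φ y * A₀ y := by
    congr 1; ext y
    by_cases hy : y ∈ V
    · rw [hA₀ y hy]
    · simp [hφ.eq_zero hy]
  rw [h0]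
  refine (h.lim φ hφ).congr' ?_
  filter_upwards [eventually_pos] with lam hl
  congr 1; ext y
  by_cases hy : y ∈ V
  · rw [hA lam hl y hy]
  · simp [hφ.eq_zero hy]

theorem WConv.const (h : ContinuousOn A₀ V) : WConv V (fun _ => A₀) A₀ :=
  ⟨fun _ _ => h, h, fun _ _ => tendsto_const_nhds⟩

theorem WConv.add (hV : IsOpen V) (hA : WConv V A A₀) (hB : WConv V B B₀) :
    WConv V (fun lam y => A lam y + B lam y) (fun y => A₀ y + B₀ y) := by
  refine ⟨fun lam hl => (hA.cont lam hl).add (hB.cont lam hl), hA.cont₀.add hB.cont₀,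
    fun φ hφ => ?_⟩
  have h0 : ∫ y, φ y * (A₀ y + B₀ y) = (∫ y, φ y * A₀ y) + ∫ y, φ y * B₀ y := by
    simp_rw [mul_add]
    exact integral_add (hφ.integrable_mul hV hA.cont₀) (hφ.integrable_mul hV hB.cont₀)
  rw [h0]
  refine ((hA.lim φ hφ).add (hB.lim φ hφ)).congr' ?_
  filter_upwards [eventually_pos] with lam hl
  simp_rw [mul_add]
  exact (integral_add (hφ.integrable_mul hV (hA.cont lam hl))
    (hφ.integrable_mul hV (hB.cont lam hl))).symm

/-- Weak limits may be multiplied with a fixed smooth function. -/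
theorem WConv.smooth_mul (hV : IsOpen V) (hA : WConv V A A₀) {c : R4 → ℝ}
    (hc : ContDiffOn ℝ ∞ c V) : WConv V (fun lam y => c y * A lam y) (fun y => c y * A₀ y) := by
  refine ⟨fun lam hl => hc.continuousOn.mul (hA.cont lam hl), hc.continuousOn.mul hA.cont₀,
    fun φ hφ => ?_⟩
  simpa only [mul_assoc] using hA.lim _ (hφ.mul hV hc)

theorem WConv.const_mul (hV : IsOpen V) (hA : WConv V A A₀) (c : ℝ) :
    WConv V (fun lam y => c * A lam y) (fun y => c * A₀ y) :=
  hA.smooth_mul hV contDiffOn_const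

theorem WConv.sub (hV : IsOpen V) (hA : WConv V A A₀) (hB : WConv V B B₀) :
    WConv V (fun lam y => A lam y - B lam y) (fun y => A₀ y - B₀ y) :=
  (hA.add hV (hB.const_mul hV (-1))).congr (fun _ _ _ _ => by ring) (fun _ _ => by ring)

theorem WConv.sum (hV : IsOpen V) {ι : Type*} {s : Finset ι} {A : ι → ℝ → R4 → ℝ}
    {A₀ : ι → R4 → ℝ} (h : ∀ i ∈ s, WConv V (A i) (A₀ i)) :
    WConv V (fun lam y => ∑ i ∈ s, A i lam y) (fun y => ∑ i ∈ s, A₀ i y) := by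
  classical
  induction s using Finset.induction_on with
  | empty => simpa using WConv.const (A₀ := fun _ => 0) continuousOn_const
  | insert i s hi ih =>
    simp only [Finset.sum_insert hi]
    exact (h i (Finset.mem_insert_self i s)).add hV
      (ih fun j hj => h j (Finset.mem_insert_of_mem hj))

/-- The product of an `O(lam)` family with a locally `L¹`-bounded one converges weakly to zero. -/
theorem WConv.of_sb_mul_lb (hV : IsOpen V) (hA : SB V A) (hB : LB V B)
    (hAc : ∀ lam, 0 < lam → ContinuousOn (A lam) V)
    (hBc : ∀ lam, 0 < lam → ContinuousOn (B lam) V) :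
    WConv V (fun lam y => A lam y * B lam y) (fun _ => 0) := by
  refine ⟨fun lam hl => (hAc lam hl).mul (hBc lam hl), continuousOn_const, fun φ hφ => ?_⟩
  simp only [mul_zero, integral_zero]
  obtain ⟨C, hC0, hC⟩ := hA.nonneg
  obtain ⟨C', hC'⟩ := hB φ hφ
  have hlim : Tendsto (fun lam : ℝ => C * lam * C') (𝓝[>] 0) (𝓝 0) := by
    have : Tendsto (fun lam : ℝ => C * lam * C') (𝓝 0) (𝓝 (C * 0 * C')) := by
      apply Continuous.tendsto; fun_prop
    simpa using this.mono_left nhdsWithin_le_nhds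
  refine squeeze_zero_norm' ?_ hlim
  filter_upwards [hC, hC', eventually_pos] with lam h h' hl
  calc ‖∫ y, φ y * (A lam y * B lam y)‖ ≤ ∫ y, |φ y * (A lam y * B lam y)| :=
        norm_integral_le_integral_norm _
    _ ≤ ∫ y, C * lam * |φ y * B lam y| := by
        refine integral_mono (hφ.integrable_mul hV ((hAc lam hl).mul (hBc lam hl))).abs
          ((hφ.integrable_mul hV (hBc lam hl)).abs.const_mul _) fun y => ?_
        by_cases hy : y ∈ V
        · simp only
          rw [mul_left_comm, abs_mul]
          exact mul_le_mul_of_nonneg_right (h y hy) (abs_nonneg _)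
        · simp [hφ.eq_zero hy]
    _ ≤ C * lam * C' := by
        rw [integral_const_mul]
        exact mul_le_mul_of_nonneg_left h' (mul_nonneg hC0 hl.le)

theorem WConv.of_sb (hV : IsOpen V) (hA : SB V A) (hAc : ∀ lam, 0 < lam → ContinuousOn (A lam) V) :
    WConv V A (fun _ => 0) :=
  (WConv.of_sb_mul_lb hV hA ((UB.const (V := V) 1).lb hV fun _ _ => continuousOn_const) hAc
    fun _ _ => continuousOn_const).congr (fun _ _ _ _ => by ring) (fun _ _ => rfl)

/-- The derivative moves onto the test function, so no bound on the derivatives of the family is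
needed. -/
theorem WConv.pd (hV : IsOpen V) (hA : WConv V A A₀)
    (hAc : ∀ lam, 0 < lam → ContDiffOn ℝ 1 (A lam) V) (hA₀ : ContDiffOn ℝ 1 A₀ V) (i : Fin 4) :
    WConv V (fun lam => Backreaction.pd i (A lam)) (Backreaction.pd i A₀) := by
  refine ⟨fun lam hl => (contDiffOn_pd hV (hAc lam hl) (m := 0) (by simp) i).continuousOn,
    (contDiffOn_pd hV hA₀ (m := 0) (by simp) i).continuousOn, fun φ hφ => ?_⟩
  rw [hφ.integral_mul_pd hV hA₀]
  refine ((hA.lim _ (hφ.pd i)).neg).congr' ?_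
  filter_upwards [eventually_pos] with lam hl
  rw [hφ.integral_mul_pd hV (hAc lam hl)]

/-- Weak limits are unique. -/
theorem WConv.unique (hV : IsOpen V) (hA : WConv V A A₀) (hB : WConv V A B₀) :
    ∀ y ∈ V, A₀ y = B₀ y := by
  have h0 : ∀ φ, IsTest V φ → ∫ y, φ y * (A₀ y - B₀ y) = 0 := by
    intro φ hφ
    simp_rw [mul_sub]
    rw [integral_sub (hφ.integrable_mul hV hA.cont₀) (hφ.integrable_mul hV hB.cont₀),
      tendsto_nhds_unique (hA.lim φ hφ) (hB.lim φ hφ), sub_self]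
  have hc : ContinuousOn (fun y => A₀ y - B₀ y) V := hA.cont₀.sub hB.cont₀
  -- The fundamental lemma of the calculus of variations gives equality almost everywhere;
  -- continuity of both limits makes it pointwise.
  have hae := hV.ae_eq_zero_of_integral_contDiff_smul_eq_zero (μ := volume)
    (hc.locallyIntegrableOn hV.measurableSet) (fun φ h1 h2 h3 => h0 φ ⟨h1, h2, h3⟩)
  have hae2 : (fun y => A₀ y - B₀ y) =ᵐ[volume.restrict V] fun _ => 0 := by
    rw [Filter.EventuallyEq, ae_restrict_iff' hV.measurableSet]; exact hae
  have := Measure.eqOn_open_of_ae_eq hae2 hV hc continuousOn_const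
  exact fun y hy => sub_eq_zero.1 (this hy)

end Bounds

end WeakConvergence

/-! ### Products of bounded families; weak bounds and nonnegativity -/

section Products

variable {V : Set R4} {φ : R4 → ℝ} {A B : ℝ → R4 → ℝ} {A₀ B₀ : R4 → ℝ}

theorem exists_isTest_eq_one (hV : IsOpen V) {K : Set R4} (hK : IsCompact K) (hKV : K ⊆ V) :
    ∃ χ, IsTest V χ ∧ (∀ y, 0 ≤ χ y) ∧ (∀ y, χ y ≤ 1) ∧ ∀ y ∈ K, χ y = 1 := by
  obtain ⟨L, hL, hKL, hLV⟩ := exists_compact_between hK hV hKV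
  obtain ⟨f, hf1, hf0, hf⟩ := exists_contMDiffMap_one_nhds_of_subset_interior (n := (⊤ : ℕ∞)) 𝓘(ℝ, R4)
    hK.isClosed hKL
  have hsub : tsupport f ⊆ L := closure_minimal
    (fun y hy => by by_contra h; exact hy (hf0 y h)) hL.isClosed
  exact ⟨f, ⟨f.contMDiff.contDiff, hL.of_isClosed_subset (isClosed_tsupport _) hsub,
    hsub.trans hLV⟩, fun y => (hf y).1, fun y => (hf y).2, fun y hy => hf1.self_of_nhdsSet y hy⟩

/-- Families whose integrals against each test function are bounded. -/
def WB (V : Set R4) (A : ℝ → R4 → ℝ) : Prop :=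
  ∀ φ, IsTest V φ → ∃ C, ∀ᶠ lam in 𝓝[>] (0 : ℝ), |∫ y, φ y * A lam y| ≤ C

theorem LB.wb (h : LB V A) : WB V A := by
  intro φ hφ
  obtain ⟨C, hC⟩ := h φ hφ
  refine ⟨C, hC.mono fun lam h => le_trans ?_ h⟩
  exact norm_integral_le_integral_norm (μ := volume) (fun y => φ y * A lam y)

theorem WB.congr (h : WB V A) (hAB : ∀ lam, 0 < lam → ∀ y ∈ V, A lam y = B lam y) : WB V B := by
  intro φ hφ
  obtain ⟨C, hC⟩ := h φ hφ
  refine ⟨C, ?_⟩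
  filter_upwards [hC, eventually_pos] with lam h hl
  convert h using 4 with y
  by_cases hy : y ∈ V
  · simp only [hAB lam hl y hy]
  · simp [hφ.eq_zero hy]

theorem WB.add (hV : IsOpen V) (hA : WB V A) (hB : WB V B)
    (hAc : ∀ lam, 0 < lam → ContinuousOn (A lam) V)
    (hBc : ∀ lam, 0 < lam → ContinuousOn (B lam) V) : WB V (fun lam y => A lam y + B lam y) := by
  intro φ hφ
  obtain ⟨C, hC⟩ := hA φ hφ
  obtain ⟨C', hC'⟩ := hB φ hφ
  refine ⟨C + C', ?_⟩
  filter_upwards [hC, hC', eventually_pos] with lam h h' hl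
  simp_rw [mul_add]
  rw [integral_add (hφ.integrable_mul hV (hAc lam hl)) (hφ.integrable_mul hV (hBc lam hl))]
  exact (abs_add_le _ _).trans (add_le_add h h')

theorem WB.neg (hA : WB V A) : WB V (fun lam y => -A lam y) := by
  intro φ hφ
  simpa [integral_neg] using hA φ hφ

theorem WB.sum (hV : IsOpen V) {ι : Type*} {s : Finset ι} {A : ι → ℝ → R4 → ℝ}
    (h : ∀ i ∈ s, WB V (A i)) (hc : ∀ i ∈ s, ∀ lam, 0 < lam → ContinuousOn (A i lam) V) :
    WB V (fun lam y => ∑ i ∈ s, A i lam y) := by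
  classical
  induction s using Finset.induction_on with
  | empty => exact fun φ _ => ⟨0, by simp⟩
  | insert i s hi ih =>
    simp only [Finset.sum_insert hi]
    exact (h i (Finset.mem_insert_self i s)).add hV
      (ih (fun j hj => h j (Finset.mem_insert_of_mem hj))
        fun j hj => hc j (Finset.mem_insert_of_mem hj)) (hc i (Finset.mem_insert_self i s))
      fun lam hl => continuousOn_finsetSum _ fun j hj => hc j (Finset.mem_insert_of_mem hj) lam hl

/-- Families of smooth functions. -/
def SM (V : Set R4) (A : ℝ → R4 → ℝ) : Prop := ∀ lam, 0 < lam → ContDiffOn ℝ ∞ (A lam) V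

theorem SM.cont (h : SM V A) : ∀ lam, 0 < lam → ContinuousOn (A lam) V :=
  fun lam hl => (h lam hl).continuousOn

theorem SM.add (hA : SM V A) (hB : SM V B) : SM V (fun lam y => A lam y + B lam y) :=
  fun lam hl => (hA lam hl).add (hB lam hl)

theorem SM.sub (hA : SM V A) (hB : SM V B) : SM V (fun lam y => A lam y - B lam y) :=
  fun lam hl => (hA lam hl).sub (hB lam hl)

theorem SM.mul (hA : SM V A) (hB : SM V B) : SM V (fun lam y => A lam y * B lam y) :=
  fun lam hl => (hA lam hl).mul (hB lam hl)

theorem SM.const (c : ℝ) : SM V (fun _ _ => c) := fun _ _ => contDiffOn_const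

theorem SM.sum {ι : Type*} {s : Finset ι} {A : ι → ℝ → R4 → ℝ} (h : ∀ i ∈ s, SM V (A i)) :
    SM V (fun lam y => ∑ i ∈ s, A i lam y) :=
  fun lam hl => ContDiffOn.sum fun i hi => h i hi lam hl

theorem SM.pd (hV : IsOpen V) (hA : SM V A) (i : Fin 4) :
    SM V (fun lam => Backreaction.pd i (A lam)) :=
  fun lam hl => contDiffOn_pd hV (hA lam hl) (by simp) i

/-- A bounded family times a derivative of a bounded family. -/
theorem WB.mul_pd (hV : IsOpen V) (hA : UB V A) (hA' : ∀ i, UB V fun lam => pd i (A lam))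
    (hAs : SM V A) (hB : UB V B) (hBs : SM V B) (i : Fin 4) :
    WB V (fun lam y => A lam y * pd i (B lam) y) := by
  -- The family is `∂(AB) - (∂A) B`. The second term is bounded, and the first is bounded after
  -- integration by parts against a test function.
  have h1 : LB V (fun lam y => -(pd i (A lam) y * B lam y)) :=
    ((hA' i).mul hB).neg.lb hV fun lam hl => (((hAs.pd hV i).mul hBs).cont lam hl).neg
  have h2 : WB V (fun lam => pd i (fun y => A lam y * B lam y)) := by
    intro φ hφ
    obtain ⟨C, hC⟩ := ((hA.mul hB).lb hV (hAs.mul hBs).cont).wb _ (hφ.pd i)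
    refine ⟨C, ?_⟩
    filter_upwards [hC, eventually_pos] with lam h hl
    rwa [hφ.integral_mul_pd hV (((hAs.mul hBs) lam hl).of_le (by simp)), abs_neg]
  refine (h2.add hV h1.wb ((hAs.mul hBs).pd hV i).cont
    fun lam hl => (((hAs.pd hV i).mul hBs).cont lam hl).neg).congr fun lam hl y hy => ?_
  have hd : ∀ {u : R4 → ℝ}, ContDiffOn ℝ ∞ u V → DifferentiableAt ℝ u y := fun hu =>
    (hu.contDiffAt (hV.mem_nhds hy)).differentiableAt (by simp)
  rw [pd_mul (hd (hAs lam hl)) (hd (hBs lam hl))]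
  ring

theorem WB.add_ub (hV : IsOpen V) (hA : WB V A) (hAs : SM V A) (hB : UB V B) (hBs : SM V B) :
    WB V (fun lam y => A lam y + B lam y) :=
  hA.add hV (hB.lb hV hBs.cont).wb hAs.cont hBs.cont

/-- A weakly bounded family of nonnegative functions is locally bounded in `L¹`. -/
theorem WB.lb_of_nonneg (hV : IsOpen V) (hA : WB V A)
    (h0 : ∀ᶠ lam in 𝓝[>] (0 : ℝ), ∀ y ∈ V, 0 ≤ A lam y)
    (hAc : ∀ lam, 0 < lam → ContinuousOn (A lam) V) : LB V A := by
  intro φ hφ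
  -- Nonnegativity allows `|φ A| ≤ K χ A`, where `χ ≥ 0` is a test function equal to one on the
  -- support of `φ`. The `L¹` norm is then bounded by a single weak integral.
  obtain ⟨χ, hχ, hχ0, -, hχ1⟩ := exists_isTest_eq_one hV hφ.compact hφ.subset
  obtain ⟨K, hK⟩ := hφ.contDiff.continuous.bounded_above_of_compact_support hφ.compact
  obtain ⟨C, hC⟩ := hA χ hχ
  refine ⟨K * C, ?_⟩
  filter_upwards [hC, h0, eventually_pos] with lam h h0 hl
  have hK0 : 0 ≤ K := (norm_nonneg _).trans (hK 0)
  calc ∫ y, |φ y * A lam y| ≤ ∫ y, K * (χ y * A lam y) := by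
        refine integral_mono (hφ.integrable_mul hV (hAc lam hl)).abs
          ((hχ.integrable_mul hV (hAc lam hl)).const_mul K) fun y => ?_
        by_cases hy : y ∈ tsupport φ
        · simp only
          rw [abs_mul, abs_of_nonneg (h0 y (hφ.subset hy)), hχ1 y hy, one_mul]
          exact mul_le_mul_of_nonneg_right (hK y) (h0 y (hφ.subset hy))
        · simp only
          rw [image_eq_zero_of_notMem_tsupport hy, zero_mul, abs_zero]
          by_cases hy' : y ∈ V
          · exact mul_nonneg hK0 (mul_nonneg (hχ0 y) (h0 y hy'))
          · simp [hχ.eq_zero hy']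
    _ ≤ K * C := by
        rw [integral_const_mul]
        exact mul_le_mul_of_nonneg_left ((le_abs_self _).trans h) hK0

/-- Bounded families of smooth functions that converge uniformly, with rate `O(lam)`. -/
structure SC (V : Set R4) (A : ℝ → R4 → ℝ) (A₀ : R4 → ℝ) : Prop where
  smooth : SM V A
  smooth₀ : ContDiffOn ℝ ∞ A₀ V
  bdd : UB V A
  sb : SB V (fun lam y => A lam y - A₀ y)

/-- Bounded families of smooth functions that converge weakly. -/
structure WC (V : Set R4) (A : ℝ → R4 → ℝ) (A₀ : R4 → ℝ) : Prop where
  smooth : SM V A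
  smooth₀ : ContDiffOn ℝ ∞ A₀ V
  bdd : UB V A
  conv : WConv V A A₀

theorem SC.bdd₀ (h : SC V A A₀) : UB V (fun _ => A₀) :=
  (h.bdd.sub h.sb.ub).congr fun _ _ _ _ => by ring

/-- Write `AB = (A - A₀) B + A₀ B`. The first term is `O(lam)` times bounded, and in the second a
fixed smooth factor can be absorbed into the test function. Two merely weakly convergent factors
could not be multiplied in this way. -/
theorem SC.mul_wc (hV : IsOpen V) (hA : SC V A A₀) (hB : WC V B B₀) :
    WC V (fun lam y => A lam y * B lam y) (fun y => A₀ y * B₀ y) := by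
  refine ⟨hA.smooth.mul hB.smooth, hA.smooth₀.mul hB.smooth₀, hA.bdd.mul hB.bdd, ?_⟩
  have h1 := WConv.of_sb_mul_lb hV hA.sb (hB.bdd.lb hV hB.smooth.cont)
    (fun lam hl => (hA.smooth.cont lam hl).sub hA.smooth₀.continuousOn) hB.smooth.cont
  exact (h1.add hV (hB.conv.smooth_mul hV hA.smooth₀)).congr (fun _ _ _ _ => by ring)
    (fun _ _ => by ring)

theorem SC.wc (hV : IsOpen V) (hA : SC V A A₀) : WC V A A₀ := by
  refine ⟨hA.smooth, hA.smooth₀, hA.bdd, ?_⟩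
  have h1 := WConv.of_sb hV hA.sb
    (fun lam hl => (hA.smooth.cont lam hl).sub hA.smooth₀.continuousOn)
  exact (h1.add hV (WConv.const hA.smooth₀.continuousOn)).congr (fun _ _ _ _ => by ring)
    (fun _ _ => by ring)

theorem SC.const (c : ℝ) : SC V (fun _ _ => c) (fun _ => c) :=
  ⟨SM.const c, contDiffOn_const, UB.const c, SB.zero.congr fun _ _ _ _ => by ring⟩

theorem SC.mul (hA : SC V A A₀) (hB : SC V B B₀) :
    SC V (fun lam y => A lam y * B lam y) (fun y => A₀ y * B₀ y) :=
  ⟨hA.smooth.mul hB.smooth, hA.smooth₀.mul hB.smooth₀, hA.bdd.mul hB.bdd,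
    ((hA.sb.mul_ub hB.bdd).add (hB.sb.ub_mul hA.bdd₀)).congr fun _ _ _ _ => by ring⟩

theorem WC.add (hV : IsOpen V) (hA : WC V A A₀) (hB : WC V B B₀) :
    WC V (fun lam y => A lam y + B lam y) (fun y => A₀ y + B₀ y) :=
  ⟨hA.smooth.add hB.smooth, hA.smooth₀.add hB.smooth₀, hA.bdd.add hB.bdd, hA.conv.add hV hB.conv⟩

theorem WC.sub (hV : IsOpen V) (hA : WC V A A₀) (hB : WC V B B₀) :
    WC V (fun lam y => A lam y - B lam y) (fun y => A₀ y - B₀ y) :=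
  ⟨hA.smooth.sub hB.smooth, hA.smooth₀.sub hB.smooth₀, hA.bdd.sub hB.bdd, hA.conv.sub hV hB.conv⟩

theorem WC.sum (hV : IsOpen V) {ι : Type*} {s : Finset ι} {A : ι → ℝ → R4 → ℝ}
    {A₀ : ι → R4 → ℝ} (h : ∀ i ∈ s, WC V (A i) (A₀ i)) :
    WC V (fun lam y => ∑ i ∈ s, A i lam y) (fun y => ∑ i ∈ s, A₀ i y) :=
  ⟨SM.sum fun i hi => (h i hi).smooth, ContDiffOn.sum fun i hi => (h i hi).smooth₀,
    UB.sum fun i hi => (h i hi).bdd, WConv.sum hV fun i hi => (h i hi).conv⟩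

theorem WC.congr (hA : WC V A A₀) (h : ∀ lam, 0 < lam → ∀ y ∈ V, A lam y = B lam y)
    (h₀ : ∀ y ∈ V, A₀ y = B₀ y) : WC V B B₀ :=
  ⟨fun lam hl => (hA.smooth lam hl).congr fun y hy => (h lam hl y hy).symm,
    hA.smooth₀.congr fun y hy => (h₀ y hy).symm, hA.bdd.congr h, hA.conv.congr h h₀⟩

theorem WC.pd (hV : IsOpen V) (hA : WC V A A₀) (i : Fin 4) :
    WConv V (fun lam => Backreaction.pd i (A lam)) (Backreaction.pd i A₀) :=
  hA.conv.pd hV (fun lam hl => (hA.smooth lam hl).of_le (by simp)) (hA.smooth₀.of_le (by simp)) i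

end Products

/-! ### Bounds and derivatives of inverse matrices -/

section Inverse

/-- A bound for the entries of the inverse of a perturbation of a matrix. -/
theorem abs_inv_apply_le {A B : Matrix (Fin 4) (Fin 4) ℝ} (hA : A.det ≠ 0) (hB : B.det ≠ 0)
    {K ε : ℝ} (hK : ∀ i j, |B⁻¹ i j| ≤ K) (hε : ∀ i j, |A i j - B i j| ≤ ε)
    (h : 16 * K * ε ≤ 1 / 2) (i j : Fin 4) : |A⁻¹ i j| ≤ 2 * K := by
  have hK0 : 0 ≤ K := (abs_nonneg _).trans (hK 0 0)
  have hε0 : 0 ≤ ε := (abs_nonneg _).trans (hε 0 0)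
  -- In this resolvent identity the unknown inverse also appears on the right. Applied to the
  -- largest entry `s` of `A⁻¹`, it gives `s ≤ K + 16 s ε K`, and smallness of `16 K ε` absorbs the
  -- last term.
  have key : A⁻¹ = B⁻¹ - A⁻¹ * (A - B) * B⁻¹ := by
    rw [Matrix.mul_sub, Matrix.sub_mul, Matrix.nonsing_inv_mul A (isUnit_iff_ne_zero.2 hA),
      Matrix.mul_assoc, Matrix.mul_nonsing_inv B (isUnit_iff_ne_zero.2 hB)]
    simp
  obtain ⟨p, -, hp⟩ := Finset.exists_max_image (Finset.univ : Finset (Fin 4 × Fin 4))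
    (fun p => |A⁻¹ p.1 p.2|) ⟨(0, 0), Finset.mem_univ _⟩
  obtain ⟨s, hs⟩ : ∃ s, s = |A⁻¹ p.1 p.2| := ⟨_, rfl⟩
  have hs' : ∀ i j, |A⁻¹ i j| ≤ s := fun i j => hs ▸ hp (i, j) (Finset.mem_univ _)
  have hs0 : 0 ≤ s := hs ▸ abs_nonneg _
  have h1 : s ≤ K + ∑ _l : Fin 4, (∑ _k : Fin 4, s * ε) * K := by
    conv_lhs => rw [hs, key, Matrix.sub_apply, Matrix.mul_apply]
    refine (abs_sub _ _).trans (add_le_add (hK _ _) ?_)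
    refine (Finset.abs_sum_le_sum_abs _ _).trans (Finset.sum_le_sum fun l _ => ?_)
    rw [abs_mul, Matrix.mul_apply]
    refine mul_le_mul ((Finset.abs_sum_le_sum_abs _ _).trans (Finset.sum_le_sum fun k _ => ?_))
      (hK _ _) (abs_nonneg _) (Finset.sum_nonneg fun _ _ => by positivity)
    rw [abs_mul]
    exact mul_le_mul (hs' _ _) (hε _ _) (abs_nonneg _) hs0
  simp only [Finset.sum_const, Finset.card_univ, Fintype.card_fin, nsmul_eq_mul] at h1
  push_cast at h1
  have : s ≤ 2 * K := by nlinarith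
  exact (hs' i j).trans this

theorem contDiffOn_inv {s : Set R4} {G : R4 → Matrix (Fin 4) (Fin 4) ℝ} {n : WithTop ℕ∞}
    (hG : ∀ i j, ContDiffOn ℝ n (fun y => G y i j) s) (hd : ∀ y ∈ s, (G y).det ≠ 0) (i j : Fin 4) :
    ContDiffOn ℝ n (fun y => (G y)⁻¹ i j) s := by
  have h : (fun y => (G y)⁻¹ i j) = fun y => (G y).det⁻¹ * (G y).adjugate i j := by
    ext y
    rw [Matrix.inv_def, Ring.inverse_eq_inv', Matrix.smul_apply, smul_eq_mul]
  rw [h]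
  refine ((contDiffOn_det hG).inv hd).mul ?_
  simp_rw [Matrix.adjugate_apply]
  refine contDiffOn_det fun a b => ?_
  simp_rw [Matrix.updateRow_apply]
  split_ifs
  · exact contDiffOn_const
  · exact hG a b

/-- Differentiating `G G⁻¹ = 1` and multiplying by `G⁻¹` from the left avoids differentiating
determinants and adjugates. -/
theorem pd_inv {V : Set R4} (hV : IsOpen V) {G : R4 → Matrix (Fin 4) (Fin 4) ℝ}
    (hG : ∀ i j, ContDiffOn ℝ ∞ (fun y => G y i j) V) (hd : ∀ y ∈ V, (G y).det ≠ 0)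
    {y : R4} (hy : y ∈ V) (k i j : Fin 4) :
    pd k (fun z => (G z)⁻¹ i j) y
      = -∑ a, ∑ b, (G y)⁻¹ i a * pd k (fun z => G z a b) y * (G y)⁻¹ b j := by
  have hdiff : ∀ {u : R4 → ℝ}, ContDiffOn ℝ ∞ u V → DifferentiableAt ℝ u y := fun hu =>
    (hu.contDiffAt (hV.mem_nhds hy)).differentiableAt (by simp)
  have hI := contDiffOn_inv hG hd
  have h1 : ∀ a, ∑ b, pd k (fun z => G z a b) y * (G y)⁻¹ b j
      = -∑ b, G y a b * pd k (fun z => (G z)⁻¹ b j) y := by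
    intro a
    have h2 : pd k (fun z => ∑ b, G z a b * (G z)⁻¹ b j) y = 0 := by
      rw [pd_congr hV hy (w := fun _ => (1 : Matrix (Fin 4) (Fin 4) ℝ) a j) (fun z hz => by
        rw [← Matrix.mul_apply, Matrix.mul_nonsing_inv _ (isUnit_iff_ne_zero.2 (hd z hz))])]
      simp [pd]
    rw [pd_sum (u := fun b z => G z a b * (G z)⁻¹ b j)
      fun b _ => (hdiff (hG a b)).fun_mul (hdiff (hI b j))] at h2
    simp_rw [pd_mul (hdiff (hG a _)) (hdiff (hI _ j))] at h2
    rw [Finset.sum_add_distrib] at h2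
    linarith
  have h3 : ∀ a, ∑ b, (G y)⁻¹ i a * pd k (fun z => G z a b) y * (G y)⁻¹ b j
      = -∑ b, (G y)⁻¹ i a * (G y a b * pd k (fun z => (G z)⁻¹ b j) y) := by
    intro a
    simp_rw [mul_assoc]
    rw [← Finset.mul_sum, h1 a, mul_neg, Finset.mul_sum]
  simp_rw [h3]
  rw [Finset.sum_neg_distrib, neg_neg, Finset.sum_comm]
  simp_rw [← mul_assoc, ← Finset.sum_mul, ← Matrix.mul_apply,
    Matrix.nonsing_inv_mul _ (isUnit_iff_ne_zero.2 (hd y hy)), Matrix.one_apply]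
  simp

end Inverse

/-! ### Curvature as a function of the first derivatives of the metric -/

/-- Twice the Christoffel symbols of the first kind, in terms of the first derivatives `D a c d`
of the metric. -/
def lowChr (D : Fin 4 → Fin 4 → Fin 4 → ℝ) (l j k : Fin 4) : ℝ := D j l k + D k l j - D l j k

/-- The product of two symbols `lowChr`, in terms of the products `m` of two derivatives. -/
def chrSq (m : (Fin 6 → Fin 4) → ℝ) (l j k s q r : Fin 4) : ℝ :=
  lowChr (fun a c d => lowChr (fun b e f => m ![a, b, c, d, e, f]) s q r) l j k

/-- The part of the Ricci tensor that is quadratic in the first derivatives of the metric, where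
`H` is the inverse of the metric. -/
def ricciQ (H : Matrix (Fin 4) (Fin 4) ℝ) (m : (Fin 6 → Fin 4) → ℝ) (j k : Fin 4) : ℝ :=
  ∑ i, ∑ l, ∑ a, ∑ b, 1 / 4 * (H l a * H i b) * (chrSq m a j k b l i - chrSq m a i k b l j)

/-- The corresponding part of the Einstein tensor. -/
def einsteinQ (G : Matrix (Fin 4) (Fin 4) ℝ) (m : (Fin 6 → Fin 4) → ℝ) (j k : Fin 4) : ℝ :=
  ricciQ G⁻¹ m j k - 1 / 2 * (∑ p, ∑ q, G⁻¹ p q * ricciQ G⁻¹ m p q) * G j k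

/-- The left hand side of Einstein's equation. -/
def einsteinLam (Λ : ℝ) (G : R4 → Matrix (Fin 4) (Fin 4) ℝ) (j k : Fin 4) (y : R4) : ℝ :=
  einstein G j k y + Λ * G y j k

theorem lowChr_mul_lowChr (D D' : Fin 4 → Fin 4 → Fin 4 → ℝ) (l j k s q r : Fin 4) :
    lowChr D l j k * lowChr D' s q r =
      lowChr (fun a c d => lowChr (fun b e f => D a c d * D' b e f) s q r) l j k := by
  simp only [lowChr]; ring

theorem christoffel_eq (G : R4 → Matrix (Fin 4) (Fin 4) ℝ) (i j k : Fin 4) (y : R4) :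
    christoffel G i j k y =
      1 / 2 * ∑ l, (G y)⁻¹ i l * lowChr (fun a c d => pd a (fun z => G z c d) y) l j k := rfl

theorem christoffel_mul_christoffel (G : R4 → Matrix (Fin 4) (Fin 4) ℝ) (i j k p q r : Fin 4)
    (y : R4) : christoffel G i j k y * christoffel G p q r y =
      ∑ a, ∑ b, 1 / 4 * ((G y)⁻¹ i a * (G y)⁻¹ p b) *
        lowChr (fun a c d => lowChr (fun b e f => pd a (fun z => G z c d) y *
          pd b (fun z => G z e f) y) b q r) a j k := by
  rw [christoffel_eq, christoffel_eq, mul_mul_mul_comm, Finset.sum_mul_sum, Finset.mul_sum]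
  refine Finset.sum_congr rfl fun a _ => ?_
  rw [Finset.mul_sum]
  refine Finset.sum_congr rfl fun b _ => ?_
  rw [← lowChr_mul_lowChr]
  ring

section LowChr

variable {V : Set R4} {D : Fin 4 → Fin 4 → Fin 4 → ℝ → R4 → ℝ}
  {D₀ : Fin 4 → Fin 4 → Fin 4 → R4 → ℝ}

theorem WC.lowChr (hV : IsOpen V) (h : ∀ a c d, WC V (D a c d) (D₀ a c d)) (l j k : Fin 4) :
    WC V (fun lam y => Backreaction.lowChr (fun a c d => D a c d lam y) l j k)
      (fun y => Backreaction.lowChr (fun a c d => D₀ a c d y) l j k) :=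
  ((h j l k).add hV (h k l j)).sub hV (h l j k)

end LowChr

/-- A one-parameter family of metrics in the coordinates of an open set `V`, with the bounds and
weak limits of the high frequency limit, and with nonnegative energy densities for the vectors in a
box. -/
structure LocalFamily (V : Set R4) (G : ℝ → R4 → Matrix (Fin 4) (Fin 4) ℝ)
    (m : (Fin 6 → Fin 4) → R4 → ℝ) (Λ : ℝ) : Prop where
  isOpen : IsOpen V
  smooth : ∀ lam, 0 ≤ lam → ∀ i j, ContDiffOn ℝ ∞ (fun y => G lam y i j) V
  symm : ∀ lam, 0 ≤ lam → ∀ y ∈ V, ∀ i j, G lam y i j = G lam y j i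
  det_ne : ∀ lam, 0 ≤ lam → ∀ y ∈ V, (G lam y).det ≠ 0
  small : ∀ i j, SB V (fun lam y => G lam y i j - G 0 y i j)
  deriv : ∀ k i j, UB V (fun lam => pd k (fun y => G lam y i j - G 0 y i j))
  bdd : ∀ i j, UB V (fun _ y => G 0 y i j)
  bdd_inv : ∀ i j, UB V (fun _ y => (G 0 y)⁻¹ i j)
  bdd_deriv : ∀ k i j, UB V (fun _ => pd k (fun y => G 0 y i j))
  smooth_weak : ∀ I, ContDiffOn ℝ ∞ (m I) V
  weak : ∀ I : Fin 6 → Fin 4, WConv V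
    (fun lam y => pd (I 0) (fun z => G lam z (I 2) (I 3) - G 0 z (I 2) (I 3)) y *
      pd (I 1) (fun z => G lam z (I 4) (I 5) - G 0 z (I 4) (I 5)) y) (m I)
  nonneg : ∃ (v : Fin 4 → ℝ) (s : ℝ), 0 < s ∧ ∀ᶠ lam in 𝓝[>] (0 : ℝ), ∀ y ∈ V,
    ∀ w : Fin 4 → ℝ, (∀ i, |w i - v i| ≤ s) →
      0 ≤ ∑ i, ∑ j, einsteinLam Λ (G lam) i j y * w i * w j

/-! ### Weak limits and weak bounds of curvature in a chart -/

namespace LocalFamily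

variable {V : Set R4} {G : ℝ → R4 → Matrix (Fin 4) (Fin 4) ℝ}
  {m : (Fin 6 → Fin 4) → R4 → ℝ} {Λ : ℝ}

theorem sc (F : LocalFamily V G m Λ) (i j : Fin 4) :
    SC V (fun lam y => G lam y i j) (fun y => G 0 y i j) :=
  ⟨fun lam hl => F.smooth lam hl.le i j, F.smooth 0 le_rfl i j,
    ((F.bdd i j).add (F.small i j).ub).congr fun _ _ _ _ => by ring, F.small i j⟩

theorem differentiableAt (F : LocalFamily V G m Λ) {lam : ℝ} (hl : 0 ≤ lam) {y : R4} (hy : y ∈ V)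
    (i j : Fin 4) : DifferentiableAt ℝ (fun z => G lam z i j) y :=
  ((F.smooth lam hl i j).contDiffAt (F.isOpen.mem_nhds hy)).differentiableAt (by simp)

theorem pd_sub (F : LocalFamily V G m Λ) {lam : ℝ} (hl : 0 ≤ lam) {y : R4} (hy : y ∈ V)
    (k i j : Fin 4) : pd k (fun z => G lam z i j - G 0 z i j) y =
      pd k (fun z => G lam z i j) y - pd k (fun z => G 0 z i j) y :=
  Backreaction.pd_sub (F.differentiableAt hl hy i j) (F.differentiableAt le_rfl hy i j) k

theorem ub_pd (F : LocalFamily V G m Λ) (k i j : Fin 4) :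
    UB V (fun lam => pd k (fun z => G lam z i j)) :=
  ((F.bdd_deriv k i j).add (F.deriv k i j)).congr fun lam hl y hy => by
    rw [F.pd_sub hl.le hy]; ring

theorem sc_const (F : LocalFamily V G m Λ) (k i j : Fin 4) :
    SC V (fun _ => pd k (fun z => G 0 z i j)) (pd k (fun z => G 0 z i j)) :=
  have h := contDiffOn_pd F.isOpen (F.smooth 0 le_rfl i j) (m := ∞) (by simp) k
  ⟨fun _ _ => h, h, F.bdd_deriv k i j, SB.zero.congr fun _ _ _ _ => by ring⟩

/-- The derivative of an `O(lam)` family tends weakly to zero although it need not become small.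
This is why products of two such derivatives can leave a nonzero limit. -/
theorem wc_diff (F : LocalFamily V G m Λ) (k i j : Fin 4) :
    WC V (fun lam => pd k (fun z => G lam z i j - G 0 z i j)) (fun _ => 0) := by
  have hs : SM V (fun lam z => G lam z i j - G 0 z i j) := fun lam hl =>
    (F.smooth lam hl.le i j).sub (F.smooth 0 le_rfl i j)
  have h := (WConv.of_sb F.isOpen (F.small i j) hs.cont).pd F.isOpen
    (fun lam hl => (hs lam hl).of_le (by simp)) contDiffOn_const k
  exact ⟨hs.pd F.isOpen k, contDiffOn_const, F.deriv k i j,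
    h.congr (fun _ _ _ _ => rfl) fun y _ => by simp [pd]⟩

theorem wc_pd (F : LocalFamily V G m Λ) (k i j : Fin 4) :
    WC V (fun lam => pd k (fun z => G lam z i j)) (pd k (fun z => G 0 z i j)) :=
  (((F.sc_const k i j).wc F.isOpen).add F.isOpen (F.wc_diff k i j)).congr
    (fun lam hl y hy => by rw [F.pd_sub hl.le hy]; ring) (fun _ _ => by ring)

/-- Split each derivative into background and perturbation. The mixed products pair a fixed function
with a weakly vanishing one, so only the product of two perturbations adds to the background term.
-/
theorem wc_pd_mul_pd (F : LocalFamily V G m Λ) (a b c d e f : Fin 4) :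
    WC V (fun lam y => pd a (fun z => G lam z c d) y * pd b (fun z => G lam z e f) y)
      (fun y => pd a (fun z => G 0 z c d) y * pd b (fun z => G 0 z e f) y +
        m ![a, b, c, d, e, f] y) := by
  have h1 := (F.sc_const a c d).mul_wc F.isOpen (F.wc_pd b e f)
  have h2 := (F.sc_const b e f).mul_wc F.isOpen (F.wc_diff a c d)
  have h3 : WC V _ (m ![a, b, c, d, e, f]) :=
    ⟨(F.wc_diff a c d).smooth.mul (F.wc_diff b e f).smooth, F.smooth_weak _,
      (F.wc_diff a c d).bdd.mul (F.wc_diff b e f).bdd, F.weak ![a, b, c, d, e, f]⟩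
  refine ((h1.add F.isOpen h2).add F.isOpen h3).congr (fun lam hl y hy => ?_) (fun _ _ => by ring)
  rw [F.pd_sub hl.le hy, F.pd_sub hl.le hy]
  ring

theorem ub_inv (F : LocalFamily V G m Λ) (i j : Fin 4) :
    UB V (fun lam y => (G lam y)⁻¹ i j) := by
  choose K₀ hK₀ using F.bdd_inv
  choose C₀ hC₀ using F.small
  obtain ⟨K, hK⟩ : ∃ K, ∀ i j, K₀ i j ≤ K :=
    ⟨∑ i, ∑ j, |K₀ i j|, fun i j => (le_abs_self _).trans
      ((Finset.single_le_sum (f := fun j => |K₀ i j|) (fun _ _ => abs_nonneg _)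
        (Finset.mem_univ j)).trans (Finset.single_le_sum (f := fun i => ∑ j, |K₀ i j|)
          (fun _ _ => Finset.sum_nonneg fun _ _ => abs_nonneg _) (Finset.mem_univ i)))⟩
  obtain ⟨C, hC⟩ : ∃ C, ∀ i j, C₀ i j ≤ C :=
    ⟨∑ i, ∑ j, |C₀ i j|, fun i j => (le_abs_self _).trans
      ((Finset.single_le_sum (f := fun j => |C₀ i j|) (fun _ _ => abs_nonneg _)
        (Finset.mem_univ j)).trans (Finset.single_le_sum (f := fun i => ∑ j, |C₀ i j|)
          (fun _ _ => Finset.sum_nonneg fun _ _ => abs_nonneg _) (Finset.mem_univ i)))⟩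
  have hlim : ∀ᶠ lam in 𝓝[>] (0 : ℝ), 16 * K * (C * lam) < 1 / 2 := by
    have : Tendsto (fun lam : ℝ => 16 * K * (C * lam)) (𝓝 0) (𝓝 (16 * K * (C * 0))) := by
      apply Continuous.tendsto; fun_prop
    exact (this.mono_left nhdsWithin_le_nhds).eventually_lt_const (by simp)
  refine ⟨2 * K, ?_⟩
  have h1 := eventually_all.2 fun i => eventually_all.2 fun j => hK₀ i j
  have h2 := eventually_all.2 fun i => eventually_all.2 fun j => hC₀ i j
  filter_upwards [h1, h2, hlim, eventually_pos] with lam h1 h2 h3 hl y hy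
  exact abs_inv_apply_le (F.det_ne lam hl.le y hy) (F.det_ne 0 le_rfl y hy)
    (fun i j => (h1 i j y hy).trans (hK i j))
    (fun i j => (h2 i j y hy).trans (mul_le_mul_of_nonneg_right (hC i j) hl.le)) h3.le i j

/-- The resolvent identity, with the uniform bounds on both inverses, transfers the rate `O(lam)`
from the metric to its inverse. -/
theorem sc_inv (F : LocalFamily V G m Λ) (i j : Fin 4) :
    SC V (fun lam y => (G lam y)⁻¹ i j) (fun y => (G 0 y)⁻¹ i j) := by
  refine ⟨fun lam hl => contDiffOn_inv (F.smooth lam hl.le) (F.det_ne lam hl.le) i j,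
    contDiffOn_inv (F.smooth 0 le_rfl) (F.det_ne 0 le_rfl) i j, F.ub_inv i j, ?_⟩
  have h := (SB.sum (s := Finset.univ) fun l _ => SB.sum (s := Finset.univ) fun k _ =>
    ((F.small k l).ub_mul (F.ub_inv i k)).mul_ub (F.bdd_inv l j)).neg
  refine h.congr fun lam hl y hy => ?_
  have key : (G lam y)⁻¹ - (G 0 y)⁻¹ = -((G lam y)⁻¹ * (G lam y - G 0 y) * (G 0 y)⁻¹) := by
    rw [Matrix.mul_sub, Matrix.sub_mul,
      Matrix.nonsing_inv_mul _ (isUnit_iff_ne_zero.2 (F.det_ne lam hl.le y hy)),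
      Matrix.mul_assoc, Matrix.mul_nonsing_inv _ (isUnit_iff_ne_zero.2 (F.det_ne 0 le_rfl y hy))]
    simp
  have h2 := congrFun (congrFun key i) j
  simp only [Matrix.sub_apply, Matrix.neg_apply, Matrix.mul_apply, Finset.sum_mul] at h2
  exact h2.symm

theorem ub_pd_inv (F : LocalFamily V G m Λ) (k i j : Fin 4) :
    UB V (fun lam => pd k (fun z => (G lam z)⁻¹ i j)) :=
  (UB.sum (s := Finset.univ) fun a _ => UB.sum (s := Finset.univ) fun b _ =>
    ((F.ub_inv i a).mul (F.ub_pd k a b)).mul (F.ub_inv b j)).neg.congr fun lam hl _ hy =>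
      (pd_inv F.isOpen (F.smooth lam hl.le) (F.det_ne lam hl.le) hy k i j).symm

theorem wc_christoffel (F : LocalFamily V G m Λ) (i j k : Fin 4) :
    WC V (fun lam => christoffel (G lam) i j k) (christoffel (G 0) i j k) :=
  (SC.const (1 / 2)).mul_wc F.isOpen (WC.sum F.isOpen (s := Finset.univ) fun l _ =>
    (F.sc_inv i l).mul_wc F.isOpen (WC.lowChr F.isOpen (fun a c d => F.wc_pd a c d) l j k))

theorem wc_christoffel_mul (F : LocalFamily V G m Λ) (i j k p q r : Fin 4) :
    WC V (fun lam y => christoffel (G lam) i j k y * christoffel (G lam) p q r y)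
      (fun y => christoffel (G 0) i j k y * christoffel (G 0) p q r y +
        ∑ a, ∑ b, 1 / 4 * ((G 0 y)⁻¹ i a * (G 0 y)⁻¹ p b) *
          chrSq (fun I => m I y) a j k b q r) := by
  refine (WC.sum F.isOpen (s := Finset.univ) fun a _ => WC.sum F.isOpen (s := Finset.univ)
    fun b _ => ((SC.const (1 / 4)).mul ((F.sc_inv i a).mul (F.sc_inv p b))).mul_wc F.isOpen
      (WC.lowChr F.isOpen (fun a' c d => WC.lowChr F.isOpen
        (fun b' e f => F.wc_pd_mul_pd a' b' c d e f) b q r) a j k)).congr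
      (fun lam hl y _ => ?_) (fun y _ => ?_)
  · rw [christoffel_mul_christoffel]
  · rw [christoffel_mul_christoffel, ← Finset.sum_add_distrib]
    refine Finset.sum_congr rfl fun a _ => ?_
    rw [← Finset.sum_add_distrib]
    refine Finset.sum_congr rfl fun b _ => ?_
    simp only [chrSq, lowChr]
    ring

/-- Second derivatives of the metric enter only through derivatives of Christoffel symbols, which
commute with weak limits. The extra term comes from the products of Christoffel symbols alone. -/
theorem wconv_ricci (F : LocalFamily V G m Λ) (j k : Fin 4) :
    WConv V (fun lam => ricci (G lam) j k)
      (fun y => ricci (G 0) j k y + ricciQ (G 0 y)⁻¹ (fun I => m I y) j k) := by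
  refine (WConv.sum F.isOpen (s := Finset.univ) fun i _ =>
    (((F.wc_christoffel i j k).pd F.isOpen i).sub F.isOpen
      ((F.wc_christoffel i i k).pd F.isOpen j)).add F.isOpen
      (WConv.sum F.isOpen (s := Finset.univ) fun l _ =>
        ((F.wc_christoffel_mul l j k i l i).sub F.isOpen
          (F.wc_christoffel_mul l i k i l j)).conv)).congr (fun _ _ _ _ => rfl) (fun y _ => ?_)
  rw [ricci, ricciQ, ← Finset.sum_add_distrib]
  refine Finset.sum_congr rfl fun i _ => ?_
  rw [add_assoc, ← Finset.sum_add_distrib]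
  congr 1
  refine Finset.sum_congr rfl fun l _ => ?_
  have h : ∀ a b : Fin 4, 1 / 4 * ((G 0 y)⁻¹ l a * (G 0 y)⁻¹ i b) *
      (chrSq (fun I => m I y) a j k b l i - chrSq (fun I => m I y) a i k b l j) =
      1 / 4 * ((G 0 y)⁻¹ l a * (G 0 y)⁻¹ i b) * chrSq (fun I => m I y) a j k b l i -
      1 / 4 * ((G 0 y)⁻¹ l a * (G 0 y)⁻¹ i b) * chrSq (fun I => m I y) a i k b l j :=
    fun a b => mul_sub _ _ _
  simp_rw [h, Finset.sum_sub_distrib]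
  ring

theorem sm_ricci (F : LocalFamily V G m Λ) (j k : Fin 4) : SM V (fun lam => ricci (G lam) j k) :=
  SM.sum (s := Finset.univ) fun i _ =>
    (((F.wc_christoffel i j k).smooth.pd F.isOpen i).sub
      ((F.wc_christoffel i i k).smooth.pd F.isOpen j)).add
      (SM.sum (s := Finset.univ) fun l _ =>
        ((F.wc_christoffel_mul l j k i l i).smooth.sub
          (F.wc_christoffel_mul l i k i l j).smooth))

/-- The Ricci tensor has no uniform bound, but its second-order part consists of derivatives of
bounded families. Multiplied by a coefficient with bounded first derivatives it still has bounded
integrals against test functions. -/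
theorem wb_mul_ricci (F : LocalFamily V G m Λ) {A : ℝ → R4 → ℝ} (hA : UB V A)
    (hA' : ∀ i, UB V fun lam => pd i (A lam)) (hAs : SM V A) (j k : Fin 4) :
    WB V (fun lam y => A lam y * ricci (G lam) j k y) := by
  have hB : ∀ i j k, WB V (fun lam y => A lam y * pd i (christoffel (G lam) i j k) y) :=
    fun i j k => WB.mul_pd F.isOpen hA hA' hAs (F.wc_christoffel i j k).bdd
      (F.wc_christoffel i j k).smooth i
  have hC : ∀ i, WB V (fun lam y => -(A lam y * pd j (christoffel (G lam) i i k) y)) :=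
    fun i => (WB.mul_pd F.isOpen hA hA' hAs (F.wc_christoffel i i k).bdd
      (F.wc_christoffel i i k).smooth j).neg
  have hQ : ∀ i, UB V (fun lam y => A lam y * ∑ l, (christoffel (G lam) l j k y *
      christoffel (G lam) i l i y - christoffel (G lam) l i k y * christoffel (G lam) i l j y)) :=
    fun i => hA.mul (UB.sum (s := Finset.univ) fun l _ => (F.wc_christoffel_mul l j k i l i).bdd.sub
      (F.wc_christoffel_mul l i k i l j).bdd)
  have hQs : ∀ i, SM V (fun lam y => A lam y * ∑ l, (christoffel (G lam) l j k y *
      christoffel (G lam) i l i y - christoffel (G lam) l i k y * christoffel (G lam) i l j y)) :=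
    fun i => hAs.mul (SM.sum (s := Finset.univ) fun l _ =>
      (F.wc_christoffel_mul l j k i l i).smooth.sub (F.wc_christoffel_mul l i k i l j).smooth)
  have hBs : ∀ i, SM V (fun lam y => A lam y * pd i (christoffel (G lam) i j k) y) :=
    fun i => hAs.mul ((F.wc_christoffel i j k).smooth.pd F.isOpen i)
  have hCs : ∀ i, SM V (fun lam y => -(A lam y * pd j (christoffel (G lam) i i k) y)) :=
    fun i lam hl => ((hAs.mul ((F.wc_christoffel i i k).smooth.pd F.isOpen j)) lam hl).neg
  refine (WB.sum F.isOpen (s := Finset.univ) (fun i _ => ((hB i j k).add F.isOpen (hC i)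
    (hBs i).cont (hCs i).cont).add_ub F.isOpen ((hBs i).add (hCs i)) (hQ i) (hQs i))
    (fun i _ => (((hBs i).add (hCs i)).add (hQs i)).cont)).congr fun lam hl y hy => ?_
  rw [ricci, Finset.mul_sum]
  exact Finset.sum_congr rfl fun i _ => by ring

theorem einsteinLam_eq (Λ : ℝ) (G : R4 → Matrix (Fin 4) (Fin 4) ℝ) (j k : Fin 4) (y : R4) :
    einsteinLam Λ G j k y = ricci G j k y - 1 / 2 * (∑ p, ∑ q, (G y)⁻¹ p q * ricci G p q y) * G y j k
      + Λ * G y j k := rfl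

theorem sm_einsteinLam (F : LocalFamily V G m Λ) (j k : Fin 4) :
    SM V (fun lam => einsteinLam Λ (G lam) j k) := by
  refine ((F.sm_ricci j k).sub (((SM.const (1 / 2)).mul (SM.sum (s := Finset.univ) fun p _ =>
    SM.sum (s := Finset.univ) fun q _ => (F.sc_inv p q).smooth.mul (F.sm_ricci p q))).mul
      (F.sc j k).smooth)).add ((SM.const Λ).mul (F.sc j k).smooth)

/-- The trace term is the Ricci tensor with coefficients `g⁻¹ g`, whose first derivatives are
bounded. This weak bound is the half of the `L¹` estimate that needs no energy condition. -/
theorem wb_einsteinLam (F : LocalFamily V G m Λ) (j k : Fin 4) :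
    WB V (fun lam => einsteinLam Λ (G lam) j k) := by
  have h1 := F.wb_mul_ricci (UB.const (V := V) 1) (fun i => (UB.const 0).congr fun _ _ _ _ => by simp [pd])
    (SM.const 1) j k
  have hs : ∀ p q, SM V (fun lam y => -1 / 2 * ((G lam y)⁻¹ p q * G lam y j k)) := fun p q =>
    (SM.const _).mul ((F.sc_inv p q).smooth.mul (F.sc j k).smooth)
  have h2 : ∀ p q, WB V (fun lam y => -1 / 2 * ((G lam y)⁻¹ p q * G lam y j k) *
      ricci (G lam) p q y) := fun p q => by
    refine F.wb_mul_ricci ((UB.const _).mul ((F.sc_inv p q).bdd.mul (F.sc j k).bdd)) (fun i => ?_)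
      (hs p q) p q
    refine ((UB.const (-1 / 2)).mul (((F.ub_pd_inv i p q).mul (F.sc j k).bdd).add
      ((F.sc_inv p q).bdd.mul (F.ub_pd i j k)))).congr fun lam hl y hy => ?_
    have hd : DifferentiableAt ℝ (fun z => (G lam z)⁻¹ p q) y :=
      (((F.sc_inv p q).smooth lam hl).contDiffAt (F.isOpen.mem_nhds hy)).differentiableAt (by simp)
    rw [pd_mul (differentiableAt_const _) (hd.fun_mul (F.differentiableAt hl.le hy j k)),
      pd_mul hd (F.differentiableAt hl.le hy j k)]
    simp [pd]
  have h2s : ∀ p q, SM V (fun lam y => -1 / 2 * ((G lam y)⁻¹ p q * G lam y j k) *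
      ricci (G lam) p q y) := fun p q => (hs p q).mul (F.sm_ricci p q)
  have h3 := WB.sum F.isOpen (s := Finset.univ) (fun p _ => WB.sum F.isOpen (s := Finset.univ)
    (fun q _ => h2 p q) (fun q _ => (h2s p q).cont))
    (fun p _ => (SM.sum (s := Finset.univ) fun q _ => h2s p q).cont)
  have h3s : SM V (fun lam y => ∑ p, ∑ q, -1 / 2 * ((G lam y)⁻¹ p q * G lam y j k) *
      ricci (G lam) p q y) := SM.sum fun p _ => SM.sum fun q _ => h2s p q
  have h1s := (SM.const 1).mul (F.sm_ricci j k)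
  refine ((h1.add F.isOpen h3 h1s.cont h3s.cont).add_ub F.isOpen (h1s.add h3s)
    ((UB.const Λ).mul (F.sc j k).bdd) ((SM.const Λ).mul (F.sc j k).smooth)).congr
      fun lam hl y hy => ?_
  rw [einsteinLam_eq, Finset.mul_sum, Finset.sum_mul, sub_eq_add_neg, ← Finset.sum_neg_distrib]
  simp_rw [Finset.mul_sum, Finset.sum_mul, ← Finset.sum_neg_distrib]
  congr 2
  · ring
  · exact Finset.sum_congr rfl fun p _ => Finset.sum_congr rfl fun q _ => by ring

end LocalFamily

/-! ### The energy condition bounds the curvature in `L¹` -/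

namespace LocalFamily

variable {V : Set R4} {G : ℝ → R4 → Matrix (Fin 4) (Fin 4) ℝ}
  {m : (Fin 6 → Fin 4) → R4 → ℝ} {Λ : ℝ}

/-- Polarisation: the nonnegative energy densities control the symmetric part of Einstein's
tensor. -/
theorem lb_einsteinLam (F : LocalFamily V G m Λ) (j k : Fin 4) :
    LB V (fun lam y => einsteinLam Λ (G lam) j k y + einsteinLam Λ (G lam) k j y) := by
  obtain ⟨v, s, hs, hpos⟩ := F.nonneg
  let f : (Fin 4 → ℝ) → ℝ → R4 → ℝ := fun w lam y =>
    ∑ i, ∑ j, einsteinLam Λ (G lam) i j y * w i * w j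
  have hfs : ∀ w, SM V (f w) := fun w => SM.sum fun i _ => SM.sum fun j _ =>
    ((F.sm_einsteinLam i j).mul (SM.const (w i))).mul (SM.const (w j))
  have hterm : ∀ (c : ℝ) i j, WB V (fun lam y => einsteinLam Λ (G lam) i j y * c) := by
    intro c i j φ hφ
    obtain ⟨C, hC⟩ := F.wb_einsteinLam i j φ hφ
    refine ⟨C * |c|, hC.mono fun lam h => ?_⟩
    simp_rw [← mul_assoc]
    rw [integral_mul_const, abs_mul]
    exact mul_le_mul_of_nonneg_right h (abs_nonneg _)
  have hfw : ∀ w, WB V (f w) := by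
    intro w
    have hts : ∀ i j, SM V (fun lam y => einsteinLam Λ (G lam) i j y * (w i * w j)) :=
      fun i j => (F.sm_einsteinLam i j).mul (SM.const _)
    refine (WB.sum F.isOpen (s := Finset.univ) (fun i _ => WB.sum F.isOpen (s := Finset.univ)
      (fun j _ => hterm (w i * w j) i j) (fun j _ => (hts i j).cont))
      (fun i _ => (SM.sum (s := Finset.univ) fun j _ => hts i j).cont)).congr
        fun lam hl y hy => ?_
    exact Finset.sum_congr rfl fun i _ => Finset.sum_congr rfl fun j _ => (mul_assoc _ _ _).symm
  -- The only use of the nonnegative energy densities: a nonnegative family with bounded weak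
  -- integrals is locally bounded in `L¹`.
  have hfl : ∀ w, (∀ i, |w i - v i| ≤ s) → LB V (f w) := fun w hw =>
    (hfw w).lb_of_nonneg F.isOpen (hpos.mono fun lam h y hy => h y hy w hw) (hfs w).cont
  -- The values at `a, b ∈ {0, 1}` all lie in the box. The mixed second difference of the quadratic
  -- form over these four vectors isolates the symmetrised `(j, k)` entry, with factor `(s / 2) ^
  -- 2`.
  let w : ℝ → ℝ → Fin 4 → ℝ := fun a b =>
    v + a • (s / 2) • Pi.single j (1 : ℝ) + b • (s / 2) • Pi.single k (1 : ℝ)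
  have hw : ∀ a b, 0 ≤ a → a ≤ 1 → 0 ≤ b → b ≤ 1 → ∀ i, |w a b i - v i| ≤ s := by
    intro a b ha ha' hb hb' i
    have h1 : ∀ l : Fin 4, 0 ≤ (Pi.single l (1 : ℝ) : Fin 4 → ℝ) i ∧
        (Pi.single l (1 : ℝ) : Fin 4 → ℝ) i ≤ 1 := by
      intro l; rw [Pi.single_apply]; split_ifs <;> norm_num
    simp only [w, Pi.add_apply, Pi.smul_apply, smul_eq_mul]
    have e1 : a * (s / 2 * (Pi.single j (1 : ℝ) : Fin 4 → ℝ) i) ≤ 1 * (s / 2 * 1) :=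
      mul_le_mul ha' (mul_le_mul_of_nonneg_left (h1 j).2 (by positivity))
        (mul_nonneg (by positivity) (h1 j).1) zero_le_one
    have e2 : b * (s / 2 * (Pi.single k (1 : ℝ) : Fin 4 → ℝ) i) ≤ 1 * (s / 2 * 1) :=
      mul_le_mul hb' (mul_le_mul_of_nonneg_left (h1 k).2 (by positivity))
        (mul_nonneg (by positivity) (h1 k).1) zero_le_one
    have e3 : 0 ≤ a * (s / 2 * (Pi.single j (1 : ℝ) : Fin 4 → ℝ) i) :=
      mul_nonneg ha (mul_nonneg (by positivity) (h1 j).1)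
    have e4 : 0 ≤ b * (s / 2 * (Pi.single k (1 : ℝ) : Fin 4 → ℝ) i) :=
      mul_nonneg hb (mul_nonneg (by positivity) (h1 k).1)
    rw [abs_le]; constructor <;> linarith
  have hc : ∀ (c : ℝ) (a b : ℝ), 0 ≤ a → a ≤ 1 → 0 ≤ b → b ≤ 1 →
      LB V (fun lam y => c * f (w a b) lam y) := fun c a b h1 h2 h3 h4 =>
    LB.ub_mul F.isOpen (UB.const c) (hfl _ (hw a b h1 h2 h3 h4)) (SM.const c).cont (hfs _).cont
  have hcs : ∀ (c : ℝ) (a b : ℝ), SM V (fun lam y => c * f (w a b) lam y) := fun c a b =>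
    (SM.const c).mul (hfs _)
  have z : (0 : ℝ) ≤ 0 := le_rfl
  have o : (1 : ℝ) ≤ 1 := le_rfl
  have zo : (0 : ℝ) ≤ 1 := zero_le_one
  refine ((((hc (4 / s ^ 2) 1 1 zo o zo o).add F.isOpen (hc (-(4 / s ^ 2)) 1 0 zo o z zo)
    (hcs _ _ _).cont (hcs _ _ _).cont).add F.isOpen (hc (-(4 / s ^ 2)) 0 1 z zo zo o)
    ((hcs _ _ _).add (hcs _ _ _)).cont (hcs _ _ _).cont).add F.isOpen
    (hc (4 / s ^ 2) 0 0 z zo z zo) (((hcs _ _ _).add (hcs _ _ _)).add (hcs _ _ _)).cont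
    (hcs _ _ _).cont).congr fun lam hl y hy => ?_
  have hf : ∀ a b, f (w a b) lam y = ∑ i, ∑ l, einsteinLam Λ (G lam) i l y * w a b i * w a b l :=
    fun _ _ => rfl
  have hsum : f (w 1 1) lam y - f (w 1 0) lam y - f (w 0 1) lam y + f (w 0 0) lam y =
      (s / 2) ^ 2 * (einsteinLam Λ (G lam) j k y + einsteinLam Λ (G lam) k j y) := by
    simp_rw [hf]
    have e : ∀ i l, (einsteinLam Λ (G lam) i l y * w 1 1 i * w 1 1 l
        - einsteinLam Λ (G lam) i l y * w 1 0 i * w 1 0 l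
        - einsteinLam Λ (G lam) i l y * w 0 1 i * w 0 1 l
        + einsteinLam Λ (G lam) i l y * w 0 0 i * w 0 0 l) =
        (s / 2) ^ 2 * (einsteinLam Λ (G lam) i l y *
          ((Pi.single j (1 : ℝ) : Fin 4 → ℝ) i * (Pi.single k (1 : ℝ) : Fin 4 → ℝ) l +
          (Pi.single k (1 : ℝ) : Fin 4 → ℝ) i * (Pi.single j (1 : ℝ) : Fin 4 → ℝ) l)) := by
      intro i l
      simp only [w, Pi.add_apply, Pi.smul_apply, smul_eq_mul]
      ring
    simp_rw [← Finset.sum_sub_distrib, ← Finset.sum_add_distrib, e, ← Finset.mul_sum]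
    simp only [Pi.single_apply, mul_add, mul_ite, mul_one, mul_zero, ite_mul, one_mul, zero_mul,
      Finset.sum_add_distrib, Finset.sum_ite_eq', Finset.mem_univ, if_true, Finset.sum_ite_irrel,
      Finset.sum_const_zero]
  have h2 : 4 / s ^ 2 * (s / 2) ^ 2 = 1 := by field_simp; norm_num
  linear_combination (4 / s ^ 2) * hsum +
    (einsteinLam Λ (G lam) j k y + einsteinLam Λ (G lam) k j y) * h2

theorem inv_symm (F : LocalFamily V G m Λ) {lam : ℝ} (hl : 0 ≤ lam) {y : R4} (hy : y ∈ V)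
    (i j : Fin 4) : (G lam y)⁻¹ i j = (G lam y)⁻¹ j i := by
  have h : (G lam y)ᵀ = G lam y := by ext i j; exact F.symm lam hl y hy j i
  have h2 : ((G lam y)⁻¹)ᵀ = (G lam y)⁻¹ := by rw [Matrix.transpose_nonsing_inv, h]
  exact congrFun (congrFun h2 j) i

theorem inv_contract (F : LocalFamily V G m Λ) {lam : ℝ} (hl : 0 ≤ lam) {y : R4} (hy : y ∈ V) :
    ∑ p, ∑ q, (G lam y)⁻¹ p q * G lam y p q = 4 := by
  have h : ∑ p, ((G lam y)⁻¹ * G lam y) p p = 4 := by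
    rw [Matrix.nonsing_inv_mul _ (isUnit_iff_ne_zero.2 (F.det_ne lam hl y hy))]
    simp
  rw [← h]
  refine Finset.sum_congr rfl fun p _ => ?_
  rw [Matrix.mul_apply]
  exact Finset.sum_congr rfl fun q _ => by rw [F.symm lam hl y hy p q]

/-- Contraction of a symmetric with an arbitrary matrix. -/
theorem sum_mul_eq_half {H R : Fin 4 → Fin 4 → ℝ} (hH : ∀ i j, H i j = H j i) :
    ∑ p, ∑ q, H p q * R p q = 1 / 2 * ∑ p, ∑ q, H p q * (R p q + R q p) := by
  have h : ∑ p, ∑ q, H p q * R q p = ∑ p, ∑ q, H p q * R p q := by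
    rw [Finset.sum_comm]
    exact Finset.sum_congr rfl fun q _ => Finset.sum_congr rfl fun p _ => by rw [hH]
  simp_rw [mul_add, Finset.sum_add_distrib, h]
  ring

/-- Trace reversal in dimension four: the left hand side of Einstein's equation has trace `-S + 4Λ`,
where `S` is the scalar curvature, which recovers `S` and hence the Ricci tensor. Only the symmetric
part is recorded, since only that part is controlled. -/
theorem ricci_symm_eq (F : LocalFamily V G m Λ) {lam : ℝ} (hl : 0 ≤ lam) {y : R4} (hy : y ∈ V)
    (j k : Fin 4) : ricci (G lam) j k y + ricci (G lam) k j y =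
      (einsteinLam Λ (G lam) j k y + einsteinLam Λ (G lam) k j y) +
      (2 * Λ - 1 / 2 * ∑ p, ∑ q, (G lam y)⁻¹ p q * (einsteinLam Λ (G lam) p q y +
        einsteinLam Λ (G lam) q p y)) * G lam y j k := by
  have h1 := F.inv_contract hl hy
  have h2 := F.symm lam hl y hy j k
  have h4 := sum_mul_eq_half (H := fun p q => (G lam y)⁻¹ p q) (R := fun p q => einsteinLam Λ (G lam) p q y)
    (F.inv_symm hl hy)
  obtain ⟨S, hS⟩ : ∃ S, S = ∑ p, ∑ q, (G lam y)⁻¹ p q * ricci (G lam) p q y := ⟨_, rfl⟩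
  have h3 : ∑ p, ∑ q, (G lam y)⁻¹ p q * einsteinLam Λ (G lam) p q y =
      S - 1 / 2 * S * 4 + Λ * 4 := by
    rw [← h1]
    have e : ∀ p q, (G lam y)⁻¹ p q * einsteinLam Λ (G lam) p q y =
        (G lam y)⁻¹ p q * ricci (G lam) p q y - 1 / 2 * S * ((G lam y)⁻¹ p q * G lam y p q)
          + Λ * ((G lam y)⁻¹ p q * G lam y p q) := fun p q => by
      rw [einsteinLam_eq, ← hS]; ring
    simp_rw [e, Finset.sum_add_distrib, Finset.sum_sub_distrib, ← Finset.mul_sum]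
    rw [← hS]
  rw [← h4, h3, einsteinLam_eq, einsteinLam_eq, ← hS, ← h2]
  ring

/-- Trace reversal has uniformly bounded coefficients, so the `L¹` bound passes from the Einstein
tensor to the Ricci tensor. -/
theorem lb_ricci (F : LocalFamily V G m Λ) (j k : Fin 4) :
    LB V (fun lam y => ricci (G lam) j k y + ricci (G lam) k j y) := by
  have hs : ∀ p q, SM V (fun lam y => einsteinLam Λ (G lam) p q y + einsteinLam Λ (G lam) q p y) :=
    fun p q => (F.sm_einsteinLam p q).add (F.sm_einsteinLam q p)
  have hc : ∀ p q, SM V (fun lam y => -1 / 2 * ((G lam y)⁻¹ p q * G lam y j k)) := fun p q =>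
    (SM.const _).mul ((F.sc_inv p q).smooth.mul (F.sc j k).smooth)
  have h1 : ∀ p q, LB V (fun lam y => -1 / 2 * ((G lam y)⁻¹ p q * G lam y j k) *
      (einsteinLam Λ (G lam) p q y + einsteinLam Λ (G lam) q p y)) := fun p q =>
    LB.ub_mul F.isOpen ((UB.const _).mul ((F.sc_inv p q).bdd.mul (F.sc j k).bdd))
      (F.lb_einsteinLam p q) (hc p q).cont (hs p q).cont
  have h2 := LB.sum F.isOpen (s := Finset.univ) (fun p _ => LB.sum F.isOpen (s := Finset.univ)
    (fun q _ => h1 p q) (fun q _ => ((hc p q).mul (hs p q)).cont))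
    (fun p _ => (SM.sum (s := Finset.univ) fun q _ => (hc p q).mul (hs p q)).cont)
  have h2s := SM.sum (s := Finset.univ) fun p _ => SM.sum (s := Finset.univ) fun q _ =>
    (hc p q).mul (hs p q)
  have h3s := (SM.const (2 * Λ)).mul (F.sc j k).smooth
  have h3 := ((UB.const (2 * Λ)).mul (F.sc j k).bdd).lb F.isOpen h3s.cont
  refine (((F.lb_einsteinLam j k).add F.isOpen h2 (hs j k).cont h2s.cont).add F.isOpen h3
    ((hs j k).add h2s).cont h3s.cont).congr fun lam hl y hy => ?_
  rw [F.ricci_symm_eq hl.le hy, add_assoc, sub_mul, Finset.mul_sum, Finset.sum_mul]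
  simp_rw [Finset.mul_sum, Finset.sum_mul]
  rw [sub_eq_add_neg, add_comm (2 * Λ * _), ← Finset.sum_neg_distrib]
  simp_rw [← Finset.sum_neg_distrib]
  congr 2
  exact Finset.sum_congr rfl fun p _ => Finset.sum_congr rfl fun q _ => by ring

/-- The weak limit of the left hand side of Einstein's equation. -/
theorem wconv_einsteinLam (F : LocalFamily V G m Λ) (j k : Fin 4) :
    WConv V (fun lam => einsteinLam Λ (G lam) j k)
      (fun y => einsteinLam Λ (G 0) j k y + einsteinQ (G 0 y) (fun I => m I y) j k) := by
  have hsc : ∀ p q, SC V _ _ := fun p q => (F.sc_inv p q).mul (F.sc j k)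
  -- The `O(lam)` error of the coefficients multiplies second derivatives of the metric, and only
  -- the `L¹` bound from the energy condition makes it vanish. Symmetrising the Ricci tensor is
  -- harmless because the inverse metric is symmetric.
  have h1 : ∀ p q, WConv V (fun lam y => ((G lam y)⁻¹ p q * G lam y j k -
      (G 0 y)⁻¹ p q * G 0 y j k) * (ricci (G lam) p q y + ricci (G lam) q p y)) (fun _ => 0) :=
    fun p q => WConv.of_sb_mul_lb F.isOpen (hsc p q).sb (F.lb_ricci p q)
      (fun lam hl => ((hsc p q).smooth.cont lam hl).sub (hsc p q).smooth₀.continuousOn)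
      ((F.sm_ricci p q).add (F.sm_ricci q p)).cont
  have h2 : ∀ p q, WConv V _ _ := fun p q =>
    (F.wconv_ricci p q).smooth_mul F.isOpen (hsc p q).smooth₀
  have h3 := (WConv.sum F.isOpen (s := Finset.univ) fun p _ => WConv.sum F.isOpen
    (s := Finset.univ) fun q _ => h1 p q).const_mul F.isOpen (1 / 2)
  have h4 := WConv.sum F.isOpen (s := Finset.univ) fun p _ => WConv.sum F.isOpen
    (s := Finset.univ) fun q _ => h2 p q
  refine (((F.wconv_ricci j k).sub F.isOpen ((h3.add F.isOpen h4).const_mul F.isOpen (1 / 2))).add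
    F.isOpen (((F.sc j k).wc F.isOpen).conv.const_mul F.isOpen Λ)).congr
      (fun lam hl y hy => ?_) (fun y hy => ?_)
  · rw [← sum_mul_eq_half (H := fun p q => (G lam y)⁻¹ p q * G lam y j k -
      (G 0 y)⁻¹ p q * G 0 y j k) (R := fun p q => ricci (G lam) p q y)
      (fun p q => by rw [F.inv_symm hl.le hy, F.inv_symm le_rfl hy]), ← Finset.sum_add_distrib]
    simp_rw [← Finset.sum_add_distrib]
    rw [einsteinLam_eq, mul_assoc, Finset.sum_mul]
    simp_rw [Finset.sum_mul]
    congr 3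
    exact Finset.sum_congr rfl fun p _ => Finset.sum_congr rfl fun q _ => by ring
  · simp only [Finset.sum_const_zero, mul_zero, zero_add]
    rw [einsteinLam_eq, einsteinQ, mul_assoc, mul_assoc, Finset.sum_mul, Finset.sum_mul]
    simp_rw [Finset.sum_mul, mul_add, Finset.sum_add_distrib, mul_right_comm _ (G 0 y j k)]
    ring

end LocalFamily

/-! ### Algebra of plane waves on Minkowski space -/

section Symbol

open Matrix

/-- The Minkowski metric. -/
def minkowski : Matrix (Fin 4) (Fin 4) ℝ := Matrix.diagonal ![-1, 1, 1, 1]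

/-- The expression `X_a`, linear in `M` and `D`, for which the Ricci tensor is the sum of
`∂_a X_a(g⁻¹, ∂ g)` and a quadratic expression in the Christoffel symbols. -/
def ricciX (M : Matrix (Fin 4) (Fin 4) ℝ) (D : Fin 4 → Fin 4 → Fin 4 → ℝ) (a j k : Fin 4) : ℝ :=
  1 / 2 * ∑ l, M a l * lowChr D l j k -
    if a = j then 1 / 2 * ∑ i, ∑ l, M i l * lowChr D l i k else 0

/-- The symbol of the linearised Ricci tensor of Minkowski space. -/
def ricciSymbol (ξ : Fin 4 → ℝ) (h : Matrix (Fin 4) (Fin 4) ℝ) (j k : Fin 4) : ℝ :=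
  ∑ a, ξ a * ricciX minkowski (fun a c d => ξ a * h c d) a j k

/-- The products of first derivatives of a plane wave with wave vector `ξ`. -/
def waveSq (ξ : Fin 4 → ℝ) (h : Matrix (Fin 4) (Fin 4) ℝ) (I : Fin 6 → Fin 4) : ℝ :=
  ξ (I 0) * h (I 2) (I 3) * (ξ (I 1) * h (I 4) (I 5))

variable (ξ : Fin 4 → ℝ) (h : Matrix (Fin 4) (Fin 4) ℝ)

/-- For symmetric `h` this is `ricciSymbol` in matrix notation, a form whose behaviour under
isometries is visible. -/
def waveL : Matrix (Fin 4) (Fin 4) ℝ :=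
  (1 / 2 : ℝ) • (vecMulVec ξ (h *ᵥ (minkowski *ᵥ ξ)) + vecMulVec (h *ᵥ (minkowski *ᵥ ξ)) ξ
    - (ξ ⬝ᵥ (minkowski *ᵥ ξ)) • h - (minkowski * h).trace • vecMulVec ξ ξ)

/-- The matrix form of `ricciQ` on a plane wave, arranged so that `waveL` and matrix products
display its covariance. -/
def waveQ : Matrix (Fin 4) (Fin 4) ℝ :=
  (1 / 2 * (minkowski * h).trace) • waveL ξ h
    + (1 / 4 * ((minkowski * h).trace ^ 2 - (minkowski * h * minkowski * h).trace)) • vecMulVec ξ ξ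
    - (1 / 2 : ℝ) • vecMulVec (h *ᵥ (minkowski *ᵥ ξ)) (h *ᵥ (minkowski *ᵥ ξ))
    + (1 / 2 * (ξ ⬝ᵥ (minkowski *ᵥ ξ))) • (h * minkowski * h)

theorem minkowski_mul_self : minkowski * minkowski = 1 := by
  rw [minkowski, Matrix.diagonal_mul_diagonal, ← Matrix.diagonal_one]
  congr 1
  ext i; fin_cases i <;> simp

theorem minkowski_inv : minkowski⁻¹ = minkowski := Matrix.inv_eq_left_inv minkowski_mul_self

theorem sum_minkowski (i : Fin 4) (f : Fin 4 → ℝ) :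
    ∑ l, minkowski i l * f l = (![-1, 1, 1, 1] : Fin 4 → ℝ) i * f i := by
  simp [minkowski, Matrix.diagonal_apply]

variable {h} (hs : ∀ i j, h i j = h j i)
include hs

theorem ricciSymbol_eq (j k : Fin 4) : ricciSymbol ξ h j k = waveL ξ h j k := by
  have h0 := hs 0 j
  have h1 := hs 1 j
  have h2 := hs 2 j
  have h3 := hs 3 j
  have g0 := hs 0 k
  have g1 := hs 1 k
  have g2 := hs 2 k
  have g3 := hs 3 k
  simp only [ricciSymbol, ricciX, sum_minkowski, lowChr, waveL, mul_sub, Finset.sum_sub_distrib,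
    mul_ite, mul_zero, Finset.sum_ite_eq', Finset.mem_univ, if_true]
  simp only [Fin.sum_univ_four, Matrix.smul_apply, Matrix.sub_apply, Matrix.add_apply,
    vecMulVec_apply, mulVec, dotProduct, Matrix.trace, Matrix.diag, Matrix.mul_apply, sum_minkowski,
    smul_eq_mul]
  simp only [minkowski, Matrix.diagonal_apply]
  simp only [h0, h1, h2, h3, g0, g1, g2, g3]
  simp
  ring

theorem ricciQ_waveSq (j k : Fin 4) : ricciQ minkowski (waveSq ξ h) j k = waveQ ξ h j k := by
  have key : ricciQ minkowski (waveSq ξ h) j k = 1 / 4 * ∑ i, ∑ l,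
      (![-1, 1, 1, 1] : Fin 4 → ℝ) l * (![-1, 1, 1, 1] : Fin 4 → ℝ) i *
      (lowChr (fun a c d => ξ a * h c d) l j k * lowChr (fun a c d => ξ a * h c d) i l i -
       lowChr (fun a c d => ξ a * h c d) l i k * lowChr (fun a c d => ξ a * h c d) i l j) := by
    rw [ricciQ, Finset.mul_sum]
    refine Finset.sum_congr rfl fun i _ => ?_
    rw [Finset.mul_sum]
    refine Finset.sum_congr rfl fun l _ => ?_
    have e : ∀ a b : Fin 4, 1 / 4 * (minkowski l a * minkowski i b) *
        (chrSq (waveSq ξ h) a j k b l i - chrSq (waveSq ξ h) a i k b l j) =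
        minkowski l a * (minkowski i b * (1 / 4 *
          (chrSq (waveSq ξ h) a j k b l i - chrSq (waveSq ξ h) a i k b l j))) :=
      fun a b => by ring
    simp_rw [e, ← Finset.mul_sum, sum_minkowski]
    rw [lowChr_mul_lowChr, lowChr_mul_lowChr]
    have e2 : ∀ l j k s q r, chrSq (waveSq ξ h) l j k s q r =
      lowChr (fun a c d => lowChr (fun b e f => ξ a * h c d * (ξ b * h e f)) s q r) l j k :=
      fun _ _ _ _ _ _ => rfl
    rw [e2, e2]
    ring
  rw [key]
  have h0 := hs 0 j
  have h1 := hs 1 j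
  have h2 := hs 2 j
  have h3 := hs 3 j
  have g0 := hs 0 k
  have g1 := hs 1 k
  have g2 := hs 2 k
  have g3 := hs 3 k
  have f1 := hs 1 0
  have f2 := hs 2 0
  have f3 := hs 3 0
  have f4 := hs 2 1
  have f5 := hs 3 1
  have f6 := hs 3 2
  simp only [lowChr, waveQ, waveL]
  simp only [Fin.sum_univ_four, Matrix.smul_apply, Matrix.sub_apply, Matrix.add_apply,
    vecMulVec_apply, mulVec, dotProduct, Matrix.trace, Matrix.diag, Matrix.mul_apply, sum_minkowski,
    smul_eq_mul]
  simp only [minkowski, Matrix.diagonal_apply]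
  simp only [h0, h1, h2, h3, g0, g1, g2, g3, f1, f2, f3, f4, f5, f6]
  simp
  ring

omit hs

/-- The contraction of the quadratic form of a plane wave that determines the energy density. -/
def waveEnergy (ξ : Fin 4 → ℝ) (h : Matrix (Fin 4) (Fin 4) ℝ) : ℝ :=
  -waveQ ξ h 0 0 - 1 / 2 * (minkowski * waveQ ξ h).trace

-- Here `η₀₀ = -1`, so the trace term of the Einstein tensor enters the energy density with the same
-- sign as the Ricci term.
include hs in
theorem einsteinQ_waveSq : -einsteinQ minkowski (waveSq ξ h) 0 0 = waveEnergy ξ h := by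
  have e : (minkowski * waveQ ξ h).trace =
      ∑ p, ∑ q, minkowski p q * ricciQ minkowski (waveSq ξ h) p q := by
    rw [Matrix.trace]
    refine Finset.sum_congr rfl fun p _ => ?_
    rw [Matrix.diag, Matrix.mul_apply, sum_minkowski, sum_minkowski, ricciQ_waveSq ξ hs]
  rw [einsteinQ, minkowski_inv, ← e, ricciQ_waveSq ξ hs, waveEnergy]
  simp [minkowski]
  ring

/-! ### Invariance under symmetric orthogonal matrices preserving the Minkowski metric -/

section Rotation

variable {R : Matrix (Fin 4) (Fin 4) ℝ} (hT : Rᵀ = R) (hR : R * R = 1)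
  (hη : R * minkowski = minkowski * R)

include hR hη in
theorem rot_mulVec (h : Matrix (Fin 4) (Fin 4) ℝ) : (R * h * R) *ᵥ (minkowski *ᵥ (R *ᵥ ξ)) =
    R *ᵥ (h *ᵥ (minkowski *ᵥ ξ)) := by
  simp only [Matrix.mulVec_mulVec]
  congr 1
  calc R * h * R * (minkowski * R) = R * h * (R * R) * minkowski := by
        rw [← hη]; simp only [Matrix.mul_assoc]
    _ = R * (h * minkowski) := by rw [hR, Matrix.mul_one, Matrix.mul_assoc]

include hT hR hη in
theorem rot_dotProduct : (R *ᵥ ξ) ⬝ᵥ (minkowski *ᵥ (R *ᵥ ξ)) = ξ ⬝ᵥ (minkowski *ᵥ ξ) := by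
  rw [Matrix.mulVec_mulVec, ← hη, ← Matrix.mulVec_mulVec, Matrix.dotProduct_mulVec,
    ← Matrix.mulVec_transpose, Matrix.mulVec_mulVec, hT, hR, Matrix.one_mulVec]

include hT in
theorem rot_vecMulVec (a b : Fin 4 → ℝ) :
    vecMulVec (R *ᵥ a) (R *ᵥ b) = R * vecMulVec a b * R := by
  rw [Matrix.mul_vecMulVec, Matrix.vecMulVec_mul, ← Matrix.mulVec_transpose, hT]

include hR hη in
theorem rot_trace (h : Matrix (Fin 4) (Fin 4) ℝ) :
    (minkowski * (R * h * R)).trace = (minkowski * h).trace := by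
  rw [← Matrix.mul_assoc, Matrix.trace_mul_comm, ← Matrix.mul_assoc, ← Matrix.mul_assoc, hη,
    Matrix.mul_assoc minkowski, hR, Matrix.mul_one]

include hR hη in
theorem rot_sandwich (h h' : Matrix (Fin 4) (Fin 4) ℝ) :
    R * h * R * minkowski * (R * h' * R) = R * (h * minkowski * h') * R := by
  calc R * h * R * minkowski * (R * h' * R) = R * h * (R * minkowski) * R * h' * R := by
        simp only [Matrix.mul_assoc]
    _ = R * h * minkowski * (R * R) * h' * R := by rw [hη]; simp only [Matrix.mul_assoc]
    _ = _ := by rw [hR, Matrix.mul_one]; simp only [Matrix.mul_assoc]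

include hT hR hη in
theorem rot_waveL (h : Matrix (Fin 4) (Fin 4) ℝ) :
    waveL (R *ᵥ ξ) (R * h * R) = R * waveL ξ h * R := by
  simp only [waveL, rot_mulVec ξ hR hη, rot_dotProduct ξ hT hR hη, rot_vecMulVec hT,
    rot_trace hR hη, Matrix.mul_smul, Matrix.smul_mul, Matrix.mul_sub, Matrix.sub_mul,
    Matrix.mul_add, Matrix.add_mul]

include hT hR hη in
theorem rot_waveQ (h : Matrix (Fin 4) (Fin 4) ℝ) :
    waveQ (R *ᵥ ξ) (R * h * R) = R * waveQ ξ h * R := by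
  have e : (minkowski * (R * h * R) * minkowski * (R * h * R)).trace =
      (minkowski * h * minkowski * h).trace := by
    rw [Matrix.mul_assoc (minkowski * _), Matrix.mul_assoc minkowski, ← Matrix.mul_assoc (R * h * R),
      rot_sandwich hR hη, rot_trace hR hη]
    simp only [Matrix.mul_assoc]
  simp only [waveQ, e, rot_waveL ξ hT hR hη, rot_mulVec ξ hR hη, rot_dotProduct ξ hT hR hη,
    rot_vecMulVec hT, rot_trace hR hη, rot_sandwich hR hη, Matrix.mul_smul, Matrix.smul_mul,
    Matrix.mul_sub, Matrix.sub_mul, Matrix.mul_add, Matrix.add_mul]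

include hT hR hη in
theorem rot_waveEnergy (h0 : R *ᵥ Pi.single 0 1 = Pi.single 0 1) (h : Matrix (Fin 4) (Fin 4) ℝ) :
    waveEnergy (R *ᵥ ξ) (R * h * R) = waveEnergy ξ h := by
  have e : ∀ A : Matrix (Fin 4) (Fin 4) ℝ, A 0 0 = Pi.single 0 1 ⬝ᵥ (A *ᵥ Pi.single 0 1) := by
    intro A; simp
  rw [waveEnergy, waveEnergy, rot_waveQ ξ hT hR hη, rot_trace hR hη, e (R * _ * _), e (waveQ ξ h),
    ← Matrix.mulVec_mulVec, h0, ← Matrix.mulVec_mulVec, Matrix.dotProduct_mulVec,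
    ← Matrix.mulVec_transpose, hT, h0]

end Rotation

/-- A reflection that fixes the time axis and takes the spatial part of `ξ` to the first axis. -/
theorem exists_reflection (ξ : Fin 4 → ℝ) : ∃ R : Matrix (Fin 4) (Fin 4) ℝ, Rᵀ = R ∧ R * R = 1 ∧
    R * minkowski = minkowski * R ∧ R *ᵥ Pi.single 0 1 = Pi.single 0 1 ∧
    (R *ᵥ ξ) 2 = 0 ∧ (R *ᵥ ξ) 3 = 0 := by
  obtain ⟨κ, hκ0, hκ⟩ : ∃ κ : ℝ, 0 ≤ κ ∧ κ ^ 2 = ξ 1 ^ 2 + ξ 2 ^ 2 + ξ 3 ^ 2 :=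
    ⟨√(ξ 1 ^ 2 + ξ 2 ^ 2 + ξ 3 ^ 2), Real.sqrt_nonneg _, Real.sq_sqrt (by positivity)⟩
  -- In this degenerate case the second and third components of `ξ` already vanish and the identity
  -- matrix works; otherwise the reflection vector below has nonzero length.
  by_cases hz : κ * (κ - ξ 1) = 0
  · have h23 : ξ 2 ^ 2 + ξ 3 ^ 2 = 0 := by
      rcases mul_eq_zero.1 hz with h | h
      · nlinarith [sq_nonneg (ξ 1), sq_nonneg (ξ 2), sq_nonneg (ξ 3)]
      · nlinarith
    have h2 : ξ 2 = 0 := by nlinarith [sq_nonneg (ξ 2), sq_nonneg (ξ 3)]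
    have h3 : ξ 3 = 0 := by nlinarith [sq_nonneg (ξ 2), sq_nonneg (ξ 3)]
    exact ⟨1, by simp, by simp, by simp, Matrix.one_mulVec _, by simpa using h2, by simpa using h3⟩
  -- The Householder vector joining the spatial part of `ξ`, of length `κ`, to `κ` times the first
  -- axis. With `c = 2 / (v ⬝ᵥ v)` the reflection `1 - c v vᵀ` exchanges the two.
  · let v : Fin 4 → ℝ := ![0, ξ 1 - κ, ξ 2, ξ 3]
    have hvv : v ⬝ᵥ v = 2 * (κ * (κ - ξ 1)) := by
      simp [v, dotProduct, Fin.sum_univ_four]; linarith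
    have hvξ : v ⬝ᵥ ξ = κ * (κ - ξ 1) := by
      simp [v, dotProduct, Fin.sum_univ_four]; linarith
    obtain ⟨c, hc⟩ : ∃ c : ℝ, c * (κ * (κ - ξ 1)) = 1 := ⟨_, inv_mul_cancel₀ hz⟩
    have hRξ : ∀ u : Fin 4 → ℝ, ((1 : Matrix (Fin 4) (Fin 4) ℝ) - c • vecMulVec v v) *ᵥ u
        = u - (c * (v ⬝ᵥ u)) • v := by
      intro u
      rw [Matrix.sub_mulVec, Matrix.one_mulVec, Matrix.smul_mulVec, Matrix.vecMulVec_mulVec]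
      ext i
      simp
      ring
    refine ⟨1 - c • vecMulVec v v, ?_, ?_, ?_, ?_, ?_, ?_⟩
    · simp [Matrix.transpose_vecMulVec]
    · rw [Matrix.mul_sub, Matrix.sub_mul, Matrix.sub_mul]
      simp only [Matrix.smul_mul, Matrix.mul_smul, Matrix.vecMulVec_mul_vecMulVec, hvv]
      simp only [Matrix.one_mul, Matrix.mul_one, smul_smul, Matrix.vecMulVec_smul]
      rw [show c * (c * (2 * (κ * (κ - ξ 1)))) = 2 * c by linear_combination 2 * c * hc, two_mul,
        add_smul]
      abel
    · ext i j
      have hv : v i * v j * ((![-1, 1, 1, 1] : Fin 4 → ℝ) j - (![-1, 1, 1, 1] : Fin 4 → ℝ) i) = 0 := by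
        fin_cases i <;> fin_cases j <;> simp [v]
      simp only [minkowski, Matrix.mul_diagonal, Matrix.diagonal_mul, Matrix.sub_apply,
        Matrix.smul_apply, vecMulVec_apply, smul_eq_mul, Matrix.one_apply]
      split_ifs with hij
      · subst hij; ring
      · linear_combination (-c) * hv
    · rw [hRξ]; simp [v]
    · rw [hRξ, hvξ, hc]; simp [v]
    · rw [hRξ, hvξ, hc]; simp [v]

/-- For a wave vector along the first axis, the energy density is nonnegative up to multiples of
the linearised Ricci tensor. -/
theorem waveEnergy_axis (h2 : ξ 2 = 0) (h3 : ξ 3 = 0) (hs : ∀ i j, h i j = h j i) :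
    waveEnergy ξ h = ξ 0 ^ 2 / 8 * ((h 2 2 - h 3 3) ^ 2 + 4 * h 2 3 ^ 2)
      + (-3 / 8 * (h 0 0 * waveL ξ h 0 0) + 1 / 8 * (h 0 0 * waveL ξ h 1 1)
      + 1 / 8 * (h 0 0 * waveL ξ h 2 2) + 1 / 8 * (h 0 0 * waveL ξ h 3 3)
      - 1 / 2 * (h 0 1 * waveL ξ h 0 1) + 1 / 2 * (h 0 2 * waveL ξ h 0 2)
      + 1 / 2 * (h 0 3 * waveL ξ h 0 3) + 1 / 8 * (h 1 1 * waveL ξ h 0 0)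
      + 5 / 8 * (h 1 1 * waveL ξ h 1 1) - 5 / 8 * (h 1 1 * waveL ξ h 2 2)
      - 5 / 8 * (h 1 1 * waveL ξ h 3 3) + 3 / 2 * (h 1 2 * waveL ξ h 1 2)
      + 3 / 2 * (h 1 3 * waveL ξ h 1 3) - 1 / 4 * (h 2 2 * waveL ξ h 0 0)
      - 1 / 2 * (h 2 2 * waveL ξ h 3 3) + 1 / 2 * (h 2 3 * waveL ξ h 2 3)
      - 1 / 4 * (h 3 3 * waveL ξ h 0 0)) := by
  have f1 := hs 1 0
  have f2 := hs 2 0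
  have f3 := hs 3 0
  have f4 := hs 2 1
  have f5 := hs 3 1
  have f6 := hs 3 2
  -- The square on the right is the energy of the two transverse trace-free polarisations. What
  -- remains is a polynomial identity in the entries of `h` and the two surviving components of `ξ`.
  simp only [waveEnergy, waveQ, waveL]
  simp only [Fin.sum_univ_four, Matrix.smul_apply, Matrix.sub_apply, Matrix.add_apply,
    vecMulVec_apply, mulVec, dotProduct, Matrix.trace, Matrix.diag, Matrix.mul_apply, sum_minkowski,
    smul_eq_mul]
  simp only [minkowski, Matrix.diagonal_apply]
  simp only [f1, f2, f3, f4, f5, f6, h2, h3]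
  simp
  ring

theorem abs_apply_le_sum (A : Matrix (Fin 4) (Fin 4) ℝ) (i j : Fin 4) :
    |A i j| ≤ ∑ i, ∑ j, |A i j| :=
  (Finset.single_le_sum (f := fun j => |A i j|) (fun _ _ => abs_nonneg _)
    (Finset.mem_univ j)).trans (Finset.single_le_sum (f := fun i => ∑ j, |A i j|)
      (fun _ _ => Finset.sum_nonneg fun _ _ => abs_nonneg _) (Finset.mem_univ i))

theorem sum_abs_rot_le {R : Matrix (Fin 4) (Fin 4) ℝ} (hR1 : ∀ i j, |R i j| ≤ 1)
    (A : Matrix (Fin 4) (Fin 4) ℝ) :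
    ∑ i, ∑ j, |(R * A * R) i j| ≤ 16 * ∑ i, ∑ j, |A i j| := by
  have h1 : ∀ i j, |(R * A * R) i j| ≤ ∑ k, ∑ l, |A k l| := by
    intro i j
    rw [Matrix.mul_apply]
    refine (Finset.abs_sum_le_sum_abs _ _).trans ?_
    rw [Finset.sum_comm]
    refine Finset.sum_le_sum fun l _ => ?_
    rw [abs_mul, Matrix.mul_apply]
    refine (mul_le_of_le_one_right (abs_nonneg _) (hR1 _ _)).trans ?_
    refine (Finset.abs_sum_le_sum_abs _ _).trans (Finset.sum_le_sum fun k _ => ?_)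
    rw [abs_mul]
    exact mul_le_of_le_one_left (abs_nonneg _) (hR1 _ _)
  calc ∑ i, ∑ j, |(R * A * R) i j| ≤ ∑ _i : Fin 4, ∑ _j : Fin 4, ∑ k, ∑ l, |A k l| :=
        Finset.sum_le_sum fun i _ => Finset.sum_le_sum fun j _ => h1 i j
    _ = _ := by simp; ring

/-- The energy density of a plane wave is nonnegative up to multiples of the linearised Ricci
tensor. -/
theorem waveEnergy_ge (hs : ∀ i j, h i j = h j i) :
    -(17 * 2 * 256 * ((∑ i, ∑ j, |h i j|) * ∑ i, ∑ j, |waveL ξ h i j|)) ≤ waveEnergy ξ h := by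
  -- In the constant, `17` is the number of products in the identity for a wave along the axis, `2`
  -- bounds their coefficients, and `256 = 16 · 16` is the cost of the reflection on the entry sums
  -- of `h` and of `waveL ξ h`.
  obtain ⟨R, hT, hR, hη, h0, h2, h3⟩ := exists_reflection ξ
  have hR1 : ∀ i j, |R i j| ≤ 1 := by
    intro i j
    have e : ∑ k, R i k * R k i = 1 := by rw [← Matrix.mul_apply, hR]; simp
    have e2 : R i j ^ 2 ≤ 1 := by
      rw [← e, sq]
      have : ∀ k, R k i = R i k := fun k => congrFun (congrFun hT i) k
      simp_rw [this]
      exact Finset.single_le_sum (f := fun k => R i k * R i k)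
        (fun _ _ => mul_self_nonneg _) (Finset.mem_univ j)
    exact (sq_le_one_iff_abs_le_one _).1 e2
  have hs' : ∀ i j, (R * h * R) i j = (R * h * R) j i := by
    have hh : hᵀ = h := by ext i j; exact hs j i
    have : (R * h * R)ᵀ = R * h * R := by
      rw [Matrix.transpose_mul, Matrix.transpose_mul, hT, hh, Matrix.mul_assoc]
    intro i j
    exact congrFun (congrFun this j) i
  rw [← rot_waveEnergy ξ hT hR hη h0, waveEnergy_axis _ h2 h3 hs', rot_waveL ξ hT hR hη]
  have ha := sum_abs_rot_le hR1 h
  have hb := sum_abs_rot_le hR1 (waveL ξ h)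
  obtain ⟨A, hA⟩ : ∃ A, A = R * h * R := ⟨_, rfl⟩
  obtain ⟨B, hB⟩ : ∃ B, B = R * waveL ξ h * R := ⟨_, rfl⟩
  rw [← hA] at ha ⊢
  rw [← hB] at hb ⊢
  obtain ⟨p, hp⟩ : ∃ p, p = ∑ i, ∑ j, |A i j| := ⟨_, rfl⟩
  obtain ⟨q, hq⟩ : ∃ q, q = ∑ i, ∑ j, |B i j| := ⟨_, rfl⟩
  have hp0 : 0 ≤ p := hp ▸ Finset.sum_nonneg fun _ _ => Finset.sum_nonneg fun _ _ => abs_nonneg _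
  have hq0 : 0 ≤ q := hq ▸ Finset.sum_nonneg fun _ _ => Finset.sum_nonneg fun _ _ => abs_nonneg _
  have hpq : p * q ≤ 256 * ((∑ i, ∑ j, |h i j|) * ∑ i, ∑ j, |waveL ξ h i j|) := by
    rw [← hp] at ha
    rw [← hq] at hb
    calc p * q ≤ (16 * ∑ i, ∑ j, |h i j|) * (16 * ∑ i, ∑ j, |waveL ξ h i j|) :=
          mul_le_mul ha hb hq0 (hp0.trans ha)
      _ = _ := by ring
  have hAB : ∀ i j k l, |A i j * B k l| ≤ p * q := by
    intro i j k l
    rw [abs_mul, hp, hq]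
    exact mul_le_mul (abs_apply_le_sum A i j) (abs_apply_le_sum B k l) (abs_nonneg _) (hp ▸ hp0)
  have hsq : 0 ≤ (R *ᵥ ξ) 0 ^ 2 / 8 * ((A 2 2 - A 3 3) ^ 2 + 4 * A 2 3 ^ 2) := by positivity
  have t1 := abs_le.1 (hAB 0 0 0 0)
  have t2 := abs_le.1 (hAB 0 0 1 1)
  have t3 := abs_le.1 (hAB 0 0 2 2)
  have t4 := abs_le.1 (hAB 0 0 3 3)
  have t5 := abs_le.1 (hAB 0 1 0 1)
  have t6 := abs_le.1 (hAB 0 2 0 2)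
  have t7 := abs_le.1 (hAB 0 3 0 3)
  have t8 := abs_le.1 (hAB 1 1 0 0)
  have t9 := abs_le.1 (hAB 1 1 1 1)
  have t10 := abs_le.1 (hAB 1 1 2 2)
  have t11 := abs_le.1 (hAB 1 1 3 3)
  have t12 := abs_le.1 (hAB 1 2 1 2)
  have t13 := abs_le.1 (hAB 1 3 1 3)
  have t14 := abs_le.1 (hAB 2 2 0 0)
  have t15 := abs_le.1 (hAB 2 2 3 3)
  have t16 := abs_le.1 (hAB 2 3 2 3)
  have t17 := abs_le.1 (hAB 3 3 0 0)
  have hpq0 : 0 ≤ p * q := mul_nonneg hp0 hq0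
  linarith [t1.1, t1.2, t2.1, t3.1, t4.1, t5.1, t5.2, t6.1, t7.1, t8.1, t9.1, t10.1, t10.2, t11.2,
    t12.1, t13.1, t14.2, t15.2, t16.1, t17.2]

/-- `einsteinQ` is linear in the products of derivatives. -/
theorem exists_einsteinQ_eq_sum (G : Matrix (Fin 4) (Fin 4) ℝ) (j k : Fin 4) :
    ∃ c : (Fin 6 → Fin 4) → ℝ, ∀ m, einsteinQ G m j k = ∑ I, c I * m I := by
  have hlow : ∀ (a : ℝ) (D D' : Fin 4 → Fin 4 → Fin 4 → ℝ) (l j k : Fin 4),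
      lowChr (fun x c d => a * D x c d + D' x c d) l j k = a * lowChr D l j k + lowChr D' l j k :=
    fun a D D' l j k => by simp only [lowChr]; ring
  have hchr : ∀ (a : ℝ) (m m' : (Fin 6 → Fin 4) → ℝ) (l j k s q r : Fin 4),
      chrSq (fun I => a * m I + m' I) l j k s q r =
        a * chrSq m l j k s q r + chrSq m' l j k s q r := fun a m m' l j k s q r => by
    simp only [chrSq, hlow]
  have hric : ∀ (a : ℝ) (H : Matrix (Fin 4) (Fin 4) ℝ) (m m' : (Fin 6 → Fin 4) → ℝ) (j k : Fin 4),
      ricciQ H (fun I => a * m I + m' I) j k = a * ricciQ H m j k + ricciQ H m' j k := by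
    intro a H m m' j k
    simp only [ricciQ, Finset.mul_sum, ← Finset.sum_add_distrib, hchr]
    refine Finset.sum_congr rfl fun i _ => Finset.sum_congr rfl fun l _ =>
      Finset.sum_congr rfl fun p _ => Finset.sum_congr rfl fun q _ => by ring
  have hein : ∀ (a : ℝ) (m m' : (Fin 6 → Fin 4) → ℝ),
      einsteinQ G (fun I => a * m I + m' I) j k = a * einsteinQ G m j k + einsteinQ G m' j k := by
    intro a m m'
    simp only [einsteinQ, hric, mul_add, Finset.sum_add_distrib, mul_left_comm _ a,
      ← Finset.mul_sum]
    ring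
  have h0 : einsteinQ G (fun _ => 0) j k = 0 := by
    have := hein 1 (fun _ => 0) (fun _ => 0)
    simp only [mul_zero, add_zero] at this
    linarith
  let f : ((Fin 6 → Fin 4) → ℝ) →ₗ[ℝ] ℝ :=
    { toFun := fun m => einsteinQ G m j k
      map_add' := fun m m' => by have e := hein 1 m m'; simp only [one_mul] at e; exact e
      map_smul' := fun a m => by have e := hein a m (fun _ => 0); simp only [h0, add_zero] at e; exact e }
  refine ⟨fun I => f (Pi.single I 1), fun m => ?_⟩
  have := f.pi_apply_eq_sum_univ m
  change f m = _
  rw [this]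
  refine Finset.sum_congr rfl fun I _ => ?_
  rw [smul_eq_mul, mul_comm]
  congr 2
  ext J
  simp [Pi.single_apply, eq_comm]

end Symbol

/-! ### The Fourier transform of test functions; multipliers acting on bounded functions -/

section Fourier

open FourierTransform ComplexConjugate SchwartzMap Module
open scoped RealInnerProductSpace LineDeriv

variable {u v : R4 → ℝ}

/-- The Fourier transform of a real function. -/
def ft (u : R4 → ℝ) : R4 → ℂ := 𝓕 (fun x => (u x : ℂ))

theorem IsTest.ofReal_compact (hu : IsTest univ u) : HasCompactSupport (fun x => (u x : ℂ)) :=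
  hu.compact.comp_left (g := fun r : ℝ => (r : ℂ)) Complex.ofReal_zero

theorem IsTest.ofReal_contDiff (hu : IsTest univ u) : ContDiff ℝ ∞ (fun x => (u x : ℂ)) :=
  Complex.ofRealCLM.contDiff.comp hu.contDiff

/-- A test function as a complex Schwartz function. -/
def IsTest.schwartz (hu : IsTest univ u) : 𝓢(R4, ℂ) :=
  hu.ofReal_compact.toSchwartzMap hu.ofReal_contDiff

theorem IsTest.ft_eq (hu : IsTest univ u) : ft u = 𝓕 hu.schwartz := by
  rw [fourier_coe]; rfl

theorem IsTest.integrable_ofReal (hu : IsTest univ u) : Integrable (fun x => (u x : ℂ)) :=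
  hu.integrable.ofReal

/-- Both transforms are Schwartz functions: one factor is bounded and the other integrable. -/
theorem IsTest.integrable_ft_mul (hu : IsTest univ u) (hv : IsTest univ v) :
    Integrable (fun ξ => conj (ft u ξ) * ft v ξ) := by
  rw [hu.ft_eq, hv.ft_eq]
  obtain ⟨C, hC⟩ := (𝓕 hu.schwartz).decay 0 0
  refine (𝓕 hv.schwartz).integrable.bdd_mul (c := C)
    ((Complex.continuous_conj.comp (𝓕 hu.schwartz).continuous).aestronglyMeasurable)
    (ae_of_all _ fun ξ => ?_)
  simpa using hC.2 ξ

theorem IsTest.parseval (hu : IsTest univ u) (hv : IsTest univ v) :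
    ∫ ξ, conj (ft u ξ) * ft v ξ = ((∫ x, u x * v x : ℝ) : ℂ) := by
  have h := integral_inner_fourier_fourier hu.schwartz hv.schwartz
  simp only [RCLike.inner_apply'] at h
  rw [hu.ft_eq, hv.ft_eq]
  refine h.trans ?_
  refine Eq.trans ?_ (integral_ofReal (𝕜 := ℂ))
  refine integral_congr_ae (ae_of_all _ fun x => ?_)
  change conj (u x : ℂ) * (v x : ℂ) = _
  simp

theorem IsTest.ft_pd (hu : IsTest univ u) (a : Fin 4) (ξ : R4) :
    ft (Backreaction.pd a u) ξ = 2 * Real.pi * Complex.I * ξ a * ft u ξ := by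
  have h := fourier_lineDerivOp_eq hu.schwartz (EuclideanSpace.single a (1 : ℝ))
  have hg : (fun x : R4 => inner ℝ x (EuclideanSpace.single a (1 : ℝ))).HasTemperateGrowth :=
    Function.hasTemperateGrowth_inner_left _
  have h2 : ft (Backreaction.pd a u) =
      𝓕 (∂_{EuclideanSpace.single a (1 : ℝ)} hu.schwartz : 𝓢(R4, ℂ)) := by
    rw [fourier_coe, ft]
    congr 1
    ext x
    rw [lineDerivOp_apply_eq_fderiv]
    change _ = fderiv ℝ (Complex.ofRealCLM ∘ u) x _
    rw [fderiv_comp x Complex.ofRealCLM.differentiableAt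
      (hu.contDiff.differentiable (by simp) x)]
    simp [Backreaction.pd]
  rw [h2, h, hu.ft_eq]
  simp only [smul_apply, smulLeftCLM_apply_apply hg]
  have hi : inner ℝ ξ (EuclideanSpace.single a (1 : ℝ)) = ξ a := by
    rw [EuclideanSpace.inner_single_right]; simp
  rw [hi]
  simp
  ring

theorem IsTest.add {V : Set R4} (hu : IsTest V u) (hv : IsTest V v) :
    IsTest V (fun x => u x + v x) :=
  ⟨hu.contDiff.add hv.contDiff, hu.compact.add hv.compact,
    (tsupport_add u v).trans (union_subset hu.subset hv.subset)⟩

theorem IsTest.zero {V : Set R4} : IsTest V (fun _ => (0 : ℝ)) :=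
  ⟨contDiff_const, HasCompactSupport.zero, by
    rw [show (fun _ : R4 => (0 : ℝ)) = 0 from rfl, tsupport_zero]; exact empty_subset _⟩

theorem IsTest.const_mul {V : Set R4} (hu : IsTest V u) (c : ℝ) : IsTest V (fun x => c * u x) :=
  ⟨contDiff_const.mul hu.contDiff, hu.compact.mul_left,
    (tsupport_mul_subset_right (f := fun _ => c)).trans hu.subset⟩

theorem IsTest.sub {V : Set R4} (hu : IsTest V u) (hv : IsTest V v) :
    IsTest V (fun x => u x - v x) := by
  simpa [sub_eq_add_neg] using hu.add (hv.const_mul (-1))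

theorem IsTest.sum {V : Set R4} {ι : Type*} {s : Finset ι} {u : ι → R4 → ℝ}
    (h : ∀ i ∈ s, IsTest V (u i)) : IsTest V (fun x => ∑ i ∈ s, u i x) := by
  classical
  induction s using Finset.induction_on with
  | empty => simpa using IsTest.zero
  | insert i s hi ih =>
    simp only [Finset.sum_insert hi]
    exact (h i (Finset.mem_insert_self i s)).add (ih fun j hj => h j (Finset.mem_insert_of_mem hj))

theorem ft_add (hu : IsTest univ u) (hv : IsTest univ v) (ξ : R4) :
    ft (fun x => u x + v x) ξ = ft u ξ + ft v ξ := by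
  have e : (fun x => ((u x + v x : ℝ) : ℂ)) = (fun x => (u x : ℂ)) + fun x => (v x : ℂ) := by
    ext x; simp
  rw [ft, e]
  exact congrFun (VectorFourier.fourierIntegral_add (μ := (volume : Measure R4)) (L := innerₗ R4)
    Real.continuous_fourierChar continuous_inner hu.integrable_ofReal hv.integrable_ofReal) ξ

theorem ft_const_mul (c : ℝ) (u : R4 → ℝ) (ξ : R4) : ft (fun x => c * u x) ξ = c * ft u ξ := by
  rw [ft, ft, Real.fourier_eq, Real.fourier_eq, ← integral_const_mul]
  congr 1
  ext x
  simp only [Circle.smul_def, smul_eq_mul]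
  push_cast
  ring

theorem ft_sum {ι : Type*} {s : Finset ι} {u : ι → R4 → ℝ} (h : ∀ i ∈ s, IsTest univ (u i))
    (ξ : R4) : ft (fun x => ∑ i ∈ s, u i x) ξ = ∑ i ∈ s, ft (u i) ξ := by
  classical
  induction s using Finset.induction_on with
  | empty => simpa using ft_const_mul 0 (fun _ => 0) ξ
  | insert i s hi ih =>
    simp only [Finset.sum_insert hi]
    rw [ft_add (h i (Finset.mem_insert_self i s))
      (IsTest.sum fun j hj => h j (Finset.mem_insert_of_mem hj)),
      ih fun j hj => h j (Finset.mem_insert_of_mem hj)]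

/-- A frequency cutoff `g` acts on bounded functions with norm at most `‖𝓕 g‖₁`. -/
theorem norm_integral_conj_ft_mul_le {F p : R4 → ℝ} (hF : IsTest univ F) (hp : IsTest univ p)
    {P : ℝ} (hP : ∀ x, |p x| ≤ P) {g : R4 → ℂ} (hg : Integrable g) (hgb : ∃ C, ∀ ξ, ‖g ξ‖ ≤ C)
    (hgc : Continuous g)
    (hg' : Integrable (𝓕 g)) :
    ‖∫ ξ, conj (ft F ξ) * (g ξ * ft p ξ)‖ ≤ (∫ x, |F x|) * (P * ∫ z, ‖𝓕 g z‖) := by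
  have hpi : Integrable (ft p) := by rw [hp.ft_eq]; exact (𝓕 hp.schwartz).integrable
  obtain ⟨C, hC⟩ := hgb
  have hgp : Integrable (fun ξ => g ξ * ft p ξ) :=
    hpi.bdd_mul hgc.aestronglyMeasurable (ae_of_all _ hC)
  -- Moving the transform off `F` lets `F` be measured in `L¹` and the filtered function in the
  -- supremum norm.
  have h1 : ∫ ξ, conj (ft F ξ) * (g ξ * ft p ξ) =
      ∫ x, conj (F x : ℂ) * 𝓕⁻ (fun ξ => g ξ * ft p ξ) x := by
    let M : ℂ →L⋆[ℂ] ℂ →L[ℂ] ℂ := innerSL ℂ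
    have hM : ∀ a b : ℂ, M a b = conj a * b := fun a b => by
      simp [M, mul_comm]
    have := VectorFourier.integral_sesq_fourierIntegral_eq_neg_flip (μ := (volume : Measure R4))
      (ν := (volume : Measure R4)) M (L := innerₗ R4)
      Real.continuous_fourierChar continuous_inner hF.integrable_ofReal hgp
    simp only [hM] at this
    refine this.trans (integral_congr_ae (ae_of_all _ fun x => ?_))
    simp only
    congr 1
    rw [Real.fourierInv_eq]
    simp [VectorFourier.fourierIntegral, real_inner_comm]
  -- Young's inequality for a convolution: the filtered function at `x` is the integral of `p`
  -- against the kernel `𝓕 g` translated by `x`.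
  have h2 : ∀ x, ‖𝓕⁻ (fun ξ => g ξ * ft p ξ) x‖ ≤ P * ∫ z, ‖𝓕 g z‖ := by
    intro x
    let e : R4 → ℂ := fun ξ => Real.fourierChar ⟪ξ, x⟫ • g ξ
    have hec : Continuous e := by
      have : Continuous fun ξ : R4 => (Real.fourierChar ⟪ξ, x⟫ : ℂ) :=
        continuous_subtype_val.comp (Real.continuous_fourierChar.comp (by fun_prop))
      simpa [e, Circle.smul_def] using! this.mul hgc
    have he : Integrable e := hg.congr' hec.aestronglyMeasurable
      (ae_of_all _ fun ξ => by simp [e])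
    have h3 : ∀ z, 𝓕 e z = 𝓕 g (z - x) := by
      intro z
      rw [Real.fourier_eq, Real.fourier_eq]
      congr 1
      ext ξ
      simp only [e, smul_smul]
      rw [← AddChar.map_add_eq_mul]
      congr 2
      rw [inner_sub_right]; ring
    have h4 : 𝓕⁻ (fun ξ => g ξ * ft p ξ) x = ∫ z, 𝓕 e z * (p z : ℂ) := by
      have := VectorFourier.integral_fourierIntegral_smul_eq_flip (μ := (volume : Measure R4))
        (ν := (volume : Measure R4)) (L := innerₗ R4) Real.continuous_fourierChar continuous_inner
        he hp.integrable_ofReal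
      simp only [smul_eq_mul] at this
      rw [Real.fourierInv_eq]
      refine Eq.trans ?_ this.symm
      congr 1
      ext ξ
      simp only [e, ft, Circle.smul_def, smul_eq_mul, mul_assoc]
      congr 2
      rw [Real.fourier_eq]
      simp [VectorFourier.fourierIntegral, real_inner_comm]
    rw [h4]
    calc ‖∫ z, 𝓕 e z * (p z : ℂ)‖ ≤ ∫ z, ‖𝓕 e z * (p z : ℂ)‖ := norm_integral_le_integral_norm _
      _ ≤ ∫ z, P * ‖𝓕 g (z - x)‖ := by
          have hi : Integrable fun z => 𝓕 g (z - x) := hg'.comp_sub_right x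
          refine integral_mono_of_nonneg (ae_of_all _ fun z => norm_nonneg _)
            (hi.norm.const_mul P) (ae_of_all _ fun z => ?_)
          simp only [norm_mul, h3, Complex.norm_real, Real.norm_eq_abs]
          rw [mul_comm]
          exact mul_le_mul_of_nonneg_right (hP z) (norm_nonneg _)
      _ = P * ∫ z, ‖𝓕 g z‖ := by
          rw [integral_const_mul, integral_sub_right_eq_self (fun z => ‖𝓕 g z‖) x]
  rw [h1]
  calc ‖∫ x, conj (F x : ℂ) * 𝓕⁻ (fun ξ => g ξ * ft p ξ) x‖
      ≤ ∫ x, ‖conj (F x : ℂ) * 𝓕⁻ (fun ξ => g ξ * ft p ξ) x‖ := norm_integral_le_integral_norm _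
    _ ≤ ∫ x, |F x| * (P * ∫ z, ‖𝓕 g z‖) := by
        refine integral_mono_of_nonneg (ae_of_all _ fun z => norm_nonneg _)
          (hF.integrable.abs.mul_const _) (ae_of_all _ fun z => ?_)
        simp only [norm_mul, RCLike.norm_conj, Complex.norm_real, Real.norm_eq_abs]
        exact mul_le_mul_of_nonneg_left (h2 z) (abs_nonneg _)
    _ = _ := integral_mul_const _ _

/-- The Fourier transform of a dilated function. -/
theorem integral_norm_fourier_comp_smul (g : R4 → ℂ) {s : ℝ} (hs : 0 < s) :
    ∫ z, ‖𝓕 (fun ξ => g (s • ξ)) z‖ = ∫ z, ‖𝓕 g z‖ := by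
  have hfr : finrank ℝ R4 = 4 := by simp
  have h1 : ∀ z, 𝓕 (fun ξ => g (s • ξ)) z = ((s ^ 4)⁻¹ : ℝ) • 𝓕 g (s⁻¹ • z) := by
    intro z
    have h0 := Measure.integral_comp_smul_of_nonneg (volume : Measure R4)
      (fun v => Real.fourierChar (-⟪v, s⁻¹ • z⟫) • g v) s (hR := hs.le)
    rw [hfr] at h0
    rw [Real.fourier_eq, Real.fourier_eq, ← h0]
    refine integral_congr_ae (ae_of_all _ fun ξ => ?_)
    simp only
    congr 3
    rw [real_inner_smul_left, real_inner_smul_right, mul_inv_cancel_left₀ hs.ne']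
  simp_rw [h1, norm_smul]
  rw [integral_const_mul, Measure.integral_comp_smul_of_nonneg volume (fun z => ‖𝓕 g z‖) s⁻¹
    (hR := (inv_pos.2 hs).le), hfr, smul_eq_mul, ← mul_assoc, Real.norm_of_nonneg (by positivity),
    inv_pow, inv_inv, inv_mul_cancel₀ (by positivity), one_mul]

end Fourier

/-! ### Low frequencies of a divergence: pairing `L¹` with a bounded potential -/

section Murat

open FourierTransform ComplexConjugate SchwartzMap Module

variable {u v : R4 → ℝ}

/-- A smooth frequency cutoff, equal to one on the unit ball. -/
def cutoff : ContDiffBump (0 : R4) := ⟨1, 2, one_pos, one_lt_two⟩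

theorem cutoff_nonneg (ξ : R4) : 0 ≤ cutoff ξ := cutoff.nonneg

theorem cutoff_le_one (ξ : R4) : cutoff ξ ≤ 1 := cutoff.le_one

theorem cutoff_eq_one {ξ : R4} (h : ‖ξ‖ ≤ 1) : cutoff ξ = 1 :=
  cutoff.one_of_mem_closedBall (by rw [mem_closedBall_zero_iff]; exact h)

theorem cutoff_eq_zero {ξ : R4} (h : 2 ≤ ‖ξ‖) : cutoff ξ = 0 :=
  cutoff.zero_of_le_dist (by rw [dist_zero_right]; exact h)

theorem continuous_cutoff : Continuous cutoff := cutoff.continuous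

/-- The multiplier of a partial derivative, with the frequency cutoff. -/
def cutoffMul (a : Fin 4) (ξ : R4) : ℂ := cutoff ξ * (2 * Real.pi * Complex.I * ξ a)

theorem cutoffMul_compact (a : Fin 4) : HasCompactSupport (cutoffMul a) :=
  (cutoff.hasCompactSupport.comp_left (g := fun r : ℝ => (r : ℂ)) Complex.ofReal_zero).mul_right

theorem cutoffMul_contDiff (a : Fin 4) : ContDiff ℝ ∞ (cutoffMul a) := by
  have h : ContDiff ℝ ∞ (fun ξ : R4 => ((ξ a : ℝ) : ℂ)) :=
    Complex.ofRealCLM.contDiff.comp (EuclideanSpace.proj (𝕜 := ℝ) a).contDiff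
  exact (Complex.ofRealCLM.contDiff.comp cutoff.contDiff).mul (contDiff_const.mul h)

theorem cutoffMul_smul (a : Fin 4) {s : ℝ} (hs : 0 < s) (ξ : R4) :
    (cutoff (s • ξ) : ℂ) * (2 * Real.pi * Complex.I * ξ a) =
      (s⁻¹ : ℝ) * cutoffMul a (s • ξ) := by
  have : (s : ℂ) ≠ 0 := by exact_mod_cast hs.ne'
  simp only [cutoffMul, PiLp.smul_apply, smul_eq_mul]
  push_cast
  field_simp

/-- The `L¹` norm of the convolution kernel of the truncated derivative. It is invariant under
dilation of the multiplier, so every scale `s` shares this constant. -/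
def cutoffNorm (a : Fin 4) : ℝ := ∫ z, ‖𝓕 (cutoffMul a) z‖

theorem cutoffNorm_nonneg (a : Fin 4) : 0 ≤ cutoffNorm a := integral_nonneg fun _ => norm_nonneg _

/-- Truncating at frequency of order `1 / s` turns a derivative into `s⁻¹` times a dilated
multiplier with fixed kernel norm, so it acts on bounded functions at cost `s⁻¹`. -/
theorem norm_integral_cutoff_le {F p : R4 → ℝ} (hF : IsTest univ F) (hp : IsTest univ p)
    {P : ℝ} (hP : ∀ x, |p x| ≤ P) (a : Fin 4) {s : ℝ} (hs : 0 < s) :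
    ‖∫ ξ, conj (ft F ξ) * ((cutoff (s • ξ) : ℂ) * (2 * Real.pi * Complex.I * ξ a) * ft p ξ)‖ ≤
      s⁻¹ * ((∫ x, |F x|) * (P * cutoffNorm a)) := by
  let S : 𝓢(R4, ℂ) := (cutoffMul_compact a).toSchwartzMap (cutoffMul_contDiff a)
  have hgc : Continuous (fun ξ : R4 => cutoffMul a (s • ξ)) :=
    (cutoffMul_contDiff a).continuous.comp (continuous_const_smul s)
  obtain ⟨C, hC⟩ := (cutoffMul_contDiff a).continuous.bounded_above_of_compact_support
    (cutoffMul_compact a)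
  have hint : Integrable (cutoffMul a) :=
    (cutoffMul_contDiff a).continuous.integrable_of_hasCompactSupport (cutoffMul_compact a)
  have hF' : Integrable (𝓕 (cutoffMul a)) := (𝓕 S).integrable
  have hg' : Integrable (𝓕 (fun ξ : R4 => cutoffMul a (s • ξ))) := by
    have h1 : 𝓕 (fun ξ : R4 => cutoffMul a (s • ξ)) =
        𝓕 ((cutoffMul_compact a).comp_smul hs.ne' |>.toSchwartzMap
          ((cutoffMul_contDiff a).comp (contDiff_const_smul s)) : 𝓢(R4, ℂ)) := by
      rw [fourier_coe]; rfl
    rw [h1]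
    exact SchwartzMap.integrable _
  have h := norm_integral_conj_ft_mul_le hF hp hP
    (g := fun ξ => cutoffMul a (s • ξ)) (hint.comp_smul hs.ne')
    ⟨C, fun ξ => hC _⟩ hgc hg'
  rw [integral_norm_fourier_comp_smul _ hs] at h
  have e : ∀ ξ : R4, conj (ft F ξ) * ((cutoff (s • ξ) : ℂ) * (2 * Real.pi * Complex.I * ξ a) *
      ft p ξ) = (s⁻¹ : ℝ) * (conj (ft F ξ) * (cutoffMul a (s • ξ) * ft p ξ)) := fun ξ => by
    rw [cutoffMul_smul a hs]; ring
  simp_rw [e]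
  rw [integral_const_mul, norm_mul, Complex.norm_real, Real.norm_of_nonneg (inv_pos.2 hs).le]
  exact mul_le_mul_of_nonneg_left h (inv_pos.2 hs).le

theorem IsTest.integrable_norm_sq (hu : IsTest univ u) : Integrable (fun ξ => ‖ft u ξ‖ ^ 2) := by
  refine (hu.integrable_ft_mul hu).norm.congr (ae_of_all _ fun ξ => ?_)
  simp [sq]

theorem IsTest.integral_norm_sq (hu : IsTest univ u) :
    ∫ ξ, ‖ft u ξ‖ ^ 2 = ∫ x, u x ^ 2 := by
  have h := hu.parseval hu
  have e : ∀ ξ, conj (ft u ξ) * ft u ξ = ((‖ft u ξ‖ ^ 2 : ℝ) : ℂ) := fun ξ => by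
    rw [Complex.conj_mul']; push_cast; rfl
  simp_rw [e] at h
  simp_rw [sq (u _)]
  exact Complex.ofReal_injective
    ((integral_ofReal (𝕜 := ℂ) (f := fun ξ => ‖ft u ξ‖ ^ 2)).symm.trans h)

theorem norm_sq_eq_sum (ξ : R4) : ‖ξ‖ ^ 2 = ∑ a, ξ a ^ 2 := by
  rw [EuclideanSpace.norm_sq_eq]; simp

theorem IsTest.norm_sq_ft_pd (hu : IsTest univ u) (a : Fin 4) (ξ : R4) :
    ‖ft (Backreaction.pd a u) ξ‖ ^ 2 = 4 * Real.pi ^ 2 * ξ a ^ 2 * ‖ft u ξ‖ ^ 2 := by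
  rw [hu.ft_pd a]
  have h1 : ‖(Real.pi : ℂ)‖ = Real.pi := by simp [abs_of_pos Real.pi_pos]
  have h2 : ‖((ξ a : ℝ) : ℂ)‖ ^ 2 = ξ a ^ 2 := by simp
  simp only [norm_mul, Complex.norm_I, h1, mul_pow, h2, Complex.norm_ofNat, one_pow, mul_one]
  ring

theorem IsTest.integrable_norm_sq_mul (hu : IsTest univ u) :
    Integrable (fun ξ => ‖ξ‖ ^ 2 * ‖ft u ξ‖ ^ 2) := by
  have h : Integrable (fun ξ => (4 * Real.pi ^ 2)⁻¹ * ∑ a, ‖ft (Backreaction.pd a u) ξ‖ ^ 2) :=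
    (integrable_finsetSum _ fun a _ => ((hu.pd a).integrable_norm_sq)).const_mul _
  refine h.congr (ae_of_all _ fun ξ => ?_)
  simp only [hu.norm_sq_ft_pd, ← Finset.mul_sum, ← Finset.sum_mul]
  rw [norm_sq_eq_sum]
  field_simp

theorem integrable_cutoff_mul {f : R4 → ℝ} (hf : Integrable f) (s : ℝ) :
    Integrable (fun ξ => cutoff (s • ξ) * f ξ) :=
  hf.bdd_mul (c := 1) (continuous_cutoff.comp (continuous_const_smul s)).aestronglyMeasurable
    (ae_of_all _ fun ξ => by
      rw [Real.norm_of_nonneg (cutoff_nonneg _)]; exact cutoff_le_one _)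

/-- If `u` is the divergence of a bounded field `p`, and the sum of an `L¹` function and the
divergence of an `L²` field `B`, then the low frequency part of `u` is controlled. -/
theorem integral_cutoff_mul_le {p B : Fin 4 → R4 → ℝ} {F : R4 → ℝ}
    (hp : ∀ a, IsTest univ (p a)) (hB : ∀ a, IsTest univ (B a)) (hF : IsTest univ F)
    (hu : ∀ x, u x = ∑ a, pd a (p a) x) (hu' : ∀ x, u x = F x + ∑ a, pd a (B a) x)
    {P : ℝ} (hP : ∀ a x, |p a x| ≤ P) {s : ℝ} (hs : 0 < s) :
    ∫ ξ, cutoff (s • ξ) * ‖ft u ξ‖ ^ 2 ≤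
      2 * (s⁻¹ * ((∫ x, |F x|) * (P * ∑ a, cutoffNorm a))) +
      4 * Real.pi ^ 2 * ∫ ξ, cutoff (s • ξ) * ∑ a, ‖ξ‖ ^ 2 * ‖ft (B a) ξ‖ ^ 2 := by
  have hut : IsTest univ u := by
    have : u = fun x => ∑ a, pd a (p a) x := funext hu
    rw [this]
    exact IsTest.sum fun a _ => (hp a).pd a
  have e1 : ∀ ξ, ft u ξ = ∑ a, 2 * Real.pi * Complex.I * ξ a * ft (p a) ξ := fun ξ => by
    rw [show u = fun x => ∑ a, pd a (p a) x from funext hu, ft_sum fun a _ => (hp a).pd a]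
    exact Finset.sum_congr rfl fun a _ => (hp a).ft_pd a ξ
  have e2 : ∀ ξ, ft u ξ = ft F ξ + ∑ a, 2 * Real.pi * Complex.I * ξ a * ft (B a) ξ := fun ξ => by
    rw [show u = fun x => F x + ∑ a, pd a (B a) x from funext hu',
      ft_add hF (IsTest.sum fun a _ => (hB a).pd a), ft_sum fun a _ => (hB a).pd a]
    congr 1
    exact Finset.sum_congr rfl fun a _ => (hB a).ft_pd a ξ
  have e3 : ∀ ξ, ‖∑ a, 2 * Real.pi * Complex.I * ξ a * ft (B a) ξ‖ ^ 2 ≤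
      4 * Real.pi ^ 2 * ∑ a, ‖ξ‖ ^ 2 * ‖ft (B a) ξ‖ ^ 2 := by
    intro ξ
    have h1 : ‖∑ a, 2 * Real.pi * Complex.I * ξ a * ft (B a) ξ‖ ≤
        ∑ a, (2 * Real.pi * |ξ a|) * ‖ft (B a) ξ‖ := by
      refine (norm_sum_le _ _).trans (Finset.sum_le_sum fun a _ => ?_)
      simp [abs_of_pos Real.pi_pos]
    calc _ ≤ (∑ a, (2 * Real.pi * |ξ a|) * ‖ft (B a) ξ‖) ^ 2 :=
          pow_le_pow_left₀ (norm_nonneg _) h1 2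
      _ ≤ (∑ a, (2 * Real.pi * |ξ a|) ^ 2) * ∑ a, ‖ft (B a) ξ‖ ^ 2 :=
          Finset.sum_mul_sq_le_sq_mul_sq _ _ _
      _ = _ := by
          simp_rw [mul_pow, sq_abs, ← Finset.mul_sum]
          rw [← norm_sq_eq_sum]; ring
  have hint1 : Integrable (fun ξ => conj (ft F ξ) * ((cutoff (s • ξ) : ℂ) * ft u ξ)) := by
    have : Integrable (fun ξ => (cutoff (s • ξ) : ℂ) * (conj (ft F ξ) * ft u ξ)) :=
      (hF.integrable_ft_mul hut).bdd_mul (c := 1) (Complex.continuous_ofReal.comp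
        (continuous_cutoff.comp (continuous_const_smul s))).aestronglyMeasurable
        (ae_of_all _ fun ξ => by
          rw [Complex.norm_real, Real.norm_of_nonneg (cutoff_nonneg _)]; exact cutoff_le_one _)
    exact this.congr (ae_of_all _ fun ξ => by ring)
  have hint2 : Integrable (fun ξ => cutoff (s • ξ) * ‖ft u ξ‖ ^ 2) :=
    integrable_cutoff_mul hut.integrable_norm_sq s
  have hint3 : Integrable (fun ξ => cutoff (s • ξ) * ∑ a, ‖ξ‖ ^ 2 * ‖ft (B a) ξ‖ ^ 2) :=
    integrable_cutoff_mul (integrable_finsetSum _ fun a _ => (hB a).integrable_norm_sq_mul) s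
  have hpt : ∀ ξ, cutoff (s • ξ) * ‖ft u ξ‖ ^ 2 ≤
      2 * (conj (ft F ξ) * ((cutoff (s • ξ) : ℂ) * ft u ξ)).re +
      4 * Real.pi ^ 2 * (cutoff (s • ξ) * ∑ a, ‖ξ‖ ^ 2 * ‖ft (B a) ξ‖ ^ 2) := by
    intro ξ
    have h3 := e3 ξ
    have h2 := e2 ξ
    obtain ⟨b, hb⟩ : ∃ b, b = ∑ a, 2 * Real.pi * Complex.I * ξ a * ft (B a) ξ := ⟨_, rfl⟩
    rw [← hb] at h2 h3
    have hre : (conj (ft F ξ) * ((cutoff (s • ξ) : ℂ) * ft u ξ)).re =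
        cutoff (s • ξ) * (conj (ft F ξ) * ft u ξ).re := by
      rw [mul_left_comm, Complex.re_ofReal_mul]
    -- With `û = F̂ + b` this is `0 ≤ |û - b|²`. It removes the `L¹` part from the quadratic term
    -- and leaves it only paired with `û`.
    have hsq : ‖ft u ξ‖ ^ 2 ≤ 2 * (conj (ft F ξ) * ft u ξ).re + ‖b‖ ^ 2 := by
      rw [show ft F ξ = ft u ξ - b by rw [h2]; ring, Complex.sq_norm, Complex.sq_norm]
      simp only [Complex.normSq_apply, map_sub, Complex.mul_re, Complex.sub_re, Complex.sub_im,
        Complex.conj_re, Complex.conj_im]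
      nlinarith [sq_nonneg ((ft u ξ).re - b.re), sq_nonneg ((ft u ξ).im - b.im)]
    rw [hre]
    have := mul_le_mul_of_nonneg_left (hsq.trans (add_le_add_right h3 _)) (cutoff_nonneg (s • ξ))
    linarith
  have hmain := integral_mono hint2 ((hint1.re.const_mul 2).add (hint3.const_mul (4 * Real.pi ^ 2)))
    hpt
  rw [integral_add' (hint1.re.const_mul 2) (hint3.const_mul _), integral_const_mul,
    integral_const_mul] at hmain
  refine hmain.trans (add_le_add_left (mul_le_mul_of_nonneg_left ?_ zero_le_two) _)
  have hre : ∫ ξ, RCLike.re (conj (ft F ξ) * ((cutoff (s • ξ) : ℂ) * ft u ξ)) ≤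
      ‖∫ ξ, conj (ft F ξ) * ((cutoff (s • ξ) : ℂ) * ft u ξ)‖ := by
    rw [integral_re hint1]; exact RCLike.re_le_norm _
  refine hre.trans ?_
  -- In the remaining pairing `û` is replaced by the divergence of the bounded field `p`, so that
  -- `F` in `L¹` meets a bounded function.
  have hsplit : ∀ ξ, conj (ft F ξ) * ((cutoff (s • ξ) : ℂ) * ft u ξ) = ∑ a, conj (ft F ξ) *
      ((cutoff (s • ξ) : ℂ) * (2 * Real.pi * Complex.I * ξ a) * ft (p a) ξ) := fun ξ => by
    rw [e1, Finset.mul_sum, Finset.mul_sum]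
    exact Finset.sum_congr rfl fun a _ => by ring
  simp_rw [hsplit]
  have hint4 : ∀ a, Integrable fun ξ => conj (ft F ξ) *
      ((cutoff (s • ξ) : ℂ) * (2 * Real.pi * Complex.I * ξ a) * ft (p a) ξ) := by
    intro a
    have : Integrable (fun ξ => (cutoff (s • ξ) : ℂ) * (conj (ft F ξ) * ft (pd a (p a)) ξ)) :=
      (hF.integrable_ft_mul ((hp a).pd a)).bdd_mul (c := 1) (Complex.continuous_ofReal.comp
        (continuous_cutoff.comp (continuous_const_smul s))).aestronglyMeasurable
        (ae_of_all _ fun ξ => by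
          rw [Complex.norm_real, Real.norm_of_nonneg (cutoff_nonneg _)]; exact cutoff_le_one _)
    refine this.congr (ae_of_all _ fun ξ => ?_)
    simp only [(hp a).ft_pd]
    ring
  rw [integral_finsetSum _ fun a _ => hint4 a]
  refine (norm_sum_le _ _).trans ?_
  rw [Finset.mul_sum, Finset.mul_sum, Finset.mul_sum]
  exact Finset.sum_le_sum fun a _ => norm_integral_cutoff_le hF (hp a) (hP a) a hs

end Murat

/-! ### Integration over scales: a negative Sobolev weight for high frequencies -/

section Weight

open ComplexConjugate Module

variable {u : R4 → ℝ}

/-- The weight `∫ s χ(s ξ) ds` over `0 ≤ s ≤ θ`, comparable to `‖ξ‖⁻²` for `‖ξ‖ ≥ 1 / θ`. -/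
def weight (θ : ℝ) (ξ : R4) : ℝ := ∫ s in (0 : ℝ)..θ, s * cutoff (s • ξ)

theorem continuous_weight_integrand (ξ : R4) : Continuous fun s : ℝ => s * cutoff (s • ξ) :=
  continuous_id.mul (continuous_cutoff.comp (by fun_prop))

theorem weight_nonneg {θ : ℝ} (hθ : 0 ≤ θ) (ξ : R4) : 0 ≤ weight θ ξ :=
  intervalIntegral.integral_nonneg hθ fun _ hs => mul_nonneg hs.1 (cutoff_nonneg _)

/-- The cutoff equals one for `s ≤ 1/‖ξ‖`, and this range lies below `θ`. Integrating `s` over it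
already gives `‖ξ‖⁻² / 2`. -/
theorem half_le_weight {θ : ℝ} (hθ : 0 < θ) {ξ : R4} (hξ : 1 / θ ≤ ‖ξ‖) :
    1 / 2 ≤ ‖ξ‖ ^ 2 * weight θ ξ := by
  have hn : 0 < ‖ξ‖ := (by positivity : 0 < 1 / θ).trans_le hξ
  have hr : ‖ξ‖⁻¹ ≤ θ := by
    rw [inv_le_comm₀ hn hθ, ← one_div]; exact hξ
  have hi := fun a b => (continuous_weight_integrand ξ).intervalIntegrable (μ := volume) a b
  have h1 : ∫ s in (0 : ℝ)..‖ξ‖⁻¹, s * cutoff (s • ξ) = ‖ξ‖⁻¹ ^ 2 / 2 := by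
    rw [intervalIntegral.integral_congr (g := fun s => s)]
    · simp [integral_id]
    · intro s hs
      rw [uIcc_of_le (by positivity)] at hs
      simp only
      rw [cutoff_eq_one, mul_one]
      rw [norm_smul, Real.norm_of_nonneg hs.1]
      exact (mul_le_mul_of_nonneg_right hs.2 hn.le).trans (inv_mul_cancel₀ hn.ne').le
  have h2 : 0 ≤ ∫ s in ‖ξ‖⁻¹..θ, s * cutoff (s • ξ) :=
    intervalIntegral.integral_nonneg hr fun s hs =>
      mul_nonneg ((by positivity : 0 ≤ ‖ξ‖⁻¹).trans hs.1) (cutoff_nonneg _)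
  rw [weight, ← intervalIntegral.integral_add_adjacent_intervals (hi 0 ‖ξ‖⁻¹) (hi ‖ξ‖⁻¹ θ), h1]
  have h3 : ‖ξ‖ ^ 2 * (‖ξ‖⁻¹ ^ 2 / 2) = 1 / 2 := by field_simp
  nlinarith [mul_nonneg (sq_nonneg ‖ξ‖) h2]

/-- The cutoff vanishes for `s ≥ 2/‖ξ‖` and is at most one, so the integral is at most `(2/‖ξ‖)² /
2`. -/
theorem weight_le {θ : ℝ} (hθ : 0 < θ) (ξ : R4) : ‖ξ‖ ^ 2 * weight θ ξ ≤ 2 := by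
  rcases (norm_nonneg ξ).eq_or_lt with hn | hn
  · rw [← hn]; norm_num
  have hi := fun a b => (continuous_weight_integrand ξ).intervalIntegrable (μ := volume) a b
  obtain ⟨r, hr⟩ : ∃ r, r = 2 / ‖ξ‖ := ⟨_, rfl⟩
  have hr0 : 0 < r := hr ▸ by positivity
  have h1 : ∫ s in (0 : ℝ)..r, s * cutoff (s • ξ) ≤ r ^ 2 / 2 := by
    have : ∫ s in (0 : ℝ)..r, s = r ^ 2 / 2 := by simp [integral_id]
    rw [← this]
    exact intervalIntegral.integral_mono_on hr0.le (hi 0 r)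
      (continuous_id.intervalIntegrable _ _) fun s hs =>
        mul_le_of_le_one_right hs.1 (cutoff_le_one _)
  have h2 : ∫ s in r..max θ r, s * cutoff (s • ξ) = 0 := by
    rw [intervalIntegral.integral_congr (g := fun _ => 0)]
    · simp
    · intro s hs
      rw [uIcc_of_le (le_max_right _ _)] at hs
      simp only
      rw [cutoff_eq_zero, mul_zero]
      rw [norm_smul, Real.norm_of_nonneg (hr0.le.trans hs.1)]
      calc 2 = r * ‖ξ‖ := by rw [hr]; field_simp
        _ ≤ s * ‖ξ‖ := mul_le_mul_of_nonneg_right hs.1 hn.le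
  have h3 : 0 ≤ ∫ s in θ..max θ r, s * cutoff (s • ξ) :=
    intervalIntegral.integral_nonneg (le_max_left _ _) fun s hs =>
      mul_nonneg (hθ.le.trans hs.1) (cutoff_nonneg _)
  have h4 : weight θ ξ ≤ r ^ 2 / 2 := by
    have e1 := intervalIntegral.integral_add_adjacent_intervals (hi 0 θ) (hi θ (max θ r))
    have e2 := intervalIntegral.integral_add_adjacent_intervals (hi 0 r) (hi r (max θ r))
    rw [weight]; linarith
  calc ‖ξ‖ ^ 2 * weight θ ξ ≤ ‖ξ‖ ^ 2 * (r ^ 2 / 2) := mul_le_mul_of_nonneg_left h4 (sq_nonneg _)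
    _ = 2 := by rw [hr]; field_simp

theorem integrable_weight_prod {f : R4 → ℝ} (hf : Integrable f) {θ : ℝ} (hθ : 0 < θ) :
    Integrable (Function.uncurry fun (s : ℝ) (ξ : R4) => s * cutoff (s • ξ) * f ξ)
      ((volume.restrict (uIoc 0 θ)).prod volume) := by
  have h1 : Integrable (fun s : ℝ => s) (volume.restrict (uIoc 0 θ)) := by
    rw [uIoc_of_le hθ.le]
    exact (continuous_id.intervalIntegrable (μ := volume) 0 θ).1
  have h2 := h1.mul_prod hf
  have hc : Continuous fun z : ℝ × R4 => cutoff (z.1 • z.2) :=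
    continuous_cutoff.comp (by fun_prop)
  refine (h2.bdd_mul (c := 1) hc.aestronglyMeasurable (ae_of_all _ fun z => ?_)).congr
    (ae_of_all _ fun z => ?_)
  · rw [Real.norm_of_nonneg (cutoff_nonneg _)]; exact cutoff_le_one _
  · simp only [Function.uncurry]; ring

theorem integral_weight_mul {f : R4 → ℝ} (hf : Integrable f) {θ : ℝ} (hθ : 0 < θ) :
    ∫ ξ, weight θ ξ * f ξ = ∫ s in (0 : ℝ)..θ, s * ∫ ξ, cutoff (s • ξ) * f ξ := by
  have h := intervalIntegral_integral_swap (integrable_weight_prod hf hθ)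
  simp only [weight]
  simp_rw [← intervalIntegral.integral_mul_const]
  rw [← h]
  congr 1
  ext s
  rw [← integral_const_mul]
  congr 1
  ext ξ
  ring

theorem integrable_weight_mul {f : R4 → ℝ} (hf : Integrable f) {θ : ℝ} (hθ : 0 < θ) :
    Integrable (fun ξ => weight θ ξ * f ξ) := by
  have h := (integrable_weight_prod hf hθ).integral_prod_right
  refine h.congr (ae_of_all _ fun ξ => ?_)
  simp only [weight, Function.uncurry]
  rw [← intervalIntegral.integral_mul_const, intervalIntegral.integral_of_le hθ.le,
    uIoc_of_le hθ.le]

theorem intervalIntegrable_weight {f : R4 → ℝ} (hf : Integrable f) {θ : ℝ} (hθ : 0 < θ) :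
    IntervalIntegrable (fun s => s * ∫ ξ, cutoff (s • ξ) * f ξ) volume 0 θ := by
  have h := (integrable_weight_prod hf hθ).integral_prod_left
  rw [intervalIntegrable_iff]
  refine h.congr (ae_of_all _ fun s => ?_)
  simp only [Function.uncurry]
  rw [← integral_const_mul]
  congr 1
  ext ξ
  ring

/-- If `u` is the divergence of a bounded field `p`, and the sum of an `L¹` function and the
divergence of an `L²` field `B`, then `u` is controlled in a negative Sobolev norm. -/
theorem integral_weight_mul_le {p B : Fin 4 → R4 → ℝ} {F : R4 → ℝ}
    (hp : ∀ a, IsTest univ (p a)) (hB : ∀ a, IsTest univ (B a)) (hF : IsTest univ F)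
    (hu : ∀ x, u x = ∑ a, pd a (p a) x) (hu' : ∀ x, u x = F x + ∑ a, pd a (B a) x)
    {P : ℝ} (hP : ∀ a x, |p a x| ≤ P) {θ : ℝ} (hθ : 0 < θ) :
    ∫ ξ, weight θ ξ * ‖ft u ξ‖ ^ 2 ≤
      2 * (θ * ((∫ x, |F x|) * (P * ∑ a, cutoffNorm a))) +
      8 * Real.pi ^ 2 * ∑ a, ∫ x, B a x ^ 2 := by
  have hut : IsTest univ u := by
    rw [show u = fun x => ∑ a, pd a (p a) x from funext hu]
    exact IsTest.sum fun a _ => (hp a).pd a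
  have hBi : Integrable (fun ξ => ∑ a, ‖ξ‖ ^ 2 * ‖ft (B a) ξ‖ ^ 2) :=
    integrable_finsetSum _ fun a _ => (hB a).integrable_norm_sq_mul
  obtain ⟨c, hc⟩ : ∃ c, c = (∫ x, |F x|) * (P * ∑ a, cutoffNorm a) := ⟨_, rfl⟩
  -- The factor `s` in the scale integral cancels the cost `s⁻¹` of the pairing. The `L¹`
  -- contribution becomes constant in `s`, and integrating over `(0, θ)` makes it `O(θ)`.
  have h1 : ∀ s ∈ Ioo 0 θ, s * ∫ ξ, cutoff (s • ξ) * ‖ft u ξ‖ ^ 2 ≤ 2 * c +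
      4 * Real.pi ^ 2 * (s * ∫ ξ, cutoff (s • ξ) * ∑ a, ‖ξ‖ ^ 2 * ‖ft (B a) ξ‖ ^ 2) := by
    intro s hs
    have h := mul_le_mul_of_nonneg_left (integral_cutoff_mul_le hp hB hF hu hu' hP hs.1) hs.1.le
    rw [← hc] at h
    refine h.trans (le_of_eq ?_)
    have := hs.1.ne'
    field_simp
  have h2 := intervalIntegral.integral_mono_on_of_le_Ioo hθ.le
    (intervalIntegrable_weight hut.integrable_norm_sq hθ)
    ((intervalIntegrable_const (c := 2 * c)).add
      ((intervalIntegrable_weight hBi hθ).const_mul (4 * Real.pi ^ 2))) h1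
  rw [intervalIntegral.integral_add intervalIntegrable_const
    ((intervalIntegrable_weight hBi hθ).const_mul _), intervalIntegral.integral_const_mul,
    intervalIntegral.integral_const_mul, ← integral_weight_mul hut.integrable_norm_sq hθ, ← integral_weight_mul hBi hθ,
    intervalIntegral.integral_const, smul_eq_mul, sub_zero] at h2
  have h3 : ∫ ξ, weight θ ξ * ∑ a, ‖ξ‖ ^ 2 * ‖ft (B a) ξ‖ ^ 2 ≤ 2 * ∑ a, ∫ x, B a x ^ 2 := by
    calc _ ≤ ∫ ξ, 2 * ∑ a, ‖ft (B a) ξ‖ ^ 2 := by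
          refine integral_mono (integrable_weight_mul hBi hθ)
            ((integrable_finsetSum _ fun a _ => (hB a).integrable_norm_sq).const_mul 2) fun ξ => ?_
          simp only
          rw [← Finset.mul_sum, ← mul_assoc, mul_comm (weight θ ξ)]
          exact mul_le_mul_of_nonneg_right (weight_le hθ ξ)
            (Finset.sum_nonneg fun _ _ => sq_nonneg _)
      _ = _ := by
          rw [integral_const_mul, integral_finsetSum _ fun a _ => (hB a).integrable_norm_sq]
          simp_rw [(hB _).integral_norm_sq]
  rw [← hc]
  have h4 := mul_le_mul_of_nonneg_left h3 (by positivity : 0 ≤ 4 * Real.pi ^ 2)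
  linarith

end Weight

/-! ### The linearised Ricci operator in Fourier space, and the weighted lower bound -/

section Positivity

open ComplexConjugate Module

/-- A linear functional of trilinear forms, in components. -/
theorem exists_eq_sum_of_linear (f : (Fin 4 → Fin 4 → Fin 4 → ℝ) → ℝ)
    (hf : ∀ (r : ℝ) D D', f (fun a c d => r * D a c d + D' a c d) = r * f D + f D') :
    ∃ K : Fin 4 → Fin 4 → Fin 4 → ℝ, ∀ D, f D = ∑ a, ∑ c, ∑ d, K a c d * D a c d := by
  have h0 : f (fun _ _ _ => 0) = 0 := by
    have := hf 1 (fun _ _ _ => 0) (fun _ _ _ => 0)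
    simp only [mul_zero, add_zero] at this
    linarith
  let g : (Fin 4 × Fin 4 × Fin 4 → ℝ) →ₗ[ℝ] ℝ :=
    { toFun := fun E => f fun a c d => E (a, c, d)
      map_add' := fun E E' => by
        have e := hf 1 (fun a c d => E (a, c, d)) (fun a c d => E' (a, c, d))
        simp only [one_mul] at e; exact e
      map_smul' := fun r E => by
        have e := hf r (fun a c d => E (a, c, d)) (fun _ _ _ => 0)
        simp only [h0, add_zero] at e; exact e }
  refine ⟨fun a c d => g (Pi.single (a, c, d) 1), fun D => ?_⟩
  have := g.pi_apply_eq_sum_univ (fun p => D p.1 p.2.1 p.2.2)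
  change g (fun p => D p.1 p.2.1 p.2.2) = _
  rw [this, Fintype.sum_prod_type]
  refine Finset.sum_congr rfl fun a _ => ?_
  rw [Fintype.sum_prod_type]
  refine Finset.sum_congr rfl fun c _ => Finset.sum_congr rfl fun d _ => ?_
  rw [smul_eq_mul, mul_comm]
  congr 2
  ext q
  simp [Pi.single_apply, eq_comm]

theorem lowChr_linear (r : ℝ) (D D' : Fin 4 → Fin 4 → Fin 4 → ℝ) (l j k : Fin 4) :
    lowChr (fun a c d => r * D a c d + D' a c d) l j k = r * lowChr D l j k + lowChr D' l j k := by
  simp only [lowChr]; ring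

theorem ricciX_linear (M : Matrix (Fin 4) (Fin 4) ℝ) (r : ℝ) (D D' : Fin 4 → Fin 4 → Fin 4 → ℝ)
    (a j k : Fin 4) : ricciX M (fun a c d => r * D a c d + D' a c d) a j k =
      r * ricciX M D a j k + ricciX M D' a j k := by
  simp only [ricciX, lowChr_linear, mul_add, Finset.sum_add_distrib, mul_left_comm _ r,
    ← Finset.mul_sum]
  split_ifs <;> ring

/-- With this expansion, smoothness, supports and Fourier transforms need only be checked for single
derivatives. -/
theorem exists_ricciX_eq_sum (M : Matrix (Fin 4) (Fin 4) ℝ) (a j k : Fin 4) :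
    ∃ K : Fin 4 → Fin 4 → Fin 4 → ℝ, ∀ D, ricciX M D a j k = ∑ b, ∑ c, ∑ d, K b c d * D b c d :=
  exists_eq_sum_of_linear _ fun r D D' => ricciX_linear M r D D' a j k

/-- The field whose divergence is the (symmetrised) linearised Ricci tensor. -/
def linX (ψ : Fin 4 → Fin 4 → R4 → ℝ) (j k a : Fin 4) (x : R4) : ℝ :=
  ricciX minkowski (fun b c d => pd b (ψ c d) x) a j k +
    ricciX minkowski (fun b c d => pd b (ψ c d) x) a k j

variable {ψ : Fin 4 → Fin 4 → R4 → ℝ}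

/-- The real and imaginary parts of the Fourier transform. -/
def ftRe (ψ : Fin 4 → Fin 4 → R4 → ℝ) (ξ : R4) : Matrix (Fin 4) (Fin 4) ℝ :=
  fun c d => (ft (ψ c d) ξ).re

def ftIm (ψ : Fin 4 → Fin 4 → R4 → ℝ) (ξ : R4) : Matrix (Fin 4) (Fin 4) ℝ :=
  fun c d => (ft (ψ c d) ξ).im

theorem isTest_ricciX {V : Set R4} (hψ : ∀ c d, IsTest V (ψ c d))
    (M : Matrix (Fin 4) (Fin 4) ℝ) (a j k : Fin 4) : IsTest V fun x => ricciX M (fun b c d => pd b (ψ c d) x) a j k := by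
  obtain ⟨K, hK⟩ := exists_ricciX_eq_sum M a j k
  simp_rw [hK]
  exact IsTest.sum fun b _ => IsTest.sum fun c _ => IsTest.sum fun d _ =>
    ((hψ c d).pd b).const_mul _

theorem isTest_linX {V : Set R4} (hψ : ∀ c d, IsTest V (ψ c d)) (j k a : Fin 4) :
    IsTest V (linX ψ j k a) :=
  (isTest_ricciX hψ _ a j k).add (isTest_ricciX hψ _ a k j)

/-- The coefficients are real, so the real and imaginary parts of the transform behave as two
separate real plane waves. -/
theorem ft_ricciX (hψ : ∀ c d, IsTest univ (ψ c d)) (M : Matrix (Fin 4) (Fin 4) ℝ)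
    (a j k : Fin 4) (ξ : R4) :
    ft (fun x => ricciX M (fun b c d => pd b (ψ c d) x) a j k) ξ = 2 * Real.pi * Complex.I *
      (ricciX M (fun b c d => ξ b * ftRe ψ ξ c d) a j k +
        Complex.I * ricciX M (fun b c d => ξ b * ftIm ψ ξ c d) a j k) := by
  obtain ⟨K, hK⟩ := exists_ricciX_eq_sum M a j k
  simp_rw [hK]
  rw [ft_sum fun b _ => IsTest.sum fun c _ => IsTest.sum fun d _ => ((hψ c d).pd b).const_mul _]
  push_cast
  simp_rw [Finset.mul_sum, ← Finset.sum_add_distrib, Finset.mul_sum]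
  refine Finset.sum_congr rfl fun b _ => ?_
  rw [ft_sum fun c _ => IsTest.sum fun d _ => ((hψ c d).pd b).const_mul _]
  refine Finset.sum_congr rfl fun c _ => ?_
  rw [ft_sum fun d _ => ((hψ c d).pd b).const_mul _]
  refine Finset.sum_congr rfl fun d _ => ?_
  rw [ft_const_mul, (hψ c d).ft_pd, ← Complex.re_add_im (ft (ψ c d) ξ)]
  simp only [ftRe, ftIm]
  ring

/-- The outer divergence and the inner gradient contribute `(2πi)² = -4π²`, and the symmetrisation
doubles the symbol `waveL`. -/
theorem ft_div_linX (hψ : ∀ c d, IsTest univ (ψ c d)) (hs : ∀ c d, ψ c d = ψ d c) (j k : Fin 4)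
    (ξ : R4) : ft (fun x => ∑ a, pd a (linX ψ j k a) x) ξ =
      -(8 * Real.pi ^ 2) * (waveL ξ (ftRe ψ ξ) j k + Complex.I * waveL ξ (ftIm ψ ξ) j k) := by
  have hR : ∀ c d, ftRe ψ ξ c d = ftRe ψ ξ d c := fun c d => by simp only [ftRe, hs c d]
  have hI : ∀ c d, ftIm ψ ξ c d = ftIm ψ ξ d c := fun c d => by simp only [ftIm, hs c d]
  have hsymm : ∀ h : Matrix (Fin 4) (Fin 4) ℝ, (∀ c d, h c d = h d c) →
      waveL ξ h k j = waveL ξ h j k := by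
    intro h hh
    simp only [waveL, Matrix.smul_apply, Matrix.sub_apply, Matrix.add_apply,
      Matrix.vecMulVec_apply, smul_eq_mul, hh k j]
    ring
  have e : ∀ (h : Matrix (Fin 4) (Fin 4) ℝ), (∀ c d, h c d = h d c) →
      ∑ a, (ξ a : ℂ) * ((ricciX minkowski (fun b c d => ξ b * h c d) a j k : ℝ) +
        (ricciX minkowski (fun b c d => ξ b * h c d) a k j : ℝ)) = 2 * waveL ξ h j k := by
    intro h hh
    have h1 := ricciSymbol_eq ξ hh j k
    have h2 := ricciSymbol_eq ξ hh k j
    rw [hsymm h hh] at h2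
    rw [ricciSymbol] at h1 h2
    simp_rw [mul_add, Finset.sum_add_distrib]
    rw [two_mul]
    nth_rw 1 [← h1]
    rw [← h2]
    push_cast
    rfl
  rw [ft_sum fun a _ => (isTest_linX hψ j k a).pd a]
  have h3 : ∀ a, ft (pd a (linX ψ j k a)) ξ = -(4 * Real.pi ^ 2) *
      ((ξ a : ℂ) * ((ricciX minkowski (fun b c d => ξ b * ftRe ψ ξ c d) a j k : ℝ) +
        (ricciX minkowski (fun b c d => ξ b * ftRe ψ ξ c d) a k j : ℝ)) + Complex.I *
      ((ξ a : ℂ) * ((ricciX minkowski (fun b c d => ξ b * ftIm ψ ξ c d) a j k : ℝ) +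
        (ricciX minkowski (fun b c d => ξ b * ftIm ψ ξ c d) a k j : ℝ)))) := by
    intro a
    rw [(isTest_linX hψ j k a).ft_pd]
    have : ft (linX ψ j k a) ξ = _ := ft_add (isTest_ricciX hψ minkowski a j k)
      (isTest_ricciX hψ minkowski a k j) ξ
    rw [this, ft_ricciX hψ, ft_ricciX hψ]
    linear_combination (4 * Real.pi ^ 2 * ξ a *
      ((ricciX minkowski (fun b c d => ξ b * ftRe ψ ξ c d) a j k : ℝ) +
        (ricciX minkowski (fun b c d => ξ b * ftRe ψ ξ c d) a k j : ℝ) + Complex.I *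
        ((ricciX minkowski (fun b c d => ξ b * ftIm ψ ξ c d) a j k : ℝ) +
        (ricciX minkowski (fun b c d => ξ b * ftIm ψ ξ c d) a k j : ℝ)))) * Complex.I_sq
  simp_rw [h3]
  rw [← Finset.mul_sum, Finset.sum_add_distrib, ← Finset.mul_sum, e _ hR, e _ hI]
  ring

theorem norm_sq_ft_div_linX (hψ : ∀ c d, IsTest univ (ψ c d)) (hs : ∀ c d, ψ c d = ψ d c)
    (j k : Fin 4) (ξ : R4) : ‖ft (fun x => ∑ a, pd a (linX ψ j k a) x) ξ‖ ^ 2 =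
      64 * Real.pi ^ 4 * (waveL ξ (ftRe ψ ξ) j k ^ 2 + waveL ξ (ftIm ψ ξ) j k ^ 2) := by
  rw [ft_div_linX hψ hs]
  obtain ⟨a, ha⟩ : ∃ a, a = waveL ξ (ftRe ψ ξ) j k := ⟨_, rfl⟩
  obtain ⟨b, hb⟩ : ∃ b, b = waveL ξ (ftIm ψ ξ) j k := ⟨_, rfl⟩
  rw [← ha, ← hb, norm_mul, mul_pow]
  have h1 : ‖-(8 * (Real.pi : ℂ) ^ 2)‖ = 8 * Real.pi ^ 2 := by
    rw [norm_neg, norm_mul, norm_pow, Complex.norm_real, Real.norm_of_nonneg Real.pi_pos.le]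
    simp
  have h2 : ‖(a : ℂ) + Complex.I * b‖ ^ 2 = a ^ 2 + b ^ 2 := by
    rw [Complex.sq_norm, Complex.normSq_apply]
    simp
    ring
  rw [h1, h2]
  ring

theorem abs_coord_le_norm (ξ : R4) (a : Fin 4) : |ξ a| ≤ ‖ξ‖ := by
  simpa using PiLp.norm_apply_le ξ a

theorem sum_abs_sq_le (A : Matrix (Fin 4) (Fin 4) ℝ) :
    (∑ i, ∑ j, |A i j|) ^ 2 ≤ 16 * ∑ i, ∑ j, A i j ^ 2 := by
  rw [← Fintype.sum_prod_type', ← Fintype.sum_prod_type']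
  refine sq_sum_le_card_mul_sum_sq.trans (le_of_eq ?_)
  simp

/-- The lower bound for the energy density of a plane wave, with a weight. -/
theorem exists_waveEnergy_ge_weight : ∃ C : ℝ, 0 ≤ C ∧ ∀ (ξ : R4) (h : Matrix (Fin 4) (Fin 4) ℝ),
    (∀ i j, h i j = h j i) → ∀ θ δ : ℝ, 0 < θ → 0 < δ →
      -(C * ((θ⁻¹ ^ 2 + δ * ‖ξ‖ ^ 2) * ∑ i, ∑ j, h i j ^ 2 +
        δ⁻¹ * (weight θ ξ * ∑ i, ∑ j, waveL ξ h i j ^ 2))) ≤ waveEnergy ξ h := by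
  obtain ⟨c, hc⟩ := exists_einsteinQ_eq_sum minkowski 0 0
  obtain ⟨A, hA⟩ : ∃ A : ℝ, A = 17 * 2 * 256 := ⟨_, rfl⟩
  obtain ⟨E, hE⟩ : ∃ E : ℝ, E = ∑ I, |c I| := ⟨_, rfl⟩
  have hE0 : 0 ≤ E := hE ▸ Finset.sum_nonneg fun _ _ => abs_nonneg _
  have hA0 : 0 ≤ A := by rw [hA]; norm_num
  -- `16 * A` serves frequencies at least `1/θ`, the `16` coming from Cauchy-Schwarz over the matrix
  -- entries. `E` serves the low frequencies, where the energy is estimated crudely.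
  refine ⟨16 * A + E, by positivity, fun ξ h hs θ δ hθ hδ => ?_⟩
  obtain ⟨H, hH⟩ : ∃ H, H = ∑ i, ∑ j, h i j ^ 2 := ⟨_, rfl⟩
  obtain ⟨L, hL⟩ : ∃ L, L = ∑ i, ∑ j, waveL ξ h i j ^ 2 := ⟨_, rfl⟩
  have hH0 : 0 ≤ H := hH ▸ Finset.sum_nonneg fun _ _ => Finset.sum_nonneg fun _ _ => sq_nonneg _
  have hL0 : 0 ≤ L := hL ▸ Finset.sum_nonneg fun _ _ => Finset.sum_nonneg fun _ _ => sq_nonneg _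
  have hw := weight_nonneg hθ.le ξ
  rw [← hH, ← hL]
  have hδ' := inv_pos.2 hδ
  rcases le_or_gt (1 / θ) ‖ξ‖ with hξ | hξ
  · have hge := waveEnergy_ge ξ hs
    rw [← hA] at hge
    have h1 := sum_abs_sq_le h
    have h2 := sum_abs_sq_le (waveL ξ h)
    rw [← hH] at h1
    rw [← hL] at h2
    obtain ⟨p, hp⟩ : ∃ p, p = ∑ i, ∑ j, |h i j| := ⟨_, rfl⟩
    obtain ⟨q, hq⟩ : ∃ q, q = ∑ i, ∑ j, |waveL ξ h i j| := ⟨_, rfl⟩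
    rw [← hp] at h1 hge
    rw [← hq] at h2 hge
    have hwl := half_le_weight hθ hξ
    have hn : 0 < ‖ξ‖ := (by positivity : 0 < 1 / θ).trans_le hξ
    -- Young's inequality, balanced so that `p` carries the gradient weight `‖ξ‖ ^ 2` and `q` its
    -- inverse, which the scale weight dominates at high frequency.
    have h3 : p * q ≤ 1 / 2 * (δ * ‖ξ‖ ^ 2 * p ^ 2 + δ⁻¹ * (2 * weight θ ξ) * q ^ 2) := by
      have e1 : (‖ξ‖ ^ 2)⁻¹ ≤ 2 * weight θ ξ := by
        rw [inv_le_iff_one_le_mul₀ (by positivity)]; linarith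
      have e2 : p * q ≤ 1 / 2 * (δ * ‖ξ‖ ^ 2 * p ^ 2 + δ⁻¹ * (‖ξ‖ ^ 2)⁻¹ * q ^ 2) := by
        have : 0 ≤ (δ * ‖ξ‖ ^ 2) * (p - δ⁻¹ * (‖ξ‖ ^ 2)⁻¹ * q) ^ 2 := by positivity
        have e3 : (δ * ‖ξ‖ ^ 2) * (p - δ⁻¹ * (‖ξ‖ ^ 2)⁻¹ * q) ^ 2 =
          δ * ‖ξ‖ ^ 2 * p ^ 2 - 2 * (p * q) + δ⁻¹ * (‖ξ‖ ^ 2)⁻¹ * q ^ 2 := by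
          field_simp
          ring
        linarith
      have e4 : δ⁻¹ * (‖ξ‖ ^ 2)⁻¹ * q ^ 2 ≤ δ⁻¹ * (2 * weight θ ξ) * q ^ 2 :=
        mul_le_mul_of_nonneg_right (mul_le_mul_of_nonneg_left e1 hδ'.le) (sq_nonneg _)
      linarith
    have h4 : δ * ‖ξ‖ ^ 2 * p ^ 2 ≤ δ * ‖ξ‖ ^ 2 * (16 * H) :=
      mul_le_mul_of_nonneg_left h1 (by positivity)
    have h5 : δ⁻¹ * (2 * weight θ ξ) * q ^ 2 ≤ δ⁻¹ * (2 * weight θ ξ) * (16 * L) :=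
      mul_le_mul_of_nonneg_left h2 (by positivity)
    have h6 : A * (p * q) ≤ A * (16 * ((δ * ‖ξ‖ ^ 2) * H + δ⁻¹ * (weight θ ξ * L))) :=
      mul_le_mul_of_nonneg_left (by nlinarith [mul_nonneg (by positivity : 0 ≤ δ * ‖ξ‖ ^ 2) hH0]) hA0
    have h7 : 0 ≤ (16 * A + E) * (θ⁻¹ ^ 2 * H) := by positivity
    have h8 : 0 ≤ E * ((δ * ‖ξ‖ ^ 2) * H + δ⁻¹ * (weight θ ξ * L)) := by positivity
    refine le_trans ?_ hge
    rw [neg_le_neg_iff]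
    nlinarith
  -- At low frequency no sign is needed: every product of two derivatives is bounded by `θ⁻²` times
  -- the squared amplitude.
  · have hb : ∀ I, |waveSq ξ h I| ≤ θ⁻¹ ^ 2 * H := by
      intro I
      have e1 : ∀ i j, |h i j| ≤ √H := fun i j => by
        apply Real.abs_le_sqrt
        rw [hH]
        exact (Finset.single_le_sum (f := fun j => h i j ^ 2) (fun _ _ => sq_nonneg _)
          (Finset.mem_univ j)).trans (Finset.single_le_sum (f := fun i => ∑ j, h i j ^ 2)
            (fun _ _ => Finset.sum_nonneg fun _ _ => sq_nonneg _) (Finset.mem_univ i))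
      have e2 : ∀ a, |ξ a| ≤ θ⁻¹ := fun a => by
        rw [← one_div]; exact (abs_coord_le_norm ξ a).trans hξ.le
      have hθ' := inv_pos.2 hθ
      have e3 : ∀ a i j, |ξ a * h i j| ≤ θ⁻¹ * √H := fun a i j => by
        rw [abs_mul]
        exact mul_le_mul (e2 a) (e1 i j) (abs_nonneg _) hθ'.le
      rw [waveSq, abs_mul]
      refine (mul_le_mul (e3 _ _ _) (e3 _ _ _) (abs_nonneg _) (by positivity)).trans (le_of_eq ?_)
      rw [mul_mul_mul_comm, Real.mul_self_sqrt hH0, sq]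
    have h1 : |waveEnergy ξ h| ≤ E * (θ⁻¹ ^ 2 * H) := by
      rw [← einsteinQ_waveSq ξ hs, abs_neg, hc, hE, Finset.sum_mul]
      refine (Finset.abs_sum_le_sum_abs _ _).trans (Finset.sum_le_sum fun I _ => ?_)
      rw [abs_mul]
      exact mul_le_mul_of_nonneg_left (hb I) (abs_nonneg _)
    refine le_trans ?_ (neg_le_of_abs_le h1)
    rw [neg_le_neg_iff]
    have h7 : 0 ≤ 16 * A * (θ⁻¹ ^ 2 * H) := by positivity
    have h8 : 0 ≤ (16 * A + E) * ((δ * ‖ξ‖ ^ 2) * H + δ⁻¹ * (weight θ ξ * L)) := by positivity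
    nlinarith

end Positivity

/-! ### The integrated energy density of a compactly supported perturbation -/

section EnergyIntegral

open ComplexConjugate Module

variable {ψ : Fin 4 → Fin 4 → R4 → ℝ}

/-- The products of first derivatives of `ψ`. -/
def gradSq (ψ : Fin 4 → Fin 4 → R4 → ℝ) (x : R4) (I : Fin 6 → Fin 4) : ℝ :=
  pd (I 0) (ψ (I 2) (I 3)) x * pd (I 1) (ψ (I 4) (I 5)) x

theorem IsTest.integrable_mul' {u v : R4 → ℝ} (hu : IsTest univ u) (hv : IsTest univ v) :
    Integrable (fun x => u x * v x) :=
  hu.integrable_mul isOpen_univ hv.contDiff.continuous.continuousOn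

theorem integrable_gradSq (hψ : ∀ c d, IsTest univ (ψ c d)) (I : Fin 6 → Fin 4) :
    Integrable (fun x => gradSq ψ x I) :=
  ((hψ _ _).pd _).integrable_mul' ((hψ _ _).pd _)

/-- Parseval in real form: the integral of a product of derivatives is the superposition of the
plane wave expressions for the real and imaginary parts of the transform. -/
theorem integrable_waveSq (hψ : ∀ c d, IsTest univ (ψ c d)) (I : Fin 6 → Fin 4) :
    Integrable (fun ξ : R4 => waveSq ξ (ftRe ψ ξ) I + waveSq ξ (ftIm ψ ξ) I) ∧
    ∫ x, gradSq ψ x I =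
      4 * Real.pi ^ 2 * ∫ ξ : R4, (waveSq ξ (ftRe ψ ξ) I + waveSq ξ (ftIm ψ ξ) I) := by
  have hu := (hψ (I 2) (I 3)).pd (I 0)
  have hv := (hψ (I 4) (I 5)).pd (I 1)
  have hi := hu.integrable_ft_mul hv
  have hp := congrArg Complex.re (hu.parseval hv)
  have hpt : ∀ ξ, (conj (ft (pd (I 0) (ψ (I 2) (I 3))) ξ) * ft (pd (I 1) (ψ (I 4) (I 5))) ξ).re =
      4 * Real.pi ^ 2 * (waveSq ξ (ftRe ψ ξ) I + waveSq ξ (ftIm ψ ξ) I) := by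
    intro ξ
    rw [(hψ _ _).ft_pd, (hψ _ _).ft_pd]
    simp only [waveSq, ftRe, ftIm, map_mul, Complex.conj_I, Complex.conj_ofReal, Complex.mul_re,
      Complex.mul_im, Complex.I_re, Complex.I_im, Complex.ofReal_re, Complex.ofReal_im,
      Complex.conj_re, Complex.conj_im, Complex.neg_re, Complex.neg_im, Complex.re_ofNat,
      Complex.im_ofNat, map_ofNat]
    ring
  have hre := hi.re
  have hre2 : Integrable fun ξ : R4 => 4 * Real.pi ^ 2 *
      (waveSq ξ (ftRe ψ ξ) I + waveSq ξ (ftIm ψ ξ) I) :=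
    hre.congr (ae_of_all _ fun ξ => hpt ξ)
  have h0 : (4 * Real.pi ^ 2) ≠ 0 := by positivity
  refine ⟨(hre2.const_mul (4 * Real.pi ^ 2)⁻¹).congr (ae_of_all _ fun ξ => ?_), ?_⟩
  · simp only; rw [inv_mul_cancel_left₀ h0]
  · rw [Complex.ofReal_re] at hp
    simp only [gradSq]
    rw [← hp, ← integral_const_mul]
    have := integral_re hi
    refine this.symm.trans (integral_congr_ae (ae_of_all _ fun ξ => hpt ξ))

theorem ftRe_sq_add_ftIm_sq (c d : Fin 4) (ξ : R4) :
    ftRe ψ ξ c d ^ 2 + ftIm ψ ξ c d ^ 2 = ‖ft (ψ c d) ξ‖ ^ 2 := by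
  rw [Complex.sq_norm, Complex.normSq_apply, ftRe, ftIm]; ring

/-- The integral of the energy density is nonnegative up to small multiples of the first derivatives
and up to the linearised Ricci tensor in a negative Sobolev norm. -/
theorem exists_integral_energy_ge : ∃ C : ℝ, 0 ≤ C ∧ ∀ (ψ : Fin 4 → Fin 4 → R4 → ℝ)
    (F : Fin 4 → Fin 4 → R4 → ℝ) (B : Fin 4 → Fin 4 → Fin 4 → R4 → ℝ) (P K θ δ : ℝ),
    (∀ c d, IsTest univ (ψ c d)) → (∀ c d, ψ c d = ψ d c) → (∀ j k, IsTest univ (F j k)) →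
    (∀ j k a, IsTest univ (B j k a)) →
    (∀ j k x, ∑ a, pd a (linX ψ j k a) x = F j k x + ∑ a, pd a (B j k a) x) →
    (∀ j k a x, |linX ψ j k a x| ≤ P) → (∀ j k, ∫ x, |F j k x| ≤ K) → 0 < θ → 0 < δ →
    -(C * (θ⁻¹ ^ 2 * (∑ c, ∑ d, ∫ x, ψ c d x ^ 2)
      + δ * (∑ c, ∑ d, ∑ a, ∫ x, pd a (ψ c d) x ^ 2)
      + δ⁻¹ * (θ * P * K + ∑ j, ∑ k, ∑ a, ∫ x, B j k a x ^ 2))) ≤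
      ∫ x, -einsteinQ minkowski (gradSq ψ x) 0 0 := by
  obtain ⟨C, hC0, hC⟩ := exists_waveEnergy_ge_weight
  obtain ⟨c, hc⟩ := exists_einsteinQ_eq_sum minkowski 0 0
  obtain ⟨N, hN⟩ : ∃ N, N = ∑ a, cutoffNorm a := ⟨_, rfl⟩
  have hN0 : 0 ≤ N := hN ▸ Finset.sum_nonneg fun a _ => cutoffNorm_nonneg a
  -- The three summands cover the three error terms: Parseval costs `4π²` for the amplitudes and
  -- nothing for the gradients, while the Ricci term collects the kernel norms `N`.
  refine ⟨4 * Real.pi ^ 2 * C + C + C * (2 * N + 2), by positivity, ?_⟩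
  intro ψ F B P K θ δ hψ hs hF hB hu hP hK hθ hδ
  have hpi : (0 : ℝ) < Real.pi := Real.pi_pos
  have hP0 : 0 ≤ P := (abs_nonneg _).trans (hP 0 0 0 0)
  -- the integral in terms of the Fourier transform
  have hE : ∫ x, -einsteinQ minkowski (gradSq ψ x) 0 0 =
      4 * Real.pi ^ 2 * ∫ ξ : R4, (waveEnergy ξ (ftRe ψ ξ) + waveEnergy ξ (ftIm ψ ξ)) := by
    have e1 : ∀ ξ : R4, waveEnergy ξ (ftRe ψ ξ) + waveEnergy ξ (ftIm ψ ξ) =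
        ∑ I, -c I * (waveSq ξ (ftRe ψ ξ) I + waveSq ξ (ftIm ψ ξ) I) := by
      intro ξ
      rw [← einsteinQ_waveSq _ (fun c d => by simp only [ftRe, hs c d]),
        ← einsteinQ_waveSq _ (fun c d => by simp only [ftIm, hs c d]), hc, hc]
      simp only [mul_add, Finset.sum_add_distrib, neg_mul, Finset.sum_neg_distrib]
    have e2 : ∀ x, -einsteinQ minkowski (gradSq ψ x) 0 0 = ∑ I, -c I * gradSq ψ x I := by
      intro x
      rw [hc]; simp only [neg_mul, Finset.sum_neg_distrib]
    simp_rw [e1, e2]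
    rw [integral_finsetSum _ fun I _ => (integrable_gradSq hψ I).const_mul _,
      integral_finsetSum _ fun I _ => (integrable_waveSq hψ I).1.const_mul _, Finset.mul_sum]
    refine Finset.sum_congr rfl fun I _ => ?_
    rw [integral_const_mul, integral_const_mul, (integrable_waveSq hψ I).2]
    ring
  have hEi : Integrable fun ξ : R4 => waveEnergy ξ (ftRe ψ ξ) + waveEnergy ξ (ftIm ψ ξ) := by
    have e1 : ∀ ξ : R4, waveEnergy ξ (ftRe ψ ξ) + waveEnergy ξ (ftIm ψ ξ) =
        ∑ I, -c I * (waveSq ξ (ftRe ψ ξ) I + waveSq ξ (ftIm ψ ξ) I) := by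
      intro ξ
      rw [← einsteinQ_waveSq _ (fun c d => by simp only [ftRe, hs c d]),
        ← einsteinQ_waveSq _ (fun c d => by simp only [ftIm, hs c d]), hc, hc]
      simp only [mul_add, Finset.sum_add_distrib, neg_mul, Finset.sum_neg_distrib]
    simp_rw [e1]
    exact integrable_finsetSum _ fun I _ => (integrable_waveSq hψ I).1.const_mul _
  -- the pointwise lower bound
  have hut : ∀ j k, IsTest univ fun x => ∑ a, pd a (linX ψ j k a) x := fun j k =>
    IsTest.sum fun a _ => (isTest_linX hψ j k a).pd a
  let h1 : R4 → ℝ := fun ξ => ∑ c, ∑ d, ‖ft (ψ c d) ξ‖ ^ 2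
  let h2 : R4 → ℝ := fun ξ => ∑ c, ∑ d, ‖ξ‖ ^ 2 * ‖ft (ψ c d) ξ‖ ^ 2
  let h3 : R4 → ℝ := fun ξ =>
    ∑ j, ∑ k, weight θ ξ * ‖ft (fun x => ∑ a, pd a (linX ψ j k a) x) ξ‖ ^ 2
  have hpt : ∀ ξ : R4, -(C * (θ⁻¹ ^ 2 * h1 ξ + δ * h2 ξ +
      δ⁻¹ * ((64 * Real.pi ^ 4)⁻¹ * h3 ξ))) ≤
        waveEnergy ξ (ftRe ψ ξ) + waveEnergy ξ (ftIm ψ ξ) := by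
    intro ξ
    have e1 := hC ξ (ftRe ψ ξ) (fun c d => by simp only [ftRe, hs c d]) θ δ hθ hδ
    have e2 := hC ξ (ftIm ψ ξ) (fun c d => by simp only [ftIm, hs c d]) θ δ hθ hδ
    have e3 : h1 ξ = (∑ i, ∑ j, ftRe ψ ξ i j ^ 2) + ∑ i, ∑ j, ftIm ψ ξ i j ^ 2 := by
      simp only [h1, ← ftRe_sq_add_ftIm_sq, Finset.sum_add_distrib]
    have e4 : h2 ξ = ‖ξ‖ ^ 2 * h1 ξ := by simp only [h1, h2, Finset.mul_sum]
    have e5 : (64 * Real.pi ^ 4)⁻¹ * h3 ξ = weight θ ξ *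
        ((∑ i, ∑ j, waveL ξ (ftRe ψ ξ) i j ^ 2) + ∑ i, ∑ j, waveL ξ (ftIm ψ ξ) i j ^ 2) := by
      simp only [h3, norm_sq_ft_div_linX hψ hs, ← Finset.mul_sum, ← Finset.sum_add_distrib]
      field_simp
    rw [e5, e4, e3]
    refine le_trans (le_of_eq ?_) (add_le_add e1 e2)
    ring
  have hi1 : Integrable h1 := integrable_finsetSum _ fun c _ => integrable_finsetSum _ fun d _ =>
    (hψ c d).integrable_norm_sq
  have hi2 : Integrable h2 := integrable_finsetSum _ fun c _ => integrable_finsetSum _ fun d _ =>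
    (hψ c d).integrable_norm_sq_mul
  have hi3 : Integrable h3 := integrable_finsetSum _ fun j _ => integrable_finsetSum _ fun k _ =>
    integrable_weight_mul (hut j k).integrable_norm_sq hθ
  have hmono := integral_mono ((((hi1.const_mul (θ⁻¹ ^ 2)).add (hi2.const_mul δ)).add
    ((hi3.const_mul (64 * Real.pi ^ 4)⁻¹).const_mul δ⁻¹)).const_mul C).neg hEi hpt
  -- the integrals
  have k1 : ∫ ξ, h1 ξ = ∑ c, ∑ d, ∫ x, ψ c d x ^ 2 := by
    rw [integral_finsetSum _ fun c _ => integrable_finsetSum _ fun d _ =>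
      (hψ c d).integrable_norm_sq]
    refine Finset.sum_congr rfl fun c _ => ?_
    rw [integral_finsetSum _ fun d _ => (hψ c d).integrable_norm_sq]
    exact Finset.sum_congr rfl fun d _ => (hψ c d).integral_norm_sq
  have k2 : 4 * Real.pi ^ 2 * ∫ ξ, h2 ξ = ∑ c, ∑ d, ∑ a, ∫ x, pd a (ψ c d) x ^ 2 := by
    rw [integral_finsetSum _ fun c _ => integrable_finsetSum _ fun d _ =>
      (hψ c d).integrable_norm_sq_mul, Finset.mul_sum]
    refine Finset.sum_congr rfl fun c _ => ?_
    rw [integral_finsetSum _ fun d _ => (hψ c d).integrable_norm_sq_mul, Finset.mul_sum]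
    refine Finset.sum_congr rfl fun d _ => ?_
    simp_rw [← ((hψ c d).pd _).integral_norm_sq]
    rw [← integral_finsetSum _ fun a _ => ((hψ c d).pd a).integrable_norm_sq, ← integral_const_mul]
    congr 1
    ext ξ
    simp_rw [(hψ c d).norm_sq_ft_pd, ← Finset.sum_mul, ← Finset.mul_sum]
    rw [← norm_sq_eq_sum]
    ring
  -- The Murat estimate applies because the same function is the divergence of the bounded field
  -- `linX` and equals `F` plus the divergence of `B`. The `32` is `2` for each of the `16` pairs
  -- `j, k`.
  have k3 : ∫ ξ, h3 ξ ≤ 32 * (θ * P * K * N) +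
      8 * Real.pi ^ 2 * ∑ j, ∑ k, ∑ a, ∫ x, B j k a x ^ 2 := by
    rw [integral_finsetSum _ fun j _ => integrable_finsetSum _ fun k _ =>
      integrable_weight_mul (hut j k).integrable_norm_sq hθ]
    have e1 : ∀ j k, ∫ ξ, weight θ ξ * ‖ft (fun x => ∑ a, pd a (linX ψ j k a) x) ξ‖ ^ 2 ≤
        2 * (θ * P * K * N) + 8 * Real.pi ^ 2 * ∑ a, ∫ x, B j k a x ^ 2 := by
      intro j k
      refine (integral_weight_mul_le (isTest_linX hψ j k) (hB j k) (hF j k) (fun x => rfl)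
        (hu j k) (hP j k) hθ).trans (add_le_add_left ?_ _)
      rw [← hN]
      have : (∫ x, |F j k x|) * (P * N) ≤ K * (P * N) :=
        mul_le_mul_of_nonneg_right (hK j k) (by positivity)
      have := mul_le_mul_of_nonneg_left this hθ.le
      linarith
    calc _ = ∑ j, ∑ k, ∫ ξ, weight θ ξ * ‖ft (fun x => ∑ a, pd a (linX ψ j k a) x) ξ‖ ^ 2 := by
          refine Finset.sum_congr rfl fun j _ => ?_
          rw [integral_finsetSum _ fun k _ =>
            integrable_weight_mul (hut j k).integrable_norm_sq hθ]
      _ ≤ ∑ j, ∑ k, (2 * (θ * P * K * N) + 8 * Real.pi ^ 2 * ∑ a, ∫ x, B j k a x ^ 2) :=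
          Finset.sum_le_sum fun j _ => Finset.sum_le_sum fun k _ => e1 j k
      _ = _ := by
          simp only [Finset.sum_add_distrib, ← Finset.mul_sum]
          simp
          ring
  obtain ⟨X, hX⟩ : ∃ X, X = ∑ c, ∑ d, ∫ x, ψ c d x ^ 2 := ⟨_, rfl⟩
  obtain ⟨Y, hY⟩ : ∃ Y, Y = ∑ c, ∑ d, ∑ a, ∫ x, pd a (ψ c d) x ^ 2 := ⟨_, rfl⟩
  obtain ⟨Z, hZ⟩ : ∃ Z, Z = ∑ j, ∑ k, ∑ a, ∫ x, B j k a x ^ 2 := ⟨_, rfl⟩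
  rw [← hX] at k1
  rw [← hY] at k2
  rw [← hZ] at k3
  have hX0 : 0 ≤ X := hX ▸ Finset.sum_nonneg fun _ _ => Finset.sum_nonneg fun _ _ =>
    integral_nonneg fun _ => sq_nonneg _
  have hY0 : 0 ≤ Y := hY ▸ Finset.sum_nonneg fun _ _ => Finset.sum_nonneg fun _ _ =>
    Finset.sum_nonneg fun _ _ => integral_nonneg fun _ => sq_nonneg _
  have hZ0 : 0 ≤ Z := hZ ▸ Finset.sum_nonneg fun _ _ => Finset.sum_nonneg fun _ _ =>
    Finset.sum_nonneg fun _ _ => integral_nonneg fun _ => sq_nonneg _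
  have hK0 : 0 ≤ K := (integral_nonneg fun _ => abs_nonneg _).trans (hK 0 0)
  have hint : ∫ ξ, -(C * (θ⁻¹ ^ 2 * h1 ξ + δ * h2 ξ + δ⁻¹ * ((64 * Real.pi ^ 4)⁻¹ * h3 ξ))) =
      -(C * (θ⁻¹ ^ 2 * X + δ * (∫ ξ, h2 ξ) + δ⁻¹ * ((64 * Real.pi ^ 4)⁻¹ * ∫ ξ, h3 ξ))) := by
    have hi12 : Integrable fun ξ => θ⁻¹ ^ 2 * h1 ξ + δ * h2 ξ :=
      (hi1.const_mul _).add (hi2.const_mul _)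
    rw [integral_neg, integral_const_mul, integral_add hi12
      ((hi3.const_mul _).const_mul _), integral_add (hi1.const_mul _) (hi2.const_mul _),
      integral_const_mul, integral_const_mul, integral_const_mul, integral_const_mul, k1]
  rw [hE, ← hX, ← hY, ← hZ]
  have hmono2 := (le_of_eq hint.symm).trans hmono
  have h4 := mul_le_mul_of_nonneg_left hmono2 (by positivity : 0 ≤ 4 * Real.pi ^ 2)
  refine le_trans ?_ h4
  have hpi4 : 4 * Real.pi ^ 2 * (64 * Real.pi ^ 4)⁻¹ = (16 * Real.pi ^ 2)⁻¹ := by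
    field_simp; norm_num
  have k4 : (16 * Real.pi ^ 2)⁻¹ * ∫ ξ, h3 ξ ≤ 2 * N * (θ * P * K) + Z := by
    have : (16 * Real.pi ^ 2)⁻¹ * (∫ ξ, h3 ξ) ≤ (16 * Real.pi ^ 2)⁻¹ *
      (32 * (θ * P * K * N) + 8 * Real.pi ^ 2 * Z) := mul_le_mul_of_nonneg_left k3 (by positivity)
    refine this.trans ?_
    have e1 : (16 * Real.pi ^ 2)⁻¹ * (32 * (θ * P * K * N) + 8 * Real.pi ^ 2 * Z) =
        2 * N * (θ * P * K) * (Real.pi ^ 2)⁻¹ + Z / 2 := by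
      field_simp; ring
    rw [e1]
    have e2 : (Real.pi ^ 2)⁻¹ ≤ 1 := inv_le_one_of_one_le₀ (by nlinarith [Real.pi_gt_three])
    have e3 : 2 * N * (θ * P * K) * (Real.pi ^ 2)⁻¹ ≤ 2 * N * (θ * P * K) * 1 :=
      mul_le_mul_of_nonneg_left e2 (by positivity)
    linarith
  have k5 := mul_le_mul_of_nonneg_left k4 (by positivity : 0 ≤ C * δ⁻¹)
  have e0 : 4 * Real.pi ^ 2 * -(C * (θ⁻¹ ^ 2 * X + δ * (∫ ξ, h2 ξ) +
      δ⁻¹ * ((64 * Real.pi ^ 4)⁻¹ * ∫ ξ, h3 ξ))) = -(4 * Real.pi ^ 2 * C * (θ⁻¹ ^ 2 * X) +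
      C * (δ * Y) + C * δ⁻¹ * ((16 * Real.pi ^ 2)⁻¹ * ∫ ξ, h3 ξ)) := by
    rw [← k2, ← hpi4]; ring
  rw [e0, neg_le_neg_iff]
  have p1 : 0 ≤ (C + C * (2 * N + 2)) * (θ⁻¹ ^ 2 * X) := by positivity
  have p2 : 0 ≤ (4 * Real.pi ^ 2 * C + C * (2 * N + 2)) * (δ * Y) := by positivity
  have p3 : 0 ≤ (4 * Real.pi ^ 2 * C + C) * (δ⁻¹ * (θ * P * K + Z)) := by positivity
  have p4 : 0 ≤ C * δ⁻¹ * (2 * (θ * P * K)) := by positivity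
  have p5 : 0 ≤ C * δ⁻¹ * ((2 * N + 1) * Z) := by positivity
  nlinarith

end EnergyIntegral

/-! ### Uniform constants, and bounded families with `L¹`-bounded derivatives -/

section Aux

variable {V : Set R4} {φ : R4 → ℝ} {A B : ℝ → R4 → ℝ}

theorem UB.uniform {ι : Type*} [Fintype ι] {A : ι → ℝ → R4 → ℝ} (h : ∀ i, UB V (A i)) :
    ∃ C, 0 ≤ C ∧ ∀ᶠ lam in 𝓝[>] (0 : ℝ), ∀ i, ∀ y ∈ V, |A i lam y| ≤ C := by
  choose C hC using h
  refine ⟨∑ i, |C i|, Finset.sum_nonneg fun _ _ => abs_nonneg _, ?_⟩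
  filter_upwards [eventually_all.2 hC] with lam h i y hy
  exact (h i y hy).trans ((le_abs_self _).trans
    (Finset.single_le_sum (f := fun i => |C i|) (fun _ _ => abs_nonneg _) (Finset.mem_univ i)))

theorem SB.uniform {ι : Type*} [Fintype ι] {A : ι → ℝ → R4 → ℝ} (h : ∀ i, SB V (A i)) :
    ∃ C, 0 ≤ C ∧ ∀ᶠ lam in 𝓝[>] (0 : ℝ), ∀ i, ∀ y ∈ V, |A i lam y| ≤ C * lam := by
  choose C hC using h
  refine ⟨∑ i, |C i|, Finset.sum_nonneg fun _ _ => abs_nonneg _, ?_⟩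
  filter_upwards [eventually_all.2 hC, eventually_pos] with lam h hl i y hy
  exact (h i y hy).trans (mul_le_mul_of_nonneg_right ((le_abs_self _).trans
    (Finset.single_le_sum (f := fun i => |C i|) (fun _ _ => abs_nonneg _) (Finset.mem_univ i))) hl.le)

/-- Families of functions that are bounded in `L¹`. -/
def IB (A : ℝ → R4 → ℝ) : Prop :=
  ∃ C, ∀ᶠ lam in 𝓝[>] (0 : ℝ), Integrable (A lam) ∧ ∫ y, |A lam y| ≤ C

theorem IB.add (hA : IB A) (hB : IB B) : IB (fun lam y => A lam y + B lam y) := by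
  obtain ⟨C, hC⟩ := hA
  obtain ⟨C', hC'⟩ := hB
  refine ⟨C + C', ?_⟩
  filter_upwards [hC, hC'] with lam h h'
  refine ⟨h.1.add h'.1, ?_⟩
  calc ∫ y, |A lam y + B lam y| ≤ ∫ y, (|A lam y| + |B lam y|) :=
        integral_mono (h.1.add h'.1).abs (h.1.abs.add h'.1.abs) fun y => abs_add_le _ _
    _ ≤ C + C' := by rw [integral_add h.1.abs h'.1.abs]; exact add_le_add h.2 h'.2

theorem IB.const_mul (hA : IB A) (c : ℝ) : IB (fun lam y => c * A lam y) := by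
  obtain ⟨C, hC⟩ := hA
  refine ⟨|c| * C, ?_⟩
  filter_upwards [hC] with lam h
  refine ⟨h.1.const_mul c, ?_⟩
  simp_rw [abs_mul]
  rw [integral_const_mul]
  exact mul_le_mul_of_nonneg_left h.2 (abs_nonneg _)

theorem IB.sum {ι : Type*} {s : Finset ι} {A : ι → ℝ → R4 → ℝ} (h : ∀ i ∈ s, IB (A i)) :
    IB (fun lam y => ∑ i ∈ s, A i lam y) := by
  classical
  induction s using Finset.induction_on with
  | empty => exact ⟨0, by simp⟩
  | insert i s hi ih =>
    simp only [Finset.sum_insert hi]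
    exact (h i (Finset.mem_insert_self i s)).add (ih fun j hj => h j (Finset.mem_insert_of_mem hj))

theorem IB.congr (hA : IB A) (h : ∀ lam, 0 < lam → ∀ y, A lam y = B lam y) : IB B := by
  obtain ⟨C, hC⟩ := hA
  refine ⟨C, ?_⟩
  filter_upwards [hC, eventually_pos] with lam h' hl
  rwa [← funext (h lam hl)]

theorem LB.ib (hV : IsOpen V) (hA : LB V A) (hAc : ∀ lam, 0 < lam → ContinuousOn (A lam) V)
    (hφ : IsTest V φ) : IB (fun lam y => φ y * A lam y) := by
  obtain ⟨C, hC⟩ := hA φ hφ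
  refine ⟨C, ?_⟩
  filter_upwards [hC, eventually_pos] with lam h hl
  exact ⟨hφ.integrable_mul hV (hAc lam hl), h⟩

theorem LB.const {A₀ : R4 → ℝ} : LB V (fun _ => A₀) := fun φ _ => ⟨∫ y, |φ y * A₀ y|, by simp⟩

theorem SM.differentiableAt (hV : IsOpen V) (hA : SM V A) {lam : ℝ} (hl : 0 < lam) {y : R4}
    (hy : y ∈ V) : DifferentiableAt ℝ (A lam) y :=
  ((hA lam hl).contDiffAt (hV.mem_nhds hy)).differentiableAt (by simp)

/-- Bounded families of smooth functions whose first derivatives are locally bounded in `L¹`. -/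
structure PB (V : Set R4) (A : ℝ → R4 → ℝ) : Prop where
  smooth : SM V A
  bdd : UB V A
  lb : ∀ i, LB V (fun lam => pd i (A lam))

theorem PB.add (hV : IsOpen V) (hA : PB V A) (hB : PB V B) :
    PB V (fun lam y => A lam y + B lam y) := by
  refine ⟨hA.smooth.add hB.smooth, hA.bdd.add hB.bdd, fun i => ?_⟩
  refine ((hA.lb i).add hV (hB.lb i) (hA.smooth.pd hV i).cont (hB.smooth.pd hV i).cont).congr
    fun lam hl y hy => ?_
  rw [pd_add (hA.smooth.differentiableAt hV hl hy) (hB.smooth.differentiableAt hV hl hy)]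

theorem PB.mul (hV : IsOpen V) (hA : PB V A) (hB : PB V B) :
    PB V (fun lam y => A lam y * B lam y) := by
  refine ⟨hA.smooth.mul hB.smooth, hA.bdd.mul hB.bdd, fun i => ?_⟩
  have h1 := LB.ub_mul hV hB.bdd (hA.lb i) hB.smooth.cont (hA.smooth.pd hV i).cont
  have h2 := LB.ub_mul hV hA.bdd (hB.lb i) hA.smooth.cont (hB.smooth.pd hV i).cont
  refine (h1.add hV h2 (hB.smooth.mul (hA.smooth.pd hV i)).cont
    (hA.smooth.mul (hB.smooth.pd hV i)).cont).congr fun lam hl y hy => ?_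
  rw [pd_mul (hA.smooth.differentiableAt hV hl hy) (hB.smooth.differentiableAt hV hl hy)]
  ring

theorem PB.const (c : ℝ) : PB V (fun _ _ => c) :=
  ⟨SM.const c, UB.const c, fun i => LB.const (A₀ := pd i fun _ => c)⟩

theorem PB.sum (hV : IsOpen V) {ι : Type*} {s : Finset ι} {A : ι → ℝ → R4 → ℝ}
    (h : ∀ i ∈ s, PB V (A i)) : PB V (fun lam y => ∑ i ∈ s, A i lam y) := by
  classical
  induction s using Finset.induction_on with
  | empty => simpa using PB.const 0
  | insert i s hi ih =>
    simp only [Finset.sum_insert hi]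
    exact (h i (Finset.mem_insert_self i s)).add hV
      (ih fun j hj => h j (Finset.mem_insert_of_mem hj))

end Aux

/-! ### The symmetrised potential of the Ricci tensor -/

section SymX

/-- The symmetrisation of `ricciX`. -/
def symX (M : Matrix (Fin 4) (Fin 4) ℝ) (D : Fin 4 → Fin 4 → Fin 4 → ℝ) (j k a : Fin 4) : ℝ :=
  ricciX M D a j k + ricciX M D a k j

theorem ricciX_sub_left (M M' : Matrix (Fin 4) (Fin 4) ℝ) (D : Fin 4 → Fin 4 → Fin 4 → ℝ)
    (a j k : Fin 4) : ricciX (M - M') D a j k = ricciX M D a j k - ricciX M' D a j k := by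
  simp only [ricciX, Matrix.sub_apply, sub_mul, Finset.sum_sub_distrib, mul_sub]
  split_ifs <;> ring

theorem symX_sub_left (M M' : Matrix (Fin 4) (Fin 4) ℝ) (D : Fin 4 → Fin 4 → Fin 4 → ℝ)
    (j k a : Fin 4) : symX (M - M') D j k a = symX M D j k a - symX M' D j k a := by
  simp only [symX, ricciX_sub_left]; ring

theorem symX_linear (M : Matrix (Fin 4) (Fin 4) ℝ) (r : ℝ) (D D' : Fin 4 → Fin 4 → Fin 4 → ℝ)
    (j k a : Fin 4) : symX M (fun b c d => r * D b c d + D' b c d) j k a =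
      r * symX M D j k a + symX M D' j k a := by
  simp only [symX, ricciX_linear]; ring

theorem exists_symX_eq_sum (M : Matrix (Fin 4) (Fin 4) ℝ) (j k a : Fin 4) :
    ∃ K : Fin 4 → Fin 4 → Fin 4 → ℝ, ∀ D, symX M D j k a = ∑ b, ∑ c, ∑ d, K b c d * D b c d :=
  exists_eq_sum_of_linear _ fun r D D' => symX_linear M r D D' j k a

theorem abs_lowChr_le {D : Fin 4 → Fin 4 → Fin 4 → ℝ} {d : ℝ} (hD : ∀ a b c, |D a b c| ≤ d)
    (l j k : Fin 4) : |lowChr D l j k| ≤ 3 * d := by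
  have h1 := abs_le.1 (hD j l k)
  have h2 := abs_le.1 (hD k l j)
  have h3 := abs_le.1 (hD l j k)
  rw [lowChr, abs_le]
  constructor <;> linarith [h1.1, h1.2, h2.1, h2.2, h3.1, h3.2]

/-- Counting terms: each lowered Christoffel symbol has three derivatives, the two contractions have
`4` and `16` entries, each with factor `1 / 2`, and symmetrisation doubles the total. -/
theorem abs_symX_le {M : Matrix (Fin 4) (Fin 4) ℝ} {D : Fin 4 → Fin 4 → Fin 4 → ℝ} {μ d : ℝ}
    (hM : ∀ i l, |M i l| ≤ μ) (hD : ∀ a b c, |D a b c| ≤ d) (j k a : Fin 4) :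
    |symX M D j k a| ≤ 60 * (μ * d) := by
  have hμ : 0 ≤ μ := (abs_nonneg _).trans (hM 0 0)
  have hd : 0 ≤ d := (abs_nonneg _).trans (hD 0 0 0)
  have h1 : ∀ i l j k, |M i l * lowChr D l j k| ≤ 3 * (μ * d) := fun i l j k => by
    rw [abs_mul]
    calc _ ≤ μ * (3 * d) := mul_le_mul (hM i l) (abs_lowChr_le hD l j k) (abs_nonneg _) hμ
      _ = _ := by ring
  have h2 : ∀ i j k, |∑ l, M i l * lowChr D l j k| ≤ 12 * (μ * d) := fun i j k => by
    refine (Finset.abs_sum_le_sum_abs _ _).trans ((Finset.sum_le_sum fun l _ => h1 i l j k).trans ?_)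
    simp; linarith
  have h3 : ∀ k, |∑ i, ∑ l, M i l * lowChr D l i k| ≤ 48 * (μ * d) := fun k => by
    refine (Finset.abs_sum_le_sum_abs _ _).trans ((Finset.sum_le_sum fun i _ => h2 i i k).trans ?_)
    simp; linarith
  have h4 : ∀ a j k, |ricciX M D a j k| ≤ 30 * (μ * d) := fun a j k => by
    have e1 := abs_le.1 (h2 a j k)
    have e2 := abs_le.1 (h3 k)
    have := mul_nonneg hμ hd
    rw [ricciX, abs_le]
    split_ifs <;> constructor <;> linarith [e1.1, e1.2, e2.1, e2.2]
  rw [symX]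
  refine (abs_add_le _ _).trans ?_
  linarith [h4 a j k, h4 a k j]

end SymX

/-! ### The divergence structure of the Ricci tensor of the family -/

namespace LocalFamily

variable {V : Set R4} {G : ℝ → R4 → Matrix (Fin 4) (Fin 4) ℝ}
  {m : (Fin 6 → Fin 4) → R4 → ℝ} {Λ : ℝ}

/-- This identifies the field whose divergence is the second-order part of the Ricci tensor: both of
its derivative terms are combined under a single divergence. -/
theorem ricciX_eq_christoffel (G : R4 → Matrix (Fin 4) (Fin 4) ℝ) (a j k : Fin 4) (y : R4) :
    ricciX (G y)⁻¹ (fun b c d => pd b (fun z => G z c d) y) a j k =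
      christoffel G a j k y - if a = j then ∑ i, christoffel G i i k y else 0 := by
  simp only [ricciX, christoffel_eq, Finset.mul_sum]

/-- The divergence of `ricciX` is the Ricci tensor up to quadratic terms. -/
theorem div_ricciX (F : LocalFamily V G m Λ) {lam : ℝ} (hl : 0 < lam) {y : R4} (hy : y ∈ V)
    (j k : Fin 4) : ∑ a, pd a (fun z => ricciX (G lam z)⁻¹
        (fun b c d => pd b (fun z => G lam z c d) z) a j k) y =
      ricci (G lam) j k y - ∑ i, ∑ l, (christoffel (G lam) l j k y * christoffel (G lam) i l i y
        - christoffel (G lam) l i k y * christoffel (G lam) i l j y) := by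
  have hd : ∀ i j k, DifferentiableAt ℝ (christoffel (G lam) i j k) y := fun i j k =>
    (F.wc_christoffel i j k).smooth.differentiableAt F.isOpen hl hy
  have h1 : ∀ a, pd a (fun z => ricciX (G lam z)⁻¹
      (fun b c d => pd b (fun z => G lam z c d) z) a j k) y =
      pd a (christoffel (G lam) a j k) y -
        if a = j then ∑ i, pd j (christoffel (G lam) i i k) y else 0 := by
    intro a
    simp_rw [ricciX_eq_christoffel]
    split_ifs with h
    · have := Backreaction.pd_sub (hd a j k) (DifferentiableAt.fun_sum (u := Finset.univ)
        (A := fun i => christoffel (G lam) i i k) fun i _ => hd i i k) a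
      rw [this, pd_sum fun i _ => hd i i k, h]
    · simp only [sub_zero]
  simp_rw [h1]
  rw [Finset.sum_sub_distrib, Finset.sum_ite_eq', if_pos (Finset.mem_univ _), ricci,
    Finset.sum_add_distrib, Finset.sum_sub_distrib]
  ring

theorem sm_ricciX (F : LocalFamily V G m Λ) (a j k : Fin 4) : SM V fun lam z =>
    ricciX (G lam z)⁻¹ (fun b c d => pd b (fun z => G lam z c d) z) a j k := by
  have h : SM V fun lam y => christoffel (G lam) a j k y -
      if a = j then ∑ i, christoffel (G lam) i i k y else 0 := by
    refine (F.wc_christoffel a j k).smooth.sub ?_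
    split_ifs
    · exact SM.sum fun i _ => (F.wc_christoffel i i k).smooth
    · exact SM.const 0
  intro lam hl
  simp_rw [ricciX_eq_christoffel]
  exact h lam hl

theorem ub_ricciX (F : LocalFamily V G m Λ) (a j k : Fin 4) : UB V fun lam z =>
    ricciX (G lam z)⁻¹ (fun b c d => pd b (fun z => G lam z c d) z) a j k := by
  simp_rw [ricciX_eq_christoffel]
  refine (F.wc_christoffel a j k).bdd.sub ?_
  split_ifs
  · exact UB.sum fun i _ => (F.wc_christoffel i i k).bdd
  · exact UB.const 0

/-- The divergence differs from the symmetrised Ricci tensor by bounded products of Christoffel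
symbols, so the `L¹` bound supplied by the energy condition carries over. -/
theorem lb_div_ricciX (F : LocalFamily V G m Λ) (j k : Fin 4) : LB V fun lam y => ∑ a,
    pd a (fun z => ricciX (G lam z)⁻¹ (fun b c d => pd b (fun z => G lam z c d) z) a j k +
      ricciX (G lam z)⁻¹ (fun b c d => pd b (fun z => G lam z c d) z) a k j) y := by
  have hQ : ∀ j k, UB V fun lam y => ∑ i, ∑ l, (christoffel (G lam) l j k y *
      christoffel (G lam) i l i y - christoffel (G lam) l i k y * christoffel (G lam) i l j y) :=
    fun j k => UB.sum fun i _ => UB.sum fun l _ => (F.wc_christoffel_mul l j k i l i).bdd.sub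
      (F.wc_christoffel_mul l i k i l j).bdd
  have hQs : ∀ j k, SM V fun lam y => ∑ i, ∑ l, (christoffel (G lam) l j k y *
      christoffel (G lam) i l i y - christoffel (G lam) l i k y * christoffel (G lam) i l j y) :=
    fun j k => SM.sum fun i _ => SM.sum fun l _ => (F.wc_christoffel_mul l j k i l i).smooth.sub
      (F.wc_christoffel_mul l i k i l j).smooth
  have hN : LB V _ := ((hQ j k).add (hQ k j)).neg.lb F.isOpen
    fun lam hl => (((hQs j k).add (hQs k j)).cont lam hl).neg
  refine ((F.lb_ricci j k).add F.isOpen hN ((F.sm_ricci j k).add (F.sm_ricci k j)).cont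
    fun lam hl => (((hQs j k).add (hQs k j)).cont lam hl).neg).congr fun lam hl y hy => ?_
  have hd := fun a j k => (F.sm_ricciX a j k).differentiableAt F.isOpen hl hy
  simp_rw [pd_add (hd _ j k) (hd _ k j)]
  rw [Finset.sum_add_distrib, F.div_ricciX hl hy, F.div_ricciX hl hy]
  ring

theorem pb_inv (F : LocalFamily V G m Λ) (i j : Fin 4) : PB V fun lam y => (G lam y)⁻¹ i j :=
  ⟨(F.sc_inv i j).smooth, F.ub_inv i j, fun k => (F.ub_pd_inv k i j).lb F.isOpen
    ((F.sc_inv i j).smooth.pd F.isOpen k).cont⟩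

theorem pb_pd (F : LocalFamily V G m Λ) (k i j : Fin 4) : PB V fun _ => pd k fun z => G 0 z i j :=
  ⟨(F.sc_const k i j).smooth, F.bdd_deriv k i j, fun _ => LB.const⟩

/-- With background derivatives in the second argument, a further derivative produces only fixed
functions and first derivatives of the inverse metric; no second derivative of the perturbed metric
appears. -/
theorem pb_ricciX (F : LocalFamily V G m Λ) (a j k : Fin 4) : PB V fun lam z =>
    ricciX (G lam z)⁻¹ (fun b c d => pd b (fun z => G 0 z c d) z) a j k := by
  have hlow : ∀ l j k, PB V fun _ z => lowChr (fun b c d => pd b (fun z => G 0 z c d) z) l j k :=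
    fun l j k => by
      have := ((F.pb_pd j l k).add F.isOpen (F.pb_pd k l j)).add F.isOpen
        ((PB.const (-1)).mul F.isOpen (F.pb_pd l j k))
      simpa only [lowChr, sub_eq_add_neg, neg_mul, one_mul] using this
  have h1 : ∀ i j k, PB V fun lam z => ∑ l, (G lam z)⁻¹ i l *
      lowChr (fun b c d => pd b (fun z => G 0 z c d) z) l j k := fun i j k =>
    PB.sum F.isOpen fun l _ => (F.pb_inv i l).mul F.isOpen (hlow l j k)
  have h2 : PB V fun lam z => if a = j then 1 / 2 * ∑ i, ∑ l, (G lam z)⁻¹ i l *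
      lowChr (fun b c d => pd b (fun z => G 0 z c d) z) l i k else 0 := by
    split_ifs
    · exact (PB.const (1 / 2)).mul F.isOpen (PB.sum F.isOpen fun i _ => h1 i i k)
    · exact PB.const 0
  have h3 := ((PB.const (1 / 2)).mul F.isOpen (h1 a j k)).add F.isOpen
    ((PB.const (-1)).mul F.isOpen h2)
  simpa only [ricciX, sub_eq_add_neg, neg_mul, one_mul] using h3

end LocalFamily

theorem IsTest.exists_bound {V : Set R4} {φ : R4 → ℝ} (hφ : IsTest V φ) :
    ∃ C, 0 ≤ C ∧ ∀ y, |φ y| ≤ C := by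
  obtain ⟨C, hC⟩ := hφ.compact.exists_bound_of_continuous hφ.contDiff.continuous
  exact ⟨C, (norm_nonneg _).trans (hC 0), hC⟩

/-- If `f` were negative at a point, a bump function supported where `f` is negative would give a
negative integral. Squares of test functions suffice, and only these arise from a quadratic
expression in the cut-off perturbation. -/
theorem nonneg_of_integral_sq_nonneg {V : Set R4} (hV : IsOpen V) {f : R4 → ℝ}
    (hf : ContinuousOn f V) (h : ∀ φ, IsTest V φ → 0 ≤ ∫ y, φ y * φ y * f y) {y : R4}
    (hy : y ∈ V) : 0 ≤ f y := by
  by_contra! hneg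
  obtain ⟨U, hUV, hU, hyU⟩ : ∃ U ⊆ V, IsOpen U ∧ y ∈ U ∧ ∀ z ∈ U, f z < 0 := by
    have h1 : ∀ᶠ z in 𝓝 y, f z < 0 :=
      (hf.continuousAt (hV.mem_nhds hy)).eventually (gt_mem_nhds hneg)
    obtain ⟨U, hU, hUo, hyU⟩ := mem_nhds_iff.1 (inter_mem h1 (hV.mem_nhds hy))
    exact ⟨U, fun z hz => (hU hz).2, hUo, hyU, fun z hz => (hU hz).1⟩
  obtain ⟨φ, hφ, -, -, hφ1⟩ := exists_isTest_eq_one hU (isCompact_singleton (x := y))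
    (singleton_subset_iff.2 hyU.1)
  have hφV := hφ.mono hUV
  have hφφ := hφV.mul hV hφ.contDiff.contDiffOn
  have hc : Continuous fun z => φ z * φ z * f z := hφφ.continuous_mul hV hf
  have hpos : 0 < ∫ z, -(φ z * φ z * f z) := by
    refine hc.neg.integral_pos_of_hasCompactSupport_nonneg_nonzero (x := y) ?_ ?_ ?_
    · exact (hφφ.compact.mul_right (f' := f)).neg
    · intro z
      by_cases hz : z ∈ U
      · have := mul_nonneg (mul_self_nonneg (φ z)) (neg_nonneg.2 (hyU.2 z hz).le)
        simp only [Pi.zero_apply]; linarith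
      · simp [hφ.eq_zero hz]
    · rw [hφ1 y rfl]; simp only [one_mul, ne_eq, neg_eq_zero]; exact hneg.ne
  rw [integral_neg] at hpos
  linarith [h φ hφV]

theorem minkowski_abs_le (i l : Fin 4) : |minkowski i l| ≤ 1 := by
  fin_cases i <;> fin_cases l <;> simp [minkowski, Matrix.diagonal]

/-- The deviation from the background metric, cut off. -/
def cutDiff (φ : R4 → ℝ) (G : ℝ → R4 → Matrix (Fin 4) (Fin 4) ℝ) (lam : ℝ) (c d : Fin 4)
    (y : R4) : ℝ := φ y * (G lam y c d - G 0 y c d)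

/-- The linearised `ricciX` with the leading coefficients frozen. -/
def diffX (M : Matrix (Fin 4) (Fin 4) ℝ) (G : ℝ → R4 → Matrix (Fin 4) (Fin 4) ℝ) (lam : ℝ)
    (j k a : Fin 4) (y : R4) : ℝ :=
  symX M (fun b c d => pd b (fun z => G lam z c d - G 0 z c d) y) j k a

/-! ### Cutting off the perturbation and freezing the coefficients -/

namespace LocalFamily

variable {V : Set R4} {G : ℝ → R4 → Matrix (Fin 4) (Fin 4) ℝ}
  {m : (Fin 6 → Fin 4) → R4 → ℝ} {Λ : ℝ} {φ : R4 → ℝ}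

theorem sm_diff (F : LocalFamily V G m Λ) (c d : Fin 4) :
    SM V fun lam y => G lam y c d - G 0 y c d :=
  fun lam hl => (F.smooth lam hl.le c d).sub (F.smooth 0 le_rfl c d)

theorem isTest_cutDiff (F : LocalFamily V G m Λ) (hφ : IsTest V φ) {lam : ℝ} (hl : 0 < lam)
    (c d : Fin 4) : IsTest V (cutDiff φ G lam c d) :=
  hφ.mul F.isOpen (F.sm_diff c d lam hl)

theorem cutDiff_symm (F : LocalFamily V G m Λ) (hφ : IsTest V φ) {lam : ℝ} (hl : 0 < lam)
    (c d : Fin 4) : cutDiff φ G lam c d = cutDiff φ G lam d c := by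
  funext y
  by_cases hy : y ∈ V
  · simp only [cutDiff, F.symm lam hl.le y hy c d, F.symm 0 le_rfl y hy c d]
  · simp only [cutDiff, hφ.eq_zero hy, zero_mul]

theorem pd_cutDiff (F : LocalFamily V G m Λ) (hφ : IsTest V φ) {lam : ℝ} (hl : 0 < lam)
    (a c d : Fin 4) (y : R4) : pd a (cutDiff φ G lam c d) y =
      φ y * pd a (fun z => G lam z c d - G 0 z c d) y + pd a φ y * (G lam y c d - G 0 y c d) := by
  by_cases hy : y ∈ V
  · have h := pd_mul (hφ.contDiff.differentiable (by simp) y)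
      ((F.sm_diff c d).differentiableAt F.isOpen hl hy) a
    rw [show cutDiff φ G lam c d = fun z => φ z * (G lam z c d - G 0 z c d) from rfl, h]
    ring
  · rw [((F.isTest_cutDiff hφ hl c d).pd a).eq_zero hy, hφ.eq_zero hy, (hφ.pd a).eq_zero hy]
    ring

/-- A derivative that falls on the cutoff leaves an undifferentiated factor `O(lam)`. Only the
product with `φ²` in front of two differentiated perturbations survives. -/
theorem tendsto_gradSq (F : LocalFamily V G m Λ) (hφ : IsTest V φ) (I : Fin 6 → Fin 4) :
    Tendsto (fun lam => ∫ y, gradSq (cutDiff φ G lam) y I) (𝓝[>] 0)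
      (𝓝 (∫ y, φ y * φ y * m I y)) := by
  have hV := F.isOpen
  have t0 := hφ.mul hV hφ.contDiff.contDiffOn
  have t1 := hφ.mul hV (hφ.pd (I 1)).contDiff.contDiffOn
  have t2 := hφ.mul hV (hφ.pd (I 0)).contDiff.contDiffOn
  have t3 := (hφ.pd (I 0)).mul hV (hφ.pd (I 1)).contDiff.contDiffOn
  have s1 := WConv.of_sb hV ((F.small (I 4) (I 5)).ub_mul (F.deriv (I 0) (I 2) (I 3)))
    (((F.sm_diff (I 2) (I 3)).pd hV (I 0)).mul (F.sm_diff (I 4) (I 5))).cont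
  have s2 := WConv.of_sb hV ((F.small (I 2) (I 3)).mul_ub (F.deriv (I 1) (I 4) (I 5)))
    ((F.sm_diff (I 2) (I 3)).mul ((F.sm_diff (I 4) (I 5)).pd hV (I 1))).cont
  have s3 := WConv.of_sb hV ((F.small (I 2) (I 3)).mul_ub (F.small (I 4) (I 5)).ub)
    ((F.sm_diff (I 2) (I 3)).mul (F.sm_diff (I 4) (I 5))).cont
  have hlim := (((F.weak I).lim _ t0).add (s1.lim _ t1)).add ((s2.lim _ t2).add (s3.lim _ t3))
  simp only [mul_zero, integral_zero, add_zero] at hlim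
  refine hlim.congr' ?_
  filter_upwards [eventually_pos] with lam hl
  have i0 := t0.integrable_mul hV ((F.weak I).cont lam hl)
  have i1 := t1.integrable_mul hV (s1.cont lam hl)
  have i2 := t2.integrable_mul hV (s2.cont lam hl)
  have i3 := t3.integrable_mul hV (s3.cont lam hl)
  rw [← integral_add i0 i1, ← integral_add i2 i3]
  refine (integral_add (i0.add i1) (i2.add i3)).symm.trans ?_
  refine integral_congr_ae (ae_of_all _ fun y => ?_)
  simp only [Pi.add_apply, gradSq, F.pd_cutDiff hφ hl]
  ring

theorem tendsto_einsteinQ (F : LocalFamily V G m Λ) (hφ : IsTest V φ) :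
    Tendsto (fun lam => ∫ y, -einsteinQ minkowski (gradSq (cutDiff φ G lam) y) 0 0) (𝓝[>] 0)
      (𝓝 (∫ y, φ y * φ y * -einsteinQ minkowski (fun I => m I y) 0 0)) := by
  obtain ⟨c, hc⟩ := exists_einsteinQ_eq_sum minkowski 0 0
  have t0 := hφ.mul F.isOpen hφ.contDiff.contDiffOn
  have h0 : ∫ y, φ y * φ y * -einsteinQ minkowski (fun I => m I y) 0 0 =
      ∑ I, -c I * ∫ y, φ y * φ y * m I y := by
    simp_rw [← integral_const_mul]
    rw [← integral_finsetSum _ fun I _ =>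
      (t0.integrable_mul F.isOpen (F.smooth_weak I).continuousOn).const_mul _]
    refine integral_congr_ae (ae_of_all _ fun y => ?_)
    simp only [hc, ← Finset.sum_neg_distrib, Finset.mul_sum]
    exact Finset.sum_congr rfl fun I _ => by ring
  rw [h0]
  refine (tendsto_finsetSum _ fun I _ => (F.tendsto_gradSq hφ I).const_mul (-c I)).congr' ?_
  filter_upwards [eventually_pos] with lam hl
  have hψ := fun c d => (F.isTest_cutDiff hφ hl c d).mono (subset_univ V)
  simp_rw [← integral_const_mul]
  rw [← integral_finsetSum _ fun I _ => (integrable_gradSq hψ I).const_mul _]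
  refine integral_congr_ae (ae_of_all _ fun y => ?_)
  simp only [hc, ← Finset.sum_neg_distrib]
  exact Finset.sum_congr rfl fun I _ => by ring

theorem diffX_inv (F : LocalFamily V G m Λ) {lam : ℝ} (hl : 0 < lam) {y : R4} (hy : y ∈ V)
    (M : Matrix (Fin 4) (Fin 4) ℝ) (j k a : Fin 4) : diffX M G lam j k a y =
      symX M (fun b c d => pd b (fun z => G lam z c d) y) j k a -
        symX M (fun b c d => pd b (fun z => G 0 z c d) y) j k a := by
  have := symX_linear M (-1) (fun b c d => pd b (fun z => G 0 z c d) y)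
    (fun b c d => pd b (fun z => G lam z c d) y) j k a
  rw [diffX]
  simp_rw [F.pd_sub hl.le hy]
  rw [show (fun b c d => pd b (fun z => G lam z c d) y - pd b (fun z => G 0 z c d) y) =
    (fun b c d => -1 * pd b (fun z => G 0 z c d) y + pd b (fun z => G lam z c d) y) from by
      funext b c d; ring, this]
  ring

theorem sm_diffX (F : LocalFamily V G m Λ) (M : Matrix (Fin 4) (Fin 4) ℝ) (j k a : Fin 4) :
    SM V fun lam => diffX M G lam j k a := by
  obtain ⟨K, hK⟩ := exists_symX_eq_sum M j k a
  have : SM V fun lam y => ∑ b, ∑ c, ∑ d, K b c d * pd b (fun z => G lam z c d - G 0 z c d) y :=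
    SM.sum fun b _ => SM.sum fun c _ => SM.sum fun d _ =>
      (SM.const _).mul ((F.sm_diff c d).pd F.isOpen b)
  intro lam hl
  exact (this lam hl).congr fun y _ => hK _

theorem sm_symX (F : LocalFamily V G m Λ) (j k a : Fin 4) : SM V fun lam z =>
    symX (G lam z)⁻¹ (fun b c d => pd b (fun z => G lam z c d) z) j k a :=
  (F.sm_ricciX a j k).add (F.sm_ricciX a k j)

theorem pb_symX (F : LocalFamily V G m Λ) (j k a : Fin 4) : PB V fun lam z =>
    symX (G lam z)⁻¹ (fun b c d => pd b (fun z => G 0 z c d) z) j k a :=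
  (F.pb_ricciX a j k).add F.isOpen (F.pb_ricciX a k j)

theorem sm_diffX_inv (F : LocalFamily V G m Λ) (j k a : Fin 4) :
    SM V fun lam y => diffX (G lam y)⁻¹ G lam j k a y := fun lam hl =>
  (((F.sm_symX j k a).sub (F.pb_symX j k a).smooth) lam hl).congr fun _ hy => F.diffX_inv hl hy _ j k a

theorem ub_diffX_inv (F : LocalFamily V G m Λ) (j k a : Fin 4) :
    UB V fun lam y => diffX (G lam y)⁻¹ G lam j k a y :=
  (((F.ub_ricciX a j k).add (F.ub_ricciX a k j)).sub (F.pb_symX j k a).bdd).congr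
    fun _ hl _ hy => (F.diffX_inv hl hy _ j k a).symm

/-- With the true inverse metric as coefficient, the divergence is the one controlled by the Ricci
tensor minus one in which only background derivatives are differentiated again. -/
theorem lb_div_diffX_inv (F : LocalFamily V G m Λ) (j k : Fin 4) :
    LB V fun lam y => ∑ a, pd a (fun z => diffX (G lam z)⁻¹ G lam j k a z) y := by
  have hV := F.isOpen
  have h1 : LB V fun lam y => ∑ a, -1 * pd a (fun z =>
      symX (G lam z)⁻¹ (fun b c d => pd b (fun z => G 0 z c d) z) j k a) y :=
    LB.sum hV (fun a _ => LB.ub_mul hV (UB.const _) ((F.pb_symX j k a).lb a)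
      (fun _ _ => continuousOn_const) ((F.pb_symX j k a).smooth.pd hV a).cont)
      fun a _ => ((SM.const _).mul ((F.pb_symX j k a).smooth.pd hV a)).cont
  refine ((F.lb_div_ricciX j k).add hV h1 (SM.sum fun a _ => (F.sm_symX j k a).pd hV a).cont
    (SM.sum fun a _ => (SM.const _).mul ((F.pb_symX j k a).smooth.pd hV a)).cont).congr
      fun lam hl y hy => ?_
  rw [← Finset.sum_add_distrib]
  refine Finset.sum_congr rfl fun a _ => ?_
  rw [pd_congr hV hy (fun z hz => F.diffX_inv hl hz (G lam z)⁻¹ j k a) a, Backreaction.pd_sub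
    ((F.sm_symX j k a).differentiableAt hV hl hy)
    ((F.pb_symX j k a).smooth.differentiableAt hV hl hy)]
  simp only [symX]
  ring

/-- The error of freezing the leading coefficients. -/
def freezeErr (φ : R4 → ℝ) (G : ℝ → R4 → Matrix (Fin 4) (Fin 4) ℝ) (lam : ℝ) (j k a : Fin 4)
    (y : R4) : ℝ := φ y * diffX (minkowski - (G lam y)⁻¹) G lam j k a y

theorem isTest_freezeErr (F : LocalFamily V G m Λ) (hφ : IsTest V φ) {lam : ℝ} (hl : 0 < lam)
    (j k a : Fin 4) : IsTest V (freezeErr φ G lam j k a) :=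
  hφ.mul F.isOpen (((F.sm_diffX minkowski j k a).sub (F.sm_diffX_inv j k a) lam hl).congr
    fun _ _ => symX_sub_left _ _ _ _ _ _)

theorem linX_cutDiff (F : LocalFamily V G m Λ) (hφ : IsTest V φ) {lam : ℝ} (hl : 0 < lam)
    (j k a : Fin 4) (y : R4) : linX (cutDiff φ G lam) j k a y =
      φ y * diffX minkowski G lam j k a y +
        symX minkowski (fun b c d => pd b φ y * (G lam y c d - G 0 y c d)) j k a := by
  change symX minkowski (fun b c d => pd b (cutDiff φ G lam c d) y) j k a = _
  simp_rw [F.pd_cutDiff hφ hl]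
  exact symX_linear _ _ _ _ _ _ _

/-- The field `linX` of the cut-off perturbation uses Minkowski coefficients. Subtracting the
freezing error replaces them by the true inverse metric, for which the divergence is locally
`L¹`-bounded; every other term has a derivative on the cutoff and at most one on the perturbation.
Thus the linearised Ricci tensor is `L¹`-bounded up to the divergence of `freezeErr`. -/
theorem ib_div (F : LocalFamily V G m Λ) (hφ : IsTest V φ) (j k : Fin 4) :
    IB fun lam y => ∑ a, pd a (linX (cutDiff φ G lam) j k a) y -
      ∑ a, pd a (freezeErr φ G lam j k a) y := by
  have hV := F.isOpen
  have h1 : IB fun lam y => φ y * ∑ a, pd a (fun z => diffX (G lam z)⁻¹ G lam j k a z) y :=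
    (F.lb_div_diffX_inv j k).ib hV (SM.sum fun a _ => (F.sm_diffX_inv j k a).pd hV a).cont hφ
  have h2 : ∀ a, IB fun lam y => pd a φ y * diffX (G lam y)⁻¹ G lam j k a y := fun a =>
    ((F.ub_diffX_inv j k a).lb hV (F.sm_diffX_inv j k a).cont).ib hV (F.sm_diffX_inv j k a).cont
      (hφ.pd a)
  choose K hK using exists_symX_eq_sum minkowski j k
  have h3 : ∀ a b c d, IB fun lam y => pd b φ y * pd a (fun z => G lam z c d - G 0 z c d) y :=
    fun a b c d => ((F.deriv a c d).lb hV ((F.sm_diff c d).pd hV a).cont).ib hV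
      ((F.sm_diff c d).pd hV a).cont (hφ.pd b)
  have h4 : ∀ a b c d, IB fun lam y => pd a (pd b φ) y * (G lam y c d - G 0 y c d) :=
    fun a b c d => ((F.small c d).ub.lb hV (F.sm_diff c d).cont).ib hV (F.sm_diff c d).cont
      ((hφ.pd b).pd a)
  have h5 : IB fun lam y => (φ y * ∑ a, pd a (fun z => diffX (G lam z)⁻¹ G lam j k a z) y +
      ∑ a, pd a φ y * diffX (G lam y)⁻¹ G lam j k a y) + ∑ a, ∑ b, ∑ c, ∑ d, K a b c d *
        (pd b φ y * pd a (fun z => G lam z c d - G 0 z c d) y +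
          pd a (pd b φ) y * (G lam y c d - G 0 y c d)) :=
    (h1.add (IB.sum fun a _ => h2 a)).add (IB.sum fun a _ => IB.sum fun b _ => IB.sum fun c _ =>
      IB.sum fun d _ => ((h3 a b c d).add (h4 a b c d)).const_mul _)
  refine h5.congr fun lam hl y => ?_
  have tl := fun a => isTest_linX (F.isTest_cutDiff hφ hl) j k a
  have tf := fun a => F.isTest_freezeErr hφ hl j k a
  by_cases hy : y ∈ V
  · rw [← Finset.sum_sub_distrib, Finset.mul_sum, ← Finset.sum_add_distrib,
      ← Finset.sum_add_distrib]
    refine Finset.sum_congr rfl fun a _ => ?_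
    rw [← Backreaction.pd_sub ((tl a).contDiff.differentiable (by simp) y)
      ((tf a).contDiff.differentiable (by simp) y)]
    have he : (fun z => linX (cutDiff φ G lam) j k a z - freezeErr φ G lam j k a z) = fun z =>
        φ z * diffX (G lam z)⁻¹ G lam j k a z +
          ∑ b, ∑ c, ∑ d, K a b c d * (pd b φ z * (G lam z c d - G 0 z c d)) := by
      funext z
      rw [F.linX_cutDiff hφ hl, hK, freezeErr]
      have := symX_sub_left minkowski (G lam z)⁻¹
        (fun b c d => pd b (fun z => G lam z c d - G 0 z c d) z) j k a
      simp only [diffX] at this ⊢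
      rw [this]; ring
    have hdφ := hφ.contDiff.differentiable (by simp) y
    have hdR := (F.sm_diffX_inv j k a).differentiableAt hV hl hy
    have hd1 : ∀ b c d, DifferentiableAt ℝ
        (fun z => pd b φ z * (G lam z c d - G 0 z c d)) y := fun b c d =>
      ((hφ.pd b).contDiff.differentiable (by simp) y).mul
        ((F.sm_diff c d).differentiableAt hV hl hy)
    have hd2 := fun b c d => (hd1 b c d).const_mul (K a b c d)
    have hd3 := fun b c => DifferentiableAt.fun_sum (u := Finset.univ) fun d _ => hd2 b c d
    have hd4 := fun b => DifferentiableAt.fun_sum (u := Finset.univ) fun c _ => hd3 b c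
    rw [he, pd_add (hdφ.fun_mul hdR) (DifferentiableAt.fun_sum fun b _ => hd4 b), pd_mul hdφ hdR,
      pd_sum fun b _ => hd4 b]
    simp_rw [pd_sum fun c _ => hd3 _ c, pd_sum fun d _ => hd2 _ _ d]
    have hp : ∀ b c d, pd a (fun z => K a b c d * (pd b φ z * (G lam z c d - G 0 z c d))) y =
        K a b c d * (pd b φ y * pd a (fun z => G lam z c d - G 0 z c d) y +
          pd a (pd b φ) y * (G lam y c d - G 0 y c d)) := fun b c d => by
      rw [pd_mul (differentiableAt_const _) (hd1 b c d),
        pd_mul ((hφ.pd b).contDiff.differentiable (by simp) y)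
          ((F.sm_diff c d).differentiableAt hV hl hy)]
      simp only [pd, fderiv_fun_const, Pi.zero_apply, zero_apply]
      ring
    simp_rw [hp]
    ring
  · have e1 := fun a => ((tl a).pd a).eq_zero hy
    have e2 := fun a => ((tf a).pd a).eq_zero hy
    have e3 := fun a => (hφ.pd a).eq_zero hy
    have e4 := fun a b => ((hφ.pd b).pd a).eq_zero hy
    simp [e1, e2, e3, e4, hφ.eq_zero hy]

end LocalFamily

/-! ### The limit of the energy inequality -/

namespace LocalFamily

variable {V : Set R4} {G : ℝ → R4 → Matrix (Fin 4) (Fin 4) ℝ}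
  {m : (Fin 6 → Fin 4) → R4 → ℝ} {Λ : ℝ} {φ : R4 → ℝ}

/-- Only first derivatives of the perturbation enter, and these are bounded; this is the bounded
potential required by the Murat estimate. -/
theorem exists_bound_linX (F : LocalFamily V G m Λ) (hφ : IsTest V φ) :
    ∃ P, ∀ᶠ lam in 𝓝[>] (0 : ℝ), ∀ j k a y, |linX (cutDiff φ G lam) j k a y| ≤ P := by
  obtain ⟨d, hd0, hd⟩ := UB.uniform (ι := Fin 4 × Fin 4 × Fin 4)
    fun i => F.deriv i.1 i.2.1 i.2.2
  obtain ⟨e, he0, he⟩ := UB.uniform (ι := Fin 4 × Fin 4) fun i => (F.small i.1 i.2).ub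
  obtain ⟨A, hA0, hA⟩ := hφ.exists_bound
  choose B hB0 hB using fun a => (hφ.pd a).exists_bound
  refine ⟨60 * (1 * (d * A + e * ∑ a, B a)), ?_⟩
  filter_upwards [hd, he, eventually_pos] with lam hd he hl j k a y
  refine abs_symX_le minkowski_abs_le (fun b c f => ?_) j k a
  rw [F.pd_cutDiff hφ hl]
  refine (abs_add_le _ _).trans (add_le_add ?_ ?_)
  · refine (hφ.abs_mul_le (hd (b, c, f)) y).trans (mul_le_mul_of_nonneg_left (hA y) hd0)
  · refine ((hφ.pd b).abs_mul_le (he (c, f)) y).trans (mul_le_mul_of_nonneg_left ?_ he0)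
    exact (hB b y).trans (Finset.single_le_sum (f := B) (fun i _ => hB0 i) (Finset.mem_univ b))

/-- The integrated inequality is applied to the cut-off perturbation with `θ = √lam` and `δ = ε`. As
`lam → 0` the amplitude term and the `L¹` term vanish. The gradient term tends to a trace of `m`
with factor `ε`, and the freezing error contributes `ε⁻¹ ε² = ε`. The constants do not depend on
`ε`, `U` or `φ`. -/
theorem exists_energy_bound (F : LocalFamily V G m Λ) : ∃ C N : ℝ, 0 ≤ C ∧ ∀ ε, 0 < ε → ∀ U ⊆ V,
    (∀ y ∈ U, ∀ i l, |minkowski i l - (G 0 y)⁻¹ i l| ≤ ε) → ∀ φ, IsTest U φ →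
      0 ≤ ∫ y, φ y * φ y * (-einsteinQ minkowski (fun I => m I y) 0 0 +
        C * ε * ((∑ c, ∑ d, ∑ a, m ![a, a, c, d, c, d] y) + N)) := by
  obtain ⟨C, hC0, hC⟩ := exists_integral_energy_ge
  obtain ⟨D, hD0, hD⟩ := UB.uniform (ι := Fin 4 × Fin 4 × Fin 4)
    fun i => F.deriv i.1 i.2.1 i.2.2
  -- `64` counts the index triples `j, k, a`. `120 = 60 · 2` is the bound for `symX` on a matrix
  -- with entries at most `2ε`, and `D` bounds the derivatives of the perturbation.
  refine ⟨C, 64 * (120 * D) ^ 2, hC0, fun ε hε U hUV hU φ hφU => ?_⟩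
  have hV := F.isOpen
  have hφ := hφU.mono hUV
  have t0 := hφ.mul hV hφ.contDiff.contDiffOn
  obtain ⟨J, hJ⟩ : ∃ J, J = ∫ y, φ y * φ y := ⟨_, rfl⟩
  have hJ0 : 0 ≤ J := hJ ▸ integral_nonneg fun y => mul_self_nonneg _
  obtain ⟨E, hE0, hE⟩ := SB.uniform (ι := Fin 4 × Fin 4) fun i => F.small i.1 i.2
  obtain ⟨H, hH0, hH⟩ := SB.uniform (ι := Fin 4 × Fin 4) fun i => (F.sc_inv i.1 i.2).sb
  obtain ⟨P, hP⟩ := F.exists_bound_linX hφ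
  obtain ⟨K, hK⟩ : ∃ K, ∀ᶠ lam in 𝓝[>] (0 : ℝ), ∀ j k,
      ∫ y, |∑ a, pd a (linX (cutDiff φ G lam) j k a) y -
        ∑ a, pd a (freezeErr φ G lam j k a) y| ≤ K := by
    choose K hK using fun i : Fin 4 × Fin 4 => F.ib_div hφ i.1 i.2
    refine ⟨∑ i, |K i|, ?_⟩
    filter_upwards [eventually_all.2 hK] with lam h j k
    exact (h (j, k)).2.trans ((le_abs_self _).trans (Finset.single_le_sum
      (f := fun i => |K i|) (fun _ _ => abs_nonneg _) (Finset.mem_univ (j, k))))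
  have hlow : ∀ᶠ lam in 𝓝[>] (0 : ℝ), -(C * (16 * E ^ 2 * J * lam +
      ε * (∑ c, ∑ d, ∑ a, ∫ y, gradSq (cutDiff φ G lam) y ![a, a, c, d, c, d]) +
      ε⁻¹ * (√lam * P * K + 64 * ((120 * D * ε) ^ 2 * J)))) ≤
      ∫ y, -einsteinQ minkowski (gradSq (cutDiff φ G lam) y) 0 0 := by
    have hHε : ∀ᶠ lam in 𝓝[>] (0 : ℝ), H * lam ≤ ε := by
      have : Tendsto (fun lam : ℝ => H * lam) (𝓝 0) (𝓝 (H * 0)) :=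
        (continuous_const.mul continuous_id).tendsto 0
      rw [mul_zero] at this
      exact (this.mono_left nhdsWithin_le_nhds).eventually (ge_mem_nhds hε)
    filter_upwards [hD, hE, hH, hP, hK, hHε, eventually_pos] with lam hD hE hH hP hK hHε hl
    have tψ := fun c d => F.isTest_cutDiff hφ hl c d
    have tψ' := fun c d => (tψ c d).mono (subset_univ V)
    have tl := fun j k a => isTest_linX tψ' j k a
    have tf := fun j k a => (F.isTest_freezeErr hφ hl j k a).mono (subset_univ V)
    have h := hC (cutDiff φ G lam) (fun j k y => ∑ a, pd a (linX (cutDiff φ G lam) j k a) y -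
        ∑ a, pd a (freezeErr φ G lam j k a) y) (freezeErr φ G lam) P K (√lam) ε tψ'
      (F.cutDiff_symm hφ hl) (fun j k => (IsTest.sum fun a _ => (tl j k a).pd a).sub
        (IsTest.sum fun a _ => (tf j k a).pd a)) tf (fun j k y => by ring) hP hK
      (Real.sqrt_pos.2 hl) hε
    refine le_trans (neg_le_neg (mul_le_mul_of_nonneg_left ?_ hC0)) h
    have hψ : ∀ c d, ∫ y, cutDiff φ G lam c d y ^ 2 ≤ (E * lam) ^ 2 * J := by
      intro c d
      rw [hJ, ← integral_const_mul]
      have i1 := (tψ' c d).integrable_mul' (tψ' c d)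
      simp_rw [← pow_two] at i1
      refine integral_mono i1 (t0.integrable.const_mul _) fun y => ?_
      have h1 : |cutDiff φ G lam c d y| ≤ E * lam * |φ y| :=
        hφ.abs_mul_le (hE (c, d)) y
      have h2 := mul_self_le_mul_self (abs_nonneg _) h1
      rw [abs_mul_abs_self, mul_mul_mul_comm, abs_mul_abs_self] at h2
      simp only
      nlinarith
    have hB : ∀ j k a, ∫ y, freezeErr φ G lam j k a y ^ 2 ≤ (120 * D * ε) ^ 2 * J := by
      intro j k a
      rw [hJ, ← integral_const_mul]
      have i1 := (tf j k a).integrable_mul' (tf j k a)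
      simp_rw [← pow_two] at i1
      refine integral_mono i1 (t0.integrable.const_mul _) fun y => ?_
      have h1 : |freezeErr φ G lam j k a y| ≤ 120 * D * ε * |φ y| := by
        refine hφU.abs_mul_le (u := fun y => diffX (minkowski - (G lam y)⁻¹) G lam j k a y)
          (fun y hy => ?_) y
        -- One `ε` is the distance of the background from Minkowski on `U`, the other the distance
        -- of the perturbed inverse metric from the background, once `H * lam ≤ ε`.
        have h3 : ∀ i l, |(minkowski - (G lam y)⁻¹) i l| ≤ 2 * ε := fun i l => by
          have e1 := hU y hy i l
          have e2 := (hH (i, l) y (hUV hy)).trans hHε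
          rw [abs_le] at e1 e2 ⊢
          simp only [Matrix.sub_apply] at e1 e2 ⊢
          constructor <;> linarith [e1.1, e1.2, e2.1, e2.2]
        refine (abs_symX_le h3 (fun b c d => hD (b, c, d) y (hUV hy)) j k a).trans ?_
        linarith
      have h2 := mul_self_le_mul_self (abs_nonneg _) h1
      rw [abs_mul_abs_self, mul_mul_mul_comm, abs_mul_abs_self] at h2
      simp only
      nlinarith
    have hsq : (√lam)⁻¹ ^ 2 = lam⁻¹ := by rw [inv_pow, Real.sq_sqrt hl.le]
    refine add_le_add (add_le_add ?_ (le_of_eq ?_)) (mul_le_mul_of_nonneg_left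
      (add_le_add le_rfl ?_) (inv_nonneg.2 hε.le))
    -- The choice `θ = √lam` pays here: `θ⁻² = lam⁻¹` against the squared amplitude `O(lam²)` leaves
    -- `O(lam)`.
    · have h4 : ∑ c, ∑ d, ∫ y, cutDiff φ G lam c d y ^ 2 ≤ 16 * ((E * lam) ^ 2 * J) := by
        refine (Finset.sum_le_sum fun c _ => Finset.sum_le_sum fun d _ => hψ c d).trans ?_
        simp; linarith
      rw [hsq]
      calc _ ≤ lam⁻¹ * (16 * ((E * lam) ^ 2 * J)) :=
            mul_le_mul_of_nonneg_left h4 (inv_nonneg.2 hl.le)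
        _ = _ := by field_simp
    · congr 1
      refine Finset.sum_congr rfl fun c _ => Finset.sum_congr rfl fun d _ =>
        Finset.sum_congr rfl fun a _ => integral_congr_ae (ae_of_all _ fun y => ?_)
      exact pow_two _
    · refine (Finset.sum_le_sum fun j _ => Finset.sum_le_sum fun k _ =>
        Finset.sum_le_sum fun a _ => hB j k a).trans ?_
      simp; linarith
  have hlim : Tendsto (fun lam => -(C * (16 * E ^ 2 * J * lam +
      ε * (∑ c, ∑ d, ∑ a, ∫ y, gradSq (cutDiff φ G lam) y ![a, a, c, d, c, d]) +
      ε⁻¹ * (√lam * P * K + 64 * ((120 * D * ε) ^ 2 * J))))) (𝓝[>] 0)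
      (𝓝 (-(C * (16 * E ^ 2 * J * 0 +
      ε * (∑ c, ∑ d, ∑ a, ∫ y, φ y * φ y * m ![a, a, c, d, c, d] y) +
      ε⁻¹ * (√0 * P * K + 64 * ((120 * D * ε) ^ 2 * J)))))) := by
    have hid : Tendsto (fun lam : ℝ => lam) (𝓝[>] 0) (𝓝 0) := tendsto_id.mono_left nhdsWithin_le_nhds
    have hsq : Tendsto (fun lam : ℝ => √lam) (𝓝[>] 0) (𝓝 √0) :=
      (Real.continuous_sqrt.tendsto 0).mono_left nhdsWithin_le_nhds
    refine (Tendsto.const_mul _ (((hid.const_mul _).add (Tendsto.const_mul _ ?_)).add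
      (Tendsto.const_mul _ (((hsq.mul_const _).mul_const _).add tendsto_const_nhds)))).neg
    exact tendsto_finsetSum _ fun c _ => tendsto_finsetSum _ fun d _ => tendsto_finsetSum _
      fun a _ => F.tendsto_gradSq hφ _
  have hfin := le_of_tendsto_of_tendsto hlim (F.tendsto_einsteinQ hφ) hlow
  have hm := fun I => t0.integrable_mul hV (F.smooth_weak I).continuousOn
  have hs : ContinuousOn (fun y => ∑ c, ∑ d, ∑ a, m ![a, a, c, d, c, d] y) V :=
    continuousOn_finsetSum _ fun c _ => continuousOn_finsetSum _ fun d _ =>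
      continuousOn_finsetSum _ fun a _ => (F.smooth_weak _).continuousOn
  have hsum : ∫ y, φ y * φ y * ∑ c, ∑ d, ∑ a, m ![a, a, c, d, c, d] y =
      ∑ c, ∑ d, ∑ a, ∫ y, φ y * φ y * m ![a, a, c, d, c, d] y := by
    simp_rw [Finset.mul_sum]
    rw [integral_finsetSum _ fun c _ => integrable_finsetSum _ fun d _ =>
      integrable_finsetSum _ fun a _ => hm _]
    refine Finset.sum_congr rfl fun c _ => ?_
    rw [integral_finsetSum _ fun d _ => integrable_finsetSum _ fun a _ => hm _]
    exact Finset.sum_congr rfl fun d _ => integral_finsetSum _ fun a _ => hm _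
  obtain ⟨c, hc⟩ := exists_einsteinQ_eq_sum minkowski 0 0
  have hQ : ContinuousOn (fun y => -einsteinQ minkowski (fun I => m I y) 0 0) V := by
    simp_rw [hc]
    exact (continuousOn_finsetSum _ fun I _ =>
      continuousOn_const.mul (F.smooth_weak I).continuousOn).neg
  have hsplit : ∫ y, φ y * φ y * (-einsteinQ minkowski (fun I => m I y) 0 0 +
        C * ε * ((∑ c, ∑ d, ∑ a, m ![a, a, c, d, c, d] y) + 64 * (120 * D) ^ 2)) =
      (∫ y, φ y * φ y * -einsteinQ minkowski (fun I => m I y) 0 0) +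
        C * ε * ((∑ c, ∑ d, ∑ a, ∫ y, φ y * φ y * m ![a, a, c, d, c, d] y) +
          64 * (120 * D) ^ 2 * J) := by
    rw [← hsum, hJ, ← integral_const_mul, ← integral_add (t0.integrable_mul hV hs)
      (t0.integrable.const_mul _), ← integral_const_mul]
    refine Eq.trans ?_ (integral_add (t0.integrable_mul hV hQ)
      (((t0.integrable_mul hV hs).add (t0.integrable.const_mul _)).const_mul _))
    refine integral_congr_ae (ae_of_all _ fun y => ?_)
    simp only [Pi.add_apply]
    ring
  rw [hsplit]
  have e : ε⁻¹ * (64 * ((120 * D * ε) ^ 2 * J)) = ε * (64 * (120 * D) ^ 2 * J) := by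
    field_simp
  simp only [Real.sqrt_zero, zero_mul, mul_zero, zero_add] at hfin
  rw [e] at hfin
  linarith

/-- Where the background metric is Minkowskian, the energy density of the backreaction with respect
to the first basis vector is nonnegative. -/
theorem einsteinQ_nonpos (F : LocalFamily V G m Λ) {y₀ : R4} (hy : y₀ ∈ V)
    (h0 : G 0 y₀ = minkowski) : einsteinQ minkowski (fun I => m I y₀) 0 0 ≤ 0 := by
  obtain ⟨C, N, hC0, hC⟩ := F.exists_energy_bound
  have hs : ContinuousOn (fun y => ∑ c, ∑ d, ∑ a, m ![a, a, c, d, c, d] y) V :=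
    continuousOn_finsetSum _ fun c _ => continuousOn_finsetSum _ fun d _ =>
      continuousOn_finsetSum _ fun a _ => (F.smooth_weak _).continuousOn
  obtain ⟨c, hc⟩ := exists_einsteinQ_eq_sum minkowski 0 0
  have hQ : ContinuousOn (fun y => -einsteinQ minkowski (fun I => m I y) 0 0) V := by
    simp_rw [hc]
    exact (continuousOn_finsetSum _ fun I _ =>
      continuousOn_const.mul (F.smooth_weak I).continuousOn).neg
  obtain ⟨S, hS⟩ : ∃ S, S = (∑ c, ∑ d, ∑ a, m ![a, a, c, d, c, d] y₀) + N := ⟨_, rfl⟩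
  -- The background is exactly Minkowskian only at `y₀`, so for each `ε` the test functions live in
  -- a smaller neighbourhood. Testing there gives the inequality at `y₀` with error `O(ε)`.
  have key : ∀ ε : ℝ, 0 < ε → 0 ≤ -einsteinQ minkowski (fun I => m I y₀) 0 0 + C * ε * S := by
    intro ε hε
    have hnhds : ∀ᶠ y in 𝓝 y₀, ∀ i l, |minkowski i l - (G 0 y)⁻¹ i l| < ε := by
      refine eventually_all.2 fun i => eventually_all.2 fun l => ?_
      have h1 : ContinuousAt (fun y => |minkowski i l - (G 0 y)⁻¹ i l|) y₀ :=
        (continuousAt_const.sub ((F.sc_inv i l).smooth₀.continuousOn.continuousAt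
          (F.isOpen.mem_nhds hy))).abs
      refine h1.eventually (gt_mem_nhds ?_)
      simpa only [h0, minkowski_inv, sub_self, abs_zero] using hε
    obtain ⟨U, hU, hUo, hyU⟩ := mem_nhds_iff.1 (inter_mem hnhds (F.isOpen.mem_nhds hy))
    have hUV : U ⊆ V := fun z hz => (hU hz).2
    rw [hS]
    exact nonneg_of_integral_sq_nonneg hUo ((hQ.add (continuousOn_const.mul
      (hs.add continuousOn_const))).mono hUV) (hC ε hε U hUV fun y hy i l => ((hU hy).1 i l).le) hyU
  have hlim : Tendsto (fun ε : ℝ => -einsteinQ minkowski (fun I => m I y₀) 0 0 + C * ε * S)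
      (𝓝[>] 0) (𝓝 (-einsteinQ minkowski (fun I => m I y₀) 0 0 + C * 0 * S)) :=
    ((by fun_prop : Continuous fun ε : ℝ =>
      -einsteinQ minkowski (fun I => m I y₀) 0 0 + C * ε * S).tendsto 0).mono_left
        nhdsWithin_le_nhds
  have := ge_of_tendsto hlim (eventually_pos.mono key)
  linarith

end LocalFamily

/-! ### The quadratic part of the Einstein tensor is independent of the frame -/

section FrameIndependence

variable (μ : MultilinearMap ℝ (fun _ : Fin 6 => R4) ℝ)

theorem multilinear_add (r : ℝ) (v : Fin 6 → R4) (s : Fin 6) (u u' : R4) :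
    μ (Function.update v s (r • u + u')) =
      r * μ (Function.update v s u) + μ (Function.update v s u') := by
  rw [μ.map_update_add, μ.map_update_smul, smul_eq_mul]

theorem vec_eq_update (a b c d e f : R4) (s : Fin 6) (u : R4) :
    Function.update ![a, b, c, d, e, f] s u =
      ![if s = 0 then u else a, if s = 1 then u else b, if s = 2 then u else c,
        if s = 3 then u else d, if s = 4 then u else e, if s = 5 then u else f] := by
  funext i
  fin_cases s <;> fin_cases i <;> rfl

/-- `chrSq` as a function of vectors. -/
def chrForm (l j k s q r : R4) : ℝ :=
  (μ ![j, q, l, k, s, r] + μ ![j, r, l, k, s, q] - μ ![j, s, l, k, q, r]) +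
  (μ ![k, q, l, j, s, r] + μ ![k, r, l, j, s, q] - μ ![k, s, l, j, q, r]) -
  (μ ![l, q, j, k, s, r] + μ ![l, r, j, k, s, q] - μ ![l, s, j, k, q, r])

theorem chrSq_frame (b : Fin 4 → R4) (l j k s q r : Fin 4) :
    chrSq (fun I => μ fun i => b (I i)) l j k s q r =
      chrForm μ (b l) (b j) (b k) (b s) (b q) (b r) := by
  have h : ∀ i₀ i₁ i₂ i₃ i₄ i₅ : Fin 4, (μ fun i => b (![i₀, i₁, i₂, i₃, i₄, i₅] i)) =
      μ ![b i₀, b i₁, b i₂, b i₃, b i₄, b i₅] := by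
    intro i₀ i₁ i₂ i₃ i₄ i₅
    congr 1; funext i; fin_cases i <;> rfl
  simp only [chrSq, lowChr, h, chrForm]

theorem multilinear_vec (r : ℝ) (a b c d e f u : R4) :
    (μ ![r • u + a, b, c, d, e, f] = r * μ ![u, b, c, d, e, f] + μ ![a, b, c, d, e, f]) ∧
    (μ ![a, r • u + b, c, d, e, f] = r * μ ![a, u, c, d, e, f] + μ ![a, b, c, d, e, f]) ∧
    (μ ![a, b, r • u + c, d, e, f] = r * μ ![a, b, u, d, e, f] + μ ![a, b, c, d, e, f]) ∧
    (μ ![a, b, c, r • u + d, e, f] = r * μ ![a, b, c, u, e, f] + μ ![a, b, c, d, e, f]) ∧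
    (μ ![a, b, c, d, r • u + e, f] = r * μ ![a, b, c, d, u, f] + μ ![a, b, c, d, e, f]) ∧
    (μ ![a, b, c, d, e, r • u + f] = r * μ ![a, b, c, d, e, u] + μ ![a, b, c, d, e, f]) := by
  have h := fun s w => multilinear_add μ r ![a, b, c, d, e, f] s u w
  simp only [vec_eq_update] at h
  exact ⟨by simpa using h 0 a, by simpa using h 1 b, by simpa using h 2 c, by simpa using h 3 d,
    by simpa using h 4 e, by simpa using h 5 f⟩

theorem chrForm_linear (t : ℝ) (l j k s q r u : R4) :
    (chrForm μ (t • u + l) j k s q r = t * chrForm μ u j k s q r + chrForm μ l j k s q r) ∧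
    (chrForm μ l (t • u + j) k s q r = t * chrForm μ l u k s q r + chrForm μ l j k s q r) ∧
    (chrForm μ l j (t • u + k) s q r = t * chrForm μ l j u s q r + chrForm μ l j k s q r) ∧
    (chrForm μ l j k (t • u + s) q r = t * chrForm μ l j k u q r + chrForm μ l j k s q r) ∧
    (chrForm μ l j k s (t • u + q) r = t * chrForm μ l j k s u r + chrForm μ l j k s q r) ∧
    (chrForm μ l j k s q (t • u + r) = t * chrForm μ l j k s q u + chrForm μ l j k s q r) := by
  have h := multilinear_vec μ t
  simp only [chrForm, (h _ _ _ _ _ _ _).1, (h _ _ _ _ _ _ _).2.1, (h _ _ _ _ _ _ _).2.2.1,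
    (h _ _ _ _ _ _ _).2.2.2.1, (h _ _ _ _ _ _ _).2.2.2.2.1, (h _ _ _ _ _ _ _).2.2.2.2.2]
  refine ⟨?_, ?_, ?_, ?_, ?_, ?_⟩ <;> ring

/-- Functions of two vectors that are linear in each of them. -/
structure IsBilin (F : R4 → R4 → ℝ) : Prop where
  left : ∀ (r : ℝ) u v w, F (r • u + v) w = r * F u w + F v w
  right : ∀ (r : ℝ) u v w, F w (r • u + v) = r * F w u + F w v

variable {F F' : R4 → R4 → ℝ}

theorem IsBilin.sum_smul (hF : IsBilin F) {ι : Type*} [Fintype ι] (a c : ι → ℝ) (u w : ι → R4) :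
    F (∑ k, a k • u k) (∑ l, c l • w l) = ∑ k, ∑ l, a k * c l * F (u k) (w l) := by
  have hL : ∀ v, F (∑ k, a k • u k) v = ∑ k, a k * F (u k) v := fun v => by
    have h := map_sum (IsLinearMap.mk' (fun u => F u v) ⟨fun x y => by
      simpa using hF.left 1 x y v, fun r x => by
        have h0 : F 0 v = 0 := by have := hF.left 1 0 0 v; simp at this; exact this
        have := hF.left r x 0 v
        rw [add_zero, h0, add_zero] at this
        exact this⟩) (fun k => a k • u k) Finset.univ
    simpa only [map_smul, smul_eq_mul, IsLinearMap.mk'_apply] using h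
  have hR : ∀ v, F v (∑ k, c k • w k) = ∑ k, c k * F v (w k) := fun v => by
    have h := map_sum (IsLinearMap.mk' (fun u => F v u) ⟨fun x y => by
      simpa using hF.right 1 x y v, fun r x => by
        have h0 : F v 0 = 0 := by have := hF.right 1 0 0 v; simp at this; exact this
        have := hF.right r x 0 v
        rw [add_zero, h0, add_zero] at this
        exact this⟩) (fun k => c k • w k) Finset.univ
    simpa only [map_smul, smul_eq_mul, IsLinearMap.mk'_apply] using h
  simp only [hL, hR, Finset.mul_sum, mul_assoc]

theorem IsBilin.sum {ι : Type*} {s : Finset ι} {F : ι → R4 → R4 → ℝ} (h : ∀ i ∈ s, IsBilin (F i)) :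
    IsBilin fun u v => ∑ i ∈ s, F i u v :=
  ⟨fun r u v w => by
    rw [Finset.mul_sum, ← Finset.sum_add_distrib]
    exact Finset.sum_congr rfl fun i hi => (h i hi).left r u v w,
  fun r u v w => by
    rw [Finset.mul_sum, ← Finset.sum_add_distrib]
    exact Finset.sum_congr rfl fun i hi => (h i hi).right r u v w⟩

theorem IsBilin.const_mul (h : IsBilin F) (c : ℝ) : IsBilin fun u v => c * F u v :=
  ⟨fun r u v w => by rw [h.left]; ring, fun r u v w => by rw [h.right]; ring⟩

theorem IsBilin.sub (h : IsBilin F) (h' : IsBilin F') : IsBilin fun u v => F u v - F' u v :=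
  ⟨fun r u v w => by rw [h.left, h'.left]; ring, fun r u v w => by rw [h.right, h'.right]; ring⟩

theorem isBilin_chrForm₁ (j k s r : R4) : IsBilin fun u v => chrForm μ v j k s u r :=
  ⟨fun t u v w => (chrForm_linear μ t w j k s v r u).2.2.2.2.1,
    fun t u v w => (chrForm_linear μ t v j k s w r u).1⟩

theorem isBilin_chrForm₂ (l j k q : R4) : IsBilin fun u v => chrForm μ l j k v q u :=
  ⟨fun t u v w => (chrForm_linear μ t l j k w q v u).2.2.2.2.2,
    fun t u v w => (chrForm_linear μ t l j k v q w u).2.2.2.1⟩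

theorem isBilin_chrForm₃ (l k q r : R4) : IsBilin fun u v => chrForm μ l u k v q r :=
  ⟨fun t u v w => (chrForm_linear μ t l v k w q r u).2.1,
    fun t u v w => (chrForm_linear μ t l w k v q r u).2.2.2.1⟩

theorem isBilin_chrForm₄ (l s q r : R4) : IsBilin fun u v => chrForm μ l u v s q r :=
  ⟨fun t u v w => (chrForm_linear μ t l v w s q r u).2.1,
    fun t u v w => (chrForm_linear μ t l w v s q r u).2.2.1⟩

theorem isBilin_chrForm₅ (l j s q : R4) : IsBilin fun u v => chrForm μ l j v s q u :=
  ⟨fun t u v w => (chrForm_linear μ t l j w s q v u).2.2.2.2.2,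
    fun t u v w => (chrForm_linear μ t l j v s q w u).2.2.1⟩

variable {b c : Fin 4 → R4} {J H H' : Matrix (Fin 4) (Fin 4) ℝ}

/-- The contraction with the inverse metric does not depend on the frame. -/
theorem IsBilin.contract_frame (hF : IsBilin F) (hb : ∀ p, b p = ∑ k, J k p • c k)
    (hH : J * H' * Jᵀ = H) : ∑ p, ∑ q, H' p q * F (b p) (b q) = ∑ p, ∑ q, H p q * F (c p) (c q) := by
  have h1 : ∀ p q, H p q = ∑ k, ∑ l, J p k * H' k l * J q l := fun p q => by
    rw [← hH, Matrix.mul_apply, Finset.sum_comm]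
    refine Finset.sum_congr rfl fun k _ => ?_
    rw [Matrix.mul_apply, Finset.sum_mul]
    rfl
  simp_rw [hb, hF.sum_smul, h1, Finset.mul_sum, Finset.sum_mul]
  rw [Finset.sum_comm_cycle]
  refine Finset.sum_congr rfl fun k _ => ?_
  rw [Finset.sum_comm_cycle]
  exact Finset.sum_congr rfl fun l _ => Finset.sum_congr rfl fun p _ =>
    Finset.sum_congr rfl fun q _ => by ring

/-- The quadratic part of the Ricci tensor as a function of vectors. -/
def ricciForm (H : Matrix (Fin 4) (Fin 4) ℝ) (c : Fin 4 → R4) (v w : R4) : ℝ :=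
  ∑ i, ∑ b, H i b * ∑ l, ∑ a, H l a * (1 / 4 * (chrForm μ (c a) v w (c b) (c l) (c i) -
    chrForm μ (c a) (c i) w (c b) (c l) v))

theorem ricciQ_frame (H : Matrix (Fin 4) (Fin 4) ℝ) (b : Fin 4 → R4) (j k : Fin 4) :
    ricciQ H (fun I => μ fun i => b (I i)) j k = ricciForm μ H b (b j) (b k) := by
  simp only [ricciQ, ricciForm, chrSq_frame, Finset.mul_sum]
  refine Finset.sum_congr rfl fun i _ => ?_
  rw [Finset.sum_comm_cycle]
  exact Finset.sum_congr rfl fun b _ => Finset.sum_congr rfl fun l _ =>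
    Finset.sum_congr rfl fun a _ => by ring

/-- The two contractions with the inverse metric are changed one after the other: the inner one with
the outer frame vectors held fixed, then the outer one, each being a contraction of a bilinear
expression. -/
theorem ricciForm_frame (hb : ∀ p, b p = ∑ k, J k p • c k) (hH : J * H' * Jᵀ = H) (v w : R4) :
    ricciForm μ H' b v w = ricciForm μ H c v w := by
  have h1 : ∀ u u', IsBilin fun l a => 1 / 4 * (chrForm μ a v w u' l u - chrForm μ a u w u' l v) :=
    fun u u' => ((isBilin_chrForm₁ μ v w u' u).sub (isBilin_chrForm₁ μ u w u' v)).const_mul _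
  have h2 : IsBilin fun u u' => ∑ p, ∑ q, H p q * (1 / 4 * (chrForm μ (c q) v w u' (c p) u -
      chrForm μ (c q) u w u' (c p) v)) :=
    IsBilin.sum fun p _ => IsBilin.sum fun q _ => (((isBilin_chrForm₂ μ (c q) v w (c p)).sub
      (isBilin_chrForm₃ μ (c q) w (c p) v)).const_mul _).const_mul _
  simp only [ricciForm]
  rw [← h2.contract_frame hb hH]
  exact Finset.sum_congr rfl fun i _ => Finset.sum_congr rfl fun j _ =>
    congrArg _ ((h1 (b i) (b j)).contract_frame hb hH)

theorem isBilin_ricciForm (H : Matrix (Fin 4) (Fin 4) ℝ) (c : Fin 4 → R4) :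
    IsBilin (ricciForm μ H c) := by
  exact IsBilin.sum fun i _ => IsBilin.sum fun b _ => (IsBilin.sum fun l _ => IsBilin.sum fun a _ =>
    (((isBilin_chrForm₄ μ (c a) (c b) (c l) (c i)).sub
      (isBilin_chrForm₅ μ (c a) (c i) (c b) (c l))).const_mul _).const_mul _).const_mul _

/-- The quadratic part of the Einstein tensor as a function of vectors. -/
def einsteinForm (g : R4 → R4 → ℝ) (H : Matrix (Fin 4) (Fin 4) ℝ) (c : Fin 4 → R4) (v w : R4) : ℝ :=
  ricciForm μ H c v w - 1 / 2 * (∑ p, ∑ q, H p q * ricciForm μ H c (c p) (c q)) * g v w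

theorem isBilin_einsteinForm {g : R4 → R4 → ℝ} (hg : IsBilin g) (H : Matrix (Fin 4) (Fin 4) ℝ)
    (c : Fin 4 → R4) : IsBilin (einsteinForm μ g H c) :=
  (isBilin_ricciForm μ H c).sub (hg.const_mul _)

theorem einsteinForm_frame (g : R4 → R4 → ℝ) (hb : ∀ p, b p = ∑ k, J k p • c k)
    (hH : J * H' * Jᵀ = H) (v w : R4) :
    einsteinForm μ g H' b v w = einsteinForm μ g H c v w := by
  have e : ricciForm μ H' b = ricciForm μ H c :=
    funext fun v => funext fun w => ricciForm_frame μ hb hH v w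
  simp only [einsteinForm, e]
  rw [(isBilin_ricciForm μ H c).contract_frame hb hH]

theorem einsteinQ_frame (g : R4 → R4 → ℝ) (b : Fin 4 → R4) (j k : Fin 4) :
    einsteinQ (Matrix.of fun p q => g (b p) (b q)) (fun I => μ fun i => b (I i)) j k =
      einsteinForm μ g (Matrix.of fun p q => g (b p) (b q))⁻¹ b (b j) (b k) := by
  simp only [einsteinQ, einsteinForm, ricciQ_frame, Matrix.of_apply]

/-- The Gram matrix transforms with `Jᵀ` and `J`; inverting and cancelling gives the law for its
inverse, which is what frame independence of contractions needs. -/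
theorem gram_inv_frame {g : R4 → R4 → ℝ} (hg : IsBilin g) (hb : ∀ p, b p = ∑ k, J k p • c k)
    (hJ : IsUnit J.det) :
    J * (Matrix.of fun p q => g (b p) (b q))⁻¹ * Jᵀ = (Matrix.of fun p q => g (c p) (c q))⁻¹ := by
  have h1 : (Matrix.of fun p q => g (b p) (b q)) = Jᵀ * (Matrix.of fun p q => g (c p) (c q)) * J := by
    ext p q
    simp only [Matrix.of_apply, hb, hg.sum_smul, Matrix.mul_apply, Matrix.transpose_apply,
      Finset.sum_mul]
    rw [Finset.sum_comm]
    exact Finset.sum_congr rfl fun k _ => Finset.sum_congr rfl fun l _ => by ring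
  rw [h1, Matrix.mul_inv_rev, Matrix.mul_inv_rev, ← Matrix.mul_assoc, Matrix.mul_nonsing_inv _ hJ,
    Matrix.one_mul, Matrix.mul_assoc, Matrix.nonsing_inv_mul _ (by rwa [Matrix.det_transpose]),
    Matrix.mul_one]

end FrameIndependence

/-! ### Weak limits on the manifold and in charts -/

section WeakLimits

theorem isTest_of_compact {U K : Set R4} (hU : IsOpen U) (hK : IsCompact K) (hKU : K ⊆ U)
    {u : R4 → ℝ} (hu : ContDiffOn ℝ ∞ u U) (h0 : ∀ y ∉ K, u y = 0) : IsTest U u := by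
  have hs : tsupport u ⊆ K := closure_minimal (fun y hy => by_contra fun h => hy (h0 y h)) hK.isClosed
  refine ⟨contDiff_iff_contDiffAt.2 fun y => ?_, hK.of_isClosed_subset (isClosed_tsupport _) hs,
    hs.trans hKU⟩
  by_cases hy : y ∈ U
  · exact hu.contDiffAt (hU.mem_nhds hy)
  · refine (contDiffAt_const (c := (0 : ℝ))).congr_of_eventuallyEq ?_
    filter_upwards [hK.isClosed.isOpen_compl.mem_nhds fun h => hy (hKU h)] with z hz using h0 z hz

variable {M : Type*} [TopologicalSpace M] [ChartedSpace R4 M] [IsManifold 𝓘(ℝ, R4) ∞ M]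
  {e : OpenPartialHomeomorph M R4} {g : BilinField M} {U : Set R4} {k : ℕ}

/-- The density `√|det g|`. -/
def density (e : OpenPartialHomeomorph M R4) (g : BilinField M) (y : R4) : ℝ := √|(comp e g y).det|

theorem density_pos {y : R4} (h : (comp e g y).det ≠ 0) : 0 < density e g y :=
  Real.sqrt_pos.2 (abs_pos.2 h)

theorem contDiffOn_density (he : e ∈ smoothCharts M) (hg : ∀ y ∈ e.target, (comp e g y).det ≠ 0) :
    ContDiffOn ℝ ∞ (density e g) e.target := by
  have h := contDiffOn_det (n := ∞) fun i j => contDiffOn_comp he g i j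
  exact (h.abs hg).sqrt fun y hy => (abs_pos.2 (hg y hy)).ne'

/-- The components of a contravariant tensor field, multiplied with the density. -/
def densComp (e : OpenPartialHomeomorph M R4) (g : BilinField M) (f : (x : M) → ContraTensor k x)
    (I : Fin k → Fin 4) : R4 → ℝ :=
  e.target.indicator fun y => density e g y * f (e.symm y) fun s => coordCovec e y (I s)

/-- The components of a covariant tensor field. -/
def covComp (e : OpenPartialHomeomorph M R4) (A : (x : M) → CovTensor k x) (I : Fin k → Fin 4)
    (y : R4) : ℝ := A (e.symm y) fun s => coordVec e y (I s)

theorem zero_of_notMem_image {f : (x : M) → ContraTensor k x} {y : R4} (hy : y ∈ e.target)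
    (h : y ∉ e '' closure {x | f x ≠ 0}) : f (e.symm y) = 0 := by
  by_contra hne
  exact h ⟨e.symm y, subset_closure hne, e.right_inv hy⟩

theorem isCompact_image_closure {f : (x : M) → ContraTensor k x}
    (hc : IsCompact (closure {x | f x ≠ 0})) (hs : closure {x | f x ≠ 0} ⊆ e.source ∩ e ⁻¹' U) :
    IsCompact (e '' closure {x | f x ≠ 0}) :=
  hc.image_of_continuousOn (e.continuousOn.mono fun _ hx => (hs hx).1)

theorem isTest_densComp (he : e ∈ smoothCharts M) (hg : ∀ y ∈ e.target, (comp e g y).det ≠ 0)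
    (hU : IsOpen U) (hUe : U ⊆ e.target) {f : (x : M) → ContraTensor k x} (hf : SmoothContra f)
    (hc : IsCompact (closure {x | f x ≠ 0})) (hs : closure {x | f x ≠ 0} ⊆ e.source ∩ e ⁻¹' U)
    (I : Fin k → Fin 4) : IsTest U (densComp e g f I) := by
  refine isTest_of_compact hU (isCompact_image_closure hc hs)
    (image_subset_iff.2 fun x hx => (hs hx).2) ?_ fun y hy => ?_
  · refine (((contDiffOn_density he hg).mul (hf e he I)).mono hUe).congr fun y hy => ?_
    rw [densComp, indicator_of_mem (hUe hy)]
  · by_cases hyt : y ∈ e.target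
    · rw [densComp, indicator_of_mem hyt, zero_of_notMem_image hyt hy]
      exact mul_zero _
    · rw [densComp, indicator_of_notMem hyt]

omit [IsManifold 𝓘(ℝ, R4) ∞ M] in
theorem zero_contract {x : M} (A : CovTensor k x) : contract (0 : ContraTensor k x) A = 0 :=
  Finset.sum_eq_zero fun _ _ => zero_mul _

variable [MeasurableSpace M] [BorelSpace M]

theorem integrable_volumeMeasure [SecondCountableTopology M] (he : e ∈ smoothCharts M)
    (g : BilinField M) {F : M → ℝ}
    (hF : ContinuousOn (fun y => F (e.symm y)) e.target) (hF0 : ∀ x ∉ e.source, F x = 0)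
    (hi : IntegrableOn (fun y => √|(comp e g y).det| * F (e.symm y)) e.target) :
    Integrable F (volumeMeasure g) := by
  rw [← integrableOn_iff_integrable_of_support_subset
    (fun x hx => by_contra fun h => hx (hF0 x h) : Function.support F ⊆ e.source), IntegrableOn,
    volumeMeasure_restrict_source he]
  have hFc : ContinuousOn F e.source := by
    refine (hF.comp e.continuousOn (fun x hx => e.map_source hx)).congr fun x hx => ?_
    simp [e.left_inv hx]
  have hFm : AEStronglyMeasurable F (chartVolume g e) := by
    rw [← chartVolume_restrict_source]
    exact hFc.aestronglyMeasurable e.open_source.measurableSet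
  have hd : ContinuousOn (fun y => (comp e g y).det) e.target :=
    (contDiffOn_det (n := ∞) fun i j => contDiffOn_comp he g i j).continuousOn
  rw [chartVolume] at hFm ⊢
  rw [integrable_map_measure hFm (aemeasurable_chart_symm g),
    integrable_withDensity_iff_integrable_smul₀']
  · simp only [ENNReal.toReal_ofReal (Real.sqrt_nonneg _), smul_eq_mul]
    exact hi
  · exact (hd.abs.sqrt.aemeasurable e.open_target.measurableSet).ennreal_ofReal
  · exact ae_of_all _ fun _ => ENNReal.ofReal_lt_top

/-- The density and the components of `f` combine into test functions on the chart, so the integral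
over the manifold is a finite sum of pairings of component functions. -/
theorem integral_contract [SecondCountableTopology M] (he : e ∈ smoothCharts M)
    (hg : ∀ y ∈ e.target, (comp e g y).det ≠ 0)
    (hU : IsOpen U) (hUe : U ⊆ e.target) {f : (x : M) → ContraTensor k x} (hf : SmoothContra f)
    (hc : IsCompact (closure {x | f x ≠ 0})) (hs : closure {x | f x ≠ 0} ⊆ e.source ∩ e ⁻¹' U)
    {A : (x : M) → CovTensor k x} (hA : ∀ I, ContinuousOn (covComp e A I) U) :
    Integrable (fun x => contract (f x) (A x)) (volumeMeasure g) ∧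
    ∫ x, contract (f x) (A x) ∂(volumeMeasure g) = ∑ I, ∫ y, densComp e g f I y * covComp e A I y := by
  have ht := isTest_densComp he hg hU hUe hf hc hs
  have hprod : ∀ y ∈ e.target, density e g y * contract (f (e.symm y)) (A (e.symm y)) =
      ∑ I, densComp e g f I y * covComp e A I y := by
    intro y hy
    rw [contract_eq_sum_coord he hy, Finset.mul_sum]
    refine Finset.sum_congr rfl fun I _ => ?_
    rw [densComp, indicator_of_mem hy, covComp, mul_assoc]
  have hcont : Continuous fun y => ∑ I, densComp e g f I y * covComp e A I y :=
    continuous_finsetSum _ fun I _ => (ht I).continuous_mul hU (hA I)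
  have hint := fun I => (ht I).integrable_mul hU (hA I)
  have hF : ContinuousOn (fun y => contract (f (e.symm y)) (A (e.symm y))) e.target := by
    refine (hcont.continuousOn.div (contDiffOn_density he hg).continuousOn
      fun y hy => (density_pos (hg y hy)).ne').congr fun y hy => ?_
    rw [Pi.div_apply, ← hprod y hy, mul_div_cancel_left₀ _ (density_pos (hg y hy)).ne']
  have hF0 : ∀ x ∉ e.source, contract (f x) (A x) = 0 := by
    intro x hx
    have : f x = 0 := by
      by_contra hne
      exact hx (hs (subset_closure hne)).1
    rw [this, zero_contract]
  have hon : ∀ y ∉ e.target, ∑ I, densComp e g f I y * covComp e A I y = 0 := by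
    intro y hy
    simp [densComp, indicator_of_notMem hy]
  have hsum := integrable_finsetSum (μ := (volume : Measure R4)) Finset.univ fun I _ => hint I
  refine ⟨integrable_volumeMeasure he g hF hF0
    (hsum.integrableOn.congr_fun (fun y hy => (hprod y hy).symm) e.open_target.measurableSet), ?_⟩
  rw [integral_volumeMeasure he g hF hF0, ← integral_finsetSum _ fun I _ => hint I,
    ← setIntegral_eq_integral_of_forall_compl_eq_zero hon]
  exact setIntegral_congr_fun e.open_target.measurableSet hprod

theorem tendsto_integral_contract [SecondCountableTopology M] (he : e ∈ smoothCharts M)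
    (hg : ∀ y ∈ e.target, (comp e g y).det ≠ 0)
    (hU : IsOpen U) (hUe : U ⊆ e.target) {f : (x : M) → ContraTensor k x} (hf : SmoothContra f)
    (hc : IsCompact (closure {x | f x ≠ 0})) (hs : closure {x | f x ≠ 0} ⊆ e.source ∩ e ⁻¹' U)
    {A : ℝ → (x : M) → CovTensor k x} {A₀ : (x : M) → CovTensor k x}
    (hA : ∀ I, WConv U (fun lam => covComp e (A lam) I) (covComp e A₀ I)) :
    Tendsto (fun lam => ∫ x, contract (f x) (A lam x) ∂(volumeMeasure g)) (𝓝[>] 0)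
      (𝓝 (∫ x, contract (f x) (A₀ x) ∂(volumeMeasure g))) := by
  have ht := isTest_densComp he hg hU hUe hf hc hs
  rw [(integral_contract he hg hU hUe hf hc hs fun I => (hA I).cont₀).2]
  refine (tendsto_finsetSum _ fun I _ => (hA I).lim _ (ht I)).congr' ?_
  filter_upwards [eventually_pos] with lam hl
  rw [(integral_contract he hg hU hUe hf hc hs fun I => (hA I).cont lam hl).2]

/-- For a scalar test function `φ`, use the tensor with the single component `φ` divided by the
density, which cancels the volume factor. Convergence is required only for tensors supported over
`U`, so that another chart may supply it. -/
theorem wconv_of_tendsto [T2Space M] [SecondCountableTopology M] (he : e ∈ smoothCharts M)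
    (hg : ∀ y ∈ e.target, (comp e g y).det ≠ 0)
    (hU : IsOpen U) (hUe : U ⊆ e.target)
    {A : ℝ → (x : M) → CovTensor k x} {A₀ : (x : M) → CovTensor k x} {I : Fin k → Fin 4}
    (hAc : ∀ lam, 0 < lam → ContinuousOn (covComp e (A lam) I) U)
    (hA₀ : ContinuousOn (covComp e A₀ I) U)
    (h : ∀ f : (x : M) → ContraTensor k x, SmoothContra f → IsCompact (closure {x | f x ≠ 0}) →
      closure {x | f x ≠ 0} ⊆ e.source ∩ e ⁻¹' U →
      Tendsto (fun lam => ∫ x, contract (f x) (A lam x) ∂(volumeMeasure g)) (𝓝[>] 0)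
      (𝓝 (∫ x, contract (f x) (A₀ x) ∂(volumeMeasure g)))) :
    WConv U (fun lam => covComp e (A lam) I) (covComp e A₀ I) := by
  refine ⟨hAc, hA₀, fun φ hφ => ?_⟩
  have hd : ContDiffOn ℝ ∞ (fun y => (density e g y)⁻¹) U :=
    ((contDiffOn_density he hg).mono hUe).inv fun y hy => (density_pos (hg y (hUe hy))).ne'
  have hψ := hφ.mul hU hd
  obtain ⟨ψ, hψ'⟩ : ∃ ψ : R4 → ℝ, ψ = fun y => φ y * (density e g y)⁻¹ := ⟨_, rfl⟩
  rw [← hψ'] at hψ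
  have key : ∀ B : (x : M) → CovTensor k x, ContinuousOn (covComp e B I) U →
      ∫ x, contract (coordTensor e ψ I x) (B x) ∂(volumeMeasure g) =
        ∫ y, φ y * covComp e B I y := by
    intro B hB
    have h1 : ∀ y ∈ e.target, contract (coordTensor e ψ I (e.symm y)) (B (e.symm y)) =
        ψ y * covComp e B I y := fun y hy => contract_coordTensor he ψ I hy (B (e.symm y))
    rw [integral_volumeMeasure he g]
    · rw [← setIntegral_eq_integral_of_forall_compl_eq_zero (s := e.target)
        (f := fun y => φ y * covComp e B I y)]
      · refine setIntegral_congr_fun e.open_target.measurableSet fun y hy => ?_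
        have := (density_pos (hg y hy)).ne'
        change density e g y * contract (coordTensor e ψ I (e.symm y)) (B (e.symm y)) = _
        rw [h1 y hy, hψ']
        field_simp
      · intro y hy
        rw [hφ.eq_zero fun h => hy (hUe h), zero_mul]
    · exact (hψ.continuous_mul hU hB).continuousOn.congr h1
    · intro x hx
      rw [coordTensor_of_notMem I, zero_contract]
      rintro ⟨y, hy, rfl⟩
      exact hx (e.map_target (hUe (hψ.subset hy)))
  have hsub := hψ.subset.trans hUe
  have hlim := h (coordTensor e ψ I) (smoothContra_coordTensor he hψ.compact hψ.contDiff hsub I)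
    (isCompact_closure_coordTensor hψ.compact hsub I) (by
      refine (closure_minimal (fun x (hx : coordTensor e ψ I x ≠ 0) =>
        by_contra fun h => hx (coordTensor_of_notMem I h))
        (isCompact_image_tsupport hψ.compact hsub).isClosed).trans ?_
      rintro _ ⟨y, hy, rfl⟩
      exact ⟨e.map_target (hsub hy), by
        rw [mem_preimage, e.right_inv (hsub hy)]; exact hψ.subset hy⟩)
  rw [key A₀ hA₀] at hlim
  refine hlim.congr' ?_
  filter_upwards [eventually_pos] with lam hl
  exact key _ (hAc lam hl)

end WeakLimits

/-! ### Lorentzian and Riemannian metrics in charts; bounds on compact sets -/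

section Charts

variable {M : Type*} [TopologicalSpace M] [ChartedSpace R4 M] [IsManifold 𝓘(ℝ, R4) ∞ M]
  {e : OpenPartialHomeomorph M R4} {y : R4}

theorem bilin_sum_coordVec (g : BilinField M) (v w : Fin 4 → ℝ) :
    (g (e.symm y) : R4 →L[ℝ] R4 →L[ℝ] ℝ) (∑ i, v i • (coordVec e y i : R4))
      (∑ i, w i • (coordVec e y i : R4)) = ∑ i, ∑ j, v i * w j * comp e g y i j :=
  bilin_sum_smul (g (e.symm y)) v w (coordVec e y) (coordVec e y)

set_option synthInstance.maxHeartbeats 400000 in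
/-- The difference of two fields of bilinear forms. -/
def diffField (g g' : BilinField M) : BilinField M := g - g'

theorem comp_diffField (g g' : BilinField M) (i j : Fin 4) :
    comp e (diffField g g') y i j = comp e g y i j - comp e g' y i j := rfl

theorem IsLorentzian.comp_symm {g : BilinField M} (hg : IsLorentzian g) (i j : Fin 4) :
    comp e g y i j = comp e g y j i :=
  (hg _).1 _ _

theorem exists_frame_eq (he : e ∈ smoothCharts M) (hy : y ∈ e.target) (g : BilinField M)
    (b : Fin 4 → Tan (e.symm y)) : Matrix.of (fun i j => g (e.symm y) (b i) (b j)) =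
      (Matrix.of fun k i => coordCovec e y k (b i))ᵀ * comp e g y *
        Matrix.of fun k i => coordCovec e y k (b i) := by
  ext i j
  have h1 := sum_coordCovec_smul_coordVec he hy (b i)
  have h2 := sum_coordCovec_smul_coordVec he hy (b j)
  have h := bilin_sum_coordVec (e := e) (y := y) g (fun k => coordCovec e y k (b i))
    (fun k => coordCovec e y k (b j))
  have h3 : (g (e.symm y) : R4 →L[ℝ] R4 →L[ℝ] ℝ)
      (∑ k, coordCovec e y k (b i) • (coordVec e y k : R4))
      (∑ k, coordCovec e y k (b j) • (coordVec e y k : R4)) = g (e.symm y) (b i) (b j) :=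
    congrArg₂ (fun u v : R4 => (g (e.symm y) : R4 →L[ℝ] R4 →L[ℝ] ℝ) u v) h1 h2
  rw [Matrix.of_apply, ← h3, h]
  simp only [Matrix.mul_apply, Matrix.transpose_apply, Matrix.of_apply, Finset.sum_mul]
  rw [Finset.sum_comm]
  exact Finset.sum_congr rfl fun k _ => Finset.sum_congr rfl fun l _ => by ring

/-- In an orthonormal frame the Gram matrix is Minkowski's, and it is a product with the component
matrix as a factor; a vanishing determinant would contradict `det = -1`. -/
theorem IsLorentzian.det_ne_zero {g : BilinField M} (hg : IsLorentzian g) (he : e ∈ smoothCharts M)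
    (hy : y ∈ e.target) : (comp e g y).det ≠ 0 := by
  obtain ⟨-, b, hb⟩ := hg (e.symm y)
  intro h0
  have h := congrArg Matrix.det (exists_frame_eq he hy g b)
  rw [Matrix.det_mul, Matrix.det_mul, h0, show Matrix.of (fun i j => g (e.symm y) (b i) (b j)) =
    minkowski from by ext i j; exact hb i j, minkowski, Matrix.det_diagonal] at h
  simp [Fin.prod_univ_four] at h

/-- A Riemannian metric as a field of bilinear forms. -/
def riemField (h : RiemMetric M) : BilinField M := ⟨fun x => h.inner x, h.contMDiff⟩

/-- The length of a coordinate vector. -/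
def coordLen (h : RiemMetric M) (e : OpenPartialHomeomorph M R4) (i : Fin 4) (y : R4) : ℝ :=
  √(h.inner (e.symm y) (coordVec e y i) (coordVec e y i))

theorem continuousOn_coordLen (he : e ∈ smoothCharts M) (h : RiemMetric M) (i : Fin 4) :
    ContinuousOn (coordLen h e i) e.target :=
  (contDiffOn_comp he (riemField h) i i).continuousOn.sqrt

theorem NormLE.abs_le {h : RiemMetric M} {k : ℕ} {A : CovTensor k (e.symm y)} {c : ℝ}
    (hA : NormLE h A c) (I : Fin k → Fin 4) :
    |A fun s => coordVec e y (I s)| ≤ c * ∏ s, coordLen h e (I s) y := hA _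

theorem continuousOn_comp_symm {C : M → ℝ}
    (hC : ContMDiff 𝓘(ℝ, R4) 𝓘(ℝ, ℝ) ∞ C) : ContinuousOn (fun y => C (e.symm y)) e.target :=
  hC.continuous.comp_continuousOn e.continuousOn_symm

theorem UB.of_continuousOn {V K : Set R4} {f : R4 → ℝ} (hK : IsCompact K) (hVK : V ⊆ K)
    (hf : ContinuousOn f K) : UB V fun _ => f := by
  obtain ⟨C, hC⟩ := hK.exists_bound_of_continuousOn hf
  exact ⟨C, Eventually.of_forall fun _ y hy => hC y (hVK hy)⟩

theorem UB.mono_abs {V : Set R4} {A B : ℝ → R4 → ℝ} (hB : UB V B)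
    (h : ∀ lam, 0 < lam → ∀ y ∈ V, |A lam y| ≤ B lam y) : UB V A := by
  obtain ⟨C, hC⟩ := hB
  refine ⟨C, ?_⟩
  filter_upwards [hC, eventually_pos] with lam h1 hl y hy
  exact (h lam hl y hy).trans ((le_abs_self _).trans (h1 y hy))

theorem SB.of_abs_le_mul {V : Set R4} {A B : ℝ → R4 → ℝ} (hB : UB V B)
    (h : ∀ lam, 0 < lam → ∀ y ∈ V, |A lam y| ≤ lam * B lam y) : SB V A := by
  obtain ⟨C, hC⟩ := hB
  refine ⟨C, ?_⟩
  filter_upwards [hC, eventually_pos] with lam h1 hl y hy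
  refine (h lam hl y hy).trans ?_
  rw [mul_comm]
  exact mul_le_mul_of_nonneg_right ((le_abs_self _).trans (h1 y hy)) hl.le

end Charts

/-! ### From covariant to partial derivatives -/

section Local

variable {M : Type*} [TopologicalSpace M] [T2Space M] [SecondCountableTopology M]
    [ChartedSpace R4 M] [IsManifold 𝓘(ℝ, R4) ∞ M] [MeasurableSpace M] [BorelSpace M]
    {Λ : ℝ} {h : RiemMetric M} {D : Connection M} {g T : ℝ → BilinField M}
    {e : OpenPartialHomeomorph M R4} {V K : Set R4}

namespace Admissible

theorem sb_comp (hg : Admissible Λ h D g T) (he : e ∈ smoothCharts M) (hK : IsCompact K)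
    (hVK : V ⊆ K) (hKe : K ⊆ e.target) (i j : Fin 4) :
    SB V fun lam y => comp e (diffField (g lam) (g 0)) y i j := by
  obtain ⟨C, hCs, hC0, hC⟩ := hg.small
  have hc : ContinuousOn (fun y => C (e.symm y) * ∏ s, coordLen h e (![i, j] s) y) K :=
    ((continuousOn_comp_symm hCs).mul
      (continuousOn_finsetProd _ fun s _ => continuousOn_coordLen he h _)).mono hKe
  refine SB.of_abs_le_mul (UB.of_continuousOn hK hVK hc) fun lam hl y hy => ?_
  rw [← mul_assoc]
  exact (hC lam hl (e.symm y)).abs_le ![i, j]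

theorem ub_nablaComp (hg : Admissible Λ h D g T) (he : e ∈ smoothCharts M) (hK : IsCompact K)
    (hVK : V ⊆ K) (hKe : K ⊆ e.target) (c a b : Fin 4) :
    UB V fun lam => nablaComp D (diffField (g lam) (g 0)) e c a b := by
  obtain ⟨C, hCs, hC0, hC⟩ := hg.deriv_bounded
  have hc : ContinuousOn (fun y => C (e.symm y) * ∏ s, coordLen h e (![c, a, b] s) y) K :=
    ((continuousOn_comp_symm hCs).mul
      (continuousOn_finsetProd _ fun s _ => continuousOn_coordLen he h _)).mono hKe
  refine (UB.of_continuousOn hK hVK hc).mono_abs fun lam hl y hy => ?_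
  have := (hC lam hl (e.symm y)).abs_le (e := e) ![c, a, b]
  exact (congrArg abs (nabla_coordVec he D _ (hKe (hVK hy)) ![c, a, b])).symm.trans_le this

/-- The difference consists of connection coefficients times undifferentiated components of `γ`,
bounded and `O(lam)` respectively on a compact set. -/
theorem sb_pd_sub_nablaComp (hg : Admissible Λ h D g T) (hD : D.ContMDiffCovariantDerivative ∞)
    (he : e ∈ smoothCharts M) (hK : IsCompact K)
    (hVK : V ⊆ K) (hKe : K ⊆ e.target) (c a b : Fin 4) :
    SB V fun lam y => pd c (fun z => comp e (diffField (g lam) (g 0)) z a b) y -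
      nablaComp D (diffField (g lam) (g 0)) e c a b y := by
  have hu := fun k c a => UB.of_continuousOn hK hVK ((continuousOn_connCoef he D hD k c a).mono hKe)
  have hs := fun i j => hg.sb_comp he hK hVK hKe i j
  refine ((SB.sum (s := Finset.univ) fun k _ => (hs k b).ub_mul (hu k c a)).add
    (SB.sum (s := Finset.univ) fun k _ => (hs a k).ub_mul (hu k c b))).congr fun lam hl y hy => ?_
  rw [nablaComp]; ring

theorem pd_diffField (g g' : BilinField M) (c a b : Fin 4) (y : R4) :
    pd c (fun z => comp e (diffField g g') z a b) y = pd c (fun z => comp e g z a b - comp e g' z a b) y := by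
  simp only [comp_diffField]

theorem continuousOn_nablaComp (hD : D.ContMDiffCovariantDerivative ∞)
    (he : e ∈ smoothCharts M) (γ : BilinField M) (c a b : Fin 4) :
    ContinuousOn (nablaComp D γ e c a b) e.target :=
  ((contDiffOn_pd e.open_target (contDiffOn_comp he γ a b) (m := ∞) (by simp) c).continuousOn.sub
    (continuousOn_finsetSum _ fun k _ => (continuousOn_connCoef he D hD k c a).mul
      (contDiffOn_comp he γ k b).continuousOn)).sub
    (continuousOn_finsetSum _ fun k _ => (continuousOn_connCoef he D hD k c b).mul
      (contDiffOn_comp he γ a k).continuousOn)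

theorem det_ne_zero (hg : Admissible Λ h D g T) (he : e ∈ smoothCharts M) :
    ∀ y ∈ e.target, (comp e (g 0) y).det ≠ 0 :=
  fun _ hy => (hg.lorentzian 0 le_rfl).det_ne_zero he hy

/-- The assumed weak limit of products of covariant derivatives passes to partial derivatives: each
correction has a factor `O(lam)` and the other factor bounded. -/
theorem wconv_pd_mul_pd (hg : Admissible Λ h D g T) (hD : D.ContMDiffCovariantDerivative ∞)
    (he : e ∈ smoothCharts M) (hV : IsOpen V) (hK : IsCompact K) (hVK : V ⊆ K) (hKe : K ⊆ e.target)
    {μ : (x : M) → CovTensor 6 x} (hμs : SmoothCov μ)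
    (hμ : WeakLimit (g 0) (fun lam x => nablaSq D (diffField (g lam) (g 0)) x) μ) (I : Fin 6 → Fin 4) :
    WConv V (fun lam y =>
      pd (I 0) (fun z => comp e (g lam) z (I 2) (I 3) - comp e (g 0) z (I 2) (I 3)) y *
      pd (I 1) (fun z => comp e (g lam) z (I 4) (I 5) - comp e (g 0) z (I 4) (I 5)) y)
      (covComp e μ I) := by
  have hVe := hVK.trans hKe
  have hn := fun lam c a b => (continuousOn_nablaComp hD he (diffField (g lam) (g 0)) c a b).mono hVe
  have hsq : ∀ lam, ∀ y ∈ V, nablaComp D (diffField (g lam) (g 0)) e (I 0) (I 2) (I 3) y *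
      nablaComp D (diffField (g lam) (g 0)) e (I 1) (I 4) (I 5) y =
      covComp e (fun x => nablaSq D (diffField (g lam) (g 0)) x) I y :=
    fun lam y hy => (nablaSq_coordVec he D _ (hVe hy) I).symm
  have h1 : WConv V (fun lam => covComp e (fun x => nablaSq D (diffField (g lam) (g 0)) x) I) (covComp e μ I) :=
    wconv_of_tendsto he (hg.det_ne_zero he) hV hVe
      (fun lam _ => ((hn lam _ _ _).mul (hn lam _ _ _)).congr fun y hy => (hsq lam y hy).symm)
      ((hμs e he I).continuousOn.mono hVe) fun f hf hc _ => hμ f hf hc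
  have hs := fun c a b => hg.sb_pd_sub_nablaComp hD he hK hVK hKe c a b
  have hu := fun c a b => hg.ub_nablaComp he hK hVK hKe c a b
  have hpc : ∀ lam c a b, ContinuousOn (fun y => pd c (fun z => comp e (diffField (g lam) (g 0)) z a b) y -
      nablaComp D (diffField (g lam) (g 0)) e c a b y) V := fun lam c a b =>
    ((contDiffOn_pd e.open_target (contDiffOn_comp he _ a b) (m := ∞) (by simp)
      c).continuousOn.mono hVe).sub (hn lam c a b)
  have h2 := WConv.of_sb hV (((hs (I 0) (I 2) (I 3)).mul_ub (hu (I 1) (I 4) (I 5))).add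
    (((hs (I 1) (I 4) (I 5)).ub_mul (hu (I 0) (I 2) (I 3))).add
      ((hs (I 0) (I 2) (I 3)).mul_ub (hs (I 1) (I 4) (I 5)).ub)))
    fun lam _ => ((hpc lam _ _ _).mul (hn lam _ _ _)).add
      (((hn lam _ _ _).mul (hpc lam _ _ _)).add ((hpc lam _ _ _).mul (hpc lam _ _ _)))
  refine (h1.add hV h2).congr (fun lam hl y hy => ?_) fun y hy => add_zero _
  rw [← hsq lam y hy, ← pd_diffField, ← pd_diffField]
  ring

end Admissible

end Local

/-! ### Admissible families in a chart -/

section Local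

variable {M : Type*} [TopologicalSpace M] [T2Space M] [SecondCountableTopology M]
    [ChartedSpace R4 M] [IsManifold 𝓘(ℝ, R4) ∞ M] [MeasurableSpace M] [BorelSpace M]
    {Λ : ℝ} {h : RiemMetric M} {D : Connection M} {g T : ℝ → BilinField M}
    {e : OpenPartialHomeomorph M R4} {y₀ : R4}

theorem abs_sum_sum_le {w : Fin 4 → ℝ} {A : Matrix (Fin 4) (Fin 4) ℝ} {W C : ℝ}
    (hw : ∀ i, |w i| ≤ W) (hA : ∀ i j, |A i j| ≤ C) :
    |∑ i, ∑ j, w i * w j * A i j| ≤ 16 * (W ^ 2 * C) := by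
  have hW : 0 ≤ W := (abs_nonneg _).trans (hw 0)
  have h : ∀ i j, |w i * w j * A i j| ≤ W ^ 2 * C := fun i j => by
    rw [abs_mul, abs_mul, pow_two]
    exact mul_le_mul (mul_le_mul (hw i) (hw j) (abs_nonneg _) hW) (hA i j) (abs_nonneg _)
      (mul_nonneg hW hW)
  refine (Finset.abs_sum_le_sum_abs _ _).trans ((Finset.sum_le_sum fun i _ =>
    (Finset.abs_sum_le_sum_abs _ _).trans (Finset.sum_le_sum fun j _ => h i j)).trans ?_)
  simp; linarith

/-- Near every point there is a box of vectors on which a Lorentzian metric is negative. -/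
theorem IsLorentzian.exists_timelike_box {g : BilinField M} (hg : IsLorentzian g)
    (he : e ∈ smoothCharts M) (hy : y₀ ∈ e.target) : ∃ (v : Fin 4 → ℝ) (s : ℝ), 0 < s ∧
      ∀ y ∈ Metric.ball y₀ s, ∀ w : Fin 4 → ℝ, (∀ i, |w i - v i| ≤ s / 2) →
        ∑ i, ∑ j, w i * w j * comp e g y i j < -1 / 2 := by
  obtain ⟨-, b, hb⟩ := hg (e.symm y₀)
  obtain ⟨v, hv⟩ : ∃ v : Fin 4 → ℝ, v = fun i => coordCovec e y₀ i (b 0) := ⟨_, rfl⟩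
  have hQ0 : ∑ i, ∑ j, v i * v j * comp e g y₀ i j = -1 := by
    have h1 := sum_coordCovec_smul_coordVec he hy (b 0)
    have h2 := bilin_sum_coordVec (e := e) (y := y₀) g v v
    rw [← h2, hv]
    have h3 : (g (e.symm y₀) : R4 →L[ℝ] R4 →L[ℝ] ℝ)
        (∑ k, coordCovec e y₀ k (b 0) • (coordVec e y₀ k : R4))
        (∑ k, coordCovec e y₀ k (b 0) • (coordVec e y₀ k : R4)) = g (e.symm y₀) (b 0) (b 0) :=
      congrArg₂ (fun u v : R4 => (g (e.symm y₀) : R4 →L[ℝ] R4 →L[ℝ] ℝ) u v) h1 h1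
    rw [h3, hb]
    simp
  have hc : ContinuousAt (fun p : R4 × (Fin 4 → ℝ) =>
      ∑ i, ∑ j, p.2 i * p.2 j * comp e g p.1 i j) (y₀, v) := by
    refine tendsto_finsetSum _ fun i _ => tendsto_finsetSum _ fun j _ => ?_
    have h1 : ContinuousAt (fun p : R4 × (Fin 4 → ℝ) => comp e g p.1 i j) (y₀, v) :=
      ContinuousAt.comp (f := Prod.fst) (g := fun y => comp e g y i j)
        ((contDiffOn_comp he g i j).continuousOn.continuousAt (e.open_target.mem_nhds hy))
        continuousAt_fst
    have h2 : ContinuousAt (fun p : R4 × (Fin 4 → ℝ) => p.2 i * p.2 j) (y₀, v) := by fun_prop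
    exact h2.mul h1
  -- The value at the centre is `-1`; the threshold `-1/2` leaves a margin of `1/2` for replacing
  -- the background by the perturbed metric.
  have hev := hc.eventually (gt_mem_nhds (show _ < (-1 / 2 : ℝ) by simp only [hQ0]; norm_num))
  obtain ⟨s, hs, hsub⟩ := Metric.mem_nhds_iff.1 hev
  refine ⟨v, s, hs, fun y hy w hw => hsub (?_ : (y, w) ∈ Metric.ball (y₀, v) s)⟩
  rw [← ball_prod_same]
  refine ⟨hy, lt_of_le_of_lt ((dist_pi_le_iff (half_pos hs).le).2 fun i => ?_) (half_lt_self hs)⟩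
  rw [Real.dist_eq]; exact hw i

namespace Admissible

/-- In a chart, an admissible family is a `LocalFamily` near every point. -/
theorem exists_localFamily (hg : Admissible Λ h D g T) (hD : D.ContMDiffCovariantDerivative ∞)
    (he : e ∈ smoothCharts M) (hy₀ : y₀ ∈ e.target)
    {μ : (x : M) → CovTensor 6 x} (hμs : SmoothCov μ)
    (hμ : WeakLimit (g 0) (fun lam x => nablaSq D (diffField (g lam) (g 0)) x) μ) :
    ∃ V, y₀ ∈ V ∧ V ⊆ e.target ∧ LocalFamily V (fun lam => comp e (g lam)) (covComp e μ) Λ := by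
  obtain ⟨v, s, hs, hbox⟩ := (hg.lorentzian 0 le_rfl).exists_timelike_box he hy₀
  obtain ⟨r, hr, hrt⟩ := Metric.nhds_basis_closedBall.mem_iff.1 (e.open_target.mem_nhds hy₀)
  -- The closed ball lies in the chart, so continuous functions are bounded on it, and the open ball
  -- lies where the box of vectors is timelike.
  obtain ⟨ρ, hρ⟩ : ∃ ρ, ρ = min r s := ⟨_, rfl⟩
  have hρ0 : 0 < ρ := hρ ▸ lt_min hr hs
  have hKe : Metric.closedBall y₀ ρ ⊆ e.target :=
    (Metric.closedBall_subset_closedBall (hρ ▸ min_le_left _ _)).trans hrt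
  have hK : IsCompact (Metric.closedBall y₀ ρ) := isCompact_closedBall y₀ ρ
  have hVK : Metric.ball y₀ ρ ⊆ Metric.closedBall y₀ ρ := Metric.ball_subset_closedBall
  have hVe := hVK.trans hKe
  have hVs : Metric.ball y₀ ρ ⊆ Metric.ball y₀ s := Metric.ball_subset_ball (hρ ▸ min_le_right _ _)
  have hL := hg.lorentzian 0 le_rfl
  have hcomp := fun i j => contDiffOn_comp he (g 0) i j
  have hsb := fun i j => hg.sb_comp he hK hVK hKe i j
  refine ⟨Metric.ball y₀ ρ, Metric.mem_ball_self hρ0, hVe, Metric.isOpen_ball,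
    fun lam _ i j => (contDiffOn_comp he (g lam) i j).mono hVe,
    fun lam hl y _ i j => (hg.lorentzian lam hl).comp_symm i j,
    fun lam hl y hy => (hg.lorentzian lam hl).det_ne_zero he (hVe hy), hsb, fun k i j => ?_,
    fun i j => UB.of_continuousOn hK hVK ((hcomp i j).continuousOn.mono hKe),
    fun i j => UB.of_continuousOn hK hVK
      ((contDiffOn_inv hcomp (fun y hy => hL.det_ne_zero he hy) i j).continuousOn.mono hKe),
    fun k i j => UB.of_continuousOn hK hVK
      ((contDiffOn_pd e.open_target (hcomp i j) (m := ∞) (by simp) k).continuousOn.mono hKe),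
    fun I => (hμs e he I).mono hVe,
    hg.wconv_pd_mul_pd hD he Metric.isOpen_ball hK hVK hKe hμs hμ, v, s / 2, half_pos hs, ?_⟩
  · exact ((hg.sb_pd_sub_nablaComp hD he hK hVK hKe k i j).ub.add
      (hg.ub_nablaComp he hK hVK hKe k i j)).congr fun lam hl y hy => by
        rw [sub_add_cancel, pd_diffField]
  · obtain ⟨C, hC0, hC⟩ := SB.uniform (ι := Fin 4 × Fin 4) fun i => hsb i.1 i.2
    obtain ⟨W, hW⟩ : ∃ W, W = ∑ i, |v i| + s / 2 := ⟨_, rfl⟩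
    -- For small `lam` the perturbation changes the quadratic form by less than the margin `1/2`,
    -- uniformly on the box. The same vectors are then timelike for `g lam`, and its energy
    -- condition applies to them.
    have hlim : Tendsto (fun lam : ℝ => 16 * (W ^ 2 * (C * lam))) (𝓝[>] 0) (𝓝 0) := by
      have : Tendsto (fun lam : ℝ => 16 * (W ^ 2 * (C * lam))) (𝓝 0)
          (𝓝 (16 * (W ^ 2 * (C * 0)))) := Continuous.tendsto (by fun_prop) 0
      simp only [mul_zero] at this
      exact this.mono_left nhdsWithin_le_nhds
    filter_upwards [hC, hlim.eventually (gt_mem_nhds (by norm_num : (0 : ℝ) < 1 / 2)),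
      eventually_pos] with lam hC hlam hl y hy w hw
    have hwW : ∀ i, |w i| ≤ W := fun i => by
      have h1 := Finset.single_le_sum (f := fun i => |v i|) (fun _ _ => abs_nonneg _)
        (Finset.mem_univ i)
      have h2 : |w i| ≤ |v i| + |w i - v i| := by
        have := abs_add_le (v i) (w i - v i); rwa [add_sub_cancel] at this
      rw [hW]; exact h2.trans (add_le_add h1 (hw i))
    have hγ := (abs_le.1 (abs_sum_sum_le (A := comp e (diffField (g lam) (g 0)) y) hwW
      fun i j => hC (i, j) y hy)).2
    have hQ := hbox y (hVs hy) w hw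
    have htime : ∑ i, ∑ j, w i * w j * comp e (g lam) y i j < 0 := by
      simp only [comp_diffField, mul_sub, Finset.sum_sub_distrib] at hγ
      linarith
    have hT : 0 ≤ ∑ i, ∑ j, w i * w j * comp e (T lam) y i j := by
      rw [← bilin_sum_coordVec] at htime ⊢
      exact hg.weak_energy lam hl _ _ htime
    have hE : ∀ i j, einsteinLam Λ (comp e (g lam)) i j y = 8 * Real.pi * comp e (T lam) y i j :=
      hg.einstein_eq lam hl e he y (hVe hy)
    simp_rw [hE]
    calc 0 ≤ 8 * Real.pi * ∑ i, ∑ j, w i * w j * comp e (T lam) y i j :=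
          mul_nonneg (by positivity) hT
      _ = _ := by
        simp_rw [Finset.mul_sum]
        exact Finset.sum_congr rfl fun i _ => Finset.sum_congr rfl fun j _ => by ring

/-- The weak limit of the stress-energy tensor in a chart, near a point. -/
theorem exists_wconv_comp (hg : Admissible Λ h D g T) (hD : D.ContMDiffCovariantDerivative ∞)
    (he : e ∈ smoothCharts M) (hy₀ : y₀ ∈ e.target)
    {μ : (x : M) → CovTensor 6 x} (hμs : SmoothCov μ)
    (hμ : WeakLimit (g 0) (fun lam x => nablaSq D (diffField (g lam) (g 0)) x) μ) :
    ∃ V, IsOpen V ∧ y₀ ∈ V ∧ V ⊆ e.target ∧ ∀ j k, WConv V (fun lam y => comp e (T lam) y j k)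
      (fun y => (8 * Real.pi)⁻¹ * (einsteinLam Λ (comp e (g 0)) j k y +
        einsteinQ (comp e (g 0) y) (fun I => covComp e μ I y) j k)) := by
  obtain ⟨V, hyV, hVe, F⟩ := hg.exists_localFamily hD he hy₀ hμs hμ
  refine ⟨V, F.isOpen, hyV, hVe, fun j k => ?_⟩
  refine ((F.wconv_einsteinLam j k).const_mul F.isOpen (8 * Real.pi)⁻¹).congr
    (fun lam hl y hy => ?_) fun y _ => rfl
  have hE : einsteinLam Λ (comp e (g lam)) j k y = 8 * Real.pi * comp e (T lam) y j k :=
    hg.einstein_eq lam hl e he y (hVe hy) j k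
  rw [hE, inv_mul_cancel_left₀ (by positivity)]

/-- The components of the effective stress-energy tensor. -/
theorem comp_effective (hg : Admissible Λ h D g T) (hD : D.ContMDiffCovariantDerivative ∞)
    (he : e ∈ smoothCharts M) {y : R4} (hy : y ∈ e.target)
    {μ : (x : M) → CovTensor 6 x} (hμs : SmoothCov μ)
    (hμ : WeakLimit (g 0) (fun lam x => nablaSq D (diffField (g lam) (g 0)) x) μ) {t : BilinField M}
    (ht : IsEffectiveStressEnergy Λ g T t) (j k : Fin 4) :
    8 * Real.pi * comp e t y j k =
      -einsteinQ (comp e (g 0) y) (fun I => covComp e μ I y) j k := by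
  obtain ⟨T₀, hT₀, hE⟩ := ht
  obtain ⟨V, hV, hyV, hVe, hw⟩ := hg.exists_wconv_comp hD he hy hμs hμ
  have hcov : ∀ S : BilinField M, covComp e (fun x => toCov (S x)) ![j, k] =
      fun y => comp e S y j k := fun S => rfl
  have hw' := wconv_of_tendsto he (hg.det_ne_zero he) hV hVe (I := ![j, k])
    (A := fun lam x => toCov (T lam x)) (A₀ := fun x => toCov (T₀ x))
    (fun lam _ => (contDiffOn_comp he (T lam) j k).continuousOn.mono hVe)
    ((contDiffOn_comp he T₀ j k).continuousOn.mono hVe) fun f hf hc _ => hT₀ f hf hc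
  -- Both the computed limit and `T₀` are weak limits of the same components, so they agree;
  -- comparison with the averaged equation leaves only the quadratic part for `t`.
  have h1 := (hw j k).unique hV hw' y hyV
  have h2 : einsteinLam Λ (comp e (g 0)) j k y =
      8 * Real.pi * (comp e T₀ y j k + comp e t y j k) := hE e he y hy j k
  rw [hcov] at h1
  simp only [h2] at h1
  have hpi : (8 * Real.pi) ≠ 0 := by positivity
  rw [inv_mul_eq_iff_eq_mul₀ hpi] at h1
  linarith

end Admissible

end Local

/-! ### Charts adapted to an orthonormal frame at a point -/

section AdaptedCharts

variable {M : Type*} [TopologicalSpace M] [ChartedSpace R4 M]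
  {e : OpenPartialHomeomorph M R4} {y : R4}

/-- The composition of a chart with a linear change of coordinates. -/
def linearChart (e : OpenPartialHomeomorph M R4) (A : R4 ≃L[ℝ] R4) : OpenPartialHomeomorph M R4 :=
  e.trans A.symm.toHomeomorph.toOpenPartialHomeomorph

theorem linear_mem_contDiffGroupoid (A : R4 ≃L[ℝ] R4) :
    A.toHomeomorph.toOpenPartialHomeomorph ∈ contDiffGroupoid ∞ 𝓘(ℝ, R4) :=
  ⟨A.contDiff.contDiffOn, A.symm.contDiff.contDiffOn⟩

theorem linearChart_mem (he : e ∈ smoothCharts M) (A : R4 ≃L[ℝ] R4) :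
    linearChart e A ∈ smoothCharts M := by
  intro e' he'
  obtain ⟨h1, h2⟩ := he e' he'
  refine ⟨?_, ?_⟩
  · rw [linearChart, OpenPartialHomeomorph.trans_symm_eq_symm_trans_symm,
      OpenPartialHomeomorph.trans_assoc]
    exact StructureGroupoid.trans _ (StructureGroupoid.symm _ (linear_mem_contDiffGroupoid A.symm)) h1
  · rw [linearChart, ← OpenPartialHomeomorph.trans_assoc]
    exact StructureGroupoid.trans _ h2 (linear_mem_contDiffGroupoid A.symm)

theorem mem_linearChart_target (A : R4 ≃L[ℝ] R4) (hy : y ∈ e.target) :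
    A.symm y ∈ (linearChart e A).target := by
  simp [linearChart, hy]

theorem linearChart_symm_apply (A : R4 ≃L[ℝ] R4) :
    (linearChart e A).symm (A.symm y) = e.symm y :=
  congrArg e.symm (A.apply_symm_apply y)

theorem coordVec_linearChart (he : e ∈ smoothCharts M) (A : R4 ≃L[ℝ] R4) (hy : y ∈ e.target)
    (i : Fin 4) : (coordVec (linearChart e A) (A.symm y) i : R4) =
      chartD e y (A (EuclideanSpace.single i (1 : ℝ))) := by
  have h1 : MDifferentiableAt 𝓘(ℝ, R4) 𝓘(ℝ, R4) e.symm (A (A.symm y)) := by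
    rw [A.apply_symm_apply]
    exact (mdifferentiable_of_mem_smoothCharts he).mdifferentiableAt_symm hy
  have h2 : MDifferentiableAt 𝓘(ℝ, R4) 𝓘(ℝ, R4) A (A.symm y) :=
    A.differentiableAt.mdifferentiableAt
  have h3 := mfderiv_comp (A.symm y) h1 h2
  have h4 := congrArg (fun L : R4 →L[ℝ] R4 => L (EuclideanSpace.single i 1)) h3
  have h5 : mfderiv 𝓘(ℝ, R4) 𝓘(ℝ, R4) A (A.symm y) = (A : R4 →L[ℝ] R4) := by
    rw [mfderiv_eq_fderiv]; exact A.fderiv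
  have h6 : ∀ z, z = y → ∀ u : R4, (mfderiv 𝓘(ℝ, R4) 𝓘(ℝ, R4) e.symm z : R4 →L[ℝ] R4) u =
      chartD e y u := by rintro z rfl u; rfl
  refine h4.trans ((h6 _ (A.apply_symm_apply y) _).trans (congrArg _ ?_))
  exact congrArg (fun L : R4 →L[ℝ] R4 => L (EuclideanSpace.single i 1)) h5

/-- Every basis of a tangent space is the coordinate basis of some chart. -/
theorem exists_chart_coordVec_eq (he : e ∈ smoothCharts M) (hy : y ∈ e.target) {c : Fin 4 → R4}
    (hc : LinearIndependent ℝ c) : ∃ e' ∈ smoothCharts M, ∃ y' ∈ e'.target,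
      e'.symm y' = e.symm y ∧ ∀ i, (coordVec e' y' i : R4) = c i := by
  have hli : LinearIndependent ℝ fun i => chartDinv e y (c i) := by
    refine hc.map' (chartDinv e y).toLinearMap (LinearMap.ker_eq_bot.2 ?_)
    intro u v huv
    have := congrArg (chartD e y) huv
    exact (chartD_chartDinv he hy u).symm.trans (this.trans (chartD_chartDinv he hy v))
  have hcard : Fintype.card (Fin 4) = Module.finrank ℝ R4 := by simp
  -- A linear change of coordinates suffices, since the frame is prescribed at one point only.
  obtain ⟨A, hA⟩ : ∃ A : R4 ≃L[ℝ] R4, ∀ i, A (EuclideanSpace.single i 1) = chartDinv e y (c i) := by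
    let B := basisOfLinearIndependentOfCardEqFinrank hli hcard
    refine ⟨((EuclideanSpace.basisFun (Fin 4) ℝ).toBasis.equiv B
      (Equiv.refl _)).toContinuousLinearEquiv, fun i => ?_⟩
    have h1 := (EuclideanSpace.basisFun (Fin 4) ℝ).toBasis.equiv_apply i B (Equiv.refl _)
    simpa [B] using h1
  refine ⟨linearChart e A, linearChart_mem he A, A.symm y, mem_linearChart_target A hy,
    linearChart_symm_apply A, fun i => ?_⟩
  rw [coordVec_linearChart he A hy, hA, chartD_chartDinv he hy]

theorem linearIndependent_of_gram {g : R4 →L[ℝ] R4 →L[ℝ] ℝ} {c : Fin 4 → R4}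
    (hc : ∀ i j, g (c i) (c j) = minkowski i j) : LinearIndependent ℝ c := by
  rw [Fintype.linearIndependent_iff]
  intro w hw i
  have h := congrArg (fun u => g u (c i)) hw
  simp only [map_sum, map_smul, sum_apply, smul_apply, smul_eq_mul, hc, map_zero, zero_apply,
    minkowski, Matrix.diagonal_apply, mul_ite, mul_zero, Finset.sum_ite_eq', Finset.mem_univ,
    if_true] at h
  fin_cases i <;> simpa using h

/-- Every timelike vector is a multiple of the first vector of an orthonormal frame. -/
theorem exists_frame_of_timelike {g : R4 →L[ℝ] R4 →L[ℝ] ℝ} (hs : ∀ u v, g u v = g v u)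
    {b : Fin 4 → R4} (hb : ∀ i j, g (b i) (b j) = minkowski i j) {v : R4} (hv : g v v < 0) :
    ∃ (c : Fin 4 → R4) (r : ℝ), (∀ i j, g (c i) (c j) = minkowski i j) ∧ v = r • c 0 := by
  obtain ⟨r, hr0, hr⟩ : ∃ r : ℝ, r ≠ 0 ∧ g v v = -r ^ 2 :=
    ⟨√(-g v v), (Real.sqrt_pos.2 (by linarith)).ne', by rw [Real.sq_sqrt (by linarith)]; ring⟩
  -- The sign of `r` is chosen so that the reflection vector `n` below is not null.
  obtain ⟨r, hr0, hr, h1⟩ : ∃ r : ℝ, r ≠ 0 ∧ g v v = -r ^ 2 ∧ r⁻¹ * g v (b 0) ≠ 1 := by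
    by_cases h : r⁻¹ * g v (b 0) = 1
    · refine ⟨-r, neg_ne_zero.2 hr0, by rw [hr]; ring, ?_⟩
      rw [inv_neg, neg_mul, h]; norm_num
    · exact ⟨r, hr0, hr, h⟩
  obtain ⟨u, hu⟩ : ∃ u, u = r⁻¹ • v := ⟨_, rfl⟩
  have huu : g u u = -1 := by
    rw [hu]; simp only [map_smul, smul_apply, smul_eq_mul, hr]; field_simp
  have hub : g u (b 0) ≠ 1 := by
    rw [hu]; simpa only [map_smul, smul_apply, smul_eq_mul] using h1
  have h00 : g (b 0) (b 0) = -1 := by rw [hb]; simp [minkowski]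
  obtain ⟨n, hn⟩ : ∃ n, n = u + b 0 := ⟨_, rfl⟩
  have hnn : g n n = 2 * g (b 0) n := by
    rw [hn]; simp only [map_add, add_apply, huu, h00, hs u (b 0)]; ring
  have hbn : g (b 0) n ≠ 0 := by
    rw [hn, map_add, h00, hs]
    intro h; exact hub (by linarith)
  -- This is the reflection in the hyperplane orthogonal to `n = u + b 0`, since `g n n = 2 * g (b
  -- 0) n`. It preserves `g` and sends `b 0` to `-u`.
  refine ⟨fun i => b i - (g (b i) n / g (b 0) n) • n, -r, fun i j => ?_, ?_⟩
  · simp only [map_sub, map_smul, sub_apply, smul_apply, smul_eq_mul, hb, hnn, hs n (b j)]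
    field_simp
    ring
  · change v = -r • (b 0 - (g (b 0) n / g (b 0) n) • n)
    rw [div_self hbn, one_smul, hn, show b 0 - (u + b 0) = -u by abel, hu, smul_neg, neg_smul,
      neg_neg, smul_smul, mul_inv_cancel₀ hr0, one_smul]

end AdaptedCharts

/-! ### The energy condition for the effective stress-energy tensor -/

section Local

variable {M : Type*} [TopologicalSpace M] [T2Space M] [SecondCountableTopology M]
    [ChartedSpace R4 M] [IsManifold 𝓘(ℝ, R4) ∞ M] [MeasurableSpace M] [BorelSpace M]
    {Λ : ℝ} {h : RiemMetric M} {D : Connection M} {g T : ℝ → BilinField M}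
    {e : OpenPartialHomeomorph M R4} {y : R4}

/-- The value of a bilinear field at a point, as a bilinear form on the model space. -/
def asForm (s : BilinField M) (x : M) : R4 →L[ℝ] R4 →L[ℝ] ℝ := s x

theorem comp_eq_of_coordVec {e' : OpenPartialHomeomorph M R4} {y' : R4} {c : Fin 4 → R4}
    (h1 : e'.symm y' = e.symm y) (h2 : ∀ i, (coordVec e' y' i : R4) = c i) (s : BilinField M)
    (i j : Fin 4) :
    comp e' s y' i j = asForm s (e.symm y) (c i) (c j) := by
  change asForm s (e'.symm y') (coordVec e' y' i) (coordVec e' y' j) = _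
  rw [h1]
  exact congrArg₂ (fun u v : R4 => asForm s (e.symm y) u v) (h2 i) (h2 j)

theorem apply_smul_self_nonneg {L : R4 →L[ℝ] R4 →L[ℝ] ℝ} {c : R4} (h : 0 ≤ L c c) (r : ℝ) :
    0 ≤ L (r • c) (r • c) := by
  simp only [map_smul, smul_apply, smul_eq_mul]
  rw [← mul_assoc]
  exact mul_nonneg (mul_self_nonneg r) h

/-- A timelike vector is a multiple of the first vector of an orthonormal frame, and that frame is a
coordinate frame of some chart at the point. There `8π t₀₀ = -einsteinQ₀₀ ≥ 0`, and rescaling a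
vector does not change the sign of a quadratic form. -/
theorem Admissible.weakEnergy_of_effective (hg : Admissible Λ h D g T)
    (hD : D.ContMDiffCovariantDerivative ∞) {t : BilinField M}
    (ht : IsEffectiveStressEnergy Λ g T t) : WeakEnergy (g 0) t := by
  obtain ⟨μ, hμs, hμ⟩ := hg.weak_limit
  have key : ∀ e ∈ smoothCharts M, ∀ y ∈ e.target, ∀ v : R4,
      asForm (g 0) (e.symm y) v v < 0 → 0 ≤ asForm t (e.symm y) v v := by
    intro e he y hy v hv
    obtain ⟨hs, b, hb⟩ := hg.lorentzian 0 le_rfl (e.symm y)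
    obtain ⟨c, r, hc, hvc⟩ := exists_frame_of_timelike (g := asForm (g 0) (e.symm y)) hs (b := b) hb hv
    obtain ⟨e', he', y', hy', h1, h2⟩ := exists_chart_coordVec_eq he hy
      (linearIndependent_of_gram hc)
    obtain ⟨V, hyV, hVe, F⟩ := hg.exists_localFamily hD he' hy' hμs hμ
    have hG : comp e' (g 0) y' = minkowski := by
      ext i j; exact (comp_eq_of_coordVec h1 h2 (g 0) i j).trans (hc i j)
    have hQ := F.einsteinQ_nonpos hyV hG
    have hE := hg.comp_effective hD he' hy' hμs hμ ht 0 0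
    rw [hG, comp_eq_of_coordVec h1 h2] at hE
    have h00 : 0 ≤ asForm t (e.symm y) (c 0) (c 0) := by
      have : 0 ≤ 8 * Real.pi * asForm t (e.symm y) (c 0) (c 0) := by
        rw [hE]; linarith
      exact nonneg_of_mul_nonneg_right this (by positivity)
    rw [hvc]
    exact apply_smul_self_nonneg h00 r
  intro x v hv
  have hx := (chartAt R4 x).left_inv (mem_chart_source R4 x)
  have h3 := key (chartAt R4 x) (IsManifold.chart_mem_maximalAtlas x) (chartAt R4 x x)
    (mem_chart_target R4 x) v
  rw [hx] at h3
  exact h3 hv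

end Local

/-! ### Gluing local weak limits to a global tensor field -/

section LimitField

theorem contDiffOn_christoffel {V : Set R4} (hV : IsOpen V) {G : R4 → Matrix (Fin 4) (Fin 4) ℝ}
    (hG : ∀ i j, ContDiffOn ℝ ∞ (fun y => G y i j) V) (hd : ∀ y ∈ V, (G y).det ≠ 0)
    (i j k : Fin 4) : ContDiffOn ℝ ∞ (christoffel G i j k) V := by
  have hpd := fun k i j => contDiffOn_pd hV (hG i j) (m := ∞) (by simp) k
  exact contDiffOn_const.mul (ContDiffOn.sum fun l _ => (contDiffOn_inv hG hd i l).mul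
    (((hpd j l k).add (hpd k l j)).sub (hpd l j k)))

theorem contDiffOn_einsteinLam {V : Set R4} (hV : IsOpen V) {G : R4 → Matrix (Fin 4) (Fin 4) ℝ}
    (hG : ∀ i j, ContDiffOn ℝ ∞ (fun y => G y i j) V) (hd : ∀ y ∈ V, (G y).det ≠ 0) (Λ : ℝ)
    (j k : Fin 4) : ContDiffOn ℝ ∞ (einsteinLam Λ G j k) V := by
  have hc := contDiffOn_christoffel hV hG hd
  have hpd := fun p i j k => contDiffOn_pd hV (hc i j k) (m := ∞) (by simp) p
  have hr : ∀ j k, ContDiffOn ℝ ∞ (ricci G j k) V := fun j k =>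
    ContDiffOn.sum fun i _ => ((hpd i i j k).sub (hpd j i i k)).add (ContDiffOn.sum fun l _ =>
      ((hc l j k).mul (hc i l i)).sub ((hc l i k).mul (hc i l j)))
  have hs : ContDiffOn ℝ ∞ (scalarCurv G) V := ContDiffOn.sum fun j _ => ContDiffOn.sum fun k _ =>
    (contDiffOn_inv hG hd j k).mul (hr j k)
  exact ((hr j k).sub ((contDiffOn_const.mul hs).mul (hG j k))).add (contDiffOn_const.mul (hG j k))

theorem contDiffOn_einsteinQ {V : Set R4} {G : R4 → Matrix (Fin 4) (Fin 4) ℝ}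
    (hG : ∀ i j, ContDiffOn ℝ ∞ (fun y => G y i j) V) (hd : ∀ y ∈ V, (G y).det ≠ 0)
    {m : (Fin 6 → Fin 4) → R4 → ℝ} (hm : ∀ I, ContDiffOn ℝ ∞ (m I) V) (j k : Fin 4) :
    ContDiffOn ℝ ∞ (fun y => einsteinQ (G y) (fun I => m I y) j k) V := by
  have hH := contDiffOn_inv hG hd
  have hlow : ∀ {D : R4 → Fin 4 → Fin 4 → Fin 4 → ℝ},
      (∀ a b c, ContDiffOn ℝ ∞ (fun y => D y a b c) V) → ∀ l j k,
      ContDiffOn ℝ ∞ (fun y => lowChr (D y) l j k) V :=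
    fun h l j k => ((h _ _ _).add (h _ _ _)).sub (h _ _ _)
  have hchr : ∀ l j k s q r, ContDiffOn ℝ ∞ (fun y => chrSq (fun I => m I y) l j k s q r) V :=
    fun l j k s q r => hlow (fun a c d => hlow (fun b e f => hm _) s q r) l j k
  have hr : ∀ j k, ContDiffOn ℝ ∞ (fun y => ricciQ (G y)⁻¹ (fun I => m I y) j k) V := fun j k =>
    ContDiffOn.sum fun i _ => ContDiffOn.sum fun l _ => ContDiffOn.sum fun a _ =>
      ContDiffOn.sum fun b _ => (contDiffOn_const.mul ((hH l a).mul (hH i b))).mul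
        ((hchr _ _ _ _ _ _).sub (hchr _ _ _ _ _ _))
  exact (hr j k).sub ((contDiffOn_const.mul (ContDiffOn.sum fun p _ => ContDiffOn.sum fun q _ =>
    (hH p q).mul (hr p q))).mul (hG j k))

/-- The bilinear form with given components with respect to a family of covectors. -/
def formOf (a : Fin 4 → Fin 4 → ℝ) (β : Fin 4 → R4 →L[ℝ] ℝ) : R4 →L[ℝ] R4 →L[ℝ] ℝ :=
  ∑ i, ∑ j, a i j • (β i).smulRight (β j)

theorem formOf_apply (a : Fin 4 → Fin 4 → ℝ) (β : Fin 4 → R4 →L[ℝ] ℝ) (v w : R4) :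
    formOf a β v w = ∑ i, ∑ j, a i j * (β i v * β j w) := by
  simp [formOf, sum_apply]

variable {M : Type*} [TopologicalSpace M] [ChartedSpace R4 M]
    {e e' : OpenPartialHomeomorph M R4} {y : R4}

/-- The bilinear forms with given components in a chart. -/
def chartForm (e : OpenPartialHomeomorph M R4) (σ : R4 → Matrix (Fin 4) (Fin 4) ℝ) (x : M) :
    Tan x →L[ℝ] Tan x →L[ℝ] ℝ :=
  formOf (fun i j => σ (e x) i j) fun i =>
    (EuclideanSpace.proj i : R4 →L[ℝ] ℝ) ∘L (mfderiv 𝓘(ℝ, R4) 𝓘(ℝ, R4) e x : R4 →L[ℝ] R4)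

theorem chartForm_coordVec (he : e ∈ smoothCharts M) (hy : y ∈ e.target)
    (σ : R4 → Matrix (Fin 4) (Fin 4) ℝ) (j k : Fin 4) :
    chartForm e σ (e.symm y) (coordVec e y j) (coordVec e y k) = σ y j k := by
  have h := formOf_apply (fun i j => σ (e (e.symm y)) i j) (coordCovec e y) (coordVec e y j)
    (coordVec e y k)
  refine h.trans ?_
  have h1 : ∀ i j : Fin 4, coordCovec e y i (coordVec e y j : R4) = if i = j then 1 else 0 :=
    coordCovec_coordVec he hy
  have h2 : ∀ S : Matrix (Fin 4) (Fin 4) ℝ,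
      ∑ p, ∑ q, S p q * ((if p = j then 1 else 0) * (if q = k then 1 else 0)) = S j k := by
    intro S; simp
  simp only [e.right_inv hy]
  refine (Finset.sum_congr rfl fun p _ => Finset.sum_congr rfl fun q _ => ?_).trans (h2 (σ y))
  exact congrArg₂ (fun u v => σ y p q * (u * v)) (h1 p j) (h1 q k)

variable [IsManifold 𝓘(ℝ, R4) ∞ M]

theorem contDiffOn_jacobian (he : e ∈ smoothCharts M) (he' : e' ∈ smoothCharts M) (i j : Fin 4) :
    ContDiffOn ℝ ∞ (fun y => jacobian e e' y i j) (e.target ∩ e.symm ⁻¹' e'.source) := by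
  have h := ((contDiffOn_transition he he').fderiv_of_isOpen isOpen_transition (m := ∞)
    (by simp)).clm_apply (contDiffOn_const (c := (EuclideanSpace.single j 1 : R4)))
  exact (EuclideanSpace.proj i : R4 →L[ℝ] ℝ).contDiff.comp_contDiffOn h

theorem chartForm_transition (he : e ∈ smoothCharts M) (he' : e' ∈ smoothCharts M)
    (hy : y ∈ e.target) (hy' : e.symm y ∈ e'.source) (σ : R4 → Matrix (Fin 4) (Fin 4) ℝ)
    (i j : Fin 4) : chartForm e' σ (e.symm y) (coordVec e y i) (coordVec e y j) =
      ∑ k, ∑ l, jacobian e e' y k i * jacobian e e' y l j * σ (e' (e.symm y)) k l := by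
  refine (bilin_transition he he' hy hy' (chartForm e' σ (e.symm y)) i j).trans
    (Finset.sum_congr rfl fun k _ => Finset.sum_congr rfl fun l _ => congrArg _ ?_)
  have h := chartForm_coordVec he' (e'.map_source hy') σ k l
  have h1 : ∀ x, x = e.symm y → ∀ u v : R4, (chartForm e' σ x : R4 →L[ℝ] R4 →L[ℝ] ℝ) u v =
      (chartForm e' σ (e.symm y) : R4 →L[ℝ] R4 →L[ℝ] ℝ) u v := by rintro _ rfl u v; rfl
  exact (h1 _ (e'.left_inv hy') _ _).symm.trans h

theorem continuousOn_chartForm (he : e ∈ smoothCharts M) (he' : e' ∈ smoothCharts M)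
    {σ : R4 → Matrix (Fin 4) (Fin 4) ℝ} (hσ : ∀ i j, ContinuousOn (fun y => σ y i j) e'.target)
    (i j : Fin 4) :
    ContinuousOn (fun y => chartForm e' σ (e.symm y) (coordVec e y i) (coordVec e y j))
      (e.target ∩ e.symm ⁻¹' e'.source) := by
  refine ContinuousOn.congr (f := fun y => ∑ k, ∑ l,
    jacobian e e' y k i * jacobian e e' y l j * σ (e' (e.symm y)) k l) ?_
    fun y hy => chartForm_transition he he' hy.1 hy.2 σ i j
  refine continuousOn_finsetSum _ fun k _ => continuousOn_finsetSum _ fun l _ => ?_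
  refine ((contDiffOn_jacobian he he' k i).continuousOn.mul
    (contDiffOn_jacobian he he' l j).continuousOn).mul ?_
  exact (hσ k l).comp (contDiffOn_transition he he').continuousOn fun y hy => e'.map_source hy.2

variable [T2Space M] [SecondCountableTopology M] [MeasurableSpace M] [BorelSpace M]
  {g₀ : BilinField M} {T : ℝ → BilinField M}

theorem WConv.mono {V V' : Set R4} {A : ℝ → R4 → ℝ} {A₀ : R4 → ℝ} (h : WConv V A A₀)
    (hV : V' ⊆ V) : WConv V' A A₀ :=
  ⟨fun lam hl => (h.cont lam hl).mono hV, h.cont₀.mono hV,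
    fun φ hφ => h.lim φ ⟨hφ.contDiff, hφ.compact, hφ.subset.trans hV⟩⟩

/-- Local weak limits of the components of tensor fields in the charts transform as the components
of a tensor field. -/
theorem chartForm_eq_of_wconv (hg : ∀ e ∈ smoothCharts M, ∀ y ∈ e.target, (comp e g₀ y).det ≠ 0)
    {σ : OpenPartialHomeomorph M R4 → R4 → Matrix (Fin 4) (Fin 4) ℝ}
    (hσs : ∀ e ∈ smoothCharts M, ∀ i j, ContDiffOn ℝ ∞ (fun y => σ e y i j) e.target)
    (hσ : ∀ e ∈ smoothCharts M, ∀ y ∈ e.target, ∃ V, IsOpen V ∧ y ∈ V ∧ V ⊆ e.target ∧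
      ∀ i j, WConv V (fun lam y => comp e (T lam) y i j) (fun y => σ e y i j))
    (he : e ∈ smoothCharts M) (he' : e' ∈ smoothCharts M) (hy : y ∈ e.target)
    (hy' : e.symm y ∈ e'.source) (i j : Fin 4) :
    chartForm e' (σ e') (e.symm y) (coordVec e y i) (coordVec e y j) = σ e y i j := by
  obtain ⟨V, hV, hyV, hVe, hw⟩ := hσ e he y hy
  obtain ⟨V', hV', hyV', hVe', hw'⟩ := hσ e' he' _ (e'.map_source hy')
  obtain ⟨U, hUdef⟩ : ∃ U, U = V ∩ ((e.target ∩ e.symm ⁻¹' e'.source) ∩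
      (fun y => e' (e.symm y)) ⁻¹' V') := ⟨_, rfl⟩
  have hU : IsOpen U := hUdef ▸ hV.inter
    ((contDiffOn_transition he he').continuousOn.isOpen_inter_preimage isOpen_transition hV')
  have hUV : U ⊆ V := hUdef ▸ inter_subset_left
  have hUt : U ⊆ e.target ∩ e.symm ⁻¹' e'.source := fun z hz => by
    rw [hUdef] at hz; exact hz.2.1
  have hwU := wconv_of_tendsto he (hg e he) hU (hUV.trans hVe) (I := ![i, j])
    (A := fun lam x => toCov (T lam x)) (A₀ := fun x => toCov (chartForm e' (σ e') x))
    (fun lam _ => (contDiffOn_comp he (T lam) i j).continuousOn.mono (hUV.trans hVe))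
    ((continuousOn_chartForm he he' (fun i j => (hσs e' he' i j).continuousOn) i j).mono hUt)
    -- A test tensor supported over `U` lies in both charts, and the limit of its pairing with `T
    -- lam` may be computed in `e'`. The resulting weak limit of the components in `e` is the field
    -- given by `σ e'`, and uniqueness identifies it with `σ e`.
    fun f hf hc hs => by
      refine tendsto_integral_contract he' (hg e' he') hV' hVe' hf hc (fun x hx => ?_) fun I => ?_
      · have h := (hs hx).2
        rw [hUdef] at h
        obtain ⟨-, ⟨-, h1⟩, h2⟩ := h
        rw [mem_preimage, e.left_inv (hs hx).1] at h1 h2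
        exact ⟨h1, h2⟩
      · exact (hw' (I 0) (I 1)).congr (fun _ _ _ _ => rfl) fun z hz =>
          (chartForm_coordVec he' (hVe' hz) (σ e') (I 0) (I 1)).symm
  exact WConv.unique hU hwU ((hw i j).mono hUV) y
    (hUdef ▸ ⟨hyV, ⟨hy, hy'⟩, hyV'⟩)

/-- At each point the preferred chart there defines the form. Since local limits in different charts
agree, its components in every chart are the prescribed smooth ones; tensoriality is inherited from
`T lam`, without computing how the curvature expressions transform. -/
theorem exists_bilinField_of_wconv
    (hg : ∀ e ∈ smoothCharts M, ∀ y ∈ e.target, (comp e g₀ y).det ≠ 0)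
    {σ : OpenPartialHomeomorph M R4 → R4 → Matrix (Fin 4) (Fin 4) ℝ}
    (hσs : ∀ e ∈ smoothCharts M, ∀ i j, ContDiffOn ℝ ∞ (fun y => σ e y i j) e.target)
    (hσ : ∀ e ∈ smoothCharts M, ∀ y ∈ e.target, ∃ V, IsOpen V ∧ y ∈ V ∧ V ⊆ e.target ∧
      ∀ i j, WConv V (fun lam y => comp e (T lam) y i j) (fun y => σ e y i j)) :
    ∃ T₀ : BilinField M, ∀ e ∈ smoothCharts M, ∀ y ∈ e.target, ∀ i j,
      comp e T₀ y i j = σ e y i j := by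
  have key : ∀ e ∈ smoothCharts M, ∀ y ∈ e.target, ∀ i j,
      chartForm (chartAt R4 (e.symm y)) (σ (chartAt R4 (e.symm y))) (e.symm y)
        (coordVec e y i) (coordVec e y j) = σ e y i j := fun e he y hy i j =>
    chartForm_eq_of_wconv hg hσs hσ he (IsManifold.chart_mem_maximalAtlas _) hy
      (mem_chart_source R4 _) i j
  exact ⟨bilinFieldOf (fun x => chartForm (chartAt R4 x) (σ (chartAt R4 x)) x)
    fun e he i j => (hσs e he i j).congr fun y hy => key e he y hy i j, key⟩

theorem smul_contract {k : ℕ} {x : M} (a : ℝ) (f : ContraTensor k x) (A : CovTensor k x) :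
    contract (a • f) A = a * contract f A :=
  (Finset.sum_congr rfl fun _ _ => mul_assoc a _ _).trans (Finset.mul_sum _ _ _).symm

theorem SmoothContra.smul {k : ℕ} {f : (x : M) → ContraTensor k x} (hf : SmoothContra f)
    {ρ : M → ℝ} (hρ : ContMDiff 𝓘(ℝ, R4) 𝓘(ℝ, ℝ) ∞ ρ) : SmoothContra fun x => ρ x • f x := by
  intro e he i
  exact (contMDiffOn_iff_contDiffOn.1
    (hρ.comp_contMDiffOn (contMDiffOn_symm_of_mem_maximalAtlas he))).mul (hf e he i)

/-- Weak convergence of tensor fields can be checked locally in charts. -/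
theorem weakLimit_of_wconv {k : ℕ} {A : ℝ → (x : M) → CovTensor k x}
    {A₀ : (x : M) → CovTensor k x}
    (hg : ∀ e ∈ smoothCharts M, ∀ y ∈ e.target, (comp e g₀ y).det ≠ 0)
    (h : ∀ e ∈ smoothCharts M, ∀ y ∈ e.target, ∃ V, IsOpen V ∧ y ∈ V ∧ V ⊆ e.target ∧
      ∀ I, WConv V (fun lam => covComp e (A lam) I) (covComp e A₀ I)) : WeakLimit g₀ A A₀ := by
  intro f hf hc
  have hch : ∀ x : M, chartAt R4 x ∈ smoothCharts M := fun x => IsManifold.chart_mem_maximalAtlas x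
  choose V hV hxV hVe hw using fun x : M => h _ (hch x) _ (mem_chart_target R4 x)
  have : LocallyCompactSpace M := ChartedSpace.locallyCompactSpace R4 M
  -- A partition of unity on the compact support splits the test tensor into finitely many pieces,
  -- each supported where convergence in one chart is known.
  obtain ⟨ρ, hρ⟩ := SmoothPartitionOfUnity.exists_isSubordinate 𝓘(ℝ, R4)
    (isClosed_closure (s := {x | f x ≠ 0}))
    (fun x : M => (chartAt R4 x).source ∩ chartAt R4 x ⁻¹' V x)
    (fun x => (chartAt R4 x).isOpen_inter_preimage (hV x))
    fun x _ => mem_iUnion_of_mem x ⟨mem_chart_source R4 x, hxV x⟩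
  have hfin := ρ.locallyFinite.finite_nonempty_inter_compact hc
  have hsum : ∀ x, f x = (∑ i ∈ hfin.toFinset, ρ i x) • f x := by
    intro x
    by_cases hx : f x = 0
    · rw [hx, smul_zero]
    · have hxK := subset_closure (s := {x | f x ≠ 0}) hx
      rw [← finsum_eq_sum_of_support_subset, ρ.sum_eq_one hxK, one_smul]
      intro i hi
      rw [Finite.coe_toFinset]
      exact ⟨x, hi, hxK⟩
  have hcl : ∀ i, closure {x | ρ i x • f x ≠ 0} ⊆ closure {x | f x ≠ 0} := fun i =>
    closure_mono fun x hx hfx => hx (by rw [hfx, smul_zero])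
  have hcpt := fun i => hc.of_isClosed_subset isClosed_closure (hcl i)
  have hsub : ∀ i, closure {x | ρ i x • f x ≠ 0} ⊆
      (chartAt R4 i).source ∩ chartAt R4 i ⁻¹' V i := fun i =>
    (closure_mono (t := Function.support (ρ i)) fun x (hx : ρ i x • f x ≠ 0) hρx =>
      hx (by rw [hρx, zero_smul])).trans (hρ i)
  have hsm := fun i => hf.smul (ρ i).contMDiff
  have heq : ∀ B : (x : M) → CovTensor k x,
      (∀ i I, ContinuousOn (covComp (chartAt R4 i) B I) (V i)) →
      ∫ x, contract (f x) (B x) ∂(volumeMeasure g₀) =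
        ∑ i ∈ hfin.toFinset, ∫ x, contract (ρ i x • f x) (B x) ∂(volumeMeasure g₀) := by
    intro B hB
    rw [← integral_finsetSum _ fun i _ => (integral_contract (hch i) (hg _ (hch i)) (hV i) (hVe i)
      (hsm i) (hcpt i) (hsub i) (hB i)).1]
    refine integral_congr_ae (ae_of_all _ fun x => ?_)
    simp only [smul_contract, ← Finset.sum_mul]
    rw [← smul_contract, ← hsum x]
  rw [heq A₀ fun i I => (hw i I).cont₀]
  refine (tendsto_finsetSum _ fun i _ => tendsto_integral_contract (hch i) (hg _ (hch i)) (hV i)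
    (hVe i) (hsm i) (hcpt i) (hsub i) (hw i)).congr' ?_
  filter_upwards [eventually_pos] with lam hl
  exact (heq (A lam) fun i I => (hw i I).cont lam hl).symm

end LimitField

/-! ### Existence of the effective stress-energy tensor -/

section Existence

variable {M : Type*} [TopologicalSpace M] [ChartedSpace R4 M]
    {e : OpenPartialHomeomorph M R4} {y : R4}

/-- The matrix of the components of the coordinate vectors in the model space. -/
def frameMatrix (e : OpenPartialHomeomorph M R4) (y : R4) : Matrix (Fin 4) (Fin 4) ℝ :=
  Matrix.of fun k p => chartD e y (EuclideanSpace.single p 1) k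

theorem isUnit_det_frameMatrix (he : e ∈ smoothCharts M) (hy : y ∈ e.target) :
    IsUnit (frameMatrix e y).det := by
  refine Matrix.isUnit_det_of_left_inverse
    (B := Matrix.of fun k q => coordCovec e y k (EuclideanSpace.single q (1 : ℝ) : R4)) ?_
  have h : ∀ (L : R4 →L[ℝ] ℝ) (w : R4), ∑ q, L (EuclideanSpace.single q 1) * w q = L w := by
    intro L w
    conv_rhs => rw [← sum_smul_single w]
    simp only [map_sum, map_smul, smul_eq_mul, mul_comm]
  ext k p
  rw [Matrix.mul_apply, Matrix.one_apply]
  exact (h (coordCovec e y k) (coordVec e y p)).trans (coordCovec_coordVec he hy k p)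

/-- The value of a covariant tensor field at a point, as a multilinear form on the model space. -/
def asMulti (μ : (x : M) → CovTensor 6 x) (x : M) : MultilinearMap ℝ (fun _ : Fin 6 => R4) ℝ := μ x

variable [IsManifold 𝓘(ℝ, R4) ∞ M] {g : BilinField M} {μ : (x : M) → CovTensor 6 x}

theorem isBilin_asForm (g : BilinField M) (x : M) : IsBilin fun v w => asForm g x v w :=
  ⟨fun r u v w => by simp, fun r u v w => by simp⟩

/-- The quadratic part of the Einstein tensor, as a bilinear form. -/
def quadForm (g : BilinField M) (μ : (x : M) → CovTensor 6 x) (x : M) : R4 → R4 → ℝ :=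
  einsteinForm (asMulti μ x) (fun v w => asForm g x v w)
    (Matrix.of fun p q => asForm g x (EuclideanSpace.single p 1) (EuclideanSpace.single q 1))⁻¹
    (fun i => EuclideanSpace.single i 1)

/-- `quadForm` is defined with the standard basis of the model space, without reference to a chart;
frame independence identifies its components in every coordinate frame. -/
theorem quadForm_coordVec (he : e ∈ smoothCharts M) (hy : y ∈ e.target) (j k : Fin 4) :
    quadForm g μ (e.symm y) (coordVec e y j) (coordVec e y k) =
      einsteinQ (comp e g y) (fun I => covComp e μ I y) j k := by
  have hb : ∀ p, (coordVec e y p : R4) =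
      ∑ k, frameMatrix e y k p • (EuclideanSpace.single k 1 : R4) :=
    fun p => (sum_smul_single (coordVec e y p)).symm
  have hG := isBilin_asForm g (e.symm y)
  have h1 := einsteinQ_frame (asMulti μ (e.symm y)) (fun v w => asForm g (e.symm y) v w)
    (fun i => (coordVec e y i : R4)) j k
  exact ((einsteinForm_frame _ _ hb
    (gram_inv_frame hG hb (isUnit_det_frameMatrix he hy)) _ _).symm).trans h1.symm

theorem exists_bilinField_quadForm (hg : ∀ e ∈ smoothCharts M, ∀ y ∈ e.target, (comp e g y).det ≠ 0)
    (hμ : SmoothCov μ) (c : ℝ) : ∃ t : BilinField M, ∀ e ∈ smoothCharts M, ∀ y ∈ e.target, ∀ j k,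
      comp e t y j k = c * einsteinQ (comp e g y) (fun I => covComp e μ I y) j k := by
  obtain ⟨B, hB⟩ : ∃ B : (x : M) → R4 →L[ℝ] R4 →L[ℝ] ℝ, ∀ x v w, B x v w = c * quadForm g μ x v w := by
    refine ⟨fun x => formOf (fun i j => c * quadForm g μ x (EuclideanSpace.single i 1)
      (EuclideanSpace.single j 1)) fun i => EuclideanSpace.proj i, fun x v w => ?_⟩
    have h : IsBilin (quadForm g μ x) := isBilin_einsteinForm _ (isBilin_asForm g x) _ _
    conv_rhs => rw [← sum_smul_single v, ← sum_smul_single w, h.sum_smul, Finset.mul_sum]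
    rw [formOf_apply]
    refine Finset.sum_congr rfl fun i _ => ?_
    rw [Finset.mul_sum]
    refine Finset.sum_congr rfl fun j _ => ?_
    change _ * (v i * w j) = c * (v i * w j * _)
    ring
  have key : ∀ e ∈ smoothCharts M, ∀ y ∈ e.target, ∀ j k, B (e.symm y) (coordVec e y j)
      (coordVec e y k) = c * einsteinQ (comp e g y) (fun I => covComp e μ I y) j k :=
    fun e he y hy j k => (hB _ _ _).trans (congrArg _ (quadForm_coordVec he hy j k))
  exact ⟨bilinFieldOf B fun e he j k => (contDiffOn_const.mul (contDiffOn_einsteinQ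
    (fun i j => contDiffOn_comp he g i j) (hg e he) (fun I => hμ e he I) j k)).congr
      fun y hy => key e he y hy j k, key⟩

variable [T2Space M] [SecondCountableTopology M] [MeasurableSpace M] [BorelSpace M]
    {Λ : ℝ} {h : RiemMetric M} {D : Connection M} {g T : ℝ → BilinField M}

/-- An admissible family has an effective stress-energy tensor. -/
theorem Admissible.exists_effective (hg : Admissible Λ h D g T)
    (hD : D.ContMDiffCovariantDerivative ∞) :
    ∃ t : BilinField M, IsEffectiveStressEnergy Λ g T t := by
  obtain ⟨μ, hμs, hμ⟩ := hg.weak_limit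
  have hdet : ∀ e ∈ smoothCharts M, ∀ y ∈ e.target, (comp e (g 0) y).det ≠ 0 :=
    fun e he => hg.det_ne_zero he
  have hw := fun e he y hy => hg.exists_wconv_comp hD (e := e) he (y₀ := y) hy hμs hμ
  -- The averaged tensor is the limit found in each chart; the averaged equation then forces `t` to
  -- be `-(8π)⁻¹` times the quadratic part.
  obtain ⟨T₀, hT₀⟩ := exists_bilinField_of_wconv hdet (σ := fun e y => Matrix.of fun j k =>
      (8 * Real.pi)⁻¹ * (einsteinLam Λ (comp e (g 0)) j k y +
        einsteinQ (comp e (g 0) y) (fun I => covComp e μ I y) j k))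
    (fun e he j k => contDiffOn_const.mul
      ((contDiffOn_einsteinLam e.open_target (fun i j => contDiffOn_comp he (g 0) i j)
        (hdet e he) Λ j k).add (contDiffOn_einsteinQ (fun i j => contDiffOn_comp he (g 0) i j)
        (hdet e he) (fun I => hμs e he I) j k))) hw
  obtain ⟨t, ht⟩ := exists_bilinField_quadForm hdet hμs (-(8 * Real.pi)⁻¹)
  refine ⟨t, T₀, weakLimit_of_wconv hdet fun e he y hy => ?_, fun e he y hy j k => ?_⟩
  · obtain ⟨V, hV, hyV, hVe, hwV⟩ := hw e he y hy
    exact ⟨V, hV, hyV, hVe, fun I => (hwV (I 0) (I 1)).congr (fun _ _ _ _ => rfl)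
      fun z hz => (hT₀ e he z (hVe hz) (I 0) (I 1)).symm⟩
  · have h1 := hT₀ e he y hy j k
    have h2 := ht e he y hy j k
    change einsteinLam Λ (comp e (g 0)) j k y =
      8 * Real.pi * (comp e T₀ y j k + comp e t y j k)
    rw [h1, h2, Matrix.of_apply]
    have hpi : (8 * Real.pi) ≠ 0 := by positivity
    field_simp
    ring

end Existence

end Backreaction

end

theorem theorem2 (M : Type*) [TopologicalSpace M] [T2Space M] [SecondCountableTopology M]
    [ChartedSpace Backreaction.R4 M] [IsManifold 𝓘(ℝ, Backreaction.R4) ∞ M]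
    [MeasurableSpace M] [BorelSpace M]
    (Λ : ℝ) (h : Backreaction.RiemMetric M)
    (D : Backreaction.Connection M) (hD : D.ContMDiffCovariantDerivative ∞)
    (g T : ℝ → Backreaction.BilinField M) (hg : Backreaction.Admissible Λ h D g T) :
    (∃ t : Backreaction.BilinField M, Backreaction.IsEffectiveStressEnergy Λ g T t) ∧
      ∀ t : Backreaction.BilinField M, Backreaction.IsEffectiveStressEnergy Λ g T t →
        Backreaction.WeakEnergy (g 0) t :=
  ⟨hg.exists_effective hD, fun _ ht => hg.weakEnergy_of_effective hD ht⟩
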